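/- **Conventions.** A *dg-algebra* is a differential graded ring $A=\bigoplus_{i\ge 0}A_i$, homologically graded, that is graded commutative ($ab=(-1)^{|a||b|}ba$, and $a^2=0$ for $|a|$ odd). It is *local* if $A_0$ is a Noetherian local ring, $H_0(A)\neq 0$, and each $H_i(A)$ is finitely generated over $H_0(A)$; then $\mathfrak m_A=\mathfrak m_{A_0}+A_{\ge 1}$, and its residue field is $A/\mathfrak m_A$. A *semifree extension* $U=A[X]\langle Y\rangle$ of $A$ is obtained by adjoining variables of positive degree (exterior variables in odd degrees, and in even degrees polynomial variables for $X$ and divided power variables for $Y$); $U(i)=A[X_{\le i}]\langle Y_{\le i}\rangle$. It is *minimal* if $\partial(U)\subseteq \mathfrak m_AU+X^2U+XY\,U+Y^{(2)}U$. For a morphism $p\colon A\to B$ of local dg-algebras, a *minimal model* (respectively an *acyclic closure*) of $B$ over $A$ is a minimal local semifree extension of the form $A[X]$ (respectively $A\langle Y\rangle$) with a local quasi-isomorphism to $B$ extending $p$. **Proposition 5.3.** Let $A$ be a local dg-algebra with residue field $k$, let $S$ be a regular local ring with maximal ideal $\mathfrak m_S$, and let $S\to A_0$ be a surjective ring homomorphism.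 Let $V=S[X]$ be a minimal model of $A$ over $S$, let $K=K(\mathfrak m_S,V)=V[e_1,\dots,e_d\mid\partial e_j=t_j]$ be the Koszul complex on a minimal generating set $t_1,\dots,t_d$ of $\mathfrak m_S$, and let $U$ be an acyclic closure over $K$ of the residue field of $K$, with filtration $U(i)=K\langle Y_{\le i}\rangle$. Then $U(1)=K$, and for all $i\ge 1$ there are surjective quasi-isomorphisms of dg-algebras $\varphi_i\colon U(i)\to k\otimes_{V(i-1)}V$ such that * the composite $V\to K=U(1)\xrightarrow{\varphi_1}k\otimes_S V$ is the canonical surjection, and * for each $i\ge1$, the restriction of $\varphi_{i+1}$ to $U(i)$ is $\varphi_i$ followed by the canonical surjection $k\otimes_{V(i-1)}V\to k\otimes_{V(i)}V$. Moreover, let $n^S_i(A)$ be the number of variables of degree $i$ in $V$, let $\varepsilon^A_i(k)$ be the number of variables of degree $i$ in an acyclic closure of $k$ over $A$, and let $m$ and $n$ be the embedding dimensions of $S$ and of $H_0(A)$. These numbers of variables are finite, and $$n^S_i(A)=\begin{cases}0,& i\le 0;\\ \varepsilon^A_{2}(k)+m-n,& i=1;\\ \varepsilon^A_{i+1}(k),&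 i>1.\end{cases}$$ In particular, if the presentation $S\to A_0$ is minimal, that is, if $S$ and $A_0$ have the same embedding dimension, then $m$ is the embedding dimension of $A_0$. -/

import Mathlib

universe u v w x

open DirectSum

/-- A nonnegatively graded, graded commutative dg-algebra (over `ℤ`), homologically indexed:
the differential `d` lowers the degree by one. -/
structure CDGA : Type (u + 1) where
  carrier : Type u
  [ring : Ring carrier]
  gr : ℕ → AddSubgroup carrier
  [graded : GradedRing gr]
  d : carrier →+ carrier
  d_zero : ∀ {a}, a ∈ gr 0 → d a = 0
  d_mem : ∀ {i a}, a ∈ gr (i + 1) → d a ∈ gr i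
  d_mul : ∀ {i a} (b), a ∈ gr i → d (a * b) = d a * b + (-1) ^ i * (a * d b)
  d_d : ∀ a, d (d a) = 0
  comm : ∀ {i j a b}, a ∈ gr i → b ∈ gr j → a * b = (-1) ^ (i * j) * (b * a)
  sq_zero : ∀ {i a}, Odd i → a ∈ gr i → a * a = 0

namespace CDGA

noncomputable section

instance : CoeSort CDGA.{u} (Type u) := ⟨CDGA.carrier⟩

instance (A : CDGA.{u}) : Ring A := A.ring

instance (A : CDGA.{u}) : GradedRing A.gr := A.graded

/-- The commutative ring `A₀`. -/
abbrev deg0 (A : CDGA.{u}) : Type u := A.gr 0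

instance (A : CDGA.{u}) : CommRing A.deg0 :=
  { (inferInstance : Ring A.deg0) with
    mul_comm := fun a b => Subtype.ext (by
      have := A.comm a.2 b.2
      simpa using this) }

/-- The inclusion of `A₀` in `A`. -/
def incl0 (A : CDGA.{u}) : A.deg0 →+* A where
  toFun a := a
  map_one' := rfl
  map_mul' _ _ := rfl
  map_zero' := rfl
  map_add' _ _ := rfl

instance (A : CDGA.{u}) : Module A.deg0 A := Module.compHom A A.incl0

theorem smul_def (A : CDGA.{u}) (a : A.deg0) (x : A) : a • x = (a : A) * x := rfl

/-- The projection of `A` to `A₀`, a ring homomorphism. -/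
def pr0 (A : CDGA.{u}) : A →+* A.deg0 where
  toFun a := GradedRing.projZeroRingHom' A.gr a
  map_one' := map_one (GradedRing.projZeroRingHom' A.gr)
  map_mul' := map_mul (GradedRing.projZeroRingHom' A.gr)
  map_zero' := map_zero (GradedRing.projZeroRingHom' A.gr)
  map_add' := map_add (GradedRing.projZeroRingHom' A.gr)

/-- The projection of `A` to its component of degree `i`. -/
def pr (A : CDGA.{u}) (i : ℕ) : A →+ A := GradedRing.proj A.gr i

theorem pr_mem (A : CDGA.{u}) (i : ℕ) (a : A) : A.pr i a ∈ A.gr i := (decompose A.gr a i).2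

theorem pr_same (A : CDGA.{u}) {i : ℕ} {a : A} (h : a ∈ A.gr i) : A.pr i a = a :=
  decompose_of_mem_same A.gr h

theorem pr_ne (A : CDGA.{u}) {i j : ℕ} {a : A} (h : a ∈ A.gr i) (hij : i ≠ j) : A.pr j a = 0 :=
  decompose_of_mem_ne A.gr h hij

theorem coe_pr0 (A : CDGA.{u}) (a : A) : (A.pr0 a : A) = A.pr 0 a := rfl

theorem sum_pr (A : CDGA.{u}) (a : A) : ∃ s : Finset ℕ, a = ∑ i ∈ s, A.pr i a := by
  classical
  exact ⟨_, (sum_support_decompose A.gr a).symm⟩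

theorem pr_d (A : CDGA.{u}) (i : ℕ) (a : A) : A.pr i (A.d a) = A.d (A.pr (i + 1) a) := by
  obtain ⟨s, hs⟩ := A.sum_pr a
  conv_lhs => rw [hs]
  conv_rhs => rw [hs]
  simp only [map_sum]
  refine Finset.sum_congr rfl fun j _ => ?_
  rcases j with _ | j
  · rw [A.d_zero (A.pr_mem 0 a), A.pr_ne (A.pr_mem 0 a) (by simp), map_zero, map_zero]
  · by_cases h : j = i
    · subst h
      rw [A.pr_same (A.pr_mem (j + 1) a), A.pr_same (A.d_mem (A.pr_mem (j + 1) a))]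
    · rw [A.pr_ne (A.pr_mem (j + 1) a) (by omega), A.pr_ne (A.d_mem (A.pr_mem (j + 1) a)) h,
        map_zero]

theorem pr_mul (A : CDGA.{u}) (i : ℕ) (a b : A) :
    A.pr i (a * b) = ∑ p ∈ Finset.HasAntidiagonal.antidiagonal i, A.pr p.1 a * A.pr p.2 b := by
  change ((decompose A.gr (a * b) i : A.gr i) : A) = _
  rw [decompose_mul, coe_mul_apply_eq_sum_antidiagonal]
  rfl

theorem d_mul_mem (A : CDGA.{u}) (P : AddSubgroup A) (a b : A)
    (h1 : ∀ i, A.d (A.pr i a) * b ∈ P) (h2 : ∀ i, A.pr i a * A.d b ∈ P) :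
    A.d (a * b) ∈ P := by
  obtain ⟨s, hs⟩ := A.sum_pr a
  rw [hs, Finset.sum_mul, map_sum]
  refine sum_mem fun i _ => ?_
  rw [A.d_mul b (A.pr_mem i a)]
  refine add_mem (h1 i) ?_
  rcases neg_one_pow_eq_or A i with h | h <;> rw [h]
  · rw [one_mul]; exact h2 i
  · rw [neg_one_mul]; exact neg_mem (h2 i)

/-! ### Homology -/

/-- The cycles of degree `i`. -/
def Z (A : CDGA.{u}) (i : ℕ) : Submodule A.deg0 A where
  carrier := {z | z ∈ A.gr i ∧ A.d z = 0}
  add_mem' ha hb := ⟨add_mem ha.1 hb.1, by rw [map_add, ha.2, hb.2, add_zero]⟩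
  zero_mem' := ⟨zero_mem _, map_zero _⟩
  smul_mem' c x hx := by
    refine ⟨?_, ?_⟩
    · have := SetLike.mul_mem_graded c.2 hx.1
      rwa [zero_add] at this
    · rw [smul_def, A.d_mul x c.2, A.d_zero c.2, hx.2]; simp

/-- The boundaries of degree `i`. -/
def B (A : CDGA.{u}) (i : ℕ) : Submodule A.deg0 A where
  carrier := {z | ∃ b ∈ A.gr (i + 1), A.d b = z}
  add_mem' := by
    rintro _ _ ⟨a, ha, rfl⟩ ⟨b, hb, rfl⟩
    exact ⟨a + b, add_mem ha hb, map_add _ _ _⟩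
  zero_mem' := ⟨0, zero_mem _, map_zero _⟩
  smul_mem' := by
    rintro c _ ⟨a, ha, rfl⟩
    refine ⟨c * a, ?_, ?_⟩
    · have := SetLike.mul_mem_graded c.2 ha
      rwa [zero_add] at this
    · rw [A.d_mul a c.2, A.d_zero c.2, smul_def]; simp

/-- The homology module `H_i(A)` over `A₀` (on which `A₀` acts through `H₀(A)`). -/
abbrev H (A : CDGA.{u}) (i : ℕ) : Type u := A.Z i ⧸ (A.B i).submoduleOf (A.Z i)

/-- The ideal of boundaries in `A₀`. -/
def B0 (A : CDGA.{u}) : Ideal A.deg0 where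
  carrier := {a | (a : A) ∈ A.B 0}
  add_mem' ha hb := (A.B 0).add_mem ha hb
  zero_mem' := (A.B 0).zero_mem
  smul_mem' c _ hx := (A.B 0).smul_mem c hx

/-- The ring `H₀(A) = A₀ / d(A₁)`. -/
abbrev H0 (A : CDGA.{u}) : Type u := A.deg0 ⧸ A.B0

/-- Local dg-algebras. Finite generation of `H_i(A)` over `H₀(A)` is the same as over `A₀`,
as `A₀ → H₀(A)` is surjective. -/
class IsLocal (A : CDGA.{u}) : Prop where
  localRing : IsLocalRing A.deg0
  noetherian : IsNoetherianRing A.deg0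
  nontrivial_H0 : Nontrivial A.H0
  finite_H : ∀ i, Module.Finite A.deg0 (A.H i)

instance (A : CDGA.{u}) [h : A.IsLocal] : IsLocalRing A.deg0 := h.localRing

instance (A : CDGA.{u}) [h : A.IsLocal] : IsNoetherianRing A.deg0 := h.noetherian

instance (A : CDGA.{u}) [h : A.IsLocal] : Nontrivial A.H0 := h.nontrivial_H0

instance (A : CDGA.{u}) [A.IsLocal] : IsLocalRing A.H0 :=
  IsLocalRing.of_surjective' (Ideal.Quotient.mk A.B0) Ideal.Quotient.mk_surjective

/-- The homogeneous maximal ideal `𝔪_A` of a local dg-algebra: all elements whose component of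
degree zero is in the maximal ideal of `A₀`. -/
def maxIdeal (A : CDGA.{u}) [A.IsLocal] : Ideal A :=
  (IsLocalRing.maximalIdeal A.deg0).comap A.pr0

/-- The residue field of a local dg-algebra. -/
abbrev residueField (A : CDGA.{u}) [A.IsLocal] : Type u := IsLocalRing.ResidueField A.deg0

theorem pr0_d_mem (A : CDGA.{u}) [A.IsLocal] (a : A) :
    A.pr0 (A.d a) ∈ IsLocalRing.maximalIdeal A.deg0 := by
  have key : A.pr0 (A.d a) ∈ A.B0 :=
    ⟨A.pr 1 a, A.pr_mem 1 a, by rw [coe_pr0, pr_d]⟩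
  exact IsLocalRing.le_maximalIdeal (Ideal.Quotient.nontrivial_iff.1 inferInstance) key

theorem d_mem_maxIdeal (A : CDGA.{u}) [A.IsLocal] (a : A) : A.d a ∈ A.maxIdeal := A.pr0_d_mem a

theorem pr_mem_maxIdeal (A : CDGA.{u}) [A.IsLocal] {a : A} (h : a ∈ A.maxIdeal) (i : ℕ) :
    A.pr i a ∈ A.maxIdeal := by
  change A.pr0 (A.pr i a) ∈ IsLocalRing.maximalIdeal A.deg0
  rcases i with _ | i
  · have : A.pr0 (A.pr 0 a) = A.pr0 a := Subtype.ext (A.pr_same (A.pr_mem 0 a))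
    rw [this]; exact h
  · have : A.pr0 (A.pr (i + 1) a) = 0 := Subtype.ext (A.pr_ne (A.pr_mem (i + 1) a) (by simp))
    rw [this]; exact zero_mem _

/-! ### Morphisms -/

/-- Morphisms of dg-algebras. -/
structure Hom (A : CDGA.{u}) (B : CDGA.{v}) extends A.carrier →+* B.carrier where
  map_gr : ∀ {i a}, a ∈ A.gr i → toRingHom a ∈ B.gr i
  map_d : ∀ a, toRingHom (A.d a) = B.d (toRingHom a)

instance (A : CDGA.{u}) (B : CDGA.{v}) : CoeFun (Hom A B) (fun _ => A → B) :=
  ⟨fun f => f.toRingHom⟩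

/-- Composition of morphisms. -/
def Hom.comp {A : CDGA.{u}} {B : CDGA.{v}} {C : CDGA.{w}} (g : Hom B C) (f : Hom A B) :
    Hom A C where
  toRingHom := g.toRingHom.comp f.toRingHom
  map_gr h := g.map_gr (f.map_gr h)
  map_d a := by simp [f.map_d, g.map_d]

/-- A morphism is local if it maps `𝔪_A` into `𝔪_B`. -/
def Hom.IsLocalMap {A : CDGA.{u}} {B : CDGA.{v}} [A.IsLocal] [B.IsLocal] (f : Hom A B) : Prop :=
  ∀ a ∈ A.maxIdeal, f a ∈ B.maxIdeal

/-- Quasi-isomorphisms: the map induced on the (total) homology `ker d / im d` is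
injective and surjective. -/
def Hom.IsQuasiIso {A : CDGA.{u}} {B : CDGA.{v}} (f : Hom A B) : Prop :=
  (∀ z, A.d z = 0 → (∃ b, B.d b = f z) → ∃ a, A.d a = z) ∧
    ∀ z, B.d z = 0 → ∃ y, A.d y = 0 ∧ ∃ b, z = f y + B.d b

/-! ### Commutative rings as dg-algebras concentrated in degree zero -/

/-- The grading of a ring with everything in degree zero. -/
def trivGr (R : Type u) [CommRing R] (i : ℕ) : AddSubgroup R := if i = 0 then ⊤ else ⊥

theorem mem_trivGr_succ {R : Type u} [CommRing R] {i : ℕ} {a : R} :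
    a ∈ trivGr R (i + 1) ↔ a = 0 := by
  simp [trivGr]

theorem mem_trivGr_zero {R : Type u} [CommRing R] (a : R) : a ∈ trivGr R 0 := by
  simp [trivGr]

instance (R : Type u) [CommRing R] : SetLike.GradedMonoid (trivGr R) where
  one_mem := mem_trivGr_zero 1
  mul_mem := by
    rintro (_ | i) (_ | j) a b ha hb
    · exact mem_trivGr_zero _
    · rw [mem_trivGr_succ] at hb; rw [hb, mul_zero]; exact zero_mem _
    · rw [mem_trivGr_succ] at ha; rw [ha, zero_mul]; exact zero_mem _
    · rw [mem_trivGr_succ] at hb; rw [hb, mul_zero]; exact zero_mem _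

/-- The decomposition of an element of a ring graded by `trivGr`. -/
def trivDecompose (R : Type u) [CommRing R] : R →+ ⨁ i, trivGr R i :=
  (DirectSum.of (fun i => trivGr R i) 0).comp
    { toFun := fun a => ⟨a, mem_trivGr_zero a⟩
      map_zero' := rfl
      map_add' := fun _ _ => rfl }

instance (R : Type u) [CommRing R] : GradedRing (trivGr R) :=
  { (inferInstance : SetLike.GradedMonoid (trivGr R)),
    DirectSum.Decomposition.ofAddHom (trivGr R) (trivDecompose R)
      (by ext a; simp [trivDecompose])
      (by
        ext i x
        rcases i with _ | i
        · simp [trivDecompose]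
        · have : x = 0 := Subtype.ext (mem_trivGr_succ.1 x.2)
          subst this; simp) with }

/-- A commutative ring as a dg-algebra concentrated in degree zero. -/
def ofRing (R : Type u) [CommRing R] : CDGA.{u} where
  carrier := R
  gr := trivGr R
  d := 0
  d_zero _ := rfl
  d_mem _ := zero_mem _
  d_mul _ _ := by simp
  d_d _ := rfl
  comm := by
    rintro (_ | i) (_ | j) a b ha hb
    · simp [mul_comm]
    · rw [mem_trivGr_succ] at hb; simp [hb]
    · rw [mem_trivGr_succ] at ha; simp [ha]
    · rw [mem_trivGr_succ] at hb; simp [hb]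
  sq_zero := by
    rintro (_ | i) a hi ha
    · simp at hi
    · rw [mem_trivGr_succ] at ha; simp [ha]

/-- The underlying ring of `ofRing R` is `R`. -/
def ofRingSelf (R : Type u) [CommRing R] : R ≃+* ofRing R where
  toFun a := a
  invFun a := a
  left_inv _ := rfl
  right_inv _ := rfl
  map_mul' _ _ := rfl
  map_add' _ _ := rfl

/-- The degree zero part of `ofRing R` is `R`. -/
def ofRingEquiv (R : Type u) [CommRing R] : R ≃+* (ofRing R).deg0 where
  toFun a := ⟨a, mem_trivGr_zero a⟩
  invFun a := a.1
  left_inv _ := rfl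
  right_inv _ := rfl
  map_mul' _ _ := rfl
  map_add' _ _ := rfl

/-- The morphism of dg-algebras from a ring `R` (in degree zero) given by `R → A₀`. -/
def ofRingHom {R : Type u} [CommRing R] {A : CDGA.{v}} (f : R →+* A.deg0) : Hom (ofRing R) A where
  toRingHom := A.incl0.comp (f.comp (ofRingSelf R).symm.toRingHom)
  map_gr := by
    rintro (_ | i) a ha
    · exact (f _).2
    · have : a = 0 := (mem_trivGr_succ (R := R) (i := i) (a := a)).1 ha
      subst this
      rw [map_zero]; exact zero_mem _
  map_d a := by
    have h : (ofRing R).d a = 0 := rfl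
    rw [h, map_zero]
    exact (A.d_zero (f _).2).symm

instance (R : Type u) [CommRing R] [IsLocalRing R] [IsNoetherianRing R] : (ofRing R).IsLocal where
  localRing := (ofRingEquiv R).isLocalRing
  noetherian := isNoetherianRing_of_ringEquiv R (ofRingEquiv R)
  nontrivial_H0 := by
    have := (ofRingEquiv R).isLocalRing
    refine Ideal.Quotient.nontrivial_iff.2 ?_
    intro h
    have h1 : (1 : (ofRing R).deg0) ∈ (ofRing R).B0 := h ▸ Submodule.mem_top
    obtain ⟨b, _, hb⟩ := h1
    exact one_ne_zero (α := (ofRing R).deg0) (Subtype.ext hb.symm)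
  finite_H i := by
    have : Module.Finite (ofRing R).deg0 ((ofRing R).Z i) := by
      have := isNoetherianRing_of_ringEquiv R (ofRingEquiv R)
      have hf : Module.Finite (ofRing R).deg0 (ofRing R) :=
        ⟨⟨{1}, by
          rw [eq_top_iff]
          intro x _
          rw [Finset.coe_singleton, Submodule.mem_span_singleton]
          exact ⟨ofRingEquiv R x, mul_one x⟩⟩⟩
      infer_instance
    infer_instance

/-- The canonical morphism from a local dg-algebra `A` to its residue field. -/
def augmentation (A : CDGA.{u}) [A.IsLocal] : Hom A (ofRing A.residueField) where
  toRingHom := (ofRingSelf A.residueField).toRingHom.comp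
    ((IsLocalRing.residue A.deg0).comp A.pr0)
  map_gr := by
    rintro (_ | i) a ha
    · exact mem_trivGr_zero (R := A.residueField) _
    · have : A.pr0 a = 0 := Subtype.ext (A.pr_ne ha (by simp))
      simp only [RingHom.comp_apply, this, map_zero]
      exact zero_mem _
  map_d a := by
    change IsLocalRing.residue A.deg0 (A.pr0 (A.d a)) = 0
    rw [IsLocalRing.residue_eq_zero_iff]
    exact A.pr0_d_mem a

/-! ### Sub- and quotient dg-algebras -/

/-- The homogeneous component of degree `i` of a subring. -/
def subGr (A : CDGA.{u}) (T : Subring A) (i : ℕ) : AddSubgroup T :=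
  (A.gr i).comap T.subtype.toAddMonoidHom

theorem mem_subGr {A : CDGA.{u}} {T : Subring A} {i : ℕ} {a : T} :
    a ∈ A.subGr T i ↔ (a : A) ∈ A.gr i := Iff.rfl

instance (A : CDGA.{u}) (T : Subring A) : SetLike.GradedMonoid (A.subGr T) where
  one_mem := SetLike.GradedOne.one_mem (A := A.gr)
  mul_mem _ _ _ _ ha hb := SetLike.GradedMul.mul_mem (A := A.gr) ha hb

theorem subGr_isInternal (A : CDGA.{u}) (T : Subring A) (hT : ∀ a ∈ T, ∀ i, A.pr i a ∈ T) :
    DirectSum.IsInternal (A.subGr T) := by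
  classical
  constructor
  · rw [injective_iff_map_eq_zero]
    intro x hx
    have h1 : ∀ (x : ⨁ i, A.subGr T i) (i : ℕ),
        A.pr i (DirectSum.coeAddMonoidHom (A.subGr T) x : T) = ((x i : T) : A) := by
      intro x i
      induction x using DirectSum.induction_on with
      | zero => simp
      | of j y =>
        rw [DirectSum.coeAddMonoidHom_of]
        by_cases h : j = i
        · subst h
          rw [DirectSum.of_eq_same]
          exact A.pr_same y.2
        · rw [DirectSum.of_eq_of_ne _ _ _ (Ne.symm h)]
          exact A.pr_ne y.2 h
      | add y z hy hz =>
        rw [map_add, Subring.coe_add, map_add, hy, hz]; rfl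
    ext i
    rw [← h1, hx]; simp
  · intro a
    obtain ⟨s, hs⟩ := A.sum_pr a
    refine ⟨∑ i ∈ s, DirectSum.of (fun i => A.subGr T i) i ⟨⟨A.pr i a, hT a a.2 i⟩, A.pr_mem i a⟩,
      ?_⟩
    rw [map_sum]
    apply Subtype.ext
    conv_rhs => rw [hs]
    simp [DirectSum.coeAddMonoidHom_of]

/-- A homogeneous subring stable under the differential, as a dg-algebra. -/
def sub (A : CDGA.{u}) (T : Subring A) (hT : ∀ a ∈ T, ∀ i, A.pr i a ∈ T)
    (hd : ∀ a ∈ T, A.d a ∈ T) : CDGA.{u} where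
  carrier := T
  gr := A.subGr T
  graded :=
    { (inferInstance : SetLike.GradedMonoid (A.subGr T)),
      (A.subGr_isInternal T hT).chooseDecomposition with }
  d := (A.d.comp T.subtype.toAddMonoidHom).codRestrict T.toAddSubgroup fun a => hd a a.2
  d_zero h := Subtype.ext (A.d_zero h)
  d_mem h := A.d_mem h
  d_mul b h := Subtype.ext (by simpa using A.d_mul (b : A) h)
  d_d a := Subtype.ext (A.d_d a)
  comm ha hb := Subtype.ext (by simpa using A.comm ha hb)
  sq_zero hi ha := Subtype.ext (A.sq_zero hi ha)

/-- The inclusion of one sub-dg-algebra in another. -/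
def subIncl (A : CDGA.{u}) {T T' : Subring A} (hT : ∀ a ∈ T, ∀ i, A.pr i a ∈ T)
    (hd : ∀ a ∈ T, A.d a ∈ T) (hT' : ∀ a ∈ T', ∀ i, A.pr i a ∈ T') (hd' : ∀ a ∈ T', A.d a ∈ T')
    (h : T ≤ T') : Hom (A.sub T hT hd) (A.sub T' hT' hd') where
  toRingHom := Subring.inclusion h
  map_gr {i a} ha := by
    change ((Subring.inclusion h a : T') : A) ∈ A.gr i
    exact ha
  map_d a := Subtype.ext (by
    change A.d (a : T).1 = A.d ((Subring.inclusion h a : T') : A)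
    rfl)

/-- The image of the homogeneous component of degree `i` in a quotient. -/
def quotGr (A : CDGA.{u}) (I : Ideal A) [I.IsTwoSided] (i : ℕ) : AddSubgroup (A ⧸ I) :=
  (A.gr i).map (Ideal.Quotient.mk I).toAddMonoidHom

instance (A : CDGA.{u}) (I : Ideal A) [I.IsTwoSided] : SetLike.GradedMonoid (A.quotGr I) where
  one_mem := ⟨1, SetLike.GradedOne.one_mem (A := A.gr), rfl⟩
  mul_mem := by
    rintro i j _ _ ⟨a, ha, rfl⟩ ⟨b, hb, rfl⟩
    exact ⟨a * b, SetLike.GradedMul.mul_mem (A := A.gr) ha hb, map_mul (Ideal.Quotient.mk I) a b⟩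

theorem quotGr_isInternal (A : CDGA.{u}) (I : Ideal A) [I.IsTwoSided]
    (hI : ∀ a ∈ I, ∀ i, A.pr i a ∈ I) : DirectSum.IsInternal (A.quotGr I) := by
  classical
  constructor
  · rw [injective_iff_map_eq_zero]
    intro x hx
    have h1 : ∀ x : ⨁ i, A.quotGr I i, ∃ a : A,
        Ideal.Quotient.mk I a = DirectSum.coeAddMonoidHom (A.quotGr I) x ∧
        ∀ i, Ideal.Quotient.mk I (A.pr i a) = (x i : A ⧸ I) := by
      intro x
      induction x using DirectSum.induction_on with
      | zero => exact ⟨0, by simp, by simp⟩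
      | of j y =>
        obtain ⟨y, a, ha, rfl⟩ := y
        refine ⟨a, ?_, fun i => ?_⟩
        · rw [DirectSum.coeAddMonoidHom_of]; rfl
        · by_cases h : j = i
          · subst h
            rw [DirectSum.of_eq_same, A.pr_same ha]; rfl
          · rw [DirectSum.of_eq_of_ne _ _ _ (Ne.symm h), A.pr_ne ha h]; simp
      | add y z hy hz =>
        obtain ⟨a, ha, ha'⟩ := hy
        obtain ⟨b, hb, hb'⟩ := hz
        refine ⟨a + b, by rw [map_add, map_add, ha, hb], fun i => ?_⟩
        rw [map_add, map_add, ha', hb']; rfl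
    obtain ⟨a, ha, ha'⟩ := h1 x
    rw [hx, Ideal.Quotient.eq_zero_iff_mem] at ha
    ext i
    rw [← ha' i, Ideal.Quotient.eq_zero_iff_mem.2 (hI a ha i)]; rfl
  · intro q
    obtain ⟨a, rfl⟩ := Ideal.Quotient.mk_surjective q
    obtain ⟨s, hs⟩ := A.sum_pr a
    refine ⟨∑ i ∈ s, DirectSum.of (fun i => A.quotGr I i) i
      ⟨Ideal.Quotient.mk I (A.pr i a), A.pr i a, A.pr_mem i a, rfl⟩, ?_⟩
    rw [map_sum]
    conv_rhs => rw [hs, map_sum]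
    simp [DirectSum.coeAddMonoidHom_of]

/-- The quotient of a dg-algebra by a homogeneous two-sided ideal stable under the
differential. -/
def quot (A : CDGA.{u}) (I : Ideal A) [I.IsTwoSided] (hI : ∀ a ∈ I, ∀ i, A.pr i a ∈ I)
    (hd : ∀ a ∈ I, A.d a ∈ I) : CDGA.{u} where
  carrier := A ⧸ I
  gr := A.quotGr I
  graded :=
    { (inferInstance : SetLike.GradedMonoid (A.quotGr I)),
      (A.quotGr_isInternal I hI).chooseDecomposition with }
  d := QuotientAddGroup.map I.toAddSubgroup I.toAddSubgroup A.d hd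
  d_zero := by
    rintro _ ⟨a, ha, rfl⟩
    exact congrArg (Ideal.Quotient.mk I) (A.d_zero ha)
  d_mem := by
    rintro i _ ⟨a, ha, rfl⟩
    exact ⟨A.d a, A.d_mem ha, rfl⟩
  d_mul := by
    rintro i _ b ⟨a, ha, rfl⟩
    obtain ⟨b, rfl⟩ := Ideal.Quotient.mk_surjective b
    have h := congrArg (Ideal.Quotient.mk I) (A.d_mul b ha)
    simp only [map_add, map_mul, map_pow, map_neg, map_one] at h
    exact h
  d_d := by
    intro a
    obtain ⟨a, rfl⟩ := Ideal.Quotient.mk_surjective a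
    exact congrArg (Ideal.Quotient.mk I) (A.d_d a)
  comm := by
    rintro i j _ _ ⟨a, ha, rfl⟩ ⟨b, hb, rfl⟩
    have h := congrArg (Ideal.Quotient.mk I) (A.comm ha hb)
    simp only [map_mul, map_pow, map_neg, map_one] at h
    exact h
  sq_zero := by
    rintro i _ hi ⟨a, ha, rfl⟩
    exact congrArg (Ideal.Quotient.mk I) (A.sq_zero hi ha)

/-- The canonical surjection from a dg-algebra to a quotient. -/
def quotMk (A : CDGA.{u}) (I : Ideal A) [I.IsTwoSided] (hI : ∀ a ∈ I, ∀ i, A.pr i a ∈ I)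
    (hd : ∀ a ∈ I, A.d a ∈ I) : Hom A (A.quot I hI hd) where
  toRingHom := Ideal.Quotient.mk I
  map_gr {_ a} h := ⟨a, h, rfl⟩
  map_d _ := rfl

/-- The canonical surjection from one quotient of a dg-algebra to another. -/
def quotFactor (A : CDGA.{u}) {I J : Ideal A} [I.IsTwoSided] [J.IsTwoSided]
    (hI : ∀ a ∈ I, ∀ i, A.pr i a ∈ I) (hd : ∀ a ∈ I, A.d a ∈ I)
    (hJ : ∀ a ∈ J, ∀ i, A.pr i a ∈ J) (hd' : ∀ a ∈ J, A.d a ∈ J) (h : I ≤ J) :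
    Hom (A.quot I hI hd) (A.quot J hJ hd') where
  toRingHom := Ideal.Quotient.factor h
  map_gr := by
    rintro i _ ⟨a, ha, rfl⟩
    exact ⟨a, ha, rfl⟩
  map_d a := by
    obtain ⟨a, rfl⟩ := Ideal.Quotient.mk_surjective a
    rfl

section Span

variable (A : CDGA.{u}) (s : Set A)

theorem span_isTwoSided (hs : ∀ a ∈ s, ∀ i, A.pr i a ∈ s) : (Ideal.span s).IsTwoSided where
  mul_mem_of_left := by
    intro x b hx
    induction hx using Submodule.span_induction with
    | mem x hx =>
      obtain ⟨S, hS⟩ := A.sum_pr x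
      obtain ⟨T, hT⟩ := A.sum_pr b
      rw [hS, hT, Finset.sum_mul_sum]
      refine Ideal.sum_mem _ fun i _ => Ideal.sum_mem _ fun j _ => ?_
      rw [A.comm (A.pr_mem i x) (A.pr_mem j b), ← mul_assoc]
      exact Ideal.mul_mem_left _ _ (Ideal.subset_span (hs x hx i))
    | zero => rw [zero_mul]; exact zero_mem _
    | add x y _ _ hx hy => rw [add_mul]; exact add_mem hx hy
    | smul a x _ hx =>
      rw [smul_eq_mul, mul_assoc]; exact Ideal.mul_mem_left _ _ hx

theorem span_pr_mem (hs : ∀ a ∈ s, ∀ i, A.pr i a ∈ s) : ∀ a ∈ Ideal.span s, ∀ i,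
    A.pr i a ∈ Ideal.span s := by
  intro x hx
  induction hx using Submodule.span_induction with
  | mem x hx => exact fun i => Ideal.subset_span (hs x hx i)
  | zero => intro i; rw [map_zero]; exact zero_mem _
  | add x y _ _ hx hy => intro i; rw [map_add]; exact add_mem (hx i) (hy i)
  | smul a x _ hx =>
    intro i
    rw [smul_eq_mul, pr_mul]
    exact Ideal.sum_mem _ fun p _ => Ideal.mul_mem_left _ _ (hx _)

theorem span_d_mem (hd : ∀ a ∈ s, A.d a ∈ s) : ∀ a ∈ Ideal.span s, A.d a ∈ Ideal.span s := by
  intro x hx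
  induction hx using Submodule.span_induction with
  | mem x hx => exact Ideal.subset_span (hd x hx)
  | zero => rw [map_zero]; exact zero_mem _
  | add x y _ _ hx hy => rw [map_add]; exact add_mem hx hy
  | smul a x hx hdx =>
    exact A.d_mul_mem (Ideal.span s).toAddSubgroup a x
      (fun i => Ideal.mul_mem_left _ _ hx) (fun i => Ideal.mul_mem_left _ _ hdx)

end Span

/-! ### Semifree extensions -/

/-- The monomial `∏ v^(e v)`, the factors being taken in increasing order of the variables;
`pw v n` is the `n`-th power, or divided power, of the variable `v`. -/
def monomial {U : CDGA.{v}} {Var : Type w} [LinearOrder Var] (pw : Var → ℕ → U)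
    (e : Var →₀ ℕ) : U :=
  (e.support.sort.map fun v => pw v (e v)).prod

/-- `U` is a semifree extension `A[X]⟨Y⟩` of `A` in variables of positive degrees.
`Var` is the set `X ∪ Y` of variables and `divided` is the subset `Y`; the complement is `X`.
The variables of odd degree are exterior, those of even degree in `X` are polynomial variables,
those of even degree in `Y` are divided power variables. The underlying graded algebra is the
corresponding free one, that is, the monomials form a basis over `A`. For degree reasons the
differential of a variable `v` lies in the subalgebra generated by `A` and the variables of degree
less than `deg v`, so the variables may be adjoined one after the other, by increasing degree. -/
structure SemifreeExt (A : CDGA.{u}) (U : CDGA.{v}) where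
  incl : Hom A U
  Var : Type w
  [ord : LinearOrder Var]
  deg : Var → ℕ
  deg_pos : ∀ x, 0 < deg x
  divided : Set Var
  /-- `pw x n` is `x ^ n` for `x` in `X` or of odd degree, and the divided power `x^(n)` for `x`
  in `Y` of even degree. -/
  pw : Var → ℕ → U
  pw_mem : ∀ x n, pw x n ∈ U.gr (n * deg x)
  pw_zero : ∀ x, pw x 0 = 1
  pw_pow : ∀ x n, x ∉ divided ∨ Odd (deg x) → pw x n = pw x 1 ^ n
  pw_mul : ∀ x m n, x ∈ divided → Even (deg x) →
    pw x m * pw x n = (m + n).choose m • pw x (m + n)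
  d_pw : ∀ x n, x ∈ divided → Even (deg x) → U.d (pw x (n + 1)) = U.d (pw x 1) * pw x n
  basis : Function.Bijective
    fun c : {e : Var →₀ ℕ // ∀ x, Odd (deg x) → e x ≤ 1} →₀ A =>
      c.sum fun e a => incl a * monomial pw e.1

namespace SemifreeExt

variable {A : CDGA.{u}} {U : CDGA.{v}} (E : SemifreeExt.{u, v, w} A U)

instance : LinearOrder E.Var := E.ord

/-- The number `n_i(U)` of variables in `X` of degree `i`. -/
def numX (i : ℤ) : ℕ := Nat.card {x : E.Var // x ∉ E.divided ∧ (E.deg x : ℤ) = i}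

/-- The number `ε_i(U)` of variables in `Y` of degree `i`. -/
def numY (i : ℤ) : ℕ := Nat.card {x : E.Var // x ∈ E.divided ∧ (E.deg x : ℤ) = i}

/-- Minimality: `d(U) ⊆ 𝔪_A U + X² U + XY U + Y^(2) U`; the last three terms together are the ideal
generated by the monomials of total exponent at least two. -/
def IsMinimal [A.IsLocal] : Prop :=
  ∀ u, U.d u ∈ Ideal.span
    (E.incl '' (A.maxIdeal : Set A) ∪ {m | ∃ e : E.Var →₀ ℕ, 2 ≤ e.degree ∧ m = monomial E.pw e})

/-- The subalgebra `U(i) = A[X_{≤ i}]⟨Y_{≤ i}⟩`. -/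
def filtSubring (i : ℕ) : Subring U :=
  Subring.closure (Set.range E.incl ∪ {m | ∃ x n, E.deg x ≤ i ∧ m = E.pw x n})

theorem incl_mem (i : ℕ) (a : A) : E.incl a ∈ E.filtSubring i :=
  Subring.subset_closure (Or.inl ⟨a, rfl⟩)

theorem pw_mem_filt {i : ℕ} {x : E.Var} (h : E.deg x ≤ i) (n : ℕ) : E.pw x n ∈ E.filtSubring i :=
  Subring.subset_closure (Or.inr ⟨x, n, h, rfl⟩)

theorem filtSubring_mono {i j : ℕ} (h : i ≤ j) : E.filtSubring i ≤ E.filtSubring j := by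
  refine Subring.closure_mono (Set.union_subset_union_right _ ?_)
  rintro _ ⟨x, n, hx, rfl⟩
  exact ⟨x, n, hx.trans h, rfl⟩

theorem incl_pr (i : ℕ) (a : A) : U.pr i (E.incl a) = E.incl (A.pr i a) := by
  obtain ⟨s, hs⟩ := A.sum_pr a
  conv_lhs => rw [hs]
  conv_rhs => rw [hs]
  simp only [map_sum]
  refine Finset.sum_congr rfl fun j _ => ?_
  by_cases h : j = i
  · subst h
    rw [A.pr_same (A.pr_mem j a), U.pr_same (E.incl.map_gr (A.pr_mem j a))]
  · rw [A.pr_ne (A.pr_mem j a) h, U.pr_ne (E.incl.map_gr (A.pr_mem j a)) h, map_zero]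

theorem filt_pr (i : ℕ) : ∀ a ∈ E.filtSubring i, ∀ j, U.pr j a ∈ E.filtSubring i := by
  intro a ha
  induction ha using Subring.closure_induction with
  | mem a ha =>
    intro j
    rcases ha with ⟨a, rfl⟩ | ⟨x, n, hx, rfl⟩
    · rw [E.incl_pr]; exact E.incl_mem i _
    · by_cases h : n * E.deg x = j
      · rw [← h, U.pr_same (E.pw_mem x n)]; exact E.pw_mem_filt hx n
      · rw [U.pr_ne (E.pw_mem x n) h]; exact zero_mem _
  | zero => intro j; rw [map_zero]; exact zero_mem _
  | one =>
    intro j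
    have h1 : (1 : U) ∈ U.gr 0 := SetLike.GradedOne.one_mem
    by_cases h : 0 = j
    · rw [← h, U.pr_same h1]; exact one_mem _
    · rw [U.pr_ne h1 h]; exact zero_mem _
  | add x y _ _ hx hy => intro j; rw [map_add]; exact add_mem (hx j) (hy j)
  | neg x _ hx => intro j; rw [map_neg]; exact neg_mem (hx j)
  | mul x y _ _ hx hy =>
    intro j
    rw [pr_mul]
    exact sum_mem fun p _ => mul_mem (hx _) (hy _)

theorem monomial_mem (e : E.Var →₀ ℕ) :
    monomial E.pw e ∈ U.gr (e.support.sort.map fun x => e x * E.deg x).sum :=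
  SetLike.list_prod_map_mem_graded _ _ _ fun x _ => E.pw_mem x (e x)

theorem mem_filt_of_deg {i j : ℕ} (h : j ≤ i) {u : U} (hu : u ∈ U.gr j) :
    u ∈ E.filtSubring i := by
  obtain ⟨c, hc⟩ := E.basis.2 u
  rw [← U.pr_same hu, ← hc]
  simp only [Finsupp.sum, map_sum]
  refine sum_mem fun e _ => ?_
  by_cases hle : (e.1.support.sort.map fun x => e.1 x * E.deg x).sum ≤ j
  · have h1 : U.pr j (E.incl (c e) * monomial E.pw e.1) =
        U.pr (j - (e.1.support.sort.map fun x => e.1 x * E.deg x).sum) (E.incl (c e)) *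
          monomial E.pw e.1 :=
      coe_decompose_mul_of_right_mem_of_le U.gr (E.monomial_mem e.1) hle
    rw [h1]
    refine mul_mem (E.filt_pr i _ (E.incl_mem i _) _) ?_
    refine list_prod_mem fun y hy => ?_
    obtain ⟨x, hx, rfl⟩ := List.mem_map.1 hy
    refine E.pw_mem_filt ?_ _
    have h2 : e.1 x * E.deg x ≤ (e.1.support.sort.map fun x => e.1 x * E.deg x).sum :=
      List.single_le_sum (by simp) _ (List.mem_map.2 ⟨x, hx, rfl⟩)
    have h3 : 0 < e.1 x := by
      rw [Finset.mem_sort, Finsupp.mem_support_iff] at hx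
      omega
    have h4 : E.deg x ≤ e.1 x * E.deg x := Nat.le_mul_of_pos_left _ h3
    omega
  · have h1 : U.pr j (E.incl (c e) * monomial E.pw e.1) = 0 :=
      coe_decompose_mul_of_right_mem_of_not_le U.gr (E.monomial_mem e.1) hle
    rw [h1]; exact zero_mem _

theorem filt_d (i : ℕ) : ∀ a ∈ E.filtSubring i, U.d a ∈ E.filtSubring i := by
  have hmul : ∀ x y, x ∈ E.filtSubring i → y ∈ E.filtSubring i → U.d x ∈ E.filtSubring i →
      U.d y ∈ E.filtSubring i → U.d (x * y) ∈ E.filtSubring i := by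
    intro x y hx hy hdx hdy
    refine U.d_mul_mem (E.filtSubring i).toAddSubgroup x y (fun j => ?_) (fun j => ?_)
    · refine (E.filtSubring i).mul_mem ?_ hy
      rcases j with _ | j
      · rw [U.d_zero (U.pr_mem 0 x)]; exact zero_mem _
      · rw [← pr_d]; exact E.filt_pr i _ hdx j
    · exact (E.filtSubring i).mul_mem (E.filt_pr i x hx j) hdy
  have hone : U.d 1 = 0 := U.d_zero (SetLike.GradedOne.one_mem (A := U.gr))
  intro a ha
  induction ha using Subring.closure_induction with
  | mem a ha =>
    rcases ha with ⟨a, rfl⟩ | ⟨x, n, hx, rfl⟩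
    · rw [← E.incl.map_d]; exact E.incl_mem i _
    · have h1 : U.d (E.pw x 1) ∈ E.filtSubring i := by
        have h2 : E.pw x 1 ∈ U.gr ((E.deg x - 1) + 1) := by
          have := E.pw_mem x 1
          rwa [one_mul, ← Nat.sub_add_cancel (E.deg_pos x)] at this
        exact E.mem_filt_of_deg (by omega) (U.d_mem h2)
      by_cases hx' : x ∈ E.divided ∧ Even (E.deg x)
      · rcases n with _ | n
        · rw [E.pw_zero, hone]; exact zero_mem _
        · rw [E.d_pw x n hx'.1 hx'.2]; exact mul_mem h1 (E.pw_mem_filt hx n)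
      · have h3 : ∀ n, U.d (E.pw x 1 ^ n) ∈ E.filtSubring i := by
          intro n
          induction n with
          | zero => rw [pow_zero, hone]; exact zero_mem _
          | succ n ih =>
            rw [pow_succ]
            exact hmul _ _ (pow_mem (E.pw_mem_filt hx 1) n) (E.pw_mem_filt hx 1) ih h1
        rw [E.pw_pow x n (by rw [← Nat.not_even_iff_odd]; tauto)]
        exact h3 n
  | zero => rw [map_zero]; exact zero_mem _
  | one => rw [hone]; exact zero_mem _
  | add x y _ _ hx hy => rw [map_add]; exact add_mem hx hy
  | neg x _ hx => rw [map_neg]; exact neg_mem hx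
  | mul x y hx hy hdx hdy => exact hmul x y hx hy hdx hdy

/-- The dg-subalgebra `U(i) = A[X_{≤ i}]⟨Y_{≤ i}⟩` of `U`. -/
def filt (i : ℕ) : CDGA.{v} := U.sub (E.filtSubring i) (E.filt_pr i) (E.filt_d i)

/-- The inclusion of `A` in `U(i)`. -/
def toFilt (i : ℕ) : Hom A (E.filt i) where
  toRingHom := E.incl.toRingHom.codRestrict (E.filtSubring i) (E.incl_mem i)
  map_gr h := E.incl.map_gr h
  map_d a := Subtype.ext (E.incl.map_d a)

/-- The inclusion of `U(i)` in `U(i + 1)`. -/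
def filtIncl (i : ℕ) : Hom (E.filt i) (E.filt (i + 1)) :=
  U.subIncl _ _ _ _ (E.filtSubring_mono i.le_succ)

section Fiber

variable [U.IsLocal]

/-- The homogeneous maximal ideal of `U(i)`, as a subset of `U`. -/
def fiberSet (i : ℕ) : Set U := {u | u ∈ E.filtSubring i ∧ u ∈ U.maxIdeal}

theorem fiberSet_pr (i : ℕ) : ∀ a ∈ E.fiberSet i, ∀ j, U.pr j a ∈ E.fiberSet i :=
  fun a ha j => ⟨E.filt_pr i a ha.1 j, U.pr_mem_maxIdeal ha.2 j⟩

theorem fiberSet_d (i : ℕ) : ∀ a ∈ E.fiberSet i, U.d a ∈ E.fiberSet i :=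
  fun a ha => ⟨E.filt_d i a ha.1, U.d_mem_maxIdeal a⟩

/-- The ideal `𝔪_{U(i)} U` of `U`. -/
def fiberIdeal (i : ℕ) : Ideal U := Ideal.span (E.fiberSet i)

instance (i : ℕ) : (E.fiberIdeal i).IsTwoSided := U.span_isTwoSided _ (E.fiberSet_pr i)

/-- The dg-algebra `k ⊗_{U(i)} U = U / 𝔪_{U(i)} U`, where `k` is the residue field of `U(i)`. -/
def fiber (i : ℕ) : CDGA.{v} :=
  U.quot (E.fiberIdeal i) (U.span_pr_mem _ (E.fiberSet_pr i)) (U.span_d_mem _ (E.fiberSet_d i))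

/-- The canonical surjection `U → k ⊗_{U(i)} U`. -/
def toFiber (i : ℕ) : Hom U (E.fiber i) := U.quotMk (E.fiberIdeal i) _ _

/-- The canonical surjection `k ⊗_{U(i)} U → k ⊗_{U(i+1)} U`. -/
def fiberMap (i : ℕ) : Hom (E.fiber i) (E.fiber (i + 1)) :=
  U.quotFactor _ _ _ _
    (Ideal.span_mono fun _ h => ⟨E.filtSubring_mono i.le_succ h.1, h.2⟩)

end Fiber

/-- `K` is the Koszul complex `A[e_j | d(e_j) = t_j]` on elements `t_j` of `A₀`. -/
def IsKoszul {d : ℕ} (t : Fin d → A) : Prop :=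
  E.divided = ∅ ∧ (∀ x, E.deg x = 1) ∧
    ∃ e : Fin d ≃ E.Var, ∀ j, U.d (E.pw (e j) 1) = E.incl (t j)

end SemifreeExt

/-- A model for a morphism `p : A → B` of local dg-algebras with switching degree `s`: a local
semifree extension `U = A[X]⟨Y⟩` of `A` with `X_{≥ s} = ∅ = Y_{< s}`, and a local
quasi-isomorphism `U → B` that extends `p`. -/
structure Model {A : CDGA.{u}} {B : CDGA.{v}} [A.IsLocal] [B.IsLocal] (p : Hom A B) (s : ℕ∞)
    (U : CDGA.{x}) [U.IsLocal] extends SemifreeExt A U where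
  toB : Hom U B
  toB_incl : ∀ a, toB (incl a) = p a
  toB_local : toB.IsLocalMap
  toB_quasiIso : toB.IsQuasiIso
  switch : ∀ x, x ∈ divided ↔ s ≤ (deg x : ℕ∞)

/-- A minimal model of `p : A → B`: a minimal model with switching degree `∞`, so that `U = A[X]`. -/
structure MinimalModel {A : CDGA.{u}} {B : CDGA.{v}} [A.IsLocal] [B.IsLocal] (p : Hom A B)
    (U : CDGA.{x}) [U.IsLocal] extends Model.{u, v, x, w} p ⊤ U where
  minimal : toSemifreeExt.IsMinimal

/-- An acyclic closure of `p : A → B`: a minimal model with switching degree `0`, so that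
`U = A⟨Y⟩`. -/
structure AcyclicClosure {A : CDGA.{u}} {B : CDGA.{v}} [A.IsLocal] [B.IsLocal] (p : Hom A B)
    (U : CDGA.{x}) [U.IsLocal] extends Model.{u, v, x, w} p 0 U where
  minimal : toSemifreeExt.IsMinimal

/-- The embedding dimension of a local ring: the minimal number of generators of its maximal
ideal. -/
def embDim (R : Type u) [CommRing R] [IsLocalRing R] : ℕ :=
  (IsLocalRing.maximalIdeal R).spanFinrank

end

end CDGA

/-!
Write `V = S[X]`, let `K` be its Koszul complex and `U` the acyclic closure over `K`. Then `U` is a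
semifree resolution of `k` over `V`, with variables the `e_j` and `Y` (`SemifreeExt.tower`). The
projection `c : U → V` that maps these variables to zero (`SemifreeExt.const`) does not commute with
the differentials, but for a variable `y` of degree at most `i + 1` the element `c (d y)` lies in
`V(i) ∩ 𝔪_V`. So `c` induces morphisms `U(i + 1) → k ⊗_{V(i)} V`
(`const_d_sub_mem_fiberIdeal`, `fiberHom`), which are surjective and compatible with each other.

They are quasi-isomorphisms if cycles in the kernel bound elements of the kernel (`LiftsCycles i`).
This is proved by induction on `i`, together with the equality `|X_i| = |Y_{i+1}|`:

* If `LiftsCycles i` holds, acyclicity of `U` and minimality of `V` and of `U` show that the linear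
  part `k Y_{i+2} → k X_{i+1}` of `c ∘ d` is bijective (`linMap_surjective`, `linMap_injective`).
* If these linear parts are bijective up to degree `i`, then by Nakayama the elements `c (d y)` may
  serve as variables of `V` in degrees up to `i` (`exists_ringEquiv_of_varsMatch`). Now
  `d y = x + ⋯`, so the `x` and `y` cancel in pairs (`pair`), and what they generate together with
  the `e_j` is quasi-isomorphic to the Koszul complex of `S`, a resolution of `k` as `S` is regular
  (`koszul_exact`, `exists_d_eq_of_mem_stage`). Over this resolution, `U(i + 1)` is semifree on the
  remaining variables of `V`, and a cycle with coefficients in the maximal ideal bounds an element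
  of the same kind (`exists_d_eq_of_rep_mem_ker`), which gives `LiftsCycles i`
  (`liftsCycles_of_match`).

That `U(1) = K` holds because `𝔪_S` consists of boundaries in `K` (`one_lt_deg_of_isKoszul`).

The resolution `U` of `k` over `V` need not be minimal, as differentials of variables of degree two
may involve the `e_j` linearly. After a change of the variables `e_j`, some of these, say `r`, are
such differentials (`exists_koszul_exchange`). The resulting pairs generate a dg-algebra
quasi-isomorphic to `V`, hence to `A` (`exists_retraction`), over which `U` is minimal. Minimal
semifree resolutions of `k` by divided power variables over quasi-isomorphic dg-algebras have the
same numbers of variables (`card_deg_eq`): such a resolution `U` over `R` has zero differential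
after base change to `k` (`coeff_d_mem_ker`, by means of derivations that commute with the
differential), so for two such resolutions, over `R` and `R'`, the homology of `W ⊗_R U` has both
the monomials of `U` and those of `W` as a basis. Comparing with an acyclic closure `W` over `A`,
with variables `Q`, one finds `|Y_2| = |Q_2| + r`, `|Y_j| = |Q_j|` for `j > 2`, and
`m - r = |Q_1|`. The number `|Q_1|` is the embedding dimension of `H₀(A)` (`card_deg_one`), and the
formula for `|X_i| = |Y_{i+1}|` follows.
-/

set_option linter.unusedSectionVars false
set_option linter.unusedSimpArgs false

universe y z y' w'

namespace CDGA

noncomputable section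

/-! ### The sign automorphism -/

section Sign

variable (A : CDGA.{u})

/-- Additive properties that hold for homogeneous elements hold for all elements. -/
theorem homogeneous_induction {A : CDGA.{u}} {p : A → Prop} (a : A) (h0 : p 0)
    (hadd : ∀ a b, p a → p b → p (a + b)) (hom : ∀ i a, a ∈ A.gr i → p a) : p a := by
  obtain ⟨s, hs⟩ := A.sum_pr a
  rw [hs]
  exact Finset.sum_induction _ p hadd h0 fun i _ => hom i _ (A.pr_mem i a)

/-- The additive map that is multiplication with `(-1) ^ (n * i)` in degree `i`. -/
def sgnAdd (n : ℕ) : A →+ A :=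
  (DirectSum.toAddMonoid fun i =>
    (zsmulAddGroupHom ((-1 : ℤ) ^ (n * i))).comp (A.gr i).subtype).comp
    (decomposeAddEquiv A.gr).toAddMonoidHom

theorem sgnAdd_of_mem (n : ℕ) {i : ℕ} {a : A} (h : a ∈ A.gr i) :
    A.sgnAdd n a = (-1) ^ (n * i) * a := by
  simp only [sgnAdd, AddMonoidHom.comp_apply, AddEquiv.toAddMonoidHom_eq_coe,
    AddMonoidHom.coe_coe, decomposeAddEquiv_apply]
  rw [decompose_of_mem A.gr h, DirectSum.toAddMonoid_of]
  simp

theorem neg_one_pow_mul_comm {R : Type*} [Ring R] (n : ℕ) (a b : R) :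
    a * ((-1) ^ n * b) = (-1) ^ n * (a * b) := by
  rcases neg_one_pow_eq_or R n with h | h <;> simp [h]

theorem neg_one_pow_mul_self {R : Type*} [Ring R] (n : ℕ) (a : R) :
    (-1) ^ n * ((-1) ^ n * a) = a := by
  rcases neg_one_pow_eq_or R n with h | h <;> simp [h]

theorem neg_one_pow_mem (n : ℕ) {P : AddSubgroup A} {a : A} (h : a ∈ P) :
    (-1) ^ n * a ∈ P := by
  rcases neg_one_pow_eq_or A n with h' | h' <;> simpa [h'] using h

theorem map_neg_one_pow_mul {B : Type*} [Ring B] {R : Type*} [Ring R] (f : R →+ B) (n : ℕ)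
    (a : R) : f ((-1) ^ n * a) = (-1) ^ n * f a := by
  rcases neg_one_pow_eq_or R n with h | h
  · rcases Nat.even_or_odd n with hn | hn <;> simp [hn.neg_one_pow]
  · rcases Nat.even_or_odd n with hn | hn <;> simp [hn.neg_one_pow]

theorem one_mem0 : (1 : A) ∈ A.gr 0 := SetLike.GradedOne.one_mem

theorem mul_mem' {i j : ℕ} {a b : A} (ha : a ∈ A.gr i) (hb : b ∈ A.gr j) : a * b ∈ A.gr (i + j) :=
  SetLike.GradedMul.mul_mem ha hb

/-- The ring automorphism that is multiplication with `(-1) ^ (n * i)` in degree `i`: the `n`-th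
power of the sign automorphism. -/
def sgn (n : ℕ) : A →+* A where
  toFun := A.sgnAdd n
  map_zero' := map_zero _
  map_add' := map_add _
  map_one' := by
    rw [A.sgnAdd_of_mem n A.one_mem0]; simp
  map_mul' a b := by
    refine homogeneous_induction (p := fun a => A.sgnAdd n (a * b) = A.sgnAdd n a * A.sgnAdd n b)
      a (by simp) (fun a a' h h' => ?_) (fun i a ha => ?_)
    · rw [add_mul, map_add, h, h', map_add, add_mul]
    refine homogeneous_induction (p := fun b => A.sgnAdd n (a * b) = A.sgnAdd n a * A.sgnAdd n b)
      b (by simp) (fun a a' h h' => ?_) (fun j b hb => ?_)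
    · rw [mul_add, map_add, h, h', map_add, mul_add]
    rw [A.sgnAdd_of_mem n ha, A.sgnAdd_of_mem n hb, A.sgnAdd_of_mem n (A.mul_mem' ha hb),
      mul_add, pow_add, mul_assoc, mul_assoc, neg_one_pow_mul_comm (n * j) a b]

variable {A}

theorem sgn_of_mem (n : ℕ) {i : ℕ} {a : A} (h : a ∈ A.gr i) :
    A.sgn n a = (-1) ^ (n * i) * a := A.sgnAdd_of_mem n h

theorem sgn_mem (n : ℕ) {i : ℕ} {a : A} (h : a ∈ A.gr i) : A.sgn n a ∈ A.gr i := by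
  rw [sgn_of_mem n h]; exact A.neg_one_pow_mem _ h

theorem sgn_sgn (m n : ℕ) (a : A) : A.sgn m (A.sgn n a) = A.sgn (m + n) a := by
  refine homogeneous_induction (p := fun a => A.sgn m (A.sgn n a) = A.sgn (m + n) a) a (by simp)
    (fun a b ha hb => by rw [map_add, map_add, ha, hb, map_add]) (fun i a ha => ?_)
  rw [sgn_of_mem n ha, ← sgn_of_mem n ha, sgn_of_mem m (sgn_mem n ha), sgn_of_mem n ha,
    sgn_of_mem _ ha, add_mul, pow_add, mul_assoc]

theorem sgn_even {n : ℕ} (hn : Even n) (a : A) : A.sgn n a = a := by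
  refine homogeneous_induction (p := fun a => A.sgn n a = a) a (by simp)
    (fun a b ha hb => by rw [map_add, ha, hb]) (fun i a ha => ?_)
  rw [sgn_of_mem _ ha, (hn.mul_right i).neg_one_pow, one_mul]

theorem sgn_self (n : ℕ) (a : A) : A.sgn n (A.sgn n a) = a := by
  rw [sgn_sgn, sgn_even ⟨n, rfl⟩]

theorem sgn_odd_of_mem {i : ℕ} {a : A} (h : a ∈ A.gr i) :
    A.sgn 1 a = (-1) ^ i * a := by rw [sgn_of_mem 1 h, one_mul]

theorem d_mul' (a b : A) : A.d (a * b) = A.d a * b + A.sgn 1 a * A.d b := by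
  refine homogeneous_induction (p := fun a => A.d (a * b) = A.d a * b + A.sgn 1 a * A.d b) a
    (by simp) (fun a a' h h' => ?_) (fun i a ha => ?_)
  · rw [add_mul, map_add, h, h', map_add, map_add, add_mul, add_mul]; abel
  · rw [A.d_mul b ha, sgn_odd_of_mem ha, mul_assoc]

theorem sgn_d (n : ℕ) (a : A) : A.sgn n (A.d a) = (-1) ^ n * A.d (A.sgn n a) := by
  refine homogeneous_induction (p := fun a => A.sgn n (A.d a) = (-1) ^ n * A.d (A.sgn n a)) a
    (by simp) (fun a a' h h' => ?_) (fun i a ha => ?_)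
  · rw [map_add, map_add, h, h', map_add, map_add, mul_add]
  · rcases i with _ | i
    · rw [A.d_zero ha, A.d_zero (sgn_mem n ha)]; simp
    · rw [sgn_of_mem n ha, sgn_of_mem n (A.d_mem ha), map_neg_one_pow_mul, mul_add, mul_one,
        add_comm, pow_add, mul_assoc, neg_one_pow_mul_self]

theorem sgn_one_d (a : A) : A.sgn 1 (A.d a) = - A.d (A.sgn 1 a) := by
  rw [sgn_d]; simp

theorem d_sgn_one (a : A) : A.d (A.sgn 1 a) = - A.sgn 1 (A.d a) := by
  rw [sgn_one_d, neg_neg]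

/-- Graded commutativity, with the sign expressed by the sign automorphism. -/
theorem mul_comm_sgn {j : ℕ} (a : A) {b : A} (hb : b ∈ A.gr j) : a * b = b * A.sgn j a := by
  refine homogeneous_induction (p := fun a => a * b = b * A.sgn j a) a (by simp)
    (fun a a' h h' => by rw [add_mul, h, h', map_add, mul_add]) (fun i a ha => ?_)
  rw [A.comm ha hb, sgn_of_mem j ha, neg_one_pow_mul_comm, mul_comm i j]

theorem mul_comm_sgn' {j : ℕ} (a : A) {b : A} (hb : b ∈ A.gr j) : b * a = A.sgn j a * b := by
  rw [mul_comm_sgn _ hb, sgn_self]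

theorem Hom.map_sgn {B : CDGA.{v}} (f : Hom A B) (n : ℕ) (a : A) :
    f (A.sgn n a) = B.sgn n (f a) := by
  refine homogeneous_induction (p := fun a => f (A.sgn n a) = B.sgn n (f a)) a (by simp)
    (fun a b ha hb => by rw [map_add, map_add, ha, hb, map_add, map_add]) (fun i a ha => ?_)
  rw [sgn_of_mem n ha, sgn_of_mem n (f.map_gr ha), map_mul, map_pow, map_neg, map_one]

theorem Hom.map_pr {B : CDGA.{v}} (f : Hom A B) (i : ℕ) (a : A) :
    f (A.pr i a) = B.pr i (f a) := by
  refine homogeneous_induction (p := fun a => f (A.pr i a) = B.pr i (f a)) a (by simp)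
    (fun a b ha hb => by rw [map_add, map_add, ha, hb, map_add, map_add]) (fun j a ha => ?_)
  by_cases h : j = i
  · subst h; rw [A.pr_same ha, B.pr_same (f.map_gr ha)]
  · rw [A.pr_ne ha h, B.pr_ne (f.map_gr ha) h, map_zero]

theorem d_one : A.d 1 = 0 := A.d_zero A.one_mem0

theorem eq_zero_of_pr {a : A} (h : ∀ i, A.pr i a = 0) : a = 0 := by
  obtain ⟨s, hs⟩ := A.sum_pr a
  rw [hs]; exact Finset.sum_eq_zero fun i _ => h i

theorem pr_pr (i j : ℕ) (a : A) : A.pr i (A.pr j a) = if i = j then A.pr j a else 0 := by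
  split_ifs with h
  · subst h; exact A.pr_same (A.pr_mem _ a)
  · exact A.pr_ne (A.pr_mem _ a) (Ne.symm h)

theorem d_pr_succ (i : ℕ) (a : A) : A.d (A.pr (i + 1) a) = A.pr i (A.d a) := (A.pr_d i a).symm

theorem d_pr_zero (a : A) : A.d (A.pr 0 a) = 0 := A.d_zero (A.pr_mem 0 a)

theorem d_pr_of_d_eq_zero {a : A} (h : A.d a = 0) (i : ℕ) : A.d (A.pr i a) = 0 := by
  cases i with
  | zero => exact d_pr_zero a
  | succ i => rw [d_pr_succ, h, map_zero]

theorem pr_zero_eq_sub (a : A) : ∃ b : A, a = A.pr 0 a + b ∧ A.pr 0 b = 0 :=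
  ⟨a - A.pr 0 a, by abel, by rw [map_sub, pr_pr]; simp⟩

end Sign

/-! ### Monomials in graded commuting families -/

/-- The structure constants of the free divided power algebra on one variable `x`: the product of
the `m`-th and the `n`-th (divided) power of `x` is `structConst deg D x m n` times the
`(m + n)`-th; here `D` is the set of divided variables. -/
def structConst {Var : Type w} (deg : Var → ℕ) (D : Set Var) (x : Var) (m n : ℕ) : ℤ := by
  classical
  exact if Odd (deg x) then (if m + n ≤ 1 then 1 else 0) else
    if x ∈ D then ((m + n).choose m : ℤ) else 1

/-- The exponent `e` is admissible if the exterior variables have exponent at most one. -/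
def IsAdm {Var : Type w} (deg : Var → ℕ) (e : Var →₀ ℕ) : Prop := ∀ x, Odd (deg x) → e x ≤ 1

/-- The admissible exponents: they index the monomial basis of a semifree extension. -/
abbrev Adm {Var : Type w} (deg : Var → ℕ) : Type w := {e : Var →₀ ℕ // ∀ x, Odd (deg x) → e x ≤ 1}

theorem IsAdm.mono {Var : Type w} {deg : Var → ℕ} {e f : Var →₀ ℕ} (hf : IsAdm deg f)
    (h : e ≤ f) : IsAdm deg e := fun x hx => (h x).trans (hf x hx)

/-- The degree of a monomial. -/
def wdeg {Var : Type w} (deg : Var → ℕ) : (Var →₀ ℕ) →+ ℕ :=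
  Finsupp.liftAddHom fun x => AddMonoidHom.mulRight (deg x)

theorem wdeg_single {Var : Type w} (deg : Var → ℕ) (x : Var) (n : ℕ) :
    wdeg deg (Finsupp.single x n) = n * deg x := by simp [wdeg]

theorem wdeg_apply {Var : Type w} (deg : Var → ℕ) (e : Var →₀ ℕ) :
    wdeg deg e = ∑ x ∈ e.support, e x * deg x := by simp [wdeg, Finsupp.sum]

theorem le_wdeg {Var : Type w} (deg : Var → ℕ) (e : Var →₀ ℕ) (x : Var) :
    e x * deg x ≤ wdeg deg e := by
  classical
  by_cases hx : x ∈ e.support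
  · rw [wdeg_apply]
    exact Finset.single_le_sum (f := fun x => e x * deg x) (fun _ _ => Nat.zero_le _) hx
  · rw [Finsupp.notMem_support_iff] at hx; simp [hx]

theorem deg_le_wdeg {Var : Type w} (deg : Var → ℕ) (e : Var →₀ ℕ) {x : Var}
    (hx : e x ≠ 0) : deg x ≤ wdeg deg e :=
  (Nat.le_mul_of_pos_left _ (Nat.pos_of_ne_zero hx)).trans (le_wdeg deg e x)

/-- The monomial with exponent `e`, in a monoid. -/
def mono {Var : Type w} [LinearOrder Var] {B : Type*} [Monoid B] (p : Var → ℕ → B)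
    (e : Var →₀ ℕ) : B :=
  (e.support.sort.map fun v => p v (e v)).prod

theorem monomial_eq_mono {U : CDGA.{v}} {Var : Type w} [LinearOrder Var] (pw : Var → ℕ → U)
    (e : Var →₀ ℕ) : monomial pw e = mono pw e := rfl

/-- The family `p` of (divided) powers satisfies, over the image of `g`, the relations that hold
in a semifree extension of `A` with variables of degrees `deg` and set of divided variables `D`. -/
structure IsFamily (A : CDGA.{u}) {Var : Type w} (deg : Var → ℕ) (D : Set Var) {B : Type x}
    [Ring B] (g : A →+* B) (p : Var → ℕ → B) : Prop where
  zero : ∀ x, p x 0 = 1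
  coef : ∀ {i a} x n, a ∈ A.gr i → g a * p x n = (-1) ^ (i * (n * deg x)) * (p x n * g a)
  comm : ∀ {x y} m n, x ≠ y →
    p x m * p y n = (-1) ^ ((m * deg x) * (n * deg y)) * (p y n * p x m)
  mul : ∀ x m n, p x m * p x n = structConst deg D x m n • p x (m + n)

namespace IsFamily

variable {A : CDGA.{u}} {Var : Type w} [LinearOrder Var] {deg : Var → ℕ} {D : Set Var}
  {B : Type x} [Ring B] {g : A →+* B} {p : Var → ℕ → B} (F : IsFamily A deg D g p)

include F

theorem prod_perm (e : Var → ℕ) {l l' : List Var} (h : l.Perm l') (hl : l.Nodup) :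
    ∃ k : ℕ, (l.map fun v => p v (e v)).prod = (-1) ^ k * (l'.map fun v => p v (e v)).prod := by
  induction h with
  | nil => exact ⟨0, by simp⟩
  | cons x h ih =>
    obtain ⟨k, hk⟩ := ih hl.of_cons
    exact ⟨k, by rw [List.map_cons, List.prod_cons, hk, List.map_cons, List.prod_cons,
      neg_one_pow_mul_comm]⟩
  | swap x y l =>
    refine ⟨(e y * deg y) * (e x * deg x), ?_⟩
    have hxy : y ≠ x := by
      intro h; subst h; simp at hl
    simp only [List.map_cons, List.prod_cons]
    rw [← mul_assoc, F.comm _ _ hxy]; simp only [mul_assoc]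
  | trans h1 h2 ih1 ih2 =>
    obtain ⟨k, hk⟩ := ih1 hl
    obtain ⟨k', hk'⟩ := ih2 (h1.nodup_iff.1 hl)
    exact ⟨k + k', by rw [hk, hk', pow_add, mul_assoc]⟩

theorem prod_filter (e : Var →₀ ℕ) (l : List Var) :
    (l.map fun v => p v (e v)).prod = ((l.filter (e · ≠ 0)).map fun v => p v (e v)).prod := by
  induction l with
  | nil => simp
  | cons x l ih =>
    by_cases hx : e x = 0
    · simp [List.filter_cons, hx, F.zero, ih]
    · simp [List.filter_cons, hx, ih]

/-- A monomial may, up to sign, be computed with its variables in any order. -/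
theorem mono_eq_list (e : Var →₀ ℕ) {l : List Var} (hl : l.Nodup) (h : ∀ v, e v ≠ 0 → v ∈ l) :
    ∃ k : ℕ, mono p e = (-1) ^ k * (l.map fun v => p v (e v)).prod := by
  rw [F.prod_filter e l]
  refine F.prod_perm e ?_ (Finset.sort_nodup _ _)
  rw [List.perm_ext_iff_of_nodup (Finset.sort_nodup _ _) (hl.filter _)]
  intro v
  simp only [Finset.mem_sort, Finsupp.mem_support_iff, List.mem_filter, decide_eq_true_eq]
  exact ⟨fun hv => ⟨h v hv, hv⟩, fun hv => hv.2⟩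

theorem prod_congr {e f : Var →₀ ℕ} {l : List Var} (h : ∀ v ∈ l, e v = f v) :
    (l.map fun v => p v (e v)).prod = (l.map fun v => p v (f v)).prod := by
  rw [List.map_congr_left fun v hv => by rw [h v hv]]

theorem structConst_of_not_isAdm {e : Var →₀ ℕ} (he : IsAdm deg e) {x : Var} {n : ℕ}
    (h : ¬ IsAdm deg (e + Finsupp.single x n)) : structConst deg D x (e x) n = 0 := by
  classical
  simp only [IsAdm, not_forall] at h
  obtain ⟨y, hy, h⟩ := h
  have hyx : y = x := by
    by_contra hyx
    apply h
    simpa [Finsupp.single_apply, Ne.symm hyx] using he y hy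
  subst hyx
  simp only [Finsupp.add_apply, Finsupp.single_eq_same] at h
  rw [structConst, if_pos hy, if_neg h]

theorem mono_mul_pw {e : Var →₀ ℕ} (he : IsAdm deg e) (x : Var) (n : ℕ) :
    ∃ z : ℤ, mono p e * p x n = z • mono p (e + Finsupp.single x n) ∧
      (¬ IsAdm deg (e + Finsupp.single x n) → z = 0) := by
  classical
  have hl : ((e.support.erase x).sort ++ [x]).Nodup := by
    rw [List.nodup_append]
    refine ⟨Finset.sort_nodup _ _, by simp, ?_⟩
    intro a ha b hb
    simp only [Finset.mem_sort, Finset.mem_erase] at ha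
    simp only [List.mem_singleton] at hb
    rw [hb]; exact ha.1
  obtain ⟨k, hk⟩ := F.mono_eq_list e hl (fun v hv => by
    by_cases h : v = x <;> simp [h, hv])
  obtain ⟨k', hk'⟩ := F.mono_eq_list (e + Finsupp.single x n) hl (fun v hv => by
    by_cases h : v = x
    · simp [h]
    · have : e v ≠ 0 := by simpa [Finsupp.single_apply, Ne.symm h] using hv
      simp [h, this])
  have hc : (((e.support.erase x).sort).map fun v => p v ((e + Finsupp.single x n) v)).prod =
      (((e.support.erase x).sort).map fun v => p v (e v)).prod := by
    refine F.prod_congr fun v hv => ?_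
    simp only [Finset.mem_sort, Finset.mem_erase] at hv
    simp [Finsupp.single_apply, Ne.symm hv.1]
  simp only [List.map_append, List.prod_append, hc] at hk hk'
  refine ⟨(-1) ^ k * (-1) ^ k' * structConst deg D x (e x) n, ?_, fun h => by
    rw [F.structConst_of_not_isAdm he h, mul_zero]⟩
  rw [hk, hk']
  simp only [List.map_cons, List.map_nil, List.prod_cons, List.prod_nil, mul_one,
    Finsupp.add_apply, Finsupp.single_eq_same]
  rw [mul_assoc, mul_assoc, F.mul, mul_smul_comm, mul_smul_comm]
  generalize (List.map (fun v => p v (e v)) (e.support.erase x).sort).prod * p x (e x + n) = t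
  rcases neg_one_pow_eq_or B k with h1 | h1 <;> rcases neg_one_pow_eq_or B k' with h2 | h2 <;>
    rcases Nat.even_or_odd k with h3 | h3 <;> rcases Nat.even_or_odd k' with h4 | h4 <;>
      simp [h3.neg_one_pow, h4.neg_one_pow]

theorem mono_mul_list {e : Var →₀ ℕ} (he : IsAdm deg e) (f : Var → ℕ) (l : List Var) :
    ∃ z : ℤ, mono p e * (l.map fun v => p v (f v)).prod =
        z • mono p (e + (l.map fun v => Finsupp.single v (f v)).sum) ∧
      (¬ IsAdm deg (e + (l.map fun v => Finsupp.single v (f v)).sum) → z = 0) := by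
  induction l generalizing e with
  | nil => exact ⟨1, by simp, fun h => absurd he (by simpa using h)⟩
  | cons x l ih =>
    obtain ⟨z, hz, hz'⟩ := F.mono_mul_pw he x (f x)
    simp only [List.map_cons, List.prod_cons, List.sum_cons]
    rw [← mul_assoc, hz, smul_mul_assoc, ← add_assoc]
    by_cases h : IsAdm deg (e + Finsupp.single x (f x))
    · obtain ⟨z', h1, h2⟩ := ih h
      exact ⟨z * z', by rw [h1, mul_smul], fun h3 => by rw [h2 h3, mul_zero]⟩
    · exact ⟨0, by rw [hz' h, zero_smul, zero_smul], fun _ => rfl⟩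

omit F in
theorem sum_single (f : Var →₀ ℕ) :
    (f.support.sort.map fun v => Finsupp.single v (f v)).sum = f := by
  classical
  conv_rhs => rw [← Finsupp.sum_single f]
  rw [Finsupp.sum, ← Finset.sum_map_toList]
  exact (List.Perm.map _ (Finset.sort_perm_toList _ _)).sum_eq

/-- The product of two monomials is an integer multiple of a monomial. -/
theorem mono_mul_mono {e : Var →₀ ℕ} (he : IsAdm deg e) (f : Var →₀ ℕ) :
    ∃ z : ℤ, mono p e * mono p f = z • mono p (e + f) ∧ (¬ IsAdm deg (e + f) → z = 0) := by
  have := F.mono_mul_list he f f.support.sort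
  rwa [sum_single] at this

/-- The product of two monomials without common variables is a monomial, up to sign. -/
theorem mono_add {e f : Var →₀ ℕ} (h : Disjoint e.support f.support) :
    ∃ k : ℕ, mono p (e + f) = (-1) ^ k * (mono p e * mono p f) := by
  classical
  have hd : ∀ v ∈ e.support, v ∉ f.support := fun v hv hv' => Finset.disjoint_left.1 h hv hv'
  obtain ⟨k, hk⟩ := F.mono_eq_list (e + f) (l := e.support.sort ++ f.support.sort) (by
    rw [List.nodup_append]
    refine ⟨Finset.sort_nodup _ _, Finset.sort_nodup _ _, ?_⟩
    intro a ha b hb hab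
    subst hab
    rw [Finset.mem_sort] at ha hb
    exact hd _ ha hb) (fun v hv => by
      simp only [List.mem_append, Finset.mem_sort, Finsupp.mem_support_iff]
      by_contra hc
      push Not at hc
      exact hv (by simp [hc.1, hc.2]))
  refine ⟨k, ?_⟩
  rw [hk, List.map_append, List.prod_append, F.prod_congr (e := e + f) (f := e) (fun v hv => ?_),
    F.prod_congr (e := e + f) (f := f) (fun v hv => ?_)]
  · rfl
  · rw [Finset.mem_sort] at hv
    have : e v = 0 := by
      by_contra h'
      exact hd v (Finsupp.mem_support_iff.2 h') hv
    simp [this]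
  · rw [Finset.mem_sort] at hv
    have : f v = 0 := Finsupp.notMem_support_iff.1 (hd v hv)
    simp [this]

theorem coef_list {i : ℕ} {a : A} (ha : a ∈ A.gr i) (f : Var → ℕ) (l : List Var) :
    ∃ k : ℕ, (l.map fun v => p v (f v)).prod * g a =
      (-1) ^ k * (g a * (l.map fun v => p v (f v)).prod) := by
  induction l with
  | nil => exact ⟨0, by simp⟩
  | cons x l ih =>
    obtain ⟨k, hk⟩ := ih
    refine ⟨k + i * (f x * deg x), ?_⟩
    simp only [List.map_cons, List.prod_cons]
    rw [mul_assoc, hk, neg_one_pow_mul_comm, ← mul_assoc (p x (f x)) (g a), pow_add, mul_assoc,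
      ← mul_assoc (g a), F.coef x (f x) ha, mul_assoc ((-1) ^ (i * _)), mul_assoc ((-1) ^ k),
      neg_one_pow_mul_self, mul_assoc (p x (f x))]

theorem coef_mono {i : ℕ} {a : A} (ha : a ∈ A.gr i) (e : Var →₀ ℕ) :
    ∃ k : ℕ, mono p e * g a = (-1) ^ k * (g a * mono p e) := F.coef_list ha _ _

omit F in
theorem mono_zero : mono p (0 : Var →₀ ℕ) = 1 := by simp [mono]

omit F in
theorem mono_single {x : Var} {n : ℕ} (hn : n ≠ 0) : mono p (Finsupp.single x n) = p x n := by
  simp [mono, Finsupp.support_single, hn]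

theorem mono_single' (x : Var) (n : ℕ) : mono p (Finsupp.single x n) = p x n := by
  rcases eq_or_ne n 0 with rfl | hn
  · rw [F.zero, Finsupp.single_zero, mono_zero]
  · exact mono_single hn

/-- The additive subgroup spanned, over the image of `A`, by the admissible monomials with exponents
in `P`. -/
def spn (_ : IsFamily A deg D g p) (P : Set (Var →₀ ℕ)) : AddSubgroup B :=
  AddSubgroup.closure {b | ∃ a e, IsAdm deg e ∧ e ∈ P ∧ b = g a * mono p e}

theorem mem_spn {P : Set (Var →₀ ℕ)} (a : A) {e : Var →₀ ℕ} (he : IsAdm deg e) (hP : e ∈ P) :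
    g a * mono p e ∈ F.spn P := AddSubgroup.subset_closure ⟨a, e, he, hP, rfl⟩

theorem spn_mono {P P' : Set (Var →₀ ℕ)} (h : P ⊆ P') : F.spn P ≤ F.spn P' :=
  AddSubgroup.closure_mono fun _ ⟨a, e, he, hP, hb⟩ => ⟨a, e, he, h hP, hb⟩

/-- The spans of sets of monomials multiply as the sets of exponents add. -/
theorem mul_mem_spn {P P' P'' : Set (Var →₀ ℕ)} (hP : ∀ e ∈ P, ∀ f ∈ P', e + f ∈ P'') {b c : B}
    (hb : b ∈ F.spn P) (hc : c ∈ F.spn P') : b * c ∈ F.spn P'' := by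
  induction hb using AddSubgroup.closure_induction with
  | mem b hb =>
    obtain ⟨a, e, he, heP, rfl⟩ := hb
    induction hc using AddSubgroup.closure_induction with
    | mem c hc =>
      obtain ⟨a', f, hf, hfP, rfl⟩ := hc
      refine homogeneous_induction (p := fun a' => g a * mono p e * (g a' * mono p f) ∈ F.spn P'')
        a' (by rw [map_zero, zero_mul, mul_zero]; exact zero_mem _)
        (fun x y hx hy => by rw [map_add, add_mul, mul_add]; exact add_mem hx hy)
        (fun i a' ha' => ?_)
      obtain ⟨k, hk⟩ := F.coef_mono ha' e
      obtain ⟨z, hz, hz'⟩ := F.mono_mul_mono he f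
      have : g a * mono p e * (g a' * mono p f) =
          (-1) ^ k * (z • (g (a * a') * mono p (e + f))) := by
        rw [mul_assoc, ← mul_assoc (mono p e), hk, map_mul, mul_assoc ((-1) ^ k),
          neg_one_pow_mul_comm, mul_assoc (g a'), hz, mul_smul_comm, mul_smul_comm, mul_assoc]
      rw [this]
      have h1 : z • (g (a * a') * mono p (e + f)) ∈ F.spn P'' := by
        by_cases h : IsAdm deg (e + f)
        · exact zsmul_mem (F.mem_spn _ h (hP e heP f hfP)) z
        · rw [hz' h, zero_smul]; exact zero_mem _
      rcases neg_one_pow_eq_or B k with h | h <;> simpa [h] using h1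
    | zero => rw [mul_zero]; exact zero_mem _
    | add x y _ _ hx hy => rw [mul_add]; exact add_mem hx hy
    | neg x _ hx => rw [mul_neg]; exact neg_mem hx
  | zero => rw [zero_mul]; exact zero_mem _
  | add x y _ _ hx hy => rw [add_mul]; exact add_mem hx hy
  | neg x _ hx => rw [neg_mul]; exact neg_mem hx

/-- The span of the monomials in a set of variables is a subring. -/
def spnRing (P : Set Var) : Subring B :=
  { F.spn {e | ∀ x ∉ P, e x = 0} with
    mul_mem' := fun {a b} ha hb => F.mul_mem_spn
      (P := {e | ∀ x ∉ P, e x = 0}) (P' := {e | ∀ x ∉ P, e x = 0})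
      (P'' := {e | ∀ x ∉ P, e x = 0}) (fun e he f hf x hx => by
        rw [Finsupp.add_apply, he x hx, hf x hx]) ha hb
    one_mem' := by
      have := F.mem_spn (P := {e | ∀ x ∉ P, e x = 0}) 1 (e := 0) (fun x _ => by simp)
        (fun x _ => rfl)
      rwa [map_one, mono_zero, mul_one] at this }

theorem mem_spnRing {P : Set Var} {b : B} :
    b ∈ F.spnRing P ↔ b ∈ F.spn {e | ∀ x ∉ P, e x = 0} := Iff.rfl

theorem coef_mem_spnRing (P : Set Var) (a : A) : g a ∈ F.spnRing P := by
  have := F.mem_spn (P := {e | ∀ x ∉ P, e x = 0}) a (e := 0) (fun x _ => by simp)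
    (fun x _ => rfl)
  rwa [mono_zero, mul_one] at this

omit [LinearOrder Var] in
theorem pw_odd {x : Var} (hx : Odd (deg x)) {n : ℕ} (hn : 2 ≤ n) (h1 : p x n = p x 1 ^ n) :
    p x n = 0 := by
  obtain ⟨n, rfl⟩ := Nat.exists_eq_add_of_le hn
  have := F.mul x 1 1
  rw [structConst, if_pos hx, if_neg (by norm_num), zero_smul] at this
  rw [h1, pow_add, pow_two, this, zero_mul]

theorem pw_mem_spnRing {P : Set Var} {x : Var} (hx : x ∈ P) {n : ℕ}
    (h : Odd (deg x) → 2 ≤ n → p x n = p x 1 ^ n) : p x n ∈ F.spnRing P := by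
  by_cases h' : Odd (deg x) ∧ 2 ≤ n
  · rw [F.pw_odd h'.1 h'.2 (h h'.1 h'.2)]; exact zero_mem _
  · have := F.mem_spn (P := {e | ∀ x ∉ P, e x = 0}) 1 (e := Finsupp.single x n) (fun y hy => by
      classical
      rw [Finsupp.single_apply]
      split_ifs with hxy
      · subst hxy
        by_contra hc
        exact h' ⟨hy, by omega⟩
      · simp) (fun y hy => by
        rw [Finsupp.single_apply, if_neg]
        rintro rfl; exact hy hx)
    rwa [map_one, one_mul, F.mono_single'] at this

omit F in
theorem map_mono {B' : Type*} [Ring B'] (φ : B →+* B') (e : Var →₀ ℕ) :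
    φ (mono p e) = mono (fun x n => φ (p x n)) e := by
  simp [mono, map_list_prod, Function.comp_def]

end IsFamily

/-! ### The monomial basis of a semifree extension -/

namespace SemifreeExt

variable {A : CDGA.{u}} {U : CDGA.{v}} (E : SemifreeExt.{u, v, w} A U)

theorem pw_pow_odd {x : E.Var} (hx : Odd (E.deg x)) {n : ℕ} (hn : 2 ≤ n) : E.pw x n = 0 := by
  obtain ⟨n, rfl⟩ := Nat.exists_eq_add_of_le hn
  have h := E.pw_mem x 1
  rw [one_mul] at h
  rw [E.pw_pow x _ (Or.inr hx), pow_add, pow_two, U.sq_zero hx h, zero_mul]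

/-- The variables of a semifree extension satisfy the defining relations. -/
theorem fam : IsFamily A E.deg E.divided E.incl.toRingHom E.pw where
  zero := E.pw_zero
  coef x n ha := U.comm (E.incl.map_gr ha) (E.pw_mem x n)
  comm m n _ := U.comm (E.pw_mem _ m) (E.pw_mem _ n)
  mul x m n := by
    classical
    rw [structConst]
    split_ifs with h1 h2 h3
    · rw [E.pw_pow x m (Or.inr h1), E.pw_pow x n (Or.inr h1), E.pw_pow x (m + n) (Or.inr h1), one_smul,
        pow_add]
    · rw [E.pw_pow x m (Or.inr h1), E.pw_pow x n (Or.inr h1), ← pow_add, ← E.pw_pow x (m + n) (Or.inr h1),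
        E.pw_pow_odd h1 (by omega), zero_smul]
    · rw [E.pw_mul x m n h3 (Nat.not_odd_iff_even.1 h1)]
      simp
    · rw [E.pw_pow x m (Or.inl h3), E.pw_pow x n (Or.inl h3), E.pw_pow x (m + n) (Or.inl h3), one_smul,
        pow_add]

/-- The coefficients of an element of `U` with respect to the monomial basis. -/
def rep : U ≃+ (Adm E.deg →₀ A) :=
  (AddEquiv.ofBijective (Finsupp.liftAddHom fun e : Adm E.deg =>
    (AddMonoidHom.mulRight (mono E.pw e.1)).comp E.incl.toRingHom.toAddMonoidHom) E.basis).symm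

/-- The monomial with exponent `e`. -/
def mon (e : Adm E.deg) : U := mono E.pw e.1

theorem rep_symm_single (e : Adm E.deg) (a : A) :
    E.rep.symm (Finsupp.single e a) = E.incl a * E.mon e := by
  change Finsupp.liftAddHom _ _ = _
  simp only [Finsupp.liftAddHom_apply_single]
  rfl

theorem rep_mon (e : Adm E.deg) (a : A) : E.rep (E.incl a * E.mon e) = Finsupp.single e a := by
  rw [← rep_symm_single, AddEquiv.apply_symm_apply]

/-- Induction on the terms of an element. -/
theorem term_induction {p : U → Prop} (u : U) (h0 : p 0) (hadd : ∀ a b, p a → p b → p (a + b))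
    (hterm : ∀ (a : A) (e : Adm E.deg), p (E.incl a * E.mon e)) : p u := by
  have : ∀ c : Adm E.deg →₀ A, p (E.rep.symm c) := by
    intro c
    induction c using Finsupp.induction_linear with
    | zero => rwa [map_zero]
    | add f g hf hg => rw [map_add]; exact hadd _ _ hf hg
    | single e a => rw [rep_symm_single]; exact hterm a e
  simpa using this (E.rep u)

theorem rep_sum (u : U) : u = (E.rep u).sum fun e a => E.incl a * E.mon e := by
  conv_lhs => rw [← E.rep.symm_apply_apply u, ← Finsupp.sum_single (E.rep u), Finsupp.sum, map_sum]
  simp [rep_symm_single, Finsupp.sum]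

theorem rep_incl_mul (a : A) (u : U) (e : Adm E.deg) :
    E.rep (E.incl a * u) e = a * E.rep u e := by
  refine E.term_induction (p := fun u => E.rep (E.incl a * u) e = a * E.rep u e) u (by simp)
    (fun u v hu hv => ?_) (fun b f => ?_)
  · rw [mul_add, map_add, Finsupp.add_apply, hu, hv, map_add, Finsupp.add_apply, mul_add]
  · rw [← mul_assoc, ← map_mul, rep_mon, rep_mon]
    by_cases h : f = e
    · subst h; simp
    · simp [Finsupp.single_apply, h]

theorem ext_rep {u v : U} (h : ∀ e, E.rep u e = E.rep v e) : u = v :=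
  E.rep.injective (Finsupp.ext h)

/-- The trivial exponent. -/
def zeroAdm : Adm E.deg := ⟨0, fun _ _ => by simp⟩

theorem mon_zeroAdm : E.mon E.zeroAdm = 1 := IsFamily.mono_zero

theorem rep_incl (a : A) : E.rep (E.incl a) = Finsupp.single E.zeroAdm a := by
  rw [← rep_mon, mon_zeroAdm, mul_one]

theorem incl_injective : Function.Injective E.incl := by
  intro a b h
  have h1 := E.rep_incl a
  rw [h, E.rep_incl] at h1
  exact (Finsupp.single_injective _ h1).symm

/-- The exponent of a single variable. -/
def varAdm (x : E.Var) : Adm E.deg := ⟨Finsupp.single x 1, fun y _ => by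
  classical
  rw [Finsupp.single_apply]; split_ifs <;> simp⟩

theorem mon_varAdm (x : E.Var) : E.mon (E.varAdm x) = E.pw x 1 := E.fam.mono_single' x 1

theorem varAdm_injective : Function.Injective E.varAdm := by
  intro x y h
  have := congrArg Subtype.val h
  exact (Finsupp.single_left_inj one_ne_zero).1 this

theorem varAdm_ne_zeroAdm (x : E.Var) : E.varAdm x ≠ E.zeroAdm := by
  intro h
  have := DFunLike.congr_fun (congrArg Subtype.val h) x
  simp [varAdm, zeroAdm] at this

theorem mon_mem (e : Adm E.deg) : E.mon e ∈ U.gr (wdeg E.deg e.1) := by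
  have := E.monomial_mem e.1
  have h : wdeg E.deg e.1 = (e.1.support.sort.map fun x => e.1 x * E.deg x).sum := by
    rw [wdeg_apply, ← Finset.sum_map_toList]
    exact (List.Perm.map _ (Finset.sort_perm_toList _ _).symm).sum_eq
  rw [h]; exact this

/-- The coefficients of the homogeneous components. -/
theorem rep_pr (j : ℕ) (u : U) (e : Adm E.deg) :
    E.rep (U.pr j u) e =
      if wdeg E.deg e.1 ≤ j then A.pr (j - wdeg E.deg e.1) (E.rep u e) else 0 := by
  refine E.term_induction (p := fun u => E.rep (U.pr j u) e =
      if wdeg E.deg e.1 ≤ j then A.pr (j - wdeg E.deg e.1) (E.rep u e) else 0) u (by simp)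
    (fun u v hu hv => ?_) (fun b f => ?_)
  · rw [map_add, map_add, Finsupp.add_apply, hu, hv, map_add, Finsupp.add_apply, map_add]
    split_ifs <;> simp
  refine homogeneous_induction (p := fun b => E.rep (U.pr j (E.incl b * E.mon f)) e =
      if wdeg E.deg e.1 ≤ j then A.pr (j - wdeg E.deg e.1) (E.rep (E.incl b * E.mon f) e) else 0) b
    (by simp) (fun a b ha hb => ?_) (fun i b hb => ?_)
  · rw [map_add, add_mul, map_add, map_add, Finsupp.add_apply, ha, hb, map_add, Finsupp.add_apply,
      map_add]
    split_ifs <;> simp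
  have h1 := U.mul_mem' (E.incl.map_gr hb) (E.mon_mem f)
  rw [rep_mon]
  by_cases hj : i + wdeg E.deg f.1 = j
  · rw [U.pr_same (hj ▸ h1), rep_mon]
    by_cases h : f = e
    · subst h
      rw [if_pos (by omega), Finsupp.single_eq_same, A.pr_same]
      convert hb using 2; omega
    · simp [Finsupp.single_apply, h]
  · rw [U.pr_ne h1 hj, map_zero, Finsupp.zero_apply]
    by_cases h : f = e
    · subst h
      split_ifs with hle
      · rw [Finsupp.single_eq_same, A.pr_ne hb]; omega
      · rfl
    · simp [Finsupp.single_apply, h]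

theorem rep_mem {j : ℕ} {u : U} (hu : u ∈ U.gr j) (e : Adm E.deg) :
    E.rep u e ∈ A.gr (j - wdeg E.deg e.1) := by
  rw [← U.pr_same hu, rep_pr]
  split_ifs
  · exact A.pr_mem _ _
  · exact zero_mem _

theorem rep_eq_zero {j : ℕ} {u : U} (hu : u ∈ U.gr j) {e : Adm E.deg} (h : j < wdeg E.deg e.1) :
    E.rep u e = 0 := by
  rw [← U.pr_same hu, rep_pr, if_neg (by omega)]

/-! ### Spans of monomials -/

theorem mem_spn_iff {P : Set (E.Var →₀ ℕ)} {u : U} :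
    u ∈ E.fam.spn P ↔ ∀ e : Adm E.deg, E.rep u e ≠ 0 → e.1 ∈ P := by
  constructor
  · intro h
    induction h using AddSubgroup.closure_induction with
    | mem x hx =>
      obtain ⟨a, e, he, hP, rfl⟩ := hx
      intro f hf
      change E.rep (E.incl a * E.mon ⟨e, he⟩) f ≠ 0 at hf
      rw [rep_mon, Finsupp.single_apply] at hf
      split_ifs at hf with h
      · rw [← h]; exact hP
      · exact absurd rfl hf
    | zero => intro e he; simp at he
    | add x y _ _ hx hy =>
      intro e he
      by_contra h
      apply he
      rw [map_add, Finsupp.add_apply, not_not.1 (mt (hx e) h), not_not.1 (mt (hy e) h), add_zero]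
    | neg x _ hx =>
      intro e he
      rw [map_neg, Finsupp.neg_apply, neg_ne_zero] at he
      exact hx e he
  · intro h
    rw [E.rep_sum u]
    exact sum_mem fun e he => E.fam.mem_spn _ e.2 (h e (Finsupp.mem_support_iff.1 he))

theorem mem_spnRing_iff {P : Set E.Var} {u : U} :
    u ∈ E.fam.spnRing P ↔ ∀ e : Adm E.deg, E.rep u e ≠ 0 → ∀ x ∉ P, e.1 x = 0 := by
  rw [IsFamily.mem_spnRing, mem_spn_iff]; rfl

theorem spnRing_mono {P P' : Set E.Var} (h : P ⊆ P') : E.fam.spnRing P ≤ E.fam.spnRing P' :=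
  E.fam.spn_mono fun _ he x hx => he x fun h' => hx (h h')

theorem pw_mem_spnRing {P : Set E.Var} {x : E.Var} (hx : x ∈ P) (n : ℕ) :
    E.pw x n ∈ E.fam.spnRing P :=
  E.fam.pw_mem_spnRing hx fun h _ => E.pw_pow x n (Or.inr h)

theorem incl_mem_spnRing (P : Set E.Var) (a : A) : E.incl a ∈ E.fam.spnRing P :=
  E.fam.coef_mem_spnRing P a

theorem mon_mem_spnRing {P : Set E.Var} {e : Adm E.deg} (h : ∀ x ∉ P, e.1 x = 0) :
    E.mon e ∈ E.fam.spnRing P := by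
  have := E.fam.mem_spn (P := {e | ∀ x ∉ P, e x = 0}) 1 e.2 h
  rwa [map_one, one_mul] at this

/-- The span of the monomials in a set of variables is generated by these variables. -/
theorem spnRing_eq_closure (P : Set E.Var) :
    E.fam.spnRing P = Subring.closure (Set.range E.incl ∪ {m | ∃ x n, x ∈ P ∧ m = E.pw x n}) := by
  apply le_antisymm
  · intro u hu
    rw [E.rep_sum u]
    refine sum_mem fun e he => mul_mem (Subring.subset_closure (Or.inl ⟨_, rfl⟩)) ?_
    refine list_prod_mem fun y hy => ?_
    obtain ⟨x, hx, rfl⟩ := List.mem_map.1 hy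
    refine Subring.subset_closure (Or.inr ⟨x, _, ?_, rfl⟩)
    by_contra hP
    rw [Finset.mem_sort, Finsupp.mem_support_iff] at hx
    exact hx (E.mem_spnRing_iff.1 hu e (Finsupp.mem_support_iff.1 he) x hP)
  · rw [Subring.closure_le]
    rintro _ (⟨a, rfl⟩ | ⟨x, n, hx, rfl⟩)
    · exact E.incl_mem_spnRing P a
    · exact E.pw_mem_spnRing hx n

theorem filtSubring_eq (i : ℕ) : E.filtSubring i = E.fam.spnRing {x | E.deg x ≤ i} := by
  rw [spnRing_eq_closure]; rfl

theorem closure_gen : Subring.closure (Set.range E.incl ∪ {m | ∃ x n, m = E.pw x n}) = ⊤ := by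
  rw [eq_top_iff]
  intro u _
  rw [E.rep_sum u]
  refine sum_mem fun e he => mul_mem (Subring.subset_closure (Or.inl ⟨_, rfl⟩)) ?_
  refine list_prod_mem fun y hy => ?_
  obtain ⟨x, hx, rfl⟩ := List.mem_map.1 hy
  exact Subring.subset_closure (Or.inr ⟨x, _, rfl⟩)

/-- The universal property of semifree extensions: a family in a ring `B` that satisfies the
relations defines a ring homomorphism. Its graph is the span of the monomials in `U × B`. -/
theorem exists_lift {B : Type x} [Ring B] {g : A →+* B} {p : E.Var → ℕ → B}
    (F : IsFamily A E.deg E.divided g p) (hp : ∀ x, Odd (E.deg x) → ∀ n, 2 ≤ n → p x n = 0) :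
    ∃ φ : U →+* B, (∀ a, φ (E.incl a) = g a) ∧ ∀ x n, φ (E.pw x n) = p x n := by
  have neg_pow : ∀ n : ℕ, ((-1) ^ n : U × B) = ((-1) ^ n, (-1) ^ n) := by
    intro n
    ext <;> simp
  let F' : IsFamily A E.deg E.divided (E.incl.toRingHom.prod g) (fun x n => (E.pw x n, p x n)) :=
    { zero := fun x => by rw [E.pw_zero, F.zero]; rfl
      coef := fun x n ha => by
        rw [neg_pow]
        exact Prod.ext (E.fam.coef x n ha) (F.coef x n ha)
      comm := fun m n h => by
        rw [neg_pow]
        exact Prod.ext (E.fam.comm m n h) (F.comm m n h)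
      mul := fun x m n => Prod.ext (E.fam.mul x m n) (F.mul x m n) }
  have hpw : ∀ x n, ((E.pw x n, p x n) : U × B) ∈ F'.spnRing Set.univ := by
    intro x n
    refine F'.pw_mem_spnRing (Set.mem_univ x) fun hx hn => ?_
    rw [Prod.pow_mk, ← E.pw_pow x n (Or.inr hx)]
    refine Prod.ext rfl ?_
    obtain ⟨n, rfl⟩ := Nat.exists_eq_add_of_le hn
    have := F.mul x 1 1
    rw [structConst, if_pos hx, if_neg (by norm_num), zero_smul] at this
    change p x (2 + n) = p x 1 ^ (2 + n)
    rw [pow_add, pow_two, this, zero_mul, hp x hx _ hn]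
  -- the graph is the set of all combinations of monomials
  have hform : ∀ b ∈ F'.spnRing Set.univ, ∃ c : Adm E.deg →₀ A,
      b.1 = c.sum (fun e a => E.incl a * E.mon e) ∧ b.2 = c.sum fun e a => g a * mono p e.1 := by
    intro b hb
    induction hb using AddSubgroup.closure_induction with
    | mem b hb =>
      obtain ⟨a, e, he, _, rfl⟩ := hb
      refine ⟨Finsupp.single ⟨e, he⟩ a, ?_, ?_⟩
      · rw [Finsupp.sum_single_index (by simp)]
        have := IsFamily.map_mono (p := fun x n => (E.pw x n, p x n)) (RingHom.fst U B) e
        exact congrArg (E.incl a * ·) this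
      · rw [Finsupp.sum_single_index (by simp)]
        have := IsFamily.map_mono (p := fun x n => (E.pw x n, p x n)) (RingHom.snd U B) e
        exact congrArg (g a * ·) this
    | zero => exact ⟨0, by simp, by simp⟩
    | add x y _ _ hx hy =>
      obtain ⟨c, hc, hc'⟩ := hx
      obtain ⟨c', hc1, hc1'⟩ := hy
      refine ⟨c + c', ?_, ?_⟩
      · rw [Finsupp.sum_add_index' (by simp) (by simp [add_mul]), ← hc, ← hc1]; rfl
      · rw [Finsupp.sum_add_index' (by simp) (by simp [add_mul]), ← hc', ← hc1']; rfl
    | neg x _ hx =>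
      obtain ⟨c, hc, hc'⟩ := hx
      refine ⟨-c, ?_, ?_⟩
      · rw [Finsupp.sum_neg_index (by simp)]
        simp only [map_neg, neg_mul, Finsupp.sum_neg, Prod.fst_neg, hc]
      · rw [Finsupp.sum_neg_index (by simp)]
        simp only [map_neg, neg_mul, Finsupp.sum_neg, Prod.snd_neg, hc']
  let π : F'.spnRing Set.univ →+* U := (RingHom.fst U B).comp (F'.spnRing Set.univ).subtype
  have hπ : Function.Bijective π := by
    constructor
    · rw [injective_iff_map_eq_zero]
      rintro ⟨b, hb⟩ h
      obtain ⟨c, h1, h2⟩ := hform b hb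
      have hb1 : b.1 = 0 := h
      rw [hb1] at h1
      have hc : c = 0 := E.basis.1 (by
        change (c.sum fun e a => E.incl a * E.mon e) = _
        rw [← h1]; simp)
      rw [hc, Finsupp.sum_zero_index] at h2
      exact Subtype.ext (Prod.ext hb1 h2)
    · have : π.range = ⊤ := by
        rw [eq_top_iff, ← E.closure_gen, Subring.closure_le]
        rintro _ (⟨a, rfl⟩ | ⟨x, n, rfl⟩)
        · exact ⟨⟨_, F'.coef_mem_spnRing _ a⟩, rfl⟩
        · exact ⟨⟨_, hpw x n⟩, rfl⟩
      exact RingHom.range_eq_top.1 this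
  let ψ := RingEquiv.ofBijective π hπ
  have key : ∀ b (hb : b ∈ F'.spnRing Set.univ), (ψ.symm b.1).1 = b := by
    intro b hb
    have : ψ.symm b.1 = ⟨b, hb⟩ := by
      rw [RingEquiv.symm_apply_eq]; rfl
    rw [this]
  refine ⟨((RingHom.snd U B).comp (F'.spnRing Set.univ).subtype).comp ψ.symm.toRingHom, ?_, ?_⟩
  · intro a
    exact congrArg Prod.snd (key _ (F'.coef_mem_spnRing _ a))
  · intro x n
    exact congrArg Prod.snd (key _ (hpw x n))

variable {A : CDGA.{u}} {U : CDGA.{v}} (E : SemifreeExt.{u, v, w} A U)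

/-! ### Splitting off a set of variables -/

theorem rep_neg_one_pow_mul (k : ℕ) (u : U) (e : Adm E.deg) :
    E.rep ((-1) ^ k * u) e = (-1) ^ k * E.rep u e := by
  rcases Nat.even_or_odd k with hk | hk
  · rw [hk.neg_one_pow, hk.neg_one_pow, one_mul, one_mul]
  · rw [hk.neg_one_pow, hk.neg_one_pow, neg_one_mul, neg_one_mul, map_neg, Finsupp.neg_apply]

open Classical in
/-- The part of an exponent in a set of variables. -/
def res (P : Set E.Var) (e : Adm E.deg) : Adm E.deg :=
  ⟨e.1.filter (· ∈ P), fun x hx => by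
    rw [Finsupp.filter_apply]; split_ifs
    · exact e.2 x hx
    · exact Nat.zero_le _⟩

theorem res_of_mem {P : Set E.Var} (e : Adm E.deg) {x : E.Var} (h : x ∈ P) :
    (E.res P e).1 x = e.1 x := by
  classical exact Finsupp.filter_apply_pos _ _ h

theorem res_of_notMem {P : Set E.Var} (e : Adm E.deg) {x : E.Var} (h : x ∉ P) :
    (E.res P e).1 x = 0 := by
  classical exact Finsupp.filter_apply_neg _ _ h

theorem res_add_res (P : Set E.Var) (e : Adm E.deg) :
    (E.res P e).1 + (E.res Pᶜ e).1 = e.1 := by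
  ext x
  rw [Finsupp.add_apply]
  by_cases h : x ∈ P
  · rw [E.res_of_mem e h, E.res_of_notMem e (not_not.2 h), add_zero]
  · rw [E.res_of_notMem e h, E.res_of_mem e (show x ∈ Pᶜ from h), zero_add]

theorem exists_sign (P : Set E.Var) (e : Adm E.deg) :
    ∃ k : ℕ, E.mon e = (-1) ^ k * (E.mon (E.res P e) * E.mon (E.res Pᶜ e)) := by
  have h : Disjoint (E.res P e).1.support (E.res Pᶜ e).1.support := by
    rw [Finset.disjoint_left]
    intro x h1 h2
    rw [Finsupp.mem_support_iff] at h1 h2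
    by_cases h : x ∈ P
    · exact h2 (E.res_of_notMem e (not_not.2 h))
    · exact h1 (E.res_of_notMem e h)
  have := E.fam.mono_add h
  rwa [E.res_add_res P e] at this

/-- The coefficients of an element of `U` with respect to the basis of `U` over the span of the
monomials in `P` that consists of the monomials in the other variables. -/
def split (P : Set E.Var) : U →+ (Adm E.deg →₀ U) :=
  (Finsupp.liftAddHom fun e => (Finsupp.singleAddHom (E.res Pᶜ e)).comp
    ((AddMonoidHom.mulRight ((-1) ^ (E.exists_sign P e).choose * E.mon (E.res P e))).comp
      E.incl.toRingHom.toAddMonoidHom)).comp E.rep.toAddMonoidHom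

theorem split_term (P : Set E.Var) (a : A) (e : Adm E.deg) :
    E.split P (E.incl a * E.mon e) = Finsupp.single (E.res Pᶜ e)
      (E.incl a * ((-1) ^ (E.exists_sign P e).choose * E.mon (E.res P e))) := by
  change Finsupp.liftAddHom _ (E.rep _) = _
  rw [rep_mon, Finsupp.liftAddHom_apply_single]
  rfl

theorem split_mul_mon {P : Set E.Var} {g : U} (hg : g ∈ E.fam.spnRing P) {m : Adm E.deg}
    (hm : ∀ x ∈ P, m.1 x = 0) : E.split P (g * E.mon m) = Finsupp.single m g := by
  rw [IsFamily.mem_spnRing] at hg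
  induction hg using AddSubgroup.closure_induction with
  | mem g hg =>
    obtain ⟨a, e, he, hP, rfl⟩ := hg
    change ∀ x ∉ P, e x = 0 at hP
    let p : Adm E.deg := ⟨e, he⟩
    have hadm : ∀ x, Odd (E.deg x) → (e + m.1) x ≤ 1 := by
      intro x hx
      rw [Finsupp.add_apply]
      by_cases h : x ∈ P
      · rw [hm x h]; exact he x hx
      · rw [hP x h, zero_add]; exact m.2 x hx
    let f : Adm E.deg := ⟨e + m.1, hadm⟩
    have h1 : E.res P f = p := by
      refine Subtype.ext (Finsupp.ext fun x => ?_)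
      by_cases h : x ∈ P
      · rw [E.res_of_mem f h]; change (e + m.1) x = e x
        rw [Finsupp.add_apply, hm x h, add_zero]
      · rw [E.res_of_notMem f h]; exact (hP x h).symm
    have h2 : E.res Pᶜ f = m := by
      refine Subtype.ext (Finsupp.ext fun x => ?_)
      by_cases h : x ∈ P
      · rw [E.res_of_notMem f (not_not.2 h), hm x h]
      · rw [E.res_of_mem f (show x ∈ Pᶜ from h)]; change (e + m.1) x = m.1 x
        rw [Finsupp.add_apply, hP x h, zero_add]
    have h3 := E.split_term P a f
    have h4 := (E.exists_sign P f).choose_spec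
    set k := (E.exists_sign P f).choose
    rw [h1, h2] at h4
    rw [h1, h2, h4, neg_one_pow_mul_comm, neg_one_pow_mul_comm, ← mul_assoc (E.incl a)] at h3
    change E.split P (E.incl a * E.mon p * E.mon m) = Finsupp.single m (E.incl a * E.mon p)
    rcases neg_one_pow_eq_or U k with hk | hk <;> rw [hk] at h3
    · simpa using h3
    · simpa using h3
  | zero => simp
  | add x y _ _ hx hy => rw [add_mul, map_add, hx, hy, Finsupp.single_add]
  | neg x _ hx => rw [neg_mul, map_neg, hx, Finsupp.single_neg]

theorem split_mem (P : Set E.Var) (u : U) (m : Adm E.deg) :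
    E.split P u m ∈ E.fam.spnRing P := by
  refine E.term_induction (p := fun u => E.split P u m ∈ E.fam.spnRing P) u (by simp)
    (fun u v hu hv => by rw [map_add]; exact add_mem hu hv) fun a e => ?_
  rw [split_term, Finsupp.single_apply]
  split_ifs
  · exact mul_mem (E.incl_mem_spnRing P a) (mul_mem (pow_mem (neg_mem (one_mem _)) _)
      (E.mon_mem_spnRing fun x hx => E.res_of_notMem e hx))
  · exact zero_mem _

theorem exists_of_split_ne_zero {P : Set E.Var} {u : U} {m : Adm E.deg} (h : E.split P u m ≠ 0) :
    ∃ e, E.rep u e ≠ 0 ∧ E.res Pᶜ e = m := by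
  by_contra hc
  push Not at hc
  apply h
  conv_lhs => rw [E.rep_sum u]
  rw [Finsupp.sum, map_sum, Finsupp.finsetSum_apply]
  refine Finset.sum_eq_zero fun e he => ?_
  rw [split_term, Finsupp.single_apply, if_neg (hc e (Finsupp.mem_support_iff.1 he))]

theorem apply_eq_zero_of_split_ne_zero {P : Set E.Var} {u : U} {m : Adm E.deg}
    (h : E.split P u m ≠ 0) {x : E.Var} (hx : x ∈ P) : m.1 x = 0 := by
  obtain ⟨e, _, rfl⟩ := E.exists_of_split_ne_zero h
  exact E.res_of_notMem e (not_not.2 hx)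

theorem split_sum (P : Set E.Var) (u : U) : u = (E.split P u).sum fun m g => g * E.mon m := by
  refine E.term_induction (p := fun u => u = (E.split P u).sum fun m g => g * E.mon m) u (by simp)
    (fun u v hu hv => ?_) fun a e => ?_
  · rw [map_add, Finsupp.sum_add_index' (by simp) (by simp [add_mul]), ← hu, ← hv]
  · rw [split_term, Finsupp.sum_single_index (by simp)]
    conv_lhs => rw [(E.exists_sign P e).choose_spec]
    rw [mul_assoc, mul_assoc]

/-- The coefficient at `p` of the coefficient of `u` at `m` is, up to sign, the coefficient of `u`
at `p + m`. -/
theorem rep_split {P : Set E.Var} (u : U) {m p f : Adm E.deg} (hm : ∀ x ∈ P, m.1 x = 0)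
    (hp : ∀ x ∉ P, p.1 x = 0) (hf : f.1 = p.1 + m.1) :
    ∃ k : ℕ, E.rep (E.split P u m) p = (-1) ^ k * E.rep u f := by
  have h1 : E.res P f = p := by
    refine Subtype.ext (Finsupp.ext fun x => ?_)
    by_cases h : x ∈ P
    · rw [E.res_of_mem f h, hf, Finsupp.add_apply, hm x h, add_zero]
    · rw [E.res_of_notMem f h, hp x h]
  have h2 : E.res Pᶜ f = m := by
    refine Subtype.ext (Finsupp.ext fun x => ?_)
    by_cases h : x ∈ P
    · rw [E.res_of_notMem f (not_not.2 h), hm x h]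
    · rw [E.res_of_mem f (show x ∈ Pᶜ from h), hf, Finsupp.add_apply, hp x h, zero_add]
  refine ⟨(E.exists_sign P f).choose, ?_⟩
  refine E.term_induction (p := fun u => E.rep (E.split P u m) p =
    (-1) ^ (E.exists_sign P f).choose * E.rep u f) u (by simp)
    (fun u v hu hv => ?_) fun a e => ?_
  · rw [map_add, Finsupp.add_apply, map_add, Finsupp.add_apply, hu, hv, map_add,
      Finsupp.add_apply, mul_add]
  rw [split_term, rep_mon]
  by_cases he : e = f
  · subst he
    generalize (E.exists_sign P e).choose = k
    rw [h2, h1, Finsupp.single_eq_same, Finsupp.single_eq_same, neg_one_pow_mul_comm,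
      rep_neg_one_pow_mul, rep_mon, Finsupp.single_eq_same]
  · generalize (E.exists_sign P e).choose = k
    rw [Finsupp.single_apply (a := e), if_neg he, mul_zero, Finsupp.single_apply]
    split_ifs with h
    · rw [neg_one_pow_mul_comm, rep_neg_one_pow_mul, rep_mon, Finsupp.single_apply, if_neg,
        mul_zero]
      rintro h'
      apply he
      refine Subtype.ext ?_
      rw [← E.res_add_res P e, h, h', hf]
    · simp
end SemifreeExt

/-- Monomials may be computed along any strictly increasing list that contains their variables. -/
theorem mono_eq_of_sortedLT {Var : Type w} [LinearOrder Var] {B : Type*} [Monoid B]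
    {p : Var → ℕ → B} (hp : ∀ x, p x 0 = 1) (e : Var →₀ ℕ) {l : List Var} (hl : l.SortedLT)
    (h : ∀ v, e v ≠ 0 → v ∈ l) : mono p e = (l.map fun v => p v (e v)).prod := by
  have h1 : ∀ l : List Var, (l.map fun v => p v (e v)).prod =
      ((l.filter (e · ≠ 0)).map fun v => p v (e v)).prod := by
    intro l
    induction l with
    | nil => simp
    | cons x l ih =>
      by_cases hx : e x = 0
      · simp [List.filter_cons, hx, hp, ih]
      · simp [List.filter_cons, hx, ih]
  have hs : (l.filter (e · ≠ 0)).SortedLT := (hl.pairwise.filter _).sortedLT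
  rw [h1 l, mono]
  congr 2
  refine List.Perm.eq_of_sortedLE (Finset.sortedLT_sort _).sortedLE hs.sortedLE ?_
  rw [List.perm_ext_iff_of_nodup (Finset.sort_nodup _ _) hs.nodup]
  intro v
  simp only [Finset.mem_sort, Finsupp.mem_support_iff, List.mem_filter, decide_eq_true_eq]
  exact ⟨fun hv => ⟨h v hv, hv⟩, fun hv => hv.2⟩

namespace SemifreeExt

/-! ### Subextensions -/

section Sub

variable {A : CDGA.{u}} {U : CDGA.{v}} (E : SemifreeExt.{u, v, w} A U)

theorem spnRing_pr (P : Set E.Var) : ∀ a ∈ E.fam.spnRing P, ∀ j, U.pr j a ∈ E.fam.spnRing P := by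
  intro a ha j
  rw [mem_spnRing_iff] at ha ⊢
  intro e he
  apply ha e
  rw [rep_pr] at he
  intro h
  rw [h] at he
  simp at he

theorem spnRing_sgn (P : Set E.Var) (n : ℕ) {a : U} (ha : a ∈ E.fam.spnRing P) :
    U.sgn n a ∈ E.fam.spnRing P := by
  obtain ⟨s, hs⟩ := U.sum_pr a
  rw [hs, map_sum]
  refine sum_mem fun i _ => ?_
  rw [U.sgn_of_mem n (U.pr_mem i a)]
  exact mul_mem (pow_mem (neg_mem (one_mem _)) _) (E.spnRing_pr P a ha i)

/-- The span of the monomials in `P` is stable under `d` if it contains the differentials of the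
variables in `P`. -/
theorem spnRing_d {P : Set E.Var} (hP : ∀ x ∈ P, U.d (E.pw x 1) ∈ E.fam.spnRing P) :
    ∀ a ∈ E.fam.spnRing P, U.d a ∈ E.fam.spnRing P := by
  have hmul : ∀ x y, x ∈ E.fam.spnRing P → y ∈ E.fam.spnRing P → U.d x ∈ E.fam.spnRing P →
      U.d y ∈ E.fam.spnRing P → U.d (x * y) ∈ E.fam.spnRing P := by
    intro x y hx hy hdx hdy
    rw [U.d_mul']
    exact add_mem (mul_mem hdx hy) (mul_mem (E.spnRing_sgn P 1 hx) hdy)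
  intro a ha
  rw [spnRing_eq_closure] at ha
  induction ha using Subring.closure_induction with
  | mem a ha =>
    rcases ha with ⟨a, rfl⟩ | ⟨x, n, hx, rfl⟩
    · rw [← E.incl.map_d]; exact E.incl_mem_spnRing P _
    · by_cases hx' : x ∈ E.divided ∧ Even (E.deg x)
      · rcases n with _ | n
        · rw [E.pw_zero, U.d_one]; exact zero_mem _
        · rw [E.d_pw x n hx'.1 hx'.2]; exact mul_mem (hP x hx) (E.pw_mem_spnRing hx n)
      · have h3 : ∀ n, U.d (E.pw x 1 ^ n) ∈ E.fam.spnRing P := by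
          intro n
          induction n with
          | zero => rw [pow_zero, U.d_one]; exact zero_mem _
          | succ n ih =>
            rw [pow_succ]
            exact hmul _ _ (pow_mem (E.pw_mem_spnRing hx 1) n) (E.pw_mem_spnRing hx 1) ih (hP x hx)
        rw [E.pw_pow x n (by rw [← Nat.not_even_iff_odd]; tauto)]
        exact h3 n
  | zero => rw [map_zero]; exact zero_mem _
  | one => rw [U.d_one]; exact zero_mem _
  | add x y _ _ hx hy => rw [map_add]; exact add_mem hx hy
  | neg x _ hx => rw [map_neg]; exact neg_mem hx
  | mul x y hx hy hdx hdy =>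
    rw [← spnRing_eq_closure] at hx hy
    exact hmul x y hx hy hdx hdy

/-- The dg-subalgebra generated over `A` by a set of variables. -/
abbrev subAlg (P : Set E.Var) (hP : ∀ x ∈ P, U.d (E.pw x 1) ∈ E.fam.spnRing P) : CDGA.{v} :=
  U.sub (E.fam.spnRing P) (E.spnRing_pr P) (E.spnRing_d hP)

/-- An exponent in the variables outside `P`, as an exponent in all variables. -/
def extAdm (P : Set E.Var) (e : Adm fun x : {x // x ∉ P} => E.deg x) : Adm E.deg :=
  ⟨e.1.embDomain (Function.Embedding.subtype _), fun x hx => by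
    by_cases h : x ∈ P
    · rw [Finsupp.embDomain_of_notMem_range _ _ _ (by simpa using h)]; exact Nat.zero_le _
    · have := Finsupp.embDomain_apply_self (Function.Embedding.subtype (· ∉ P)) e.1 ⟨x, h⟩
      change e.1.embDomain _ x = _ at this
      rw [this]; exact e.2 ⟨x, h⟩ hx⟩

theorem extAdm_apply (P : Set E.Var) (e : Adm fun x : {x // x ∉ P} => E.deg x)
    (x : {x // x ∉ P}) : (E.extAdm P e).1 x = e.1 x :=
  Finsupp.embDomain_apply_self (Function.Embedding.subtype (· ∉ P)) e.1 x

theorem extAdm_apply_of_mem (P : Set E.Var) (e : Adm fun x : {x // x ∉ P} => E.deg x)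
    {x : E.Var} (h : x ∈ P) : (E.extAdm P e).1 x = 0 :=
  Finsupp.embDomain_of_notMem_range _ _ _ (by simpa using h)

theorem extAdm_injective (P : Set E.Var) : Function.Injective (E.extAdm P) := by
  intro e f h
  refine Subtype.ext (Finsupp.ext fun x => ?_)
  rw [← E.extAdm_apply P e, ← E.extAdm_apply P f, h]

theorem mono_extAdm (P : Set E.Var) (e : Adm fun x : {x // x ∉ P} => E.deg x) :
    monomial (fun (x : {x // x ∉ P}) n => E.pw x n) e.1 = E.mon (E.extAdm P e) := by
  have hl : (e.1.support.sort.map Subtype.val).SortedLT :=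
    ((List.pairwise_map (f := Subtype.val)).2 (Finset.sortedLT_sort e.1.support).pairwise).sortedLT
  rw [mon, mono_eq_of_sortedLT E.pw_zero _ hl]
  · rw [List.map_map]
    refine congrArg List.prod (List.map_congr_left fun x _ => ?_)
    exact congrArg (E.pw x) (E.extAdm_apply P e x).symm
  · intro x hx
    by_cases h : x ∈ P
    · exact absurd (E.extAdm_apply_of_mem P e h) hx
    · have := E.extAdm_apply P e ⟨x, h⟩
      change (E.extAdm P e).1 x = _ at this
      rw [this] at hx
      simp only [List.mem_map, Finset.mem_sort, Finsupp.mem_support_iff]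
      exact ⟨⟨x, h⟩, hx, rfl⟩

theorem exists_extAdm {P : Set E.Var} {m : Adm E.deg} (h : ∀ x ∈ P, m.1 x = 0) :
    ∃ e, E.extAdm P e = m := by
  refine ⟨⟨m.1.comapDomain Subtype.val Subtype.val_injective.injOn, fun x hx => m.2 x hx⟩, ?_⟩
  refine Subtype.ext (Finsupp.ext fun x => ?_)
  by_cases hx : x ∈ P
  · rw [extAdm_apply_of_mem _ _ _ hx, h x hx]
  · exact E.extAdm_apply P _ ⟨x, hx⟩

/-- `U` is semifree over the dg-subalgebra generated by a set of variables. -/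
def subExt (P : Set E.Var) (hP : ∀ x ∈ P, U.d (E.pw x 1) ∈ E.fam.spnRing P) :
    SemifreeExt.{v, v, w} (E.subAlg P hP) U where
  incl :=
    { toRingHom := (E.fam.spnRing P).subtype
      map_gr := fun h => h
      map_d := fun _ => rfl }
  Var := {x // x ∉ P}
  deg x := E.deg x
  deg_pos x := E.deg_pos x
  divided := {x | x.1 ∈ E.divided}
  pw x n := E.pw x n
  pw_mem x n := E.pw_mem x n
  pw_zero x := E.pw_zero x
  pw_pow x n h := E.pw_pow x n h
  pw_mul x m n h h' := E.pw_mul x m n h h'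
  d_pw x n h h' := E.d_pw x n h h'
  basis := by
    let f : (Adm (fun x : {x // x ∉ P} => E.deg x) →₀ E.subAlg P hP) →+ U :=
      Finsupp.liftAddHom fun e => (AddMonoidHom.mulRight (E.mon (E.extAdm P e))).comp
        (E.fam.spnRing P).subtype.toAddMonoidHom
    have hs : ∀ e (g : E.subAlg P hP), f (Finsupp.single e g) = g.1 * E.mon (E.extAdm P e) := by
      intro e g
      rw [Finsupp.liftAddHom_apply_single]; rfl
    suffices h : Function.Bijective f by
      convert h using 2 with c
      change _ = Finsupp.liftAddHom _ _
      rw [Finsupp.liftAddHom_apply]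
      refine Finsupp.sum_congr fun e _ => ?_
      rw [E.mono_extAdm P e]; rfl
    have h1 : ∀ c e, E.split P (f c) (E.extAdm P e) = (c e).1 := by
      intro c e
      induction c using Finsupp.induction_linear with
      | zero => rw [map_zero, map_zero]; rfl
      | add c c' h h' => rw [map_add, map_add, Finsupp.add_apply, h, h']; rfl
      | single m g =>
        rw [hs, E.split_mul_mon g.2 fun x hx => E.extAdm_apply_of_mem P m hx]
        by_cases h : m = e
        · subst h; simp
        · rw [Finsupp.single_apply, if_neg fun h' => h (E.extAdm_injective P h'),
            Finsupp.single_apply, if_neg h]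
          rfl
    constructor
    · intro c c' h
      refine Finsupp.ext fun e => Subtype.ext ?_
      rw [← h1, ← h1, h]
    · intro u
      suffices u ∈ f.range from this
      rw [E.split_sum P u]
      refine sum_mem fun m hm => ?_
      obtain ⟨e, rfl⟩ := E.exists_extAdm fun x hx =>
        E.apply_eq_zero_of_split_ne_zero (Finsupp.mem_support_iff.1 hm) hx
      exact ⟨Finsupp.single e ⟨_, E.split_mem P u _⟩, hs _ _⟩

/-- The coefficients with respect to `subExt` are those of `split`. -/
theorem subExt_rep (P : Set E.Var) (hP : ∀ x ∈ P, U.d (E.pw x 1) ∈ E.fam.spnRing P) (u : U)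
    (e : Adm (E.subExt P hP).deg) :
    ((E.subExt P hP).rep u e : E.subAlg P hP).1 = E.split P u (E.extAdm P e) := by
  refine (E.subExt P hP).term_induction (p := fun u => ((E.subExt P hP).rep u e :
    E.subAlg P hP).1 = E.split P u (E.extAdm P e)) u ?_ (fun u v hu hv => ?_) fun g m => ?_
  · rw [map_zero, map_zero]; rfl
  · rw [map_add, map_add, Finsupp.add_apply, Finsupp.add_apply, ← hu, ← hv]; rfl
  · rw [rep_mon]
    have : (E.subExt P hP).mon m = E.mon (E.extAdm P m) := E.mono_extAdm P m
    rw [this]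
    have h2 := E.split_mul_mon g.2 fun x hx => E.extAdm_apply_of_mem P m hx
    refine Eq.trans ?_ (DFunLike.congr_fun h2 (E.extAdm P e)).symm
    by_cases h : m = e
    · subst h; simp
    · rw [Finsupp.single_apply, if_neg h,
        Finsupp.single_apply, if_neg fun h' => h (E.extAdm_injective P h')]
      rfl

end Sub

/-! ### Towers -/

section Tower

variable {A : CDGA.{u}} {B : CDGA.{v}} {C : CDGA.{x}} (E : SemifreeExt.{u, v, w} A B)
  (F : SemifreeExt.{v, x, y} B C)

/-- The degrees of the variables in a tower. -/
def towerDeg : E.Var ⊕ₗ F.Var → ℕ := fun z => Sum.elim E.deg F.deg (ofLex z)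

/-- The powers of the variables in a tower. -/
def towerPw : E.Var ⊕ₗ F.Var → ℕ → C := fun z n =>
  Sum.elim (fun x => F.incl (E.pw x n)) (fun y => F.pw y n) (ofLex z)

/-- The exponent in a tower with given components. -/
def towerAdm (e : Adm E.deg) (f : Adm F.deg) : Adm (towerDeg E F) :=
  ⟨(Finsupp.sumFinsuppEquivProdFinsupp.symm (e.1, f.1) : E.Var ⊕ F.Var →₀ ℕ), by
    rintro (x | y) h
    · exact e.2 x h
    · exact f.2 y h⟩

theorem towerAdm_inl (e : Adm E.deg) (f : Adm F.deg) (x : E.Var) :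
    (towerAdm E F e f).1 (Sum.inlₗ x) = e.1 x := rfl

theorem towerAdm_inr (e : Adm E.deg) (f : Adm F.deg) (y : F.Var) :
    (towerAdm E F e f).1 (Sum.inrₗ y) = f.1 y := rfl

theorem towerAdm_inj {e e' : Adm E.deg} {f f' : Adm F.deg} :
    towerAdm E F e f = towerAdm E F e' f' ↔ e = e' ∧ f = f' := by
  refine ⟨fun h => ⟨Subtype.ext (Finsupp.ext fun x => ?_), Subtype.ext (Finsupp.ext fun y => ?_)⟩,
    fun h => by rw [h.1, h.2]⟩
  · rw [← towerAdm_inl E F e f, h]; rfl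
  · rw [← towerAdm_inr E F e f, h]; rfl

theorem exists_towerAdm (m : Adm (towerDeg E F)) : ∃ e f, towerAdm E F e f = m := by
  obtain ⟨m, hm⟩ := m
  obtain ⟨⟨e, f⟩, rfl⟩ := (Finsupp.sumFinsuppEquivProdFinsupp (α := E.Var) (β := F.Var)
    (γ := ℕ)).symm.surjective m
  exact ⟨⟨e, fun x hx => hm (Sum.inlₗ x) hx⟩, ⟨f, fun y hy => hm (Sum.inrₗ y) hy⟩, rfl⟩

theorem mono_towerAdm (e : Adm E.deg) (f : Adm F.deg) :
    monomial (towerPw E F) (towerAdm E F e f).1 = F.incl (E.mon e) * F.mon f := by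
  have hl : (e.1.support.sort.map Sum.inlₗ ++ f.1.support.sort.map Sum.inrₗ :
      List (E.Var ⊕ₗ F.Var)).SortedLT := by
    refine List.Pairwise.sortedLT ?_
    rw [List.pairwise_append, List.pairwise_map, List.pairwise_map]
    refine ⟨?_, ?_, ?_⟩
    · exact (Finset.sortedLT_sort e.1.support).pairwise.imp fun h => Sum.Lex.inl_lt_inl_iff.2 h
    · exact (Finset.sortedLT_sort f.1.support).pairwise.imp fun h => Sum.Lex.inr_lt_inr_iff.2 h
    · intro a ha b hb
      obtain ⟨a, _, rfl⟩ := List.mem_map.1 ha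
      obtain ⟨b, _, rfl⟩ := List.mem_map.1 hb
      exact Sum.Lex.inl_lt_inr a b
  rw [monomial_eq_mono, mono_eq_of_sortedLT (p := towerPw E F) _ _ hl]
  · rw [List.map_append, List.prod_append, List.map_map, List.map_map]
    refine congrArg₂ _ ?_ rfl
    change _ = F.incl.toRingHom (mono E.pw e.1)
    rw [IsFamily.map_mono]
    rfl
  · rintro (x | y) h
    · refine List.mem_append_left _ (List.mem_map.2 ⟨x, ?_, rfl⟩)
      rw [Finset.mem_sort, Finsupp.mem_support_iff]; exact h
    · refine List.mem_append_right _ (List.mem_map.2 ⟨y, ?_, rfl⟩)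
      rw [Finset.mem_sort, Finsupp.mem_support_iff]; exact h
  · rintro (x | y)
    · exact (congrArg F.incl (E.pw_zero x)).trans (map_one F.incl.toRingHom)
    · exact F.pw_zero y

/-- A semifree extension of a semifree extension is a semifree extension. -/
def tower : SemifreeExt.{u, x, max w y} A C where
  incl := F.incl.comp E.incl
  Var := E.Var ⊕ₗ F.Var
  deg := towerDeg E F
  deg_pos := by
    rintro (x | y)
    · exact E.deg_pos x
    · exact F.deg_pos y
  divided := {z | Sum.elim (· ∈ E.divided) (· ∈ F.divided) (ofLex z)}
  pw := towerPw E F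
  pw_mem := by
    rintro (x | y) n
    · exact F.incl.map_gr (E.pw_mem x n)
    · exact F.pw_mem y n
  pw_zero := by
    rintro (x | y)
    · exact (congrArg F.incl (E.pw_zero x)).trans (map_one F.incl.toRingHom)
    · exact F.pw_zero y
  pw_pow := by
    rintro (x | y) n h
    · exact (congrArg F.incl (E.pw_pow x n h)).trans (map_pow F.incl.toRingHom _ _)
    · exact F.pw_pow y n h
  pw_mul := by
    rintro (x | y) m n h h'
    · have := congrArg F.incl.toRingHom (E.pw_mul x m n h h')
      rwa [map_mul, map_nsmul] at this
    · exact F.pw_mul y m n h h'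
  d_pw := by
    rintro (x | y) n h h'
    · have := congrArg F.incl.toRingHom (E.d_pw x n h h')
      rwa [map_mul, F.incl.map_d, F.incl.map_d] at this
    · exact F.d_pw y n h h'
  basis := by
    let f : (Adm (towerDeg E F) →₀ A) →+ C :=
      Finsupp.liftAddHom fun e => (AddMonoidHom.mulRight (monomial (towerPw E F) e.1)).comp
        (F.incl.comp E.incl).toRingHom.toAddMonoidHom
    have hs : ∀ e e' (a : A), f (Finsupp.single (towerAdm E F e e') a) =
        F.incl (E.incl a * E.mon e) * F.mon e' := by
      intro e e' a
      rw [Finsupp.liftAddHom_apply_single]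
      change F.incl (E.incl a) * monomial (towerPw E F) (towerAdm E F e e').1 = _
      rw [mono_towerAdm, ← mul_assoc]
      congr 1
      exact (map_mul F.incl.toRingHom _ _).symm
    suffices h : Function.Bijective f from h
    have h1 : ∀ c e e', E.rep (F.rep (f c) e') e = c (towerAdm E F e e') := by
      intro c e e'
      induction c using Finsupp.induction_linear with
      | zero => simp
      | add c c' h h' => simp only [map_add, Finsupp.add_apply, h, h']
      | single m g =>
        obtain ⟨l, l', rfl⟩ := exists_towerAdm E F m
        rw [hs, rep_mon]
        by_cases h : l' = e'
        · subst h
          rw [Finsupp.single_eq_same, rep_mon]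
          by_cases h : l = e
          · subst h; simp
          · rw [Finsupp.single_apply, if_neg h, Finsupp.single_apply, if_neg]
            rw [towerAdm_inj]; tauto
        · rw [Finsupp.single_apply, if_neg h, Finsupp.single_apply, if_neg, map_zero]
          · rfl
          rw [towerAdm_inj]; tauto
    constructor
    · intro c c' h
      refine Finsupp.ext fun m => ?_
      obtain ⟨e, e', rfl⟩ := exists_towerAdm E F m
      rw [← h1, ← h1, h]
    · intro u
      suffices u ∈ f.range from this
      refine F.term_induction (p := (· ∈ f.range)) u (zero_mem _)
        (fun _ _ => add_mem) fun b e' => ?_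
      refine E.term_induction (p := fun b => F.incl b * F.mon e' ∈ f.range) b ?_ ?_ ?_
      · rw [map_zero F.incl.toRingHom, zero_mul]; exact zero_mem _
      · intro b b' h h'
        rw [map_add F.incl.toRingHom, add_mul]; exact add_mem h h'
      · intro a e
        exact ⟨_, hs e e' a⟩

/-- The exponent in a tower with given components, as an exponent of `tower E F`. -/
def tAdm (e : Adm E.deg) (f : Adm F.deg) : Adm (tower E F).deg := towerAdm E F e f

theorem tAdm_inj {e e' : Adm E.deg} {f f' : Adm F.deg} :
    tAdm E F e f = tAdm E F e' f' ↔ e = e' ∧ f = f' := towerAdm_inj E F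

theorem exists_tAdm (m : Adm (tower E F).deg) : ∃ e f, tAdm E F e f = m := exists_towerAdm E F m

theorem tower_mon (e : Adm E.deg) (f : Adm F.deg) :
    (tower E F).mon (tAdm E F e f) = F.incl (E.mon e) * F.mon f := mono_towerAdm E F e f

/-- Coefficients in a tower are coefficients of coefficients. -/
theorem tower_rep (u : C) (e : Adm E.deg) (f : Adm F.deg) :
    (tower E F).rep u (tAdm E F e f) = E.rep (F.rep u f) e := by
  refine (tower E F).term_induction (p := fun u => (tower E F).rep u (tAdm E F e f) =
    E.rep (F.rep u f) e) u ?_ (fun u v hu hv => ?_) fun a m => ?_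
  · simp only [map_zero, Finsupp.zero_apply]
  · simp only [map_add, Finsupp.add_apply, hu, hv]
  obtain ⟨l, l', rfl⟩ := exists_tAdm E F m
  have : (tower E F).incl a * (F.incl (E.mon l) * F.mon l') =
      F.incl (E.incl a * E.mon l) * F.mon l' := by
    rw [← mul_assoc]
    congr 1
    exact (map_mul F.incl.toRingHom _ _).symm
  rw [rep_mon, tower_mon, this, rep_mon]
  by_cases h : l' = f
  · subst h
    rw [Finsupp.single_eq_same, rep_mon]
    by_cases h : l = e
    · subst h; simp
    · rw [Finsupp.single_apply, if_neg, Finsupp.single_apply, if_neg h]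
      rw [tAdm_inj]; tauto
  · rw [Finsupp.single_apply, if_neg, Finsupp.single_apply, if_neg h, map_zero]
    · rfl
    rw [tAdm_inj]; tauto

end Tower

/-! ### Change of variables -/

section Transport

variable {A : CDGA.{u}} {U : CDGA.{v}} (E : SemifreeExt.{u, v, w} A U)

/-- The semifree extension with variables the images of the given ones under an automorphism of
the underlying graded `A`-algebra. -/
def transport (Φ : U ≃+* U) (hgr : ∀ {i a}, a ∈ U.gr i → Φ a ∈ U.gr i)
    (hincl : ∀ a, Φ (E.incl a) = E.incl a) (hdiv : ∀ x ∈ E.divided, ¬ Even (E.deg x)) :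
    SemifreeExt.{u, v, w} A U where
  incl := E.incl
  Var := E.Var
  deg := E.deg
  deg_pos := E.deg_pos
  divided := E.divided
  pw x n := Φ (E.pw x n)
  pw_mem x n := hgr (E.pw_mem x n)
  pw_zero x := by rw [E.pw_zero, map_one]
  pw_pow x n h := by rw [E.pw_pow x n h, map_pow]
  pw_mul x m n h h' := by rw [← map_mul, E.pw_mul x m n h h', map_nsmul]
  d_pw x n h h' := absurd h' (hdiv x h)
  basis := by
    convert Φ.bijective.comp E.basis using 2 with c
    rw [Function.comp_apply, Finsupp.sum, Finsupp.sum, map_sum]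
    refine Finset.sum_congr rfl fun e _ => ?_
    rw [map_mul, hincl]
    congr 1
    exact (IsFamily.map_mono Φ.toRingHom e.1).symm

end Transport

end SemifreeExt

/-! ### Adjoining a pair of variables that cancel -/

/-- The filtration of `G⟨x, y⟩` by the total exponent in `x` and `y`; the monomials of total exponent
`c + 1` are `P c` and `Q c`. -/
def pairFilt {R : Type*} [Ring R] (G : Subring R) (P Q : ℕ → R) : ℕ → AddSubgroup R
  | 0 => G.toAddSubgroup
  | c + 1 =>
    { carrier := {u | ∃ u' ∈ pairFilt G P Q c, ∃ p ∈ G, ∃ q ∈ G, u = u' + p * P c + q * Q c}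
      add_mem' := by
        rintro _ _ ⟨u, hu, p, hp, q, hq, rfl⟩ ⟨u', hu', p', hp', q', hq', rfl⟩
        exact ⟨_, add_mem hu hu', _, add_mem hp hp', _, add_mem hq hq', by
          rw [add_mul, add_mul]; abel⟩
      zero_mem' := ⟨0, zero_mem _, 0, zero_mem _, 0, zero_mem _, by simp⟩
      neg_mem' := by
        rintro _ ⟨u, hu, p, hp, q, hq, rfl⟩
        exact ⟨_, neg_mem hu, _, neg_mem hp, _, neg_mem hq, by rw [neg_mul, neg_mul]; abel⟩ }

section PairFilt

variable {R : Type*} [Ring R] {G : Subring R} {P Q : ℕ → R}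

theorem pairFilt_mono {c c' : ℕ} (h : c ≤ c') : pairFilt G P Q c ≤ pairFilt G P Q c' := by
  induction h with
  | refl => exact le_rfl
  | step _ ih =>
    refine ih.trans fun u hu => ?_
    exact ⟨u, hu, 0, zero_mem _, 0, zero_mem _, by simp⟩

theorem mul_mem_pairFilt {c : ℕ} {g u : R} (hg : g ∈ G) (hu : u ∈ pairFilt G P Q c) :
    g * u ∈ pairFilt G P Q c := by
  induction c generalizing u with
  | zero => exact G.mul_mem hg hu
  | succ c ih =>
    obtain ⟨u', hu', p, hp, q, hq, rfl⟩ := hu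
    exact ⟨_, ih hu', _, mul_mem hg hp, _, mul_mem hg hq, by
      rw [mul_add, mul_add, mul_assoc, mul_assoc]⟩

theorem left_mem_pairFilt (c : ℕ) : P c ∈ pairFilt G P Q (c + 1) :=
  ⟨0, zero_mem _, 1, one_mem _, 0, zero_mem _, by simp⟩

theorem right_mem_pairFilt (c : ℕ) : Q c ∈ pairFilt G P Q (c + 1) :=
  ⟨0, zero_mem _, 0, zero_mem _, 1, one_mem _, by simp⟩

end PairFilt

/-- If `d (P c)` is `Q c` and `d (Q c)` vanishes, up to terms of smaller total exponent, then an
element whose differential lies in `G` differs from an element of `G` by a boundary. -/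
theorem exists_sub_d_mem {U : CDGA.{v}} {G : Subring U} {P Q : ℕ → U}
    (hGs : ∀ g ∈ G, U.sgn 1 g ∈ G) (hGd : ∀ g ∈ G, U.d g ∈ G)
    (hind : ∀ c, ∀ p ∈ G, ∀ q ∈ G, p * P c + q * Q c ∈ pairFilt G P Q c → p = 0 ∧ q = 0)
    (hP : ∀ c, U.d (P c) - Q c ∈ pairFilt G P Q c) (hQ : ∀ c, U.d (Q c) ∈ pairFilt G P Q c)
    (c : ℕ) : ∀ u ∈ pairFilt G P Q c, U.d u ∈ G → ∃ w ∈ pairFilt G P Q c, u - U.d w ∈ G := by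
  -- the filtration is stable under `d`
  have hdF : ∀ c, ∀ u ∈ pairFilt G P Q c, U.d u ∈ pairFilt G P Q c := by
    intro c
    induction c with
    | zero => exact hGd
    | succ c ih =>
      rintro _ ⟨u, hu, p, hp, q, hq, rfl⟩
      rw [map_add, map_add, U.d_mul', U.d_mul']
      refine add_mem (add_mem (pairFilt_mono c.le_succ (ih u hu)) (add_mem ?_ ?_)) (add_mem ?_ ?_)
      · exact mul_mem_pairFilt (hGd p hp) (left_mem_pairFilt c)
      · refine mul_mem_pairFilt (hGs p hp) ?_
        have := add_mem (pairFilt_mono c.le_succ (hP c)) (right_mem_pairFilt c)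
        rwa [sub_add_cancel] at this
      · exact mul_mem_pairFilt (hGd q hq) (right_mem_pairFilt c)
      · exact mul_mem_pairFilt (hGs q hq) (pairFilt_mono c.le_succ (hQ c))
  have h0 : ∀ c, ∀ g ∈ G, g ∈ pairFilt G P Q c := fun c g hg => pairFilt_mono (Nat.zero_le c) hg
  induction c with
  | zero => exact fun u hu _ => ⟨0, zero_mem _, by rw [map_zero, sub_zero]; exact hu⟩
  | succ c ih =>
    rintro _ ⟨u, hu, p, hp, q, hq, rfl⟩ hd
    -- the leading terms of `d (u + p P + q Q)`, which lies in `G`, vanish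
    have h1 : U.d p * P c + (U.d q + U.sgn 1 p) * Q c ∈ pairFilt G P Q c := by
      have h2 : U.d p * P c + (U.d q + U.sgn 1 p) * Q c =
          U.d (u + p * P c + q * Q c) - U.d u - U.sgn 1 p * (U.d (P c) - Q c) -
            U.sgn 1 q * U.d (Q c) := by
        rw [map_add, map_add, U.d_mul', U.d_mul', mul_sub, add_mul]; abel
      rw [h2]
      exact sub_mem (sub_mem (sub_mem (h0 c _ hd) (hdF c u hu))
        (mul_mem_pairFilt (hGs p hp) (hP c))) (mul_mem_pairFilt (hGs q hq) (hQ c))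
    obtain ⟨_, h3⟩ := hind c _ (hGd p hp) _ (add_mem (hGd q hq) (hGs p hp)) h1
    -- hence `p = d (sgn q)`, and subtracting `d (sgn q * P c)` lowers the filtration
    have h4 : U.d (U.sgn 1 q) = p := by
      rw [d_sgn_one, eq_neg_of_add_eq_zero_left h3, map_neg, neg_neg, sgn_self]
    have h5 : u + p * P c + q * Q c - U.d (U.sgn 1 q * P c) ∈ pairFilt G P Q c := by
      have : u + p * P c + q * Q c - U.d (U.sgn 1 q * P c) = u - q * (U.d (P c) - Q c) := by
        rw [U.d_mul', h4, sgn_self, mul_sub]; abel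
      rw [this]
      exact sub_mem hu (mul_mem_pairFilt hq (hP c))
    obtain ⟨w, hw, hw'⟩ := ih _ h5 (by rw [map_sub, U.d_d, sub_zero]; exact hd)
    refine ⟨U.sgn 1 q * P c + w, add_mem (mul_mem_pairFilt (hGs q hq) (left_mem_pairFilt c))
      (pairFilt_mono c.le_succ hw), ?_⟩
    rw [map_add, ← sub_sub]
    exact hw'

namespace SemifreeExt

variable {A : CDGA.{u}} {U : CDGA.{v}} (E : SemifreeExt.{u, v, w} A U)

/-- The exponent of a monomial in two variables. -/
def pairAdm {x y : E.Var} (hxy : x ≠ y) (a b : ℕ) (ha : Odd (E.deg x) → a ≤ 1)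
    (hb : Odd (E.deg y) → b ≤ 1) : Adm E.deg :=
  ⟨Finsupp.single x a + Finsupp.single y b, fun z hz => by
    classical
    rw [Finsupp.add_apply, Finsupp.single_apply, Finsupp.single_apply]
    by_cases h1 : x = z
    · subst h1; rw [if_pos rfl, if_neg (Ne.symm hxy)]; exact ha hz
    · rw [if_neg h1, zero_add]
      split_ifs with h2
      · subst h2; exact hb hz
      · exact Nat.zero_le _⟩

theorem pairAdm_degree {x y : E.Var} (hxy : x ≠ y) (a b : ℕ) (ha : Odd (E.deg x) → a ≤ 1)
    (hb : Odd (E.deg y) → b ≤ 1) : (E.pairAdm hxy a b ha hb).1.degree = a + b := by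
  simp [pairAdm]

theorem mon_pairAdm {x y : E.Var} (hxy : x ≠ y) (a b : ℕ) (ha : Odd (E.deg x) → a ≤ 1)
    (hb : Odd (E.deg y) → b ≤ 1) :
    ∃ k : ℕ, E.mon (E.pairAdm hxy a b ha hb) = (-1) ^ k * (E.pw x a * E.pw y b) := by
  classical
  obtain ⟨k, hk⟩ := E.fam.mono_add (e := Finsupp.single x a) (f := Finsupp.single y b) (by
    rw [Finset.disjoint_left]
    intro z hz hz'
    have h1 := Finsupp.support_single_subset hz
    have h2 := Finsupp.support_single_subset hz'
    rw [Finset.mem_singleton] at h1 h2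
    exact hxy (h1.symm.trans h2))
  refine ⟨k, ?_⟩
  rw [← E.fam.mono_single' x a, ← E.fam.mono_single' y b]
  exact hk

theorem pairAdm_apply_of_ne {x y z : E.Var} (hxy : x ≠ y) (a b : ℕ) (ha : Odd (E.deg x) → a ≤ 1)
    (hb : Odd (E.deg y) → b ≤ 1) (h1 : z ≠ x) (h2 : z ≠ y) :
    (E.pairAdm hxy a b ha hb).1 z = 0 := by
  simp [pairAdm, Finsupp.single_apply, Ne.symm h1, Ne.symm h2]

theorem pairAdm_apply_right {x y : E.Var} (hxy : x ≠ y) (a b : ℕ) (ha : Odd (E.deg x) → a ≤ 1)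
    (hb : Odd (E.deg y) → b ≤ 1) : (E.pairAdm hxy a b ha hb).1 y = b := by
  simp [pairAdm, Finsupp.single_apply, hxy]

/-- Adjoining variables `x` and `y` with `d y = x`, up to terms in the subalgebra `G` generated by
the variables in `P`, and with `d x` in `G`, does not change the homology. -/
theorem pair {P : Set E.Var} (hPd : ∀ z ∈ P, U.d (E.pw z 1) ∈ E.fam.spnRing P) {x y : E.Var}
    (hx : x ∉ P) (hy : y ∉ P) (hxy : x ≠ y) (hdeg : E.deg y = E.deg x + 1)
    (hdx : U.d (E.pw x 1) ∈ E.fam.spnRing P)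
    (hdy : U.d (E.pw y 1) - E.pw x 1 ∈ E.fam.spnRing P)
    (hdiv : (Even (E.deg x) ∧ x ∉ E.divided) ∨ (Odd (E.deg x) ∧ y ∈ E.divided)) :
    ∀ u ∈ E.fam.spnRing (P ∪ {x, y}), U.d u ∈ E.fam.spnRing P →
      ∃ w ∈ E.fam.spnRing (P ∪ {x, y}), u - U.d w ∈ E.fam.spnRing P := by
  classical
  set G := E.fam.spnRing P with hG
  have hxm : E.pw x 1 ∈ U.gr (E.deg x) := by simpa using E.pw_mem x 1
  have hym : E.pw y 1 ∈ U.gr (E.deg y) := by simpa using E.pw_mem y 1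
  have hgm : U.d (E.pw y 1) - E.pw x 1 ∈ U.gr (E.deg x) := sub_mem (U.d_mem (hdeg ▸ hym)) hxm
  set g := U.d (E.pw y 1) - E.pw x 1 with hg
  have hdy' : U.d (E.pw y 1) = E.pw x 1 + g := by rw [hg]; abel
  -- the monomials of total exponent `c + 1`
  obtain ⟨a, b, a', b', ha, hb, ha', hb', hs, hs', hne, hP, hQ, hall⟩ :
      ∃ (a b a' b' : ℕ → ℕ) (_ : ∀ c, Odd (E.deg x) → a c ≤ 1) (_ : ∀ c, Odd (E.deg y) → b c ≤ 1)
        (_ : ∀ c, Odd (E.deg x) → a' c ≤ 1) (_ : ∀ c, Odd (E.deg y) → b' c ≤ 1),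
        (∀ c, a c + b c = c + 1) ∧ (∀ c, a' c + b' c = c + 1) ∧ (∀ c, b c ≠ b' c) ∧
        (∀ c, U.d (E.pw x (a c) * E.pw y (b c)) - E.pw x (a' c) * E.pw y (b' c) ∈
          pairFilt G (fun c => E.pw x (a c) * E.pw y (b c))
            (fun c => E.pw x (a' c) * E.pw y (b' c)) c) ∧
        (∀ c, U.d (E.pw x (a' c) * E.pw y (b' c)) ∈
          pairFilt G (fun c => E.pw x (a c) * E.pw y (b c))
            (fun c => E.pw x (a' c) * E.pw y (b' c)) c) ∧
        ∀ i j, (Odd (E.deg x) → i ≤ 1) → (Odd (E.deg y) → j ≤ 1) → (i = 0 ∧ j = 0) ∨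
          (∃ c, i = a c ∧ j = b c) ∨ ∃ c, i = a' c ∧ j = b' c := by
    -- `x` polynomial and `y` exterior: the monomials are `x ^ c * y` and `x ^ (c + 1)`
    rcases hdiv with ⟨hev, hnd⟩ | ⟨hodd, hyd⟩
    · have hyo : Odd (E.deg y) := by rw [hdeg]; exact hev.add_one
      have hxo : ¬ Odd (E.deg x) := Nat.not_odd_iff_even.2 hev
      have hpow : ∀ n, E.pw x n = E.pw x 1 ^ n := fun n => E.pw_pow x n (Or.inl hnd)
      have hcent : ∀ u, E.pw x 1 * u = u * E.pw x 1 := by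
        intro u
        rw [U.mul_comm_sgn' u hxm, U.sgn_even hev]
      have hdpow : ∀ n, U.d (E.pw x (n + 1)) = (n + 1 : ℕ) * U.d (E.pw x 1) * E.pw x n := by
        intro n
        induction n with
        | zero => simp [E.pw_zero]
        | succ n ih =>
          have h1 : E.pw x (n + 1 + 1) = E.pw x 1 * E.pw x (n + 1) := by
            rw [hpow (n + 1 + 1), hpow (n + 1), pow_succ']
          have h2 : E.pw x (n + 1) = E.pw x 1 * E.pw x n := by
            rw [hpow (n + 1), hpow n, pow_succ']
          have h3 : U.sgn 1 (E.pw x 1) = E.pw x 1 := by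
            rw [U.sgn_of_mem 1 hxm, one_mul, hev.neg_one_pow, one_mul]
          rw [h1, U.d_mul', ih, h3, ← mul_assoc, hcent, mul_assoc _ (E.pw x 1), ← h2]
          push_cast
          rw [add_mul ((n : U) + 1), add_mul ((n + 1 : U) * _), one_mul]
          abel
      set F := pairFilt G (fun c => E.pw x c * E.pw y 1) (fun c => E.pw x (c + 1) * E.pw y 0)
      have hxF : ∀ c, E.pw x c ∈ F c := by
        rintro (_ | c)
        · rw [E.pw_zero]; exact G.one_mem
        · have := right_mem_pairFilt (G := G) (P := fun c => E.pw x c * E.pw y 1)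
            (Q := fun c => E.pw x (c + 1) * E.pw y 0) c
          change E.pw x (c + 1) * E.pw y 0 ∈ F (c + 1) at this
          rwa [E.pw_zero, mul_one] at this
      have hnG : ∀ n : ℕ, (n : U) ∈ G := fun n => natCast_mem G n
      refine ⟨fun c => c, fun _ => 1, fun c => c + 1, fun _ => 0, fun _ h => absurd h hxo,
        fun _ _ => le_rfl, fun _ h => absurd h hxo, fun _ _ => Nat.zero_le _, fun _ => rfl,
        fun _ => rfl, fun _ => one_ne_zero, fun c => ?_, fun c => ?_, fun i j _ hj => ?_⟩
      · have h1 : U.d (E.pw x c * E.pw y 1) - E.pw x (c + 1) * E.pw y 0 =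
            U.d (E.pw x c) * E.pw y 1 + g * E.pw x c := by
          have h3 : U.sgn 1 (E.pw x c) = E.pw x c := by
            rw [U.sgn_of_mem 1 (E.pw_mem x c), one_mul, (hev.mul_left c).neg_one_pow, one_mul]
          have h4 : E.pw x c * g = g * E.pw x c := by
            have := U.mul_comm_sgn' g (E.pw_mem x c)
            rwa [U.sgn_even (hev.mul_left c)] at this
          rw [U.d_mul', h3, hdy', E.pw_zero, mul_one, mul_add, h4, hpow (c + 1), hpow c, pow_succ]
          abel
        rw [h1]
        refine add_mem ?_ (mul_mem_pairFilt hdy (hxF c))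
        rcases c with _ | c
        · rw [E.pw_zero, U.d_one, zero_mul]; exact zero_mem _
        · rw [hdpow, mul_assoc]
          exact mul_mem_pairFilt (mul_mem (hnG _) hdx) (left_mem_pairFilt (G := G)
            (P := fun c => E.pw x c * E.pw y 1) (Q := fun c => E.pw x (c + 1) * E.pw y 0) c)
      · change U.d (E.pw x (c + 1) * E.pw y 0) ∈ F c
        rw [E.pw_zero, mul_one, hdpow]
        exact mul_mem_pairFilt (mul_mem (hnG _) hdx) (hxF c)
      · have := hj hyo
        rcases j with _ | j
        · rcases i with _ | i
          · exact Or.inl ⟨rfl, rfl⟩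
          · exact Or.inr (Or.inr ⟨i, rfl, rfl⟩)
        · exact Or.inr (Or.inl ⟨i, rfl, show j + 1 = 1 by omega⟩)
    -- `x` exterior and `y` divided: the monomials are `y ^ (c + 1)` and `x * y ^ (c)`, with divided
    -- powers of `y`
    · have hye : Even (E.deg y) := by rw [hdeg]; exact hodd.add_one
      have hyo : ¬ Odd (E.deg y) := Nat.not_odd_iff_even.2 hye
      have hdpow : ∀ n, U.d (E.pw y (n + 1)) = (E.pw x 1 + g) * E.pw y n := fun n => by
        rw [E.d_pw y n hyd hye, hdy']
      set F := pairFilt G (fun c => E.pw x 0 * E.pw y (c + 1)) (fun c => E.pw x 1 * E.pw y c)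
      have hyF : ∀ c, E.pw y c ∈ F c := by
        rintro (_ | c)
        · rw [E.pw_zero]; exact G.one_mem
        · have := left_mem_pairFilt (G := G) (P := fun c => E.pw x 0 * E.pw y (c + 1))
            (Q := fun c => E.pw x 1 * E.pw y c) c
          change E.pw x 0 * E.pw y (c + 1) ∈ F (c + 1) at this
          rwa [E.pw_zero, one_mul] at this
      refine ⟨fun c => 0, fun c => c + 1, fun c => 1, fun c => c, fun _ _ => Nat.zero_le _,
        fun _ h => absurd h hyo, fun _ _ => le_rfl, fun _ h => absurd h hyo, fun c => Nat.zero_add _,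
        fun c => Nat.add_comm 1 c, fun _ => by simp, fun c => ?_, fun c => ?_, fun i j hi _ => ?_⟩
      · change U.d (E.pw x 0 * E.pw y (c + 1)) - E.pw x 1 * E.pw y c ∈ F c
        rw [E.pw_zero, one_mul, hdpow, add_mul, add_sub_cancel_left]
        exact mul_mem_pairFilt hdy (hyF c)
      · change U.d (E.pw x 1 * E.pw y c) ∈ F c
        rw [U.d_mul']
        refine add_mem (mul_mem_pairFilt hdx (hyF c)) ?_
        rcases c with _ | c
        · rw [E.pw_zero, U.d_one, mul_zero]; exact zero_mem _
        · have h3 : U.sgn 1 (E.pw x 1) = - E.pw x 1 := by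
            rw [U.sgn_of_mem 1 hxm, one_mul, hodd.neg_one_pow, neg_one_mul]
          have h4 : E.pw x 1 * g = - (g * E.pw x 1) := by
            have := U.mul_comm_sgn' g hxm
            rw [this, U.sgn_of_mem _ hgm, (hodd.mul hodd).neg_one_pow, neg_one_mul, neg_mul]
          rw [hdpow, h3, ← mul_assoc, neg_mul, mul_add, U.sq_zero hodd hxm, zero_add, h4, neg_neg,
            mul_assoc]
          exact mul_mem_pairFilt hdy (right_mem_pairFilt (G := G)
            (P := fun c => E.pw x 0 * E.pw y (c + 1)) (Q := fun c => E.pw x 1 * E.pw y c) c)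
      · have := hi hodd
        rcases i with _ | i
        · rcases j with _ | j
          · exact Or.inl ⟨rfl, rfl⟩
          · exact Or.inr (Or.inl ⟨j, rfl, rfl⟩)
        · exact Or.inr (Or.inr ⟨j, show i + 1 = 1 by omega, rfl⟩)
  set F := pairFilt G (fun c => E.pw x (a c) * E.pw y (b c))
    (fun c => E.pw x (a' c) * E.pw y (b' c)) with hF
  -- coefficients of products with these monomials
  have hsplit : ∀ i j (hi : Odd (E.deg x) → i ≤ 1) (hj : Odd (E.deg y) → j ≤ 1), ∃ k : ℕ,
      ∀ p ∈ G, E.split P (p * (E.pw x i * E.pw y j)) =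
        Finsupp.single (E.pairAdm hxy i j hi hj) ((-1) ^ k * p) := by
    intro i j hi hj
    obtain ⟨k, hk⟩ := E.mon_pairAdm hxy i j hi hj
    refine ⟨k, fun p hp => ?_⟩
    have h1 : p * (E.pw x i * E.pw y j) = ((-1) ^ k * p) * E.mon (E.pairAdm hxy i j hi hj) := by
      rw [hk, neg_one_pow_mul_comm, ← mul_assoc ((-1) ^ k), neg_one_pow_mul_self]
    rw [h1, E.split_mul_mon (mul_mem (pow_mem (neg_mem (one_mem _)) _) hp)]
    intro z hz
    exact E.pairAdm_apply_of_ne hxy i j hi hj (fun h => hx (h ▸ hz)) (fun h => hy (h ▸ hz))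
  -- the filtration bounds the total exponents, so it is strictly increasing
  have hbound : ∀ c, ∀ u ∈ F c, ∀ m, E.split P u m ≠ 0 → m.1.degree ≤ c := by
    intro c
    induction c with
    | zero =>
      intro u hu m hm
      have := E.split_mul_mon (P := P) hu (m := E.zeroAdm) fun _ _ => rfl
      rw [mon_zeroAdm, mul_one] at this
      rw [this, Finsupp.single_apply] at hm
      split_ifs at hm with h
      · rw [← h]; simp [zeroAdm]
      · exact absurd rfl hm
    | succ c ih =>
      rintro _ ⟨u, hu, p, hp, q, hq, rfl⟩ m hm
      obtain ⟨k, hk⟩ := hsplit _ _ (ha c) (hb c)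
      obtain ⟨k', hk'⟩ := hsplit _ _ (ha' c) (hb' c)
      rw [map_add, map_add, hk p hp, hk' q hq, Finsupp.add_apply, Finsupp.add_apply,
        Finsupp.single_apply, Finsupp.single_apply] at hm
      by_cases h1 : E.pairAdm hxy _ _ (ha c) (hb c) = m
      · rw [← h1, pairAdm_degree, hs]
      · by_cases h2 : E.pairAdm hxy _ _ (ha' c) (hb' c) = m
        · rw [← h2, pairAdm_degree, hs']
        · rw [if_neg h1, if_neg h2, add_zero, add_zero] at hm
          exact (ih u hu m hm).trans c.le_succ
  have hind : ∀ c, ∀ p ∈ G, ∀ q ∈ G, p * (E.pw x (a c) * E.pw y (b c)) +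
      q * (E.pw x (a' c) * E.pw y (b' c)) ∈ F c → p = 0 ∧ q = 0 := by
    intro c p hp q hq h
    obtain ⟨k, hk⟩ := hsplit _ _ (ha c) (hb c)
    obtain ⟨k', hk'⟩ := hsplit _ _ (ha' c) (hb' c)
    have hne' : E.pairAdm hxy _ _ (ha c) (hb c) ≠ E.pairAdm hxy _ _ (ha' c) (hb' c) := by
      intro h
      have := DFunLike.congr_fun (congrArg Subtype.val h) y
      rw [pairAdm_apply_right, pairAdm_apply_right] at this
      exact hne c this
    have h1 := mt (hbound c _ h (E.pairAdm hxy _ _ (ha c) (hb c)))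
      (by rw [pairAdm_degree, hs]; omega)
    have h2 := mt (hbound c _ h (E.pairAdm hxy _ _ (ha' c) (hb' c)))
      (by rw [pairAdm_degree, hs']; omega)
    rw [not_not, map_add, hk p hp, hk' q hq, Finsupp.add_apply, Finsupp.single_eq_same,
      Finsupp.single_apply, if_neg (Ne.symm hne'), add_zero] at h1
    rw [not_not, map_add, hk p hp, hk' q hq, Finsupp.add_apply, Finsupp.single_eq_same,
      Finsupp.single_apply, if_neg hne', zero_add] at h2
    constructor
    · rw [← neg_one_pow_mul_self k p, h1, mul_zero]
    · rw [← neg_one_pow_mul_self k' q, h2, mul_zero]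
  -- the filtration is exhaustive
  have hmon : ∀ i j, (Odd (E.deg x) → i ≤ 1) → (Odd (E.deg y) → j ≤ 1) →
      ∃ c, E.pw x i * E.pw y j ∈ F c := by
    intro i j hi hj
    rcases hall i j hi hj with ⟨rfl, rfl⟩ | ⟨c, rfl, rfl⟩ | ⟨c, rfl, rfl⟩
    · exact ⟨0, by rw [E.pw_zero, E.pw_zero, mul_one]; exact G.one_mem⟩
    · exact ⟨c + 1, left_mem_pairFilt (G := G) (P := fun c => E.pw x (a c) * E.pw y (b c)) c⟩
    · exact ⟨c + 1, right_mem_pairFilt (G := G) (Q := fun c => E.pw x (a' c) * E.pw y (b' c)) c⟩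
  have hex : ∀ u ∈ E.fam.spnRing (P ∪ {x, y}), ∃ c, u ∈ F c := by
    intro u hu
    rw [E.split_sum P u, Finsupp.sum]
    have : ∀ s ⊆ (E.split P u).support, ∃ c, ∑ m ∈ s, E.split P u m * E.mon m ∈ F c := by
      intro s
      induction s using Finset.induction_on with
      | empty => exact fun _ => ⟨0, by simp⟩
      | insert m s hm ih =>
        intro hsub
        rw [Finset.insert_subset_iff] at hsub
        obtain ⟨c, hc⟩ := ih hsub.2
        have hm0 := Finsupp.mem_support_iff.1 hsub.1
        obtain ⟨e, he, hem⟩ := E.exists_of_split_ne_zero hm0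
        have hz : ∀ z, z ≠ x → z ≠ y → m.1 z = 0 := by
          intro z hzx hzy
          by_cases hz : z ∈ P
          · exact E.apply_eq_zero_of_split_ne_zero hm0 hz
          · rw [← hem, E.res_of_mem e (show z ∈ Pᶜ from hz)]
            refine E.mem_spnRing_iff.1 hu e he z ?_
            rintro (h | h | h)
            · exact hz h
            · exact hzx h
            · exact hzy h
        have hmeq : E.pairAdm hxy (m.1 x) (m.1 y) (m.2 x) (m.2 y) = m := by
          refine Subtype.ext (Finsupp.ext fun z => ?_)
          by_cases h1 : z = x
          · subst h1; simp [pairAdm, Finsupp.single_apply, Ne.symm hxy]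
          · by_cases h2 : z = y
            · subst h2; exact E.pairAdm_apply_right hxy _ _ (m.2 x) (m.2 z)
            · rw [E.pairAdm_apply_of_ne hxy _ _ _ _ h1 h2, hz z h1 h2]
        obtain ⟨k, hk⟩ := E.mon_pairAdm hxy _ _ (m.2 x) (m.2 y)
        rw [hmeq] at hk
        obtain ⟨c', hc'⟩ := hmon _ _ (m.2 x) (m.2 y)
        refine ⟨max c c', ?_⟩
        rw [Finset.sum_insert hm]
        refine add_mem (mul_mem_pairFilt (E.split_mem P u m) ?_)
          (pairFilt_mono (le_max_left c c') hc)
        rw [hk]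
        exact mul_mem_pairFilt (pow_mem (neg_mem (one_mem _)) _)
          (pairFilt_mono (le_max_right c c') hc')
    exact this _ subset_rfl
  have hFsub : ∀ c, ∀ u ∈ F c, u ∈ E.fam.spnRing (P ∪ {x, y}) := by
    have hxy' : ∀ i j, E.pw x i * E.pw y j ∈ E.fam.spnRing (P ∪ {x, y}) := fun i j =>
      mul_mem (E.pw_mem_spnRing (by simp) i) (E.pw_mem_spnRing (by simp) j)
    have hGG : G ≤ E.fam.spnRing (P ∪ {x, y}) := E.spnRing_mono Set.subset_union_left
    intro c
    induction c with
    | zero => exact fun u hu => hGG hu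
    | succ c ih =>
      rintro _ ⟨u, hu, p, hp, q, hq, rfl⟩
      exact add_mem (add_mem (ih u hu) (mul_mem (hGG hp) (hxy' _ _)))
        (mul_mem (hGG hq) (hxy' _ _))
  intro u hu hdu
  obtain ⟨c, hc⟩ := hex u hu
  -- `exists_sub_d_mem` applies at every stage of the filtration
  obtain ⟨w, hw, hw'⟩ := exists_sub_d_mem (fun g hg => E.spnRing_sgn P 1 hg) (E.spnRing_d hPd)
    hind hP hQ c u hc hdu
  exact ⟨w, hFsub c w hw, hw'⟩

variable {A : CDGA.{u}} {U : CDGA.{v}} (E : SemifreeExt.{u, v, w} A U)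

/-! ### Derivations compatible with divided powers -/

/-- The admissible values on variables of a derivation of degree `-n`. -/
def IsDerValue (n : ℕ) (ϑ : E.Var → U) : Prop :=
  ∀ x, (E.deg x < n → ϑ x = 0) ∧ (n ≤ E.deg x → ϑ x ∈ U.gr (E.deg x - n))

/-- `θ` is the `A`-linear derivation of degree `-n` that is compatible with divided powers and has
the values `ϑ` on the variables. -/
structure IsDer (n : ℕ) (ϑ : E.Var → U) (θ : U →+ U) : Prop where
  leibniz : ∀ a b, θ (a * b) = θ a * b + U.sgn n a * θ b
  incl : ∀ a, θ (E.incl a) = 0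
  var : ∀ x, θ (E.pw x 1) = ϑ x
  pw : ∀ x m, Even (E.deg x) → θ (E.pw x (m + 1)) = ϑ x * E.pw x m

theorem twisted_comm {n i j : ℕ} {a b : U} (ha : a ∈ U.gr i) (hn : n ≤ j) (hb : b ∈ U.gr (j - n)) :
    U.sgn n a * b = (-1) ^ (i * j) * (b * a) := by
  rw [U.sgn_of_mem n ha, mul_assoc, U.comm ha hb, ← mul_assoc, ← pow_add]
  congr 2
  rw [Nat.mul_sub, Nat.mul_comm n i]
  have := Nat.mul_le_mul_left i hn
  omega

/-- The values of a derivation on powers of variables. -/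
def derPw (ϑ : E.Var → U) (x : E.Var) (m : ℕ) : U := by
  classical
  exact if m = 0 ∨ (Odd (E.deg x) ∧ 2 ≤ m) then 0 else ϑ x * E.pw x (m - 1)

theorem derPw_zero (ϑ : E.Var → U) (x : E.Var) : E.derPw ϑ x 0 = 0 := by simp [derPw]

theorem derPw_one (ϑ : E.Var → U) (x : E.Var) : E.derPw ϑ x 1 = ϑ x := by simp [derPw, E.pw_zero]

theorem derPw_odd (ϑ : E.Var → U) {x : E.Var} (hx : Odd (E.deg x)) (m : ℕ) :
    E.derPw ϑ x (m + 2) = 0 := by simp [derPw, hx]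

theorem derPw_even (ϑ : E.Var → U) {x : E.Var} (hx : Even (E.deg x)) (m : ℕ) :
    E.derPw ϑ x (m + 1) = ϑ x * E.pw x m := by
  simp [derPw, Nat.not_odd_iff_even.2 hx]

theorem derPw_mem {n : ℕ} {ϑ : E.Var → U} (hϑ : E.IsDerValue n ϑ) (x : E.Var) (m : ℕ) :
    E.derPw ϑ x m = 0 ∨ (n ≤ m * E.deg x ∧ E.derPw ϑ x m ∈ U.gr (m * E.deg x - n)) := by
  classical
  rw [derPw]
  split_ifs with h
  · exact Or.inl rfl
  · by_cases hn : n ≤ E.deg x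
    · right
      obtain ⟨m, rfl⟩ := Nat.exists_eq_succ_of_ne_zero (fun h0 => h (Or.inl h0))
      have h1 := U.mul_mem' ((hϑ x).2 hn) (E.pw_mem x m)
      have h2 : (m + 1) * E.deg x = m * E.deg x + E.deg x := by ring
      refine ⟨by rw [Nat.succ_eq_add_one, h2]; omega, ?_⟩
      have h3 : E.deg x - n + m * E.deg x = (m + 1) * E.deg x - n := by omega
      rw [h3] at h1
      exact h1
    · left; rw [(hϑ x).1 (by omega), zero_mul]

theorem comm_derPw {n i : ℕ} {ϑ : E.Var → U} (hϑ : E.IsDerValue n ϑ) {a : U} (ha : a ∈ U.gr i)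
    (x : E.Var) (m : ℕ) : U.sgn n a * E.derPw ϑ x m =
      (-1) ^ (i * (m * E.deg x)) * (E.derPw ϑ x m * a) := by
  rcases E.derPw_mem hϑ x m with h | ⟨h1, h2⟩
  · rw [h]; simp
  · exact twisted_comm ha h1 h2

theorem fin_two_neg_one_pow {R : Type*} [Ring R] (k : ℕ) (M : Matrix (Fin 2) (Fin 2) R) :
    (-1) ^ k * M = !![(-1) ^ k * M 0 0, (-1) ^ k * M 0 1; (-1) ^ k * M 1 0, (-1) ^ k * M 1 1] := by
  rcases Nat.even_or_odd k with h | h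
  · rw [h.neg_one_pow, h.neg_one_pow]; simp [← Matrix.eta_fin_two]
  · rw [h.neg_one_pow, h.neg_one_pow]
    ext i j
    fin_cases i <;> fin_cases j <;> simp

/-- Derivations with prescribed values exist: the map `u ↦ !![u, 0; θ u, sgn n u]` to lower
triangular matrices is multiplicative if and only if `θ` is a derivation, and the universal property
of `U` provides such a homomorphism. -/
theorem exists_isDer (hdiv : ∀ x, Even (E.deg x) → x ∈ E.divided) {n : ℕ} {ϑ : E.Var → U}
    (hϑ : E.IsDerValue n ϑ) : ∃ θ, E.IsDer n ϑ θ := by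
  let g : A →+* Matrix (Fin 2) (Fin 2) U :=
    { toFun := fun a => !![E.incl a, 0; 0, U.sgn n (E.incl a)]
      map_one' := by
        rw [map_one E.incl.toRingHom, map_one, Matrix.one_fin_two]
      map_mul' := fun a b => by
        rw [Matrix.mul_fin_two, map_mul E.incl.toRingHom, map_mul]
        simp
      map_zero' := by
        rw [map_zero E.incl.toRingHom, map_zero]
        ext i j; fin_cases i <;> fin_cases j <;> rfl
      map_add' := fun a b => by
        rw [map_add E.incl.toRingHom, map_add]
        ext i j; fin_cases i <;> fin_cases j <;> simp }
  let p : E.Var → ℕ → Matrix (Fin 2) (Fin 2) U := fun x m =>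
    !![E.pw x m, 0; E.derPw ϑ x m, U.sgn n (E.pw x m)]
  have F : IsFamily A E.deg E.divided g p :=
    { zero := fun x => by
        change !![E.pw x 0, 0; E.derPw ϑ x 0, U.sgn n (E.pw x 0)] = 1
        rw [E.pw_zero, derPw_zero, map_one, Matrix.one_fin_two]
      coef := fun {i a} x m ha => by
        have h1 := E.fam.coef x m ha
        have h2 := congrArg (U.sgn n) h1
        simp only [map_mul, map_pow, map_neg, map_one] at h2
        have h3 := E.comm_derPw hϑ (E.incl.map_gr ha) x m
        change !![E.incl a, 0; 0, U.sgn n (E.incl a)] *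
          !![E.pw x m, 0; E.derPw ϑ x m, U.sgn n (E.pw x m)] = (-1) ^ (i * (m * E.deg x)) *
          (!![E.pw x m, 0; E.derPw ϑ x m, U.sgn n (E.pw x m)] *
            !![E.incl a, 0; 0, U.sgn n (E.incl a)])
        rw [Matrix.mul_fin_two, Matrix.mul_fin_two, fin_two_neg_one_pow]
        ext k l
        fin_cases k <;> fin_cases l
        · simpa using h1
        · simp
        · simpa using h3
        · simpa using h2
      comm := fun {x y} m m' hxy => by
        have h1 := E.fam.comm m m' hxy
        have h2 := congrArg (U.sgn n) h1
        simp only [map_mul, map_pow, map_neg, map_one] at h2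
        have h3 := E.comm_derPw hϑ (E.pw_mem x m) y m'
        have h4 := E.comm_derPw hϑ (E.pw_mem y m') x m
        change !![E.pw x m, 0; E.derPw ϑ x m, U.sgn n (E.pw x m)] *
          !![E.pw y m', 0; E.derPw ϑ y m', U.sgn n (E.pw y m')] =
          (-1) ^ ((m * E.deg x) * (m' * E.deg y)) *
          (!![E.pw y m', 0; E.derPw ϑ y m', U.sgn n (E.pw y m')] *
          !![E.pw x m, 0; E.derPw ϑ x m, U.sgn n (E.pw x m)])
        rw [Matrix.mul_fin_two, Matrix.mul_fin_two, fin_two_neg_one_pow]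
        ext k l
        fin_cases k <;> fin_cases l
        · simpa using h1
        · simp
        · have h5 : E.derPw ϑ x m * E.pw y m' + U.sgn n (E.pw x m) * E.derPw ϑ y m' =
              (-1) ^ ((m * E.deg x) * (m' * E.deg y)) *
                (E.derPw ϑ y m' * E.pw x m + U.sgn n (E.pw y m') * E.derPw ϑ x m) := by
            rw [h3, h4, mul_add, Nat.mul_comm (m' * E.deg y), neg_one_pow_mul_self, add_comm]
          simpa using h5
        · simpa using h2
      mul := fun x m m' => by
        have h1 := E.fam.mul x m m'
        have h2 := congrArg (U.sgn n) h1
        rw [map_mul, map_zsmul] at h2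
        have h5 : E.derPw ϑ x m * E.pw x m' + U.sgn n (E.pw x m) * E.derPw ϑ x m' =
            structConst E.deg E.divided x m m' • E.derPw ϑ x (m + m') := by
          classical
          rcases Nat.even_or_odd (E.deg x) with he | ho
          · have hd := hdiv x he
            rw [structConst, if_neg (Nat.not_odd_iff_even.2 he), if_pos hd]
            have hc : ∀ m u, U.sgn n (E.pw x m) * u = u * E.pw x m := by
              intro m u
              rw [U.sgn_of_mem n (E.pw_mem x m),
                ((he.mul_left m).mul_left n).neg_one_pow, one_mul,
                U.mul_comm_sgn' u (E.pw_mem x m), U.sgn_even (he.mul_left m)]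
            rw [hc]
            rcases m with _ | m
            · simp [derPw_zero, E.pw_zero]
            rcases m' with _ | m'
            · simp [derPw_zero, E.pw_zero]
            have h6 : m + 1 + (m' + 1) = m + m' + 1 + 1 := by omega
            rw [E.derPw_even ϑ he, E.derPw_even ϑ he, h6, E.derPw_even ϑ he, mul_assoc, mul_assoc,
              E.pw_mul x _ _ hd he, E.pw_mul x _ _ hd he, Nat.choose_succ_succ,
              show m' + (m + 1) = m + m' + 1 by omega, show m + (m' + 1) = m + m' + 1 by omega]
            have h7 : (m + m' + 1).choose m' = (m + m' + 1).choose (m + 1) := by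
              rw [← Nat.choose_symm_of_eq_add]; omega
            rw [h7, mul_smul_comm, mul_smul_comm, ← add_smul, natCast_zsmul]
          · rw [structConst, if_pos ho]
            have hz : ∀ k, E.pw x (k + 2) = 0 := fun k => E.pw_pow_odd ho (by omega)
            rcases m with _ | _ | m
            · rcases m' with _ | _ | m'
              · simp [derPw_zero]
              · simp [derPw_zero, E.pw_zero]
              · simp [derPw_zero, E.pw_zero, derPw_odd _ _ ho]
            · rcases m' with _ | _ | m'
              · simp [derPw_zero, E.pw_zero]
              · have h6 := E.comm_derPw hϑ (E.pw_mem x 1) x 1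
                simp only [one_mul] at h6
                rw [(ho.mul ho).neg_one_pow] at h6
                simp only [zero_add]
                rw [h6, if_neg (by norm_num)]
                simp
              · simp [derPw_odd _ _ ho, hz]
            · rw [if_neg (by omega)]
              simp [derPw_odd _ _ ho, hz]
        change !![E.pw x m, 0; E.derPw ϑ x m, U.sgn n (E.pw x m)] *
          !![E.pw x m', 0; E.derPw ϑ x m', U.sgn n (E.pw x m')] =
          structConst E.deg E.divided x m m' •
            !![E.pw x (m + m'), 0; E.derPw ϑ x (m + m'), U.sgn n (E.pw x (m + m'))]
        rw [Matrix.mul_fin_two]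
        ext k l
        fin_cases k <;> fin_cases l
        · simpa using h1
        · simp
        · simpa using h5
        · simpa using h2 }
  obtain ⟨φ, hφ, hφ'⟩ := E.exists_lift F (fun x hx m hm => by
    obtain ⟨m, rfl⟩ := Nat.exists_eq_add_of_le' hm
    change !![E.pw x (m + 2), 0; E.derPw ϑ x (m + 2), U.sgn n (E.pw x (m + 2))] = 0
    rw [E.derPw_odd ϑ hx, E.pw_pow_odd hx (by omega), map_zero]
    ext i j; fin_cases i <;> fin_cases j <;> rfl)
  have key : ∀ u, φ u 0 0 = u ∧ φ u 0 1 = 0 ∧ φ u 1 1 = U.sgn n u := by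
    intro u
    have hu : u ∈ Subring.closure (Set.range E.incl ∪ {m | ∃ x n, m = E.pw x n}) := by
      rw [E.closure_gen]; trivial
    induction hu using Subring.closure_induction with
    | mem u hu =>
      rcases hu with ⟨a, rfl⟩ | ⟨x, m, rfl⟩
      · rw [hφ]; exact ⟨rfl, rfl, rfl⟩
      · rw [hφ']; exact ⟨rfl, rfl, rfl⟩
    | zero => simp
    | one => simp
    | add u v _ _ hu hv => simp [hu, hv]
    | neg u _ hu => simp [hu]
    | mul u v _ _ hu hv => simp [Matrix.mul_apply, Fin.sum_univ_two, hu, hv]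
  refine ⟨{ toFun := fun u => φ u 1 0, map_zero' := by simp, map_add' := by simp }, ?_, ?_, ?_, ?_⟩
  · intro a b
    change φ (a * b) 1 0 = φ a 1 0 * b + U.sgn n a * φ b 1 0
    rw [map_mul, Matrix.mul_apply, Fin.sum_univ_two, (key b).1, (key a).2.2]
  · intro a
    change φ (E.incl a) 1 0 = 0
    rw [hφ]; rfl
  · intro x
    change φ (E.pw x 1) 1 0 = _
    rw [hφ']; exact E.derPw_one ϑ x
  · intro x m hx
    change φ (E.pw x (m + 1)) 1 0 = _
    rw [hφ']; exact E.derPw_even ϑ hx m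

namespace IsDer

variable {E} {n : ℕ} {ϑ : E.Var → U} {θ : U →+ U} (h : E.IsDer n ϑ θ)

include h

theorem one : θ 1 = 0 := by
  have := h.incl 1
  rwa [map_one E.incl.toRingHom] at this

theorem incl_mul (a : A) (u : U) : θ (E.incl a * u) = U.sgn n (E.incl a) * θ u := by
  rw [h.leibniz, h.incl, zero_mul, zero_add]

/-- The value on a power of a variable is determined by the value on the variable. -/
theorem pw' (x : E.Var) (m : ℕ) : θ (E.pw x (m + 1)) = ϑ x * E.pw x m ∨ θ (E.pw x (m + 1)) = 0 := by
  rcases Nat.even_or_odd (E.deg x) with he | ho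
  · exact Or.inl (h.pw x m he)
  · rcases m with _ | m
    · left; rw [zero_add, h.var, E.pw_zero, mul_one]
    · right; rw [E.pw_pow_odd ho (by omega), map_zero]

theorem eq_on {ϑ' : E.Var → U} {θ' : U →+ U} (h' : E.IsDer n ϑ' θ') {P : Set E.Var}
    (hP : ∀ x ∈ P, ϑ x = ϑ' x) : ∀ u ∈ E.fam.spnRing P, θ u = θ' u := by
  intro u hu
  rw [spnRing_eq_closure] at hu
  induction hu using Subring.closure_induction with
  | mem u hu =>
    rcases hu with ⟨a, rfl⟩ | ⟨x, m, hx, rfl⟩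
    · rw [h.incl, h'.incl]
    · rcases m with _ | m
      · rw [E.pw_zero, h.one, h'.one]
      · rcases Nat.even_or_odd (E.deg x) with he | ho
        · rw [h.pw x m he, h'.pw x m he, hP x hx]
        · rcases m with _ | m
          · rw [zero_add, h.var, h'.var, hP x hx]
          · rw [E.pw_pow_odd ho (by omega), map_zero, map_zero]
  | zero => rw [map_zero, map_zero]
  | one => rw [h.one, h'.one]
  | add u v _ _ hu hv => rw [map_add, map_add, hu, hv]
  | neg u _ hu => rw [map_neg, map_neg, hu]
  | mul u v _ _ hu hv => rw [h.leibniz, h'.leibniz, hu, hv]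

theorem eq_zero_on {P : Set E.Var} (hP : ∀ x ∈ P, ϑ x = 0) : ∀ u ∈ E.fam.spnRing P, θ u = 0 := by
  have h0 : E.IsDer n (fun _ => 0) 0 := ⟨by simp, by simp, by simp, by simp⟩
  exact fun u hu => h.eq_on h0 hP u hu

theorem degree (hϑ : E.IsDerValue n ϑ) {i : ℕ} {u : U} (hu : u ∈ U.gr i) :
    (i < n → θ u = 0) ∧ (n ≤ i → θ u ∈ U.gr (i - n)) := by
  let good : ℕ → AddSubgroup U := fun i =>
    { carrier := {z | (i < n → z = 0) ∧ (n ≤ i → z ∈ U.gr (i - n))}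
      add_mem' := fun ha hb => ⟨fun h => by rw [ha.1 h, hb.1 h, add_zero],
        fun h => add_mem (ha.2 h) (hb.2 h)⟩
      zero_mem' := ⟨fun _ => rfl, fun _ => zero_mem _⟩
      neg_mem' := fun ha => ⟨fun h => by rw [ha.1 h, neg_zero], fun h => neg_mem (ha.2 h)⟩ }
  suffices ∀ u i, θ (U.pr i u) ∈ good i by
    have := this u i
    rw [U.pr_same hu] at this
    exact this
  intro u
  have hu : u ∈ Subring.closure (Set.range E.incl ∪ {m | ∃ x n, m = E.pw x n}) := by
    rw [E.closure_gen]; trivial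
  induction hu using Subring.closure_induction with
  | mem u hu =>
    intro i
    rcases hu with ⟨a, rfl⟩ | ⟨x, m, rfl⟩
    · rw [E.incl_pr, h.incl]; exact zero_mem _
    · by_cases hi : m * E.deg x = i
      · rw [← hi, U.pr_same (E.pw_mem x m)]
        rcases m with _ | m
        · rw [E.pw_zero, h.one]; exact zero_mem _
        · rcases h.pw' x m with h1 | h1
          · rw [h1]
            have h2 : (m + 1) * E.deg x = m * E.deg x + E.deg x := by ring
            by_cases hn : n ≤ E.deg x
            · have h3 := U.mul_mem' ((hϑ x).2 hn) (E.pw_mem x m)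
              refine ⟨fun _ => by omega, fun _ => ?_⟩
              rw [show E.deg x - n + m * E.deg x = (m + 1) * E.deg x - n by omega] at h3
              exact h3
            · rw [(hϑ x).1 (by omega), zero_mul]; exact zero_mem _
          · rw [h1]; exact zero_mem _
      · rw [U.pr_ne (E.pw_mem x m) hi, map_zero]; exact zero_mem _
  | zero => intro i; rw [map_zero, map_zero]; exact zero_mem _
  | one =>
    intro i
    by_cases hi : 0 = i
    · rw [← hi, U.pr_same U.one_mem0, h.one]; exact zero_mem _
    · rw [U.pr_ne U.one_mem0 hi, map_zero]; exact zero_mem _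
  | add u v _ _ hu hv => intro i; rw [map_add, map_add]; exact add_mem (hu i) (hv i)
  | neg u _ hu => intro i; rw [map_neg, map_neg]; exact neg_mem (hu i)
  | mul u v _ _ hu hv =>
    intro i
    rw [pr_mul, map_sum]
    refine sum_mem fun p hp => ?_
    rw [Finset.HasAntidiagonal.mem_antidiagonal] at hp
    rw [h.leibniz]
    refine add_mem ?_ ?_
    · have h1 := hu p.1
      refine ⟨fun hi => ?_, fun hi => ?_⟩
      · rw [h1.1 (by omega), zero_mul]
      · by_cases h2 : n ≤ p.1
        · have := U.mul_mem' (h1.2 h2) (U.pr_mem p.2 v)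
          rwa [show p.1 - n + p.2 = i - n by omega] at this
        · rw [h1.1 (by omega), zero_mul]; exact zero_mem _
    · have h1 := hv p.2
      refine ⟨fun hi => ?_, fun hi => ?_⟩
      · rw [h1.1 (by omega), mul_zero]
      · by_cases h2 : n ≤ p.2
        · have := U.mul_mem' (U.sgn_mem n (U.pr_mem p.1 u)) (h1.2 h2)
          rwa [show p.1 + (p.2 - n) = i - n by omega] at this
        · rw [h1.1 (by omega), mul_zero]; exact zero_mem _

theorem map_sgn (hϑ : E.IsDerValue n ϑ) (u : U) :
    θ (U.sgn 1 u) = (-1) ^ n * U.sgn 1 (θ u) := by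
  refine homogeneous_induction (p := fun u => θ (U.sgn 1 u) = (-1) ^ n * U.sgn 1 (θ u)) u
    (by simp) (fun a b ha hb => by rw [map_add, map_add, ha, hb, map_add, map_add, mul_add]) ?_
  intro i a ha
  rw [U.sgn_of_mem 1 ha, one_mul, map_neg_one_pow_mul]
  obtain ⟨h1, h2⟩ := h.degree hϑ ha
  by_cases hi : n ≤ i
  · rw [U.sgn_of_mem 1 (h2 hi), one_mul, ← mul_assoc, ← pow_add, Nat.add_sub_cancel' hi]
  · rw [h1 (by omega)]; simp

/-- A derivation commutes with the differential if it does so on variables. -/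
theorem comm_d (hϑ : E.IsDerValue n ϑ) (hdiv : ∀ x, Even (E.deg x) → x ∈ E.divided)
    {P : Set E.Var} (hP : ∀ x ∈ P, U.d (ϑ x) = (-1) ^ n * θ (U.d (E.pw x 1))) :
    ∀ u ∈ E.fam.spnRing P, U.d (θ u) = (-1) ^ n * θ (U.d u) := by
  intro u hu
  rw [spnRing_eq_closure] at hu
  induction hu using Subring.closure_induction with
  | mem u hu =>
    rcases hu with ⟨a, rfl⟩ | ⟨x, m, hx, rfl⟩
    · rw [h.incl, ← E.incl.map_d, h.incl, map_zero, mul_zero]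
    · rcases m with _ | m
      · rw [E.pw_zero, h.one, U.d_one, map_zero, map_zero, mul_zero]
      rcases m with _ | m
      · rw [zero_add, h.var, hP x hx]
      rcases Nat.even_or_odd (E.deg x) with he | ho
      · rw [h.pw x _ he, E.d_pw x (m + 1) (hdiv x he) he, U.d_mul', h.leibniz, hP x hx, h.pw x _ he,
          E.d_pw x m (hdiv x he) he, mul_add, mul_assoc]
        congr 1
        have hxm : E.pw x 1 ∈ U.gr (E.deg x - 1 + 1) := by
          have := E.pw_mem x 1
          rwa [one_mul, ← Nat.sub_add_cancel (E.deg_pos x)] at this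
        by_cases hn : n ≤ E.deg x
        · have h1 := (hϑ x).2 hn
          have h3 := twisted_comm (U.d_mem hxm) hn h1
          have h4 : Even ((E.deg x - 1) * E.deg x) := he.mul_left _
          rw [h4.neg_one_pow, one_mul] at h3
          rw [← mul_assoc (U.sgn n _), h3, U.sgn_of_mem 1 h1, one_mul, ← mul_assoc, ← mul_assoc,
            ← mul_assoc]
          congr 3
          obtain ⟨l, hl⟩ := Nat.exists_eq_add_of_le hn
          rw [hl] at he
          rw [hl, Nat.add_sub_cancel_left]
          rcases Nat.even_or_odd n with h5 | h5
          · rw [h5.neg_one_pow, ((Nat.even_add.1 he).1 h5).neg_one_pow]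
          · have : Odd l := by
              rw [← Nat.not_even_iff_odd] at h5 ⊢
              exact fun h6 => h5 ((Nat.even_add.1 he).2 h6)
            rw [h5.neg_one_pow, this.neg_one_pow]
        · rw [(hϑ x).1 (by omega)]; simp
      · rw [E.pw_pow_odd ho (by omega)]; simp
  | zero => simp
  | one => rw [h.one, U.d_one, map_zero, map_zero, mul_zero]
  | add u v _ _ hu hv => rw [map_add, map_add, hu, hv, map_add, map_add, mul_add]
  | neg u _ hu => rw [map_neg, map_neg, hu, map_neg, map_neg, mul_neg]
  | mul u v _ _ hu hv =>
    rw [h.leibniz, map_add, U.d_mul', U.d_mul', U.d_mul', map_add, h.leibniz, h.leibniz, hu, hv,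
      h.map_sgn hϑ, U.sgn_d, U.sgn_sgn, U.sgn_sgn, Nat.add_comm n 1]
    simp only [mul_add, mul_assoc, neg_one_pow_mul_comm, neg_one_pow_mul_self]
    abel

end IsDer

variable {A : CDGA.{u}} {U : CDGA.{v}} (E : SemifreeExt.{u, v, w} A U)

/-! ### Minimality of acyclic closures -/

/-- A ring homomorphism `η : U → k` that vanishes in positive degrees and on boundaries, such that
all cycles in its kernel are boundaries. Surjectivity is not required: `U` is a resolution of the
image of `η`. -/
structure IsResolution {k : Type*} [Ring k] (U : CDGA.{v}) (η : U →+* k) : Prop where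
  pos : ∀ {i u}, 0 < i → u ∈ U.gr i → η u = 0
  d : ∀ u, η (U.d u) = 0
  exact : ∀ z, U.d z = 0 → η z = 0 → ∃ w, U.d w = z

theorem IsResolution.exact_gr {k : Type*} [Ring k] {η : U →+* k} (hη : IsResolution U η)
    {i : ℕ} {z : U} (hz : z ∈ U.gr i) (hd : U.d z = 0) (h : η z = 0) :
    ∃ w ∈ U.gr (i + 1), U.d w = z := by
  obtain ⟨w, hw⟩ := hη.exact z hd h
  exact ⟨U.pr (i + 1) w, U.pr_mem _ _, by rw [d_pr_succ, hw, U.pr_same hz]⟩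

variable {E} in
/-- In the monomials in `g` and other variables on which a derivation vanishes, the derivation
lowers the exponent of `g`. -/
theorem IsDer.mon {n : ℕ} {ϑ : E.Var → U} {θ : U →+ U} (h : E.IsDer n ϑ θ) {g : E.Var}
    (hg : ϑ g = 1) (e : Adm E.deg) (he : ∀ x, e.1 x ≠ 0 → x ≠ g → ϑ x = 0) :
    (e.1 g = 0 → θ (E.mon e) = 0) ∧ (e.1 g ≠ 0 → ∀ f : Adm E.deg, f.1 = e.1 - Finsupp.single g 1 →
      ∃ k : ℕ, θ (E.mon e) = (-1) ^ k * E.mon f) := by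
  classical
  have hrest : ∀ f : Adm E.deg, (∀ x, f.1 x ≠ 0 → e.1 x ≠ 0) → f.1 g = 0 → θ (E.mon f) = 0 := by
    intro f hf hfg
    refine h.eq_zero_on (P := {x | ϑ x = 0}) (fun x hx => hx) _ (E.mon_mem_spnRing fun x hx => ?_)
    by_contra hfx
    exact hx (he x (hf x hfx) fun hxg => hfx (hxg ▸ hfg))
  refine ⟨fun h0 => hrest e (fun _ hx => hx) h0, fun h0 f hf => ?_⟩
  have hra : IsAdm E.deg (e.1.erase g) := IsAdm.mono e.2 (by
    intro x; rw [Finsupp.erase_apply]; split_ifs <;> simp)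
  let r : Adm E.deg := ⟨e.1.erase g, hra⟩
  have hr0 : θ (E.mon r) = 0 := hrest r (fun x hx => by
    change e.1.erase g x ≠ 0 at hx
    rw [Finsupp.erase_apply] at hx
    split_ifs at hx with h1
    · exact absurd rfl hx
    · exact hx) (Finsupp.erase_same)
  have hdis : ∀ m : ℕ, Disjoint (Finsupp.single g m).support (e.1.erase g).support := by
    intro m
    rw [Finset.disjoint_left]
    intro x hx hx'
    have := Finset.mem_singleton.1 (Finsupp.support_single_subset hx)
    rw [this] at hx'
    simp at hx'
  obtain ⟨m, hm⟩ := Nat.exists_eq_succ_of_ne_zero h0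
  have he1 : e.1 = Finsupp.single g (m + 1) + e.1.erase g := by
    rw [← Nat.succ_eq_add_one, ← hm, Finsupp.single_add_erase]
  have hf1 : f.1 = Finsupp.single g m + e.1.erase g := by
    rw [hf]
    ext x
    rw [Finsupp.tsub_apply, Finsupp.add_apply, Finsupp.erase_apply, Finsupp.single_apply,
      Finsupp.single_apply]
    by_cases hx : g = x
    · subst hx; simp [hm]
    · simp [hx, Ne.symm hx]
  obtain ⟨k, hk⟩ := E.fam.mono_add (hdis (m + 1))
  obtain ⟨k', hk'⟩ := E.fam.mono_add (hdis m)
  rw [← he1, E.fam.mono_single'] at hk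
  rw [← hf1, E.fam.mono_single'] at hk'
  have hpw : θ (E.pw g (m + 1)) = E.pw g m := by
    rcases Nat.even_or_odd (E.deg g) with hev | ho
    · rw [h.pw g m hev, hg, one_mul]
    · have : m = 0 := by have := e.2 g ho; omega
      subst this
      rw [zero_add, h.var, hg, E.pw_zero]
  refine ⟨k + k', ?_⟩
  have h1 : E.mon e = (-1) ^ k * (E.pw g (m + 1) * E.mon r) := hk
  have h2 : E.mon f = (-1) ^ k' * (E.pw g m * E.mon r) := hk'
  rw [h1, map_neg_one_pow_mul, h.leibniz, hr0, mul_zero, add_zero, hpw, h2, pow_add, mul_assoc,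
    neg_one_pow_mul_self]

variable {k : Type*} [CommRing k] {η : U →+* k} (hη : IsResolution U η)

include hη

theorem IsResolution.map_sgn (n : ℕ) (u : U) : η (U.sgn n u) = η u := by
  refine homogeneous_induction (p := fun u => η (U.sgn n u) = η u) u (by simp)
    (fun a b ha hb => by rw [map_add, map_add, ha, hb, map_add]) fun i a ha => ?_
  rcases Nat.eq_zero_or_pos i with rfl | hi
  · rw [U.sgn_of_mem n ha, mul_zero, pow_zero, one_mul]
  · rw [hη.pos hi ha, hη.pos hi (U.sgn_mem n ha)]

/-- The image of an element in `k` only depends on its constant coefficient. -/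
theorem IsResolution.apply_eq (u : U) : η u = η (E.incl (E.rep u E.zeroAdm)) := by
  refine E.term_induction (p := fun u => η u = η (E.incl (E.rep u E.zeroAdm))) u ?_
    (fun u v hu hv => ?_) fun a e => ?_
  · simp only [map_zero, Finsupp.zero_apply]
  · rw [map_add, hu, hv, map_add, Finsupp.add_apply, map_add E.incl.toRingHom, map_add]
  · rw [rep_mon]
    by_cases he : e = E.zeroAdm
    · subst he
      rw [mon_zeroAdm, mul_one, Finsupp.single_eq_same]
    · rw [Finsupp.single_apply, if_neg he, map_mul, map_zero E.incl.toRingHom, map_zero,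
        hη.pos _ (E.mon_mem e), mul_zero]
      obtain ⟨x, hx⟩ : ∃ x, e.1 x ≠ 0 := by
        by_contra hc
        push Not at hc
        exact he (Subtype.ext (Finsupp.ext hc))
      exact (E.deg_pos x).trans_le (deg_le_wdeg E.deg e.1 hx)

/-- For every variable `g` there is a derivation with value `1` on `g` that commutes with the
differential, provided that `g` has no linear occurrence in boundaries. The values on the other
variables are found one degree after the other. -/
theorem exists_isDer_comm_d (hdiv : ∀ x, Even (E.deg x) → x ∈ E.divided) (g : E.Var)
    (hlin : ∀ u, η (E.incl (E.rep (U.d u) (E.varAdm g))) = 0) (N : ℕ) :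
    ∃ ϑ θ, E.IsDerValue (E.deg g) ϑ ∧ E.IsDer (E.deg g) ϑ θ ∧ ϑ g = 1 ∧
      (∀ x, x ≠ g → E.deg x ≤ E.deg g → ϑ x = 0) ∧
      ∀ x, E.deg x ≤ N → U.d (ϑ x) = (-1) ^ E.deg g * θ (U.d (E.pw x 1)) := by
  classical
  set n := E.deg g with hn
  induction N with
  -- the derivation with value `1` on `g` that vanishes on the other variables
  | zero =>
    have hϑ : E.IsDerValue n (Pi.single g 1) := by
      intro x
      by_cases hx : x = g
      · subst hx
        refine ⟨fun h => by omega, fun _ => ?_⟩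
        rw [Pi.single_eq_same, hn, Nat.sub_self]
        exact U.one_mem0
      · rw [Pi.single_eq_of_ne hx]
        exact ⟨fun _ => rfl, fun _ => zero_mem _⟩
    obtain ⟨θ, hθ⟩ := E.exists_isDer hdiv hϑ
    refine ⟨_, θ, hϑ, hθ, Pi.single_eq_same g 1, fun x hx _ => Pi.single_eq_of_ne hx 1,
      fun x hx => ?_⟩
    have := E.deg_pos x
    omega
  | succ N ih =>
    obtain ⟨ϑ, θ, hϑ, hθ, hg, h0, hd⟩ := ih
    have hdm : ∀ x, U.d (E.pw x 1) ∈ U.gr (E.deg x - 1) := by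
      intro x
      have := E.pw_mem x 1
      rw [one_mul, ← Nat.sub_add_cancel (E.deg_pos x)] at this
      exact U.d_mem this
    have hfilt : ∀ x i, E.deg x ≤ i + 1 → U.d (E.pw x 1) ∈ E.fam.spnRing {x | E.deg x ≤ i} := by
      intro x i hx
      rw [← filtSubring_eq]
      exact E.mem_filt_of_deg (by omega) (hdm x)
    -- the new values: `θ (d x)` is a cycle in the kernel of `η`, hence a boundary
    have hw : ∀ x, E.deg x = N + 1 → n < N + 1 → ∃ w ∈ U.gr (E.deg x - n),
        U.d w = (-1) ^ n * θ (U.d (E.pw x 1)) := by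
      intro x hx hnN
      have h1 := (hθ.degree hϑ (hdm x)).2 (by omega)
      have h2 : U.d (θ (U.d (E.pw x 1))) = 0 := by
        rw [hθ.comm_d hϑ hdiv hd _ (hfilt x N hx.le), U.d_d, map_zero, mul_zero]
      have h3 : η (θ (U.d (E.pw x 1))) = 0 := by
        -- in degree `0` the value under `η` is the linear coefficient of `g` in `d x`
        rcases Nat.lt_or_ge n N with hlt | hge
        · exact hη.pos (by omega) h1
        · have hnN' : n = N := by omega
          conv_lhs => rw [E.rep_sum (U.d (E.pw x 1)), Finsupp.sum]
          rw [map_sum, map_sum]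
          refine Finset.sum_eq_zero fun e he => ?_
          rw [hθ.incl_mul]
          by_cases heg : e = E.varAdm g
          · subst heg
            rw [mon_varAdm, hθ.var, hg, mul_one, hη.map_sgn, hlin]
          · have hwd : wdeg E.deg e.1 ≤ N := by
              by_contra hc
              exact Finsupp.mem_support_iff.1 he (E.rep_eq_zero (hdm x) (by omega))
            have hvar : ∀ y, e.1 y ≠ 0 → E.deg y ≤ n := fun y hy =>
              (deg_le_wdeg E.deg e.1 hy).trans (by omega)
            have heg0 : e.1 g = 0 := by
              by_contra hc
              apply heg
              have h4 : e.1 = Finsupp.single g 1 + (e.1 - Finsupp.single g 1) := by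
                ext y
                rw [Finsupp.add_apply, Finsupp.tsub_apply, Finsupp.single_apply]
                split_ifs with h
                · subst h; omega
                · omega
              have h5 := congrArg (wdeg E.deg) h4
              rw [map_add, wdeg_single, one_mul] at h5
              refine Subtype.ext ?_
              rw [h4]
              have h6 : e.1 - Finsupp.single g 1 = 0 := by
                ext y
                by_contra hy
                have := deg_le_wdeg E.deg _ hy
                have := E.deg_pos y
                omega
              rw [h6, add_zero]; rfl
            rw [(hθ.mon hg e fun y hy hyg => h0 y hyg (hvar y hy)).1 heg0, mul_zero, map_zero]
      have h4 : (-1) ^ n * θ (U.d (E.pw x 1)) ∈ U.gr (E.deg x - 1 - n) := U.neg_one_pow_mem n h1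
      obtain ⟨w, hw, hw'⟩ := hη.exact_gr h4 (by rw [map_neg_one_pow_mul, h2, mul_zero])
        (by rw [map_mul, h3, mul_zero])
      refine ⟨w, ?_, hw'⟩
      rwa [show E.deg x - 1 - n + 1 = E.deg x - n by omega] at hw
    choose! W hW hW' using hw
    -- only the values in degree `N + 1` are changed
    let ϑ' : E.Var → U := fun x => if E.deg x = N + 1 ∧ n < N + 1 then W x else ϑ x
    have hϑ' : E.IsDerValue n ϑ' := by
      intro x
      by_cases hx : E.deg x = N + 1 ∧ n < N + 1
      · have : ϑ' x = W x := if_pos hx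
        rw [this]
        exact ⟨fun h => by omega, fun _ => hW x hx.1 hx.2⟩
      · have : ϑ' x = ϑ x := if_neg hx
        rw [this]; exact hϑ x
    obtain ⟨θ', hθ'⟩ := E.exists_isDer hdiv hϑ'
    have hlow : ∀ x ∈ {x | E.deg x ≤ N}, ϑ' x = ϑ x := fun x hx => if_neg (fun h => by
      have : E.deg x ≤ N := hx
      omega)
    have hagree : ∀ x, E.deg x ≤ N + 1 → θ' (U.d (E.pw x 1)) = θ (U.d (E.pw x 1)) :=
      fun x hx => hθ'.eq_on hθ hlow _ (hfilt x N hx)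
    refine ⟨ϑ', θ', hϑ', hθ', ?_, ?_, ?_⟩
    · rw [← hg]; exact if_neg (by omega)
    · intro x hx hxn
      rw [← h0 x hx hxn]; exact if_neg (by omega)
    · intro x hx
      rw [hagree x hx]
      rcases Nat.lt_or_ge N (E.deg x) with hlt | hle
      · have hx' : E.deg x = N + 1 := by omega
        by_cases hnN : n < N + 1
        · have : ϑ' x = W x := if_pos ⟨hx', hnN⟩
          rw [this, hW' x hx' hnN]
        · have : ϑ' x = ϑ x := if_neg fun h => hnN h.2
          rw [this, (hθ.degree hϑ (hdm x)).1 (by omega), mul_zero]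
          by_cases hxg : x = g
          · rw [hxg, hg, U.d_one]
          · rw [h0 x hxg (by omega), map_zero]
      · rw [hlow x hle, hd x hle]

/-- If no variable occurs linearly, with a unit coefficient, in a boundary, then all coefficients
of boundaries are in the kernel of the augmentation. -/
theorem coeff_d_mem_ker (hdiv : ∀ x, Even (E.deg x) → x ∈ E.divided)
    (hlin : ∀ u g, η (E.incl (E.rep (U.d u) (E.varAdm g))) = 0) (u : U) (e : Adm E.deg) :
    η (E.incl (E.rep (U.d u) e)) = 0 := by
  classical
  have hadd : ∀ (e : Adm E.deg) (a b : U), η (E.incl (E.rep (a + b) e)) =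
      η (E.incl (E.rep a e)) + η (E.incl (E.rep b e)) := by
    intro e a b
    rw [map_add, Finsupp.add_apply, map_add E.incl.toRingHom, map_add]
  have hzero : ∀ e : Adm E.deg, η (E.incl (E.rep (0 : U) e)) = 0 := by
    intro e
    rw [map_zero, Finsupp.zero_apply, map_zero E.incl.toRingHom, map_zero]
  suffices H : ∀ j, ∀ u ∈ U.gr j, ∀ e, η (E.incl (E.rep (U.d u) e)) = 0 by
    refine homogeneous_induction (p := fun u => ∀ e, η (E.incl (E.rep (U.d u) e)) = 0) u
      (fun e => by rw [map_zero, hzero])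
      (fun a b ha hb e => by rw [map_add, hadd, ha, hb, add_zero]) (fun i a ha => H i a ha) e
  -- induction on the degree of `u`, since derivations lower degrees
  intro j
  induction j using Nat.strong_induction_on with
  | _ j ih =>
  intro u hu
  by_contra hc
  push Not at hc
  set v := U.d u with hv
  -- the monomials whose coefficients are not in the kernel of `η`
  let bad := (E.rep v).support.filter fun e => η (E.incl (E.rep v e)) ≠ 0
  have hbad : ∀ {e}, e ∈ bad ↔ η (E.incl (E.rep v e)) ≠ 0 := by
    intro e
    rw [Finset.mem_filter, Finsupp.mem_support_iff]
    refine ⟨fun h => h.2, fun h => ⟨fun h0 => h ?_, h⟩⟩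
    rw [h0, map_zero E.incl.toRingHom, map_zero]
  let pairs := bad.biUnion fun e => e.1.support.image fun x => (e, x)
  have hpairs : ∀ e x, (e, x) ∈ pairs ↔ e ∈ bad ∧ e.1 x ≠ 0 := by
    intro e x
    simp only [pairs, Finset.mem_biUnion, Finset.mem_image, Finsupp.mem_support_iff]
    constructor
    · rintro ⟨e', he', x', hx', h⟩
      obtain ⟨rfl, rfl⟩ := Prod.mk.inj h
      exact ⟨he', hx'⟩
    · rintro ⟨h1, h2⟩
      exact ⟨e, h1, x, h2, rfl⟩
  have hne : pairs.Nonempty := by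
    obtain ⟨e, he⟩ := hc
    have he0 : e ≠ E.zeroAdm := by
      rintro rfl
      apply he
      rw [← hη.apply_eq E]
      exact hη.d u
    obtain ⟨x, hx⟩ : ∃ x, e.1 x ≠ 0 := by
      by_contra hc
      push Not at hc
      exact he0 (Subtype.ext (Finsupp.ext hc))
    exact ⟨(e, x), (hpairs e x).2 ⟨hbad.2 he, hx⟩⟩
  -- a variable `g` of maximal degree in these monomials: on them the derivation at `g` lowers the
  -- exponent of `g` and does nothing else
  obtain ⟨⟨e₀, g⟩, he₀, hmax⟩ := pairs.exists_max_image (fun q => E.deg q.2) hne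
  obtain ⟨he₀, hg₀⟩ := (hpairs _ _).1 he₀
  obtain ⟨ϑ, θ, hϑ, hθ, hg, h0, hd⟩ := E.exists_isDer_comm_d hη hdiv g (fun u => hlin u g) j
  -- `θ v` is, up to sign, the boundary of `θ u`, which has smaller degree than `u`
  have hvan : ∀ e, η (E.incl (E.rep (θ v) e)) = 0 := by
    intro e
    have huf : u ∈ E.fam.spnRing {x | E.deg x ≤ j} := by
      rw [← filtSubring_eq]; exact E.mem_filt_of_deg le_rfl hu
    have h1 := hθ.comm_d hϑ hdiv (P := {x | E.deg x ≤ j}) hd u huf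
    have h2 : θ v = (-1) ^ E.deg g * U.d (θ u) := by rw [h1, neg_one_pow_mul_self]
    rw [h2, rep_neg_one_pow_mul, map_mul E.incl.toRingHom, map_mul]
    obtain ⟨h3, h4⟩ := hθ.degree hϑ hu
    by_cases hgj : E.deg g ≤ j
    · have := E.deg_pos g
      rw [ih (j - E.deg g) (by omega) _ (h4 hgj), mul_zero]
    · rw [h3 (by omega), map_zero, hzero, mul_zero]
  have hadm : IsAdm E.deg (e₀.1 - Finsupp.single g 1) := IsAdm.mono e₀.2 tsub_le_self
  let e₁ : Adm E.deg := ⟨e₀.1 - Finsupp.single g 1, hadm⟩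
  -- the coefficient of `θ v` at `e₀ - g` comes from the term of `v` at `e₀` only
  have hterm : ∀ e ∈ (E.rep v).support, e ≠ e₀ →
      η (E.incl (E.rep (θ (E.incl (E.rep v e) * E.mon e)) e₁)) = 0 := by
    intro e _ hee
    have hsg : U.sgn (E.deg g) (E.incl (E.rep v e)) = E.incl (A.sgn (E.deg g) (E.rep v e)) :=
      (E.incl.map_sgn _ _).symm
    rw [hθ.incl_mul, hsg, rep_incl_mul, map_mul E.incl.toRingHom, map_mul]
    by_cases hb : e ∈ bad
    · have hvars : ∀ x, e.1 x ≠ 0 → x ≠ g → ϑ x = 0 := fun x hx hxg =>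
        h0 x hxg (hmax (e, x) ((hpairs e x).2 ⟨hb, hx⟩))
      obtain ⟨h1, h2⟩ := hθ.mon hg e hvars
      by_cases heg : e.1 g = 0
      · rw [h1 heg, hzero, mul_zero]
      · have hadm' : IsAdm E.deg (e.1 - Finsupp.single g 1) := IsAdm.mono e.2 tsub_le_self
        obtain ⟨l, hl⟩ := h2 heg ⟨_, hadm'⟩ rfl
        have h5 : (⟨_, hadm'⟩ : Adm E.deg) ≠ e₁ := by
          intro h
          apply hee
          have h6 : e.1 - Finsupp.single g 1 = e₀.1 - Finsupp.single g 1 := congrArg Subtype.val h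
          refine Subtype.ext (Finsupp.ext fun x => ?_)
          have h7 := DFunLike.congr_fun h6 x
          rw [Finsupp.tsub_apply, Finsupp.tsub_apply, Finsupp.single_apply] at h7
          split_ifs at h7 with hx
          · subst hx; omega
          · omega
        have h8 := E.rep_mon (⟨_, hadm'⟩ : Adm E.deg) 1
        rw [map_one E.incl.toRingHom, one_mul] at h8
        rw [hl, rep_neg_one_pow_mul, h8, Finsupp.single_apply, if_neg h5, mul_zero,
          map_zero E.incl.toRingHom, map_zero, mul_zero]
    · have : η (E.incl (A.sgn (E.deg g) (E.rep v e))) = 0 := by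
        rw [← hsg, hη.map_sgn]
        exact not_not.1 (mt hbad.2 hb)
      rw [this, zero_mul]
  -- and it is not in the kernel of `η`, a contradiction
  have hlead : η (E.incl (E.rep (θ (E.incl (E.rep v e₀) * E.mon e₀)) e₁)) ≠ 0 := by
    have hsg : U.sgn (E.deg g) (E.incl (E.rep v e₀)) = E.incl (A.sgn (E.deg g) (E.rep v e₀)) :=
      (E.incl.map_sgn _ _).symm
    have hvars : ∀ x, e₀.1 x ≠ 0 → x ≠ g → ϑ x = 0 := fun x hx hxg =>
      h0 x hxg (hmax (e₀, x) ((hpairs e₀ x).2 ⟨he₀, hx⟩))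
    obtain ⟨l, hl⟩ := (hθ.mon hg e₀ hvars).2 hg₀ e₁ rfl
    have h8 := E.rep_mon e₁ 1
    rw [map_one E.incl.toRingHom, one_mul] at h8
    rw [hθ.incl_mul, hsg, rep_incl_mul, map_mul E.incl.toRingHom, map_mul, hl,
      rep_neg_one_pow_mul, h8, Finsupp.single_eq_same, ← hsg, hη.map_sgn, mul_one]
    intro h
    apply hbad.1 he₀
    rw [map_pow E.incl.toRingHom, map_neg E.incl.toRingHom, map_one E.incl.toRingHom, map_pow,
      map_neg, map_one, mul_comm] at h
    rw [← neg_one_pow_mul_self l (η (E.incl (E.rep v e₀))), h, mul_zero]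
  apply hlead
  have h1 := hvan e₁
  rw [E.rep_sum v, Finsupp.sum, map_sum, map_sum, Finsupp.finsetSum_apply,
    map_sum E.incl.toRingHom, map_sum, Finset.sum_eq_single e₀ hterm] at h1
  · exact h1
  · intro h
    rw [Finsupp.notMem_support_iff] at h
    exact absurd (by rw [h, map_zero E.incl.toRingHom, map_zero]) (hbad.1 he₀)

end SemifreeExt

/-! ### Quasi-isomorphisms of filtered complexes -/

/-- Quasi-isomorphisms of abelian groups with differentials. -/
structure IsQI {N N' : Type*} [AddCommGroup N] [AddCommGroup N'] (d : N →+ N) (d' : N' →+ N')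
    (h : N →+ N') : Prop where
  comm : ∀ n, h (d n) = d' (h n)
  inj : ∀ z, d z = 0 → ∀ b, h z = d' b → ∃ a, d a = z
  surj : ∀ z, d' z = 0 → ∃ y, d y = 0 ∧ ∃ b, h y - z = d' b

namespace IsQI

variable {N N' N'' : Type*} [AddCommGroup N] [AddCommGroup N'] [AddCommGroup N''] {d : N →+ N}
  {d' : N' →+ N'} {d'' : N'' →+ N''} {h : N →+ N'} {h' : N' →+ N''}

/-- Acyclicity of the mapping cone. -/
theorem cone (H : IsQI d d' h) {n : N} {n' : N'} (hn : d n = 0)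
    (hn' : h n = d' n') : ∃ a b, d a = n ∧ h a - n' = d' b := by
  obtain ⟨a, ha⟩ := H.inj n hn n' hn'
  obtain ⟨y, hy, b, hb⟩ := H.surj (h a - n') (by rw [map_sub, ← H.comm, ha, hn', sub_self])
  exact ⟨a - y, -b, by rw [map_sub, ha, hy, sub_zero], by rw [map_sub, map_neg, ← hb]; abel⟩

theorem of_cone (hh : ∀ n, h (d n) = d' (h n))
    (H : ∀ n n', d n = 0 → h n = d' n' → ∃ a b, d a = n ∧ h a - n' = d' b) : IsQI d d' h where
  comm := hh
  inj z hz b hb := by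
    obtain ⟨a, _, ha, _⟩ := H z b hz hb
    exact ⟨a, ha⟩
  surj z hz := by
    obtain ⟨a, b, ha, hb⟩ := H 0 z (map_zero d) (by rw [map_zero, hz])
    exact ⟨a, ha, b, hb⟩

theorem of_comp (H : IsQI d d' h) (H' : IsQI d d'' (h'.comp h))
    (hh' : ∀ n, h' (d' n) = d'' (h' n)) : IsQI d' d'' h' where
  comm := hh'
  inj z hz c hc := by
    obtain ⟨y, hy, b, hb⟩ := H.surj z hz
    have hy' : h y = z + d' b := by rw [← hb]; abel
    obtain ⟨x, hx⟩ := H'.inj y hy (c + h' b) (by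
      rw [AddMonoidHom.comp_apply, hy', map_add, hc, hh', map_add])
    exact ⟨h x - b, by rw [map_sub, ← H.comm, hx, hy']; abel⟩
  surj z hz := by
    obtain ⟨y, hy, b, hb⟩ := H'.surj z hz
    exact ⟨h y, by rw [← H.comm, hy, map_zero], b, hb⟩

/-- Let `r` be a filtration, and let `Δ` be a differential that is `± δ` on the summand at `m`, up
to terms of filtration less than `r m`. Then, in the components of top filtration of `f`, the value
`Δ f` is `± δ f`. -/
theorem apply_of_filtered {M L : Type*} [AddCommGroup L] {r : M → ℕ} {s : M → ℤ} (δ : L →+ L)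
    (Δ : (M →₀ L) →+ (M →₀ L))
    (hΔ : ∀ m n m', r m ≤ r m' → Δ (Finsupp.single m n) m' = Finsupp.single m (s m • δ n) m')
    (f : M →₀ L) (m' : M) (hf : ∀ m, f m ≠ 0 → r m ≤ r m') : Δ f m' = s m' • δ (f m') := by
  classical
  conv_lhs => rw [← Finsupp.sum_single f]
  rw [Finsupp.sum, map_sum, Finsupp.finsetSum_apply]
  rw [Finset.sum_congr rfl fun m hm => hΔ m (f m) m' (hf m (Finsupp.mem_support_iff.1 hm))]
  by_cases hm : m' ∈ f.support
  · rw [Finset.sum_eq_single m' (fun b _ hb => by rw [Finsupp.single_apply, if_neg hb])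
      (fun hn => absurd hm hn), Finsupp.single_eq_same]
  · rw [Finsupp.notMem_support_iff.1 hm, map_zero, smul_zero]
    refine Finset.sum_eq_zero fun b hb => ?_
    rw [Finsupp.single_apply, if_neg]
    rintro rfl
    exact hm hb

/-- Let `h` be a quasi-isomorphism. A map of complexes that is `h` on each summand is a quasi-
isomorphism if the differentials are those of the summands, up to sign and up to terms of smaller
filtration. -/
theorem mapRange (H : IsQI d d' h) {M : Type*} (r : M → ℕ) (s : M → ℤ) (hs : ∀ m, s m * s m = 1)
    {D : (M →₀ N) →+ (M →₀ N)} {D' : (M →₀ N') →+ (M →₀ N')}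
    (hD : ∀ m n m', r m ≤ r m' → D (Finsupp.single m n) m' = Finsupp.single m (s m • d n) m')
    (hD' : ∀ m n m', r m ≤ r m' → D' (Finsupp.single m n) m' = Finsupp.single m (s m • d' n) m')
    (hDD : ∀ f, D (D f) = 0) (hDD' : ∀ f, D' (D' f) = 0)
    (hc : ∀ f, Finsupp.mapRange.addMonoidHom h (D f) = D' (Finsupp.mapRange.addMonoidHom h f)) :
    IsQI D D' (Finsupp.mapRange.addMonoidHom (ι := M) h) := by
  classical
  set g := Finsupp.mapRange.addMonoidHom (ι := M) h with hg
  have hgap : ∀ f m, g f m = h (f m) := fun f m => by simp [hg]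
  have htop1 := fun f m' hf => apply_of_filtered d D hD f m' hf
  have htop2 := fun f m' hf => apply_of_filtered d' D' hD' f m' hf
  -- induction on a bound for the filtration degrees of a cycle of the mapping cone
  suffices key : ∀ c, ∀ f f', (∀ m, f m ≠ 0 → r m < c) → (∀ m, f' m ≠ 0 → r m < c) → D f = 0 →
      g f = D' f' → ∃ a b, D a = f ∧ g a - f' = D' b by
    refine of_cone hc fun f f' hf hf' => ?_
    refine key ((f.support ∪ f'.support).sup r + 1) f f' (fun m hm => ?_) (fun m hm => ?_) hf hf'
    · exact Nat.lt_succ_of_le (Finset.le_sup (f := r)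
        (Finset.mem_union_left _ (Finsupp.mem_support_iff.2 hm)))
    · exact Nat.lt_succ_of_le (Finset.le_sup (f := r)
        (Finset.mem_union_right _ (Finsupp.mem_support_iff.2 hm)))
  intro c
  induction c with
  | zero =>
    intro f f' hf hf' _ _
    have h1 : f = 0 := Finsupp.ext fun m => by
      by_contra hm
      exact absurd (hf m hm) (Nat.not_lt_zero _)
    have h2 : f' = 0 := Finsupp.ext fun m => by
      by_contra hm
      exact absurd (hf' m hm) (Nat.not_lt_zero _)
    exact ⟨0, 0, by rw [h1, map_zero], by rw [h2, map_zero, map_zero, sub_zero]⟩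
  | succ c ih =>
    intro f f' hf hf' hDf hgf
    have hss : ∀ m (x : N), s m • s m • x = x := fun m x => by rw [← mul_smul, hs, one_smul]
    have hss' : ∀ m (x : N'), s m • s m • x = x := fun m x => by rw [← mul_smul, hs, one_smul]
    -- the components of top filtration are cycles of the cone of `h`, hence boundaries
    have hex : ∀ m, ∃ a b, r m = c → d a = f m ∧ h a - s m • f' m = d' b := by
      intro m
      by_cases hm : r m = c
      · have h1 := htop1 f m fun m' hm' => by have := hf m' hm'; omega
        have h2 := htop2 f' m fun m' hm' => by have := hf' m' hm'; omega
        rw [hDf, Finsupp.zero_apply] at h1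
        have h3 : d (f m) = 0 := by
          rw [← hss m (d (f m)), ← h1, smul_zero]
        obtain ⟨a, b, ha, hb⟩ := H.cone (n := f m) (n' := s m • f' m) h3 (by
          rw [map_zsmul, ← h2, ← hgf, hgap])
        exact ⟨a, b, fun _ => ⟨ha, hb⟩⟩
      · exact ⟨0, 0, fun h => absurd h hm⟩
    choose a b hab using hex
    let T := (f.support ∪ f'.support).filter (r · = c)
    -- lift these boundaries and subtract them; this lowers the bound
    let ν : M →₀ N := Finsupp.onFinset T (fun m => if m ∈ T then s m • a m else 0)
      (fun m hm => by by_contra h; exact hm (if_neg h))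
    let ν' : M →₀ N' := Finsupp.onFinset T (fun m => if m ∈ T then b m else 0)
      (fun m hm => by by_contra h; exact hm (if_neg h))
    have hT : ∀ m, m ∈ T → r m = c := fun m hm => (Finset.mem_filter.1 hm).2
    have hνr : ∀ m, ν m ≠ 0 → r m = c := by
      intro m hm
      by_contra h
      exact hm (if_neg fun h' => h (hT m h'))
    have hνr' : ∀ m, ν' m ≠ 0 → r m = c := by
      intro m hm
      by_contra h
      exact hm (if_neg fun h' => h (hT m h'))
    have hnT : ∀ m, r m = c → m ∉ T → f m = 0 ∧ f' m = 0 := by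
      intro m hm hmT
      simp only [T, Finset.mem_filter, Finset.mem_union, Finsupp.mem_support_iff] at hmT
      tauto
    obtain ⟨a', b', ha', hb'⟩ := ih (f - D ν) (f' - g ν + D' ν') (fun m hm => by
        by_contra hcm
        apply hm
        rw [Finsupp.sub_apply, htop1 ν m fun m' hm' => by have := hνr m' hm'; omega]
        rcases Nat.lt_or_ge c (r m) with hlt | hle
        · have h1 : f m = 0 := by by_contra h0; have := hf m h0; omega
          have h2 : ν m = 0 := by by_contra h0; have := hνr m h0; omega
          rw [h1, h2, map_zero, smul_zero, sub_zero]
        · have hmc : r m = c := by omega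
          by_cases hmT : m ∈ T
          · have : ν m = s m • a m := if_pos hmT
            rw [this, map_zsmul, hss, (hab m hmc).1, sub_self]
          · have : ν m = 0 := if_neg hmT
            rw [this, (hnT m hmc hmT).1, map_zero, smul_zero, sub_zero])
      (fun m hm => by
        by_contra hcm
        apply hm
        rw [Finsupp.add_apply, Finsupp.sub_apply, hgap,
          htop2 ν' m fun m' hm' => by have := hνr' m' hm'; omega]
        rcases Nat.lt_or_ge c (r m) with hlt | hle
        · have h1 : f' m = 0 := by by_contra h0; have := hf' m h0; omega
          have h2 : ν m = 0 := by by_contra h0; have := hνr m h0; omega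
          have h3 : ν' m = 0 := by by_contra h0; have := hνr' m h0; omega
          rw [h1, h2, h3, map_zero, map_zero, smul_zero, sub_zero, add_zero]
        · have hmc : r m = c := by omega
          by_cases hmT : m ∈ T
          · have h1 : ν m = s m • a m := if_pos hmT
            have h2 : ν' m = b m := if_pos hmT
            rw [h1, h2, ← (hab m hmc).2, smul_sub, hss', map_zsmul]
            abel
          · have h1 : ν m = 0 := if_neg hmT
            have h2 : ν' m = 0 := if_neg hmT
            rw [h1, h2, (hnT m hmc hmT).2, map_zero, map_zero, smul_zero, sub_zero, add_zero])
      (by rw [map_sub, hDD, hDf, sub_zero])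
      (by rw [map_sub, map_add, map_sub, hDD', hc, hgf, add_zero])
    refine ⟨a' + ν, b' + ν', ?_, ?_⟩
    · rw [map_add, ha', sub_add_cancel]
    · rw [map_add, map_add, ← hb']; abel

end IsQI

namespace SemifreeExt

/-! ### Base change of semifree extensions -/

section BaseChange

variable {R : CDGA.{u}} {U : CDGA.{v}} (E : SemifreeExt.{u, v, w} R U) {N : CDGA.{x}}
  (ρ : Hom R N)

/-- The element `n ⊗ u` of `N ⊗_R U`, which is a free `N`-module on the monomials. -/
def tens (n : N) : U →+ (Adm E.deg →₀ N) :=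
  (Finsupp.mapRange.addMonoidHom
    ((AddMonoidHom.mulLeft n).comp ρ.toRingHom.toAddMonoidHom)).comp E.rep.toAddMonoidHom

theorem tens_apply (n : N) (u : U) (m : Adm E.deg) : E.tens ρ n u m = n * ρ (E.rep u m) := by
  simp [tens]

theorem tens_add (n n' : N) (u : U) : E.tens ρ (n + n') u = E.tens ρ n u + E.tens ρ n' u := by
  ext m
  rw [Finsupp.add_apply, tens_apply, tens_apply, tens_apply, add_mul]

theorem tens_zero (u : U) : E.tens ρ 0 u = 0 := by
  ext m
  rw [tens_apply, zero_mul]; rfl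

theorem tens_incl_mul (n : N) (r : R) (u : U) :
    E.tens ρ n (E.incl r * u) = E.tens ρ (n * ρ r) u := by
  ext m
  rw [tens_apply, tens_apply, rep_incl_mul, map_mul ρ.toRingHom, mul_assoc]

theorem tens_mon (n : N) (m : Adm E.deg) : E.tens ρ n (E.mon m) = Finsupp.single m n := by
  classical
  ext m'
  have := E.rep_mon m 1
  rw [map_one E.incl.toRingHom, one_mul] at this
  rw [tens_apply, this, Finsupp.single_apply, Finsupp.single_apply]
  split_ifs
  · rw [map_one ρ.toRingHom, mul_one]
  · rw [map_zero ρ.toRingHom, mul_zero]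

/-- The differential of `N ⊗_R U`. -/
def tensD : (Adm E.deg →₀ N) →+ (Adm E.deg →₀ N) :=
  Finsupp.liftAddHom fun m =>
    { toFun := fun n => E.tens ρ (N.d n) (E.mon m) + E.tens ρ (N.sgn 1 n) (U.d (E.mon m))
      map_zero' := by rw [map_zero, map_zero, tens_zero, tens_zero, add_zero]
      map_add' := fun n n' => by rw [map_add, map_add, tens_add, tens_add]; abel }

theorem tensD_single (m : Adm E.deg) (n : N) : E.tensD ρ (Finsupp.single m n) =
    E.tens ρ (N.d n) (E.mon m) + E.tens ρ (N.sgn 1 n) (U.d (E.mon m)) := by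
  rw [tensD, Finsupp.liftAddHom_apply_single]; rfl

theorem tensD_tens (n : N) (u : U) :
    E.tensD ρ (E.tens ρ n u) = E.tens ρ (N.d n) u + E.tens ρ (N.sgn 1 n) (U.d u) := by
  refine E.term_induction (p := fun u => E.tensD ρ (E.tens ρ n u) =
    E.tens ρ (N.d n) u + E.tens ρ (N.sgn 1 n) (U.d u)) u (by simp) (fun u v hu hv => ?_) fun a e => ?_
  · rw [map_add, map_add, hu, hv, map_add, map_add, map_add]; abel
  · rw [tens_incl_mul, tens_mon, tensD_single, N.d_mul', U.d_mul', map_add, tens_incl_mul,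
      ← E.incl.map_d, ← E.incl.map_sgn, tens_incl_mul, tens_incl_mul, tens_add, ρ.map_d, ρ.map_sgn,
      map_mul, add_assoc]

theorem tens_induction {p : (Adm E.deg →₀ N) → Prop} (f : Adm E.deg →₀ N) (h0 : p 0)
    (hadd : ∀ a b, p a → p b → p (a + b)) (h : ∀ n u, p (E.tens ρ n u)) : p f := by
  induction f using Finsupp.induction_linear with
  | zero => exact h0
  | add f g hf hg => exact hadd f g hf hg
  | single m n => rw [← E.tens_mon ρ]; exact h _ _

theorem tensD_tensD (f : Adm E.deg →₀ N) : E.tensD ρ (E.tensD ρ f) = 0 := by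
  refine E.tens_induction ρ (p := fun f => E.tensD ρ (E.tensD ρ f) = 0) f (by simp)
    (fun a b ha hb => by rw [map_add, map_add, ha, hb, add_zero]) fun n u => ?_
  rw [tensD_tens, map_add, tensD_tens, tensD_tens, N.d_d, U.d_d, tens_zero, map_zero, zero_add,
    add_zero, N.sgn_one_d, ← tens_add, neg_add_cancel, tens_zero]

theorem tensD_apply (m : Adm E.deg) (n : N) {m' : Adm E.deg}
    (h : wdeg E.deg m.1 ≤ wdeg E.deg m'.1) :
    E.tensD ρ (Finsupp.single m n) m' = Finsupp.single m (N.d n) m' := by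
  rw [tensD_single, tens_mon, Finsupp.add_apply, tens_apply]
  have : E.rep (U.d (E.mon m)) m' = 0 := by
    have h1 := E.mon_mem m
    rcases Nat.eq_zero_or_pos (wdeg E.deg m.1) with h0 | hpos
    · rw [h0] at h1
      rw [U.d_zero h1, map_zero, Finsupp.zero_apply]
    · rw [← Nat.sub_add_cancel hpos] at h1
      exact E.rep_eq_zero (U.d_mem h1) (by omega)
  rw [this, map_zero ρ.toRingHom, mul_zero, add_zero]

/-- The action of `N` on `N ⊗_R U`. -/
def act (n : N) : (Adm E.deg →₀ N) →+ (Adm E.deg →₀ N) :=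
  Finsupp.mapRange.addMonoidHom (AddMonoidHom.mulLeft n)

theorem act_apply (n : N) (f : Adm E.deg →₀ N) (m : Adm E.deg) : E.act n f m = n * f m := by
  simp [act]

theorem act_tens (n n' : N) (u : U) : E.act n (E.tens ρ n' u) = E.tens ρ (n * n') u := by
  ext m
  rw [act_apply, tens_apply, tens_apply, mul_assoc]

theorem tensD_act (n : N) (f : Adm E.deg →₀ N) :
    E.tensD ρ (E.act n f) = E.act (N.d n) f + E.act (N.sgn 1 n) (E.tensD ρ f) := by
  refine E.tens_induction ρ (p := fun f => E.tensD ρ (E.act n f) =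
    E.act (N.d n) f + E.act (N.sgn 1 n) (E.tensD ρ f)) f (by simp) (fun a b ha hb => ?_) fun n' u => ?_
  · rw [map_add, map_add, ha, hb, map_add, map_add, map_add]; abel
  · rw [act_tens, tensD_tens, N.d_mul', tens_add, tensD_tens, map_add, act_tens, act_tens, act_tens,
      map_mul, add_assoc]

end BaseChange

end SemifreeExt

/-- The identity morphism. -/
def Hom.id (R : CDGA.{u}) : Hom R R where
  toRingHom := RingHom.id R
  map_gr h := h
  map_d _ := rfl

theorem Hom.IsQuasiIso.isQI {R : CDGA.{u}} {R' : CDGA.{v}} {ρ : Hom R R'} (h : ρ.IsQuasiIso) :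
    IsQI R.d R'.d ρ.toRingHom.toAddMonoidHom where
  comm := ρ.map_d
  inj z hz b hb := h.1 z hz ⟨b, hb.symm⟩
  surj z hz := by
    obtain ⟨y, hy, b, hb⟩ := h.2 z hz
    refine ⟨y, hy, -b, ?_⟩
    change ρ y - z = _
    rw [hb, map_neg]; abel

/-- Let `k` act, by `sm`, on the complex `T`. Suppose that the `k`-linear map `g₁` kills boundaries
and that cycles killed by `g₂` are boundaries. If the basis elements in `J₁` are images under `g₁`
of cycles that `g₂` maps to the span of the basis elements in `J₂`, then `J₁` has at most as many
elements as `J₂`: the `g₂`-images of these cycles are linearly independent. -/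
theorem finite_and_card_le {T : Type*} [AddCommGroup T] {D : T →+ T} {k : Type*} [Field k]
    {M₁ M₂ : Type*} {g₁ : T →+ (M₁ →₀ k)} {g₂ : T →+ (M₂ →₀ k)} (sm : k → T →+ T)
    (hsD : ∀ c t, D (sm c t) = sm c (D t)) (hs₁ : ∀ c t m, g₁ (sm c t) m = c * g₁ t m)
    (hs₂ : ∀ c t m, g₂ (sm c t) m = c * g₂ t m) (hg₁ : ∀ t, g₁ (D t) = 0)
    (hg₂ : ∀ t, D t = 0 → g₂ t = 0 → ∃ a, D a = t) (J₁ : Set M₁) (J₂ : Set M₂) [Finite J₂]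
    (hJ : ∀ m ∈ J₁, ∃ t, D t = 0 ∧ g₁ t = Finsupp.single m 1 ∧ ∀ q ∉ J₂, g₂ t q = 0) :
    Finite J₁ ∧ Nat.card J₁ ≤ Nat.card J₂ := by
  classical
  have := Fintype.ofFinite J₂
  choose! t ht1 ht2 ht3 using hJ
  have hli : LinearIndependent k fun m : J₁ => fun q : J₂ => g₂ (t m) q := by
    rw [linearIndependent_iff']
    intro s c hc m hm
    have h1 : g₂ (∑ m ∈ s, sm (c m) (t m)) = 0 := by
      ext q
      rw [map_sum, Finsupp.finsetSum_apply, Finsupp.zero_apply]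
      by_cases hq : q ∈ J₂
      · have := congrFun hc ⟨q, hq⟩
        rw [Finset.sum_apply] at this
        simp only [Pi.smul_apply, smul_eq_mul, Pi.zero_apply] at this
        rw [← this]
        exact Finset.sum_congr rfl fun m _ => hs₂ _ _ _
      · refine Finset.sum_eq_zero fun m _ => ?_
        rw [hs₂, ht3 m.1 m.2 q hq, mul_zero]
    obtain ⟨a, ha⟩ := hg₂ _ (by
      rw [map_sum]
      refine Finset.sum_eq_zero fun m _ => ?_
      rw [hsD, ht1 m.1 m.2, map_zero]) h1
    have h2 := DFunLike.congr_fun (hg₁ a) m.1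
    rw [ha, map_sum, Finsupp.finsetSum_apply, Finset.sum_eq_single m, hs₁, ht2 m.1 m.2,
      Finsupp.single_eq_same, mul_one] at h2
    · exact h2
    · intro b _ hb
      rw [hs₁, ht2 b.1 b.2, Finsupp.single_apply, if_neg fun h => hb (Subtype.ext h), mul_zero]
    · exact fun h => absurd hm h
  have hf := hli.finite
  refine ⟨hf, ?_⟩
  have := Fintype.ofFinite J₁
  have h := hli.fintype_card_le_finrank
  rw [Module.finrank_pi] at h
  rwa [Nat.card_eq_fintype_card, Nat.card_eq_fintype_card]

namespace SemifreeExt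

section Resolution

variable {A : CDGA.{u}} {U : CDGA.{v}} (E : SemifreeExt.{u, v, w} A U)
variable {k : Type*} [CommRing k] {η : U →+* k} (hη : IsResolution U η)

include hη

theorem IsResolution.pr_zero (u : U) : η (U.pr 0 u) = η u := by
  refine homogeneous_induction (p := fun u => η (U.pr 0 u) = η u) u (by simp)
    (fun a b ha hb => by rw [map_add, map_add, ha, hb, map_add]) fun i a ha => ?_
  rcases Nat.eq_zero_or_pos i with rfl | hi
  · rw [U.pr_same ha]
  · rw [U.pr_ne ha hi.ne', map_zero, hη.pos hi ha]

theorem rep_mul_incl {j : ℕ} {u : U} (hu : u ∈ U.gr j) (a : A) (e : Adm E.deg) :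
    E.rep (u * E.incl a) e = A.sgn j a * E.rep u e := by
  rw [U.mul_comm_sgn' _ hu, ← E.incl.map_sgn, rep_incl_mul]

theorem IsResolution.rep_mul_incl (u : U) (a : A) (e : Adm E.deg) :
    η (E.incl (E.rep (u * E.incl a) e)) = η (E.incl (E.rep u e)) * η (E.incl a) := by
  refine homogeneous_induction (p := fun u => η (E.incl (E.rep (u * E.incl a) e)) =
    η (E.incl (E.rep u e)) * η (E.incl a)) u ?_ (fun u v hu hv => ?_) fun i b hb => ?_
  · rw [zero_mul, map_zero, Finsupp.zero_apply, map_zero E.incl.toRingHom, map_zero, zero_mul]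
  · rw [add_mul, map_add, Finsupp.add_apply, map_add E.incl.toRingHom, map_add, hu, hv, map_add,
      Finsupp.add_apply, map_add E.incl.toRingHom, map_add, add_mul]
  · rw [SemifreeExt.rep_mul_incl E hη hb, map_mul E.incl.toRingHom, map_mul, E.incl.map_sgn,
      hη.map_sgn, mul_comm]

end Resolution

/-! ### Comparison of minimal resolutions -/

section Compare

variable {R : CDGA.{u}} {R' : CDGA.{v}} {U : CDGA.{w}} {W : CDGA.{x}}
  (E : SemifreeExt.{u, w, y} R U) (E' : SemifreeExt.{v, x, z} R' W) (ρ : Hom R R')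

/-- The homogeneous component of degree `j` in a base change. -/
def tensPr {N : CDGA.{x}} (j : ℕ) : (Adm E.deg →₀ N) →+ (Adm E.deg →₀ N) :=
  Finsupp.liftAddHom fun m =>
    if wdeg E.deg m.1 ≤ j then (Finsupp.singleAddHom m).comp (N.pr (j - wdeg E.deg m.1)) else 0

theorem tensPr_apply {N : CDGA.{x}} (j : ℕ) (f : Adm E.deg →₀ N) (m : Adm E.deg) :
    E.tensPr j f m = if wdeg E.deg m.1 ≤ j then N.pr (j - wdeg E.deg m.1) (f m) else 0 := by
  classical
  induction f using Finsupp.induction_linear with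
  | zero => simp
  | add f g hf hg =>
    rw [map_add, Finsupp.add_apply, hf, hg, Finsupp.add_apply, map_add]
    split_ifs <;> simp
  | single m' n =>
    rw [tensPr, Finsupp.liftAddHom_apply_single]
    by_cases h : m' = m
    · subst h
      split_ifs
      · simp
      · rfl
    · rw [Finsupp.single_apply, if_neg h, map_zero, ite_self]
      split_ifs
      · simp [Finsupp.single_apply, h]
      · rfl

theorem tensPr_tens {N : CDGA.{x}} (ρ : Hom R N) (j : ℕ) {a b : ℕ} {n : N} {u : U}
    (hn : n ∈ N.gr a) (hu : u ∈ U.gr b) :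
    E.tensPr j (E.tens ρ n u) = if a + b = j then E.tens ρ n u else 0 := by
  ext m
  rw [tensPr_apply, tens_apply]
  by_cases hm : wdeg E.deg m.1 ≤ b
  · have h1 := N.mul_mem' hn (ρ.map_gr (E.rep_mem hu m))
    split_ifs with h2 h3 h3
    · rw [tens_apply, N.pr_same]
      convert h1 using 2; omega
    · rw [N.pr_ne h1 (by omega)]; rfl
    · omega
    · rfl
  · have h1 : n * ρ (E.rep u m) = 0 := by
      rw [E.rep_eq_zero hu (by omega), map_zero ρ.toRingHom, mul_zero]
    rw [h1, map_zero, ite_self]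
    split_ifs
    · rw [tens_apply, h1]
    · rfl

theorem tens_hom_induction {N : CDGA.{x}} (ρ : Hom R N) {p : (Adm E.deg →₀ N) → Prop}
    (f : Adm E.deg →₀ N) (h0 : p 0) (hadd : ∀ a b, p a → p b → p (a + b))
    (h : ∀ a b n u, n ∈ N.gr a → u ∈ U.gr b → p (E.tens ρ n u)) : p f := by
  induction f using Finsupp.induction_linear with
  | zero => exact h0
  | add f g hf hg => exact hadd f g hf hg
  | single m n =>
    refine homogeneous_induction (p := fun n => p (Finsupp.single m n)) n (by simpa)
      (fun a b ha hb => by rw [Finsupp.single_add]; exact hadd _ _ ha hb) fun i n hn => ?_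
    rw [← E.tens_mon ρ]
    exact h _ _ _ _ hn (E.mon_mem m)

theorem tensD_tensPr {N : CDGA.{x}} (ρ : Hom R N) (j : ℕ) (f : Adm E.deg →₀ N)
    (hf : E.tensD ρ f = 0) : E.tensD ρ (E.tensPr j f) = 0 := by
  rcases j with _ | j
  · clear hf
    refine E.tens_hom_induction ρ (p := fun f => E.tensD ρ (E.tensPr 0 f) = 0) f (by simp)
      (fun a b ha hb => by rw [map_add, map_add, ha, hb, add_zero]) fun a b n u hn hu => ?_
    rw [tensPr_tens E ρ 0 hn hu]
    split_ifs with h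
    · obtain ⟨rfl, rfl⟩ : a = 0 ∧ b = 0 := by omega
      rw [tensD_tens, N.d_zero hn, U.d_zero hu, tens_zero, map_zero, add_zero]
    · rw [map_zero]
  · have key : E.tensD ρ (E.tensPr (j + 1) f) = E.tensPr j (E.tensD ρ f) := by
      clear hf
      refine E.tens_hom_induction ρ (p := fun f => E.tensD ρ (E.tensPr (j + 1) f) =
        E.tensPr j (E.tensD ρ f)) f (by simp)
        (fun a b ha hb => by rw [map_add, map_add, ha, hb, map_add, map_add]) fun a b n u hn hu => ?_
      rw [tensPr_tens E ρ _ hn hu, tensD_tens, map_add]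
      have h1 : E.tensPr j (E.tens ρ (N.d n) u) =
          if a + b = j + 1 then E.tens ρ (N.d n) u else 0 := by
        rcases a with _ | a
        · rw [N.d_zero hn, tens_zero, map_zero, ite_self]
        · rw [tensPr_tens E ρ _ (N.d_mem hn) hu]
          exact if_congr (by omega) rfl rfl
      have h2 : E.tensPr j (E.tens ρ (N.sgn 1 n) (U.d u)) =
          if a + b = j + 1 then E.tens ρ (N.sgn 1 n) (U.d u) else 0 := by
        rcases b with _ | b
        · rw [U.d_zero hu, map_zero, map_zero, ite_self]
        · rw [tensPr_tens E ρ _ (N.sgn_mem 1 hn) (U.d_mem hu)]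
          exact if_congr (by omega) rfl rfl
      rw [h1, h2]
      split_ifs
      · rw [tensD_tens]
      · rw [map_zero, add_zero]
    rw [key, hf, map_zero]

variable {k : Type*} [Field k] {η : U →+* k} {η' : W →+* k}

/-- The augmentation `R' ⊗_R U → k` is a quasi-isomorphism. -/
theorem isQI_tens (hρ : ρ.IsQuasiIso) (hη : IsResolution U η) (hη' : IsResolution W η')
    (hcomp : ∀ r, η (E.incl r) = η' (E'.incl (ρ r)))
    (hsurj : ∀ c, ∃ r ∈ R'.gr 0, η' (E'.incl r) = c) :
    IsQI (E.tensD ρ) (0 : k →+ k)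
      (((η'.comp E'.incl.toRingHom).toAddMonoidHom).comp (Finsupp.applyAddHom E.zeroAdm)) := by
  -- `R ⊗_R U → R' ⊗_R U` is a quasi-isomorphism, as `R → R'` is; and `R ⊗_R U` is `U`
  have h1 : IsQI (E.tensD (Hom.id R)) (E.tensD ρ)
      (Finsupp.mapRange.addMonoidHom ρ.toRingHom.toAddMonoidHom) := by
    refine hρ.isQI.mapRange (fun m => wdeg E.deg m.1) (fun _ => 1) (fun _ => one_mul 1)
      (fun m n m' h => ?_) (fun m n m' h => ?_) (E.tensD_tensD _) (E.tensD_tensD _) fun f => ?_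
    · rw [one_smul]; exact E.tensD_apply _ m n h
    · rw [one_smul]; exact E.tensD_apply _ m n h
    · have ht : ∀ n u, Finsupp.mapRange.addMonoidHom ρ.toRingHom.toAddMonoidHom
          (E.tens (Hom.id R) n u) = E.tens ρ (ρ n) u := by
        intro n u
        ext m
        rw [Finsupp.mapRange.addMonoidHom_apply, Finsupp.mapRange_apply, tens_apply, tens_apply]
        exact map_mul ρ.toRingHom _ _
      refine E.tens_induction (Hom.id R) (p := fun f => Finsupp.mapRange.addMonoidHom
        ρ.toRingHom.toAddMonoidHom (E.tensD (Hom.id R) f) = E.tensD ρ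
          (Finsupp.mapRange.addMonoidHom ρ.toRingHom.toAddMonoidHom f)) f (by simp)
        (fun a b ha hb => by rw [map_add, map_add, ha, hb, map_add, map_add]) fun n u => ?_
      rw [tensD_tens, map_add, ht, ht, ht, tensD_tens, ρ.map_d, ρ.map_sgn]
  have hrep : ∀ u, E.tensD (Hom.id R) (E.rep u) = E.rep (U.d u) := by
    have : ∀ u, E.rep u = E.tens (Hom.id R) 1 u := by
      intro u
      ext m
      rw [tens_apply, one_mul]; rfl
    intro u
    rw [this, this, tensD_tens, R.d_one, tens_zero, zero_add, map_one]
  have h2 : IsQI U.d (E.tensD ρ) ((Finsupp.mapRange.addMonoidHom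
      ρ.toRingHom.toAddMonoidHom).comp E.rep.toAddMonoidHom) := by
    refine ⟨fun n => ?_, fun z hz b hb => ?_, fun z hz => ?_⟩
    · rw [AddMonoidHom.comp_apply, AddMonoidHom.comp_apply, ← h1.comm]
      exact congrArg _ (hrep n).symm
    · obtain ⟨a, ha⟩ := h1.inj (E.rep z) (by rw [hrep, hz, map_zero]) b hb
      refine ⟨E.rep.symm a, E.rep.injective ?_⟩
      rw [← hrep, AddEquiv.apply_symm_apply, ha]
    · obtain ⟨y, hy, b, hb⟩ := h1.surj z hz
      refine ⟨E.rep.symm y, E.rep.injective ?_, b, ?_⟩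
      · rw [← hrep, AddEquiv.apply_symm_apply, hy, map_zero]
      · rw [← hb, AddMonoidHom.comp_apply]
        congr 2
        exact E.rep.apply_symm_apply y
  refine h2.of_comp ?_ ?_
  · have hval : ∀ u, (((η'.comp E'.incl.toRingHom).toAddMonoidHom).comp
        (Finsupp.applyAddHom E.zeroAdm)) (((Finsupp.mapRange.addMonoidHom
        ρ.toRingHom.toAddMonoidHom).comp E.rep.toAddMonoidHom) u) = η u := by
      intro u
      rw [hη.apply_eq E, hcomp]
      rfl
    refine ⟨fun u => ?_, fun z hz b hb => ?_, fun c _ => ?_⟩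
    · rw [AddMonoidHom.comp_apply, hval, hη.d]; rfl
    · rw [AddMonoidHom.comp_apply, hval] at hb
      exact hη.exact z hz hb
    · obtain ⟨r, hr, hrc⟩ := hsurj c
      obtain ⟨y, hy, b, hb⟩ := hρ.2 r (R'.d_zero hr)
      refine ⟨E.incl y, by rw [← E.incl.map_d, hy, map_zero E.incl.toRingHom], 0, ?_⟩
      rw [AddMonoidHom.comp_apply, hval, hcomp, ← hrc, hb, map_add E'.incl.toRingHom, map_add,
        E'.incl.map_d, hη'.d, add_zero, sub_self]
      rfl
  · intro f
    have : ∀ n u, ((η'.comp E'.incl.toRingHom).toAddMonoidHom.comp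
        (Finsupp.applyAddHom E.zeroAdm)) (E.tens ρ n u) = η' (E'.incl n) * η u := by
      intro n u
      change η' (E'.incl (E.tens ρ n u E.zeroAdm)) = _
      rw [tens_apply, map_mul E'.incl.toRingHom, map_mul, ← hcomp, ← hη.apply_eq E]
    refine E.tens_induction ρ (p := fun f => ((η'.comp E'.incl.toRingHom).toAddMonoidHom.comp
      (Finsupp.applyAddHom E.zeroAdm)) (E.tensD ρ f) = 0) f (by simp)
      (fun a b ha hb => by rw [map_add, map_add, ha, hb, add_zero]) fun n u => ?_
    rw [tensD_tens, map_add, this, this, E'.incl.map_d, hη'.d, hη.d, zero_mul, mul_zero, add_zero]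

/-- The map `W ⊗_R U → k ⊗_R U`. -/
def toLeft (η' : W →+* k) : (Adm E.deg →₀ W) →+ (Adm E.deg →₀ k) :=
  Finsupp.mapRange.addMonoidHom η'.toAddMonoidHom

/-- The map `W ⊗_R U → W ⊗_{R'} k`. -/
def toRight (η' : W →+* k) : (Adm E.deg →₀ W) →+ (Adm E'.deg →₀ k) :=
  ((Finsupp.mapRange.addMonoidHom (η'.comp E'.incl.toRingHom).toAddMonoidHom).comp
    E'.rep.toAddMonoidHom).comp (Finsupp.applyAddHom E.zeroAdm)

theorem toLeft_apply (f : Adm E.deg →₀ W) (m : Adm E.deg) : E.toLeft η' f m = η' (f m) := by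
  simp [toLeft]

theorem toRight_apply (f : Adm E.deg →₀ W) (q : Adm E'.deg) :
    E.toRight E' η' f q = η' (E'.incl (E'.rep (f E.zeroAdm) q)) := by
  simp [toRight]

/-- `W → k` is a quasi-isomorphism, hence so is `W ⊗_R U → k ⊗_R U`; the differential of the target
vanishes by minimality. -/
theorem isQI_toLeft (hη' : IsResolution W η')
    (hcomp : ∀ r, η (E.incl r) = η' (E'.incl (ρ r)))
    (hsurj : ∀ c, ∃ r ∈ R'.gr 0, η' (E'.incl r) = c)
    (hmin : ∀ u e, η (E.incl (E.rep (U.d u) e)) = 0) :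
    IsQI (E.tensD (E'.incl.comp ρ)) 0 (E.toLeft η') := by
  have h1 : IsQI W.d (0 : k →+ k) η'.toAddMonoidHom := by
    refine ⟨hη'.d, fun z hz b hb => hη'.exact z hz hb, fun c _ => ?_⟩
    obtain ⟨r, hr, hrc⟩ := hsurj c
    refine ⟨E'.incl r, W.d_zero (E'.incl.map_gr hr), 0, ?_⟩
    rw [AddMonoidHom.zero_apply, sub_eq_zero]
    exact hrc
  refine h1.mapRange (fun m => wdeg E.deg m.1) (fun _ => 1) (fun _ => one_mul 1)
      (fun m n m' h => ?_) (fun m n m' h => by simp) (E.tensD_tensD _) (fun _ => rfl) fun f => ?_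
  · rw [one_smul]; exact E.tensD_apply _ m n h
  · refine E.tens_induction (E'.incl.comp ρ) (p := fun f => Finsupp.mapRange.addMonoidHom
      η'.toAddMonoidHom (E.tensD (E'.incl.comp ρ) f) = 0) f (by simp)
      (fun a b ha hb => by rw [map_add, map_add, ha, hb, add_zero]) fun n u => ?_
    ext m
    rw [tensD_tens]
    change E.toLeft η' _ m = 0
    rw [toLeft_apply, Finsupp.add_apply, tens_apply, tens_apply, map_add, map_mul, map_mul, hη'.d,
      zero_mul, zero_add]
    have := hmin u m
    rw [hcomp] at this
    exact mul_eq_zero_of_right _ this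

/-- The decomposition of `W ⊗_R U` as a sum of copies of `R' ⊗_R U` indexed by the monomials
of `W`. -/
def blocks : (Adm E'.deg →₀ (Adm E.deg →₀ R')) →+ (Adm E.deg →₀ W) :=
  Finsupp.liftAddHom fun q => (E.act (E'.mon q)).comp
    (Finsupp.mapRange.addMonoidHom E'.incl.toRingHom.toAddMonoidHom)

theorem blocks_single (q : Adm E'.deg) (t : Adm E.deg →₀ R') :
    E.blocks E' (Finsupp.single q t) = E.act (E'.mon q)
      (Finsupp.mapRange.addMonoidHom E'.incl.toRingHom.toAddMonoidHom t) := by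
  rw [blocks, Finsupp.liftAddHom_apply_single]; rfl

theorem rep_blocks (c : Adm E'.deg →₀ (Adm E.deg →₀ R')) (m : Adm E.deg) (q : Adm E'.deg) :
    E'.rep (E.blocks E' c m) q = R'.sgn (wdeg E'.deg q.1) (c q m) := by
  classical
  induction c using Finsupp.induction_linear with
  | zero => simp
  | add c c' h h' => simp only [map_add, Finsupp.add_apply, h, h']
  | single q' t =>
    rw [blocks_single, act_apply, Finsupp.mapRange.addMonoidHom_apply, Finsupp.mapRange_apply]
    change E'.rep (E'.mon q' * E'.incl (t m)) q = _
    rw [W.mul_comm_sgn' _ (E'.mon_mem q'), ← E'.incl.map_sgn, rep_mon, Finsupp.single_apply,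
      Finsupp.single_apply]
    split_ifs with h
    · rw [h]
    · simp

theorem blocks_bijective : Function.Bijective (E.blocks E') := by
  constructor
  · rw [injective_iff_map_eq_zero]
    intro c hc
    ext q m
    have h1 := E.rep_blocks E' c m q
    rw [hc, Finsupp.zero_apply, map_zero, Finsupp.zero_apply] at h1
    rw [← R'.sgn_self (wdeg E'.deg q.1) (c q m), ← h1, map_zero]; rfl
  · intro f
    induction f using Finsupp.induction_linear with
    | zero => exact ⟨0, map_zero _⟩
    | add f g hf hg =>
      obtain ⟨a, ha⟩ := hf
      obtain ⟨b, hb⟩ := hg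
      exact ⟨a + b, by rw [map_add, ha, hb]⟩
    | single m n =>
      refine E'.term_induction (p := fun n => ∃ a, E.blocks E' a = Finsupp.single m n) n
        ⟨0, by rw [Finsupp.single_zero, map_zero]⟩ ?_ fun r q => ?_
      · rintro a b ⟨a', ha⟩ ⟨b', hb⟩
        exact ⟨a' + b', by rw [Finsupp.single_add, map_add, ha, hb]⟩
      refine ⟨Finsupp.single q (Finsupp.single m (R'.sgn (wdeg E'.deg q.1) r)), ?_⟩
      rw [blocks_single, Finsupp.mapRange.addMonoidHom_apply, Finsupp.mapRange_single, act,
        Finsupp.mapRange.addMonoidHom_apply, Finsupp.mapRange_single]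
      congr 1
      change E'.mon q * E'.incl _ = _
      rw [W.mul_comm_sgn' _ (E'.mon_mem q), ← E'.incl.map_sgn, R'.sgn_self]

theorem toRight_tens (hη : IsResolution U η) (hη' : IsResolution W η')
    (hcomp : ∀ r, η (E.incl r) = η' (E'.incl (ρ r))) (n : W) (u : U) (q : Adm E'.deg) :
    E.toRight E' η' (E.tens (E'.incl.comp ρ) n u) q = η' (E'.incl (E'.rep n q)) * η u := by
  rw [toRight_apply, tens_apply]
  change η' (E'.incl (E'.rep (n * E'.incl (ρ _)) q)) = _
  rw [hη'.rep_mul_incl, ← hcomp, ← hη.apply_eq E]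

/-- By minimality of `W`, the map to `W ⊗_{R'} k` kills boundaries. -/
theorem toRight_tensD (hη : IsResolution U η) (hη' : IsResolution W η')
    (hcomp : ∀ r, η (E.incl r) = η' (E'.incl (ρ r)))
    (hmin' : ∀ w e, η' (E'.incl (E'.rep (W.d w) e)) = 0) (f : Adm E.deg →₀ W) :
    E.toRight E' η' (E.tensD (E'.incl.comp ρ) f) = 0 := by
  refine E.tens_induction (E'.incl.comp ρ) (p := fun f => E.toRight E' η'
    (E.tensD (E'.incl.comp ρ) f) = 0) f (by simp)
    (fun a b ha hb => by rw [map_add, map_add, ha, hb, add_zero]) fun n u => ?_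
  ext q
  rw [tensD_tens, map_add, Finsupp.add_apply, toRight_tens E E' ρ hη hη' hcomp,
    toRight_tens E E' ρ hη hη' hcomp, hmin', hη.d, zero_mul, mul_zero, add_zero]
  rfl

/-- The complex `W ⊗_R U` is filtered by the degrees of the monomials of `W`, with subquotients `R'
⊗_R U`, which are resolutions of `k`. -/
theorem isQI_toRight (hρ : ρ.IsQuasiIso) (hη : IsResolution U η) (hη' : IsResolution W η')
    (hcomp : ∀ r, η (E.incl r) = η' (E'.incl (ρ r)))
    (hsurj : ∀ c, ∃ r ∈ R'.gr 0, η' (E'.incl r) = c)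
    (hmin' : ∀ w e, η' (E'.incl (E'.rep (W.d w) e)) = 0) :
    IsQI (E.tensD (E'.incl.comp ρ)) 0 (E.toRight E' η') := by
  classical
  let L := AddEquiv.ofBijective (E.blocks E') (E.blocks_bijective E')
  have hL : ∀ c, L c = E.blocks E' c := fun _ => rfl
  let D := E.tensD (E'.incl.comp ρ)
  -- the differential of `W ⊗_R U`, transported to the sum of copies of `R' ⊗_R U`
  let Δ : (Adm E'.deg →₀ (Adm E.deg →₀ R')) →+ (Adm E'.deg →₀ (Adm E.deg →₀ R')) :=
    (L.symm.toAddMonoidHom.comp D).comp L.toAddMonoidHom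
  have hΔ : ∀ c, L (Δ c) = D (L c) := fun c => L.apply_symm_apply _
  set ι := Finsupp.mapRange.addMonoidHom (ι := Adm E.deg) E'.incl.toRingHom.toAddMonoidHom with hι
  have hιt : ∀ n u, ι (E.tens ρ n u) = E.tens (E'.incl.comp ρ) (E'.incl n) u := by
    intro n u
    ext m
    rw [hι, Finsupp.mapRange.addMonoidHom_apply, Finsupp.mapRange_apply, tens_apply, tens_apply]
    exact map_mul E'.incl.toRingHom _ _
  have hιD : ∀ t, D (ι t) = ι (E.tensD ρ t) := by
    intro t
    refine E.tens_induction ρ (p := fun t => D (ι t) = ι (E.tensD ρ t)) t (by simp)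
      (fun a b ha hb => by rw [map_add, map_add, ha, hb, map_add, map_add]) fun n u => ?_
    rw [hιt, E.tensD_tens ρ, map_add, hιt, hιt]
    change E.tensD _ _ = _
    rw [tensD_tens, E'.incl.map_d, E'.incl.map_sgn]
  have hgL : ∀ c, Finsupp.mapRange.addMonoidHom (ι := Adm E'.deg)
      (((η'.comp E'.incl.toRingHom).toAddMonoidHom).comp
      (Finsupp.applyAddHom E.zeroAdm : (Adm E.deg →₀ R') →+ R')) c =
      E.toRight E' η' (L c) := by
    intro c
    ext q
    rw [toRight_apply, hL, rep_blocks, E'.incl.map_sgn, hη'.map_sgn,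
      Finsupp.mapRange.addMonoidHom_apply, Finsupp.mapRange_apply]
    rfl
  have h1 : IsQI (N := Adm E'.deg →₀ (Adm E.deg →₀ R'.carrier)) (N' := Adm E'.deg →₀ k) Δ 0
      (Finsupp.mapRange.addMonoidHom (ι := Adm E'.deg)
      (((η'.comp E'.incl.toRingHom).toAddMonoidHom).comp
        (Finsupp.applyAddHom E.zeroAdm : (Adm E.deg →₀ R') →+ R'))) := by
    refine (E.isQI_tens E' ρ hρ hη hη' hcomp hsurj).mapRange (fun q => wdeg E'.deg q.1)
      (fun q => (-1) ^ wdeg E'.deg q.1) (fun q => by rw [← pow_add, ← two_mul, pow_mul]; simp)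
      (fun q t q' hq => ?_) (fun m n m' h => by simp) (fun f => ?_) (fun _ => rfl) fun f => ?_
    -- on the copy at a monomial `q`, up to copies at monomials of smaller degree, the differential
    -- is that of `R' ⊗_R U`, with a sign
    · have h2 : L (Δ (Finsupp.single q t)) = E.act (W.d (E'.mon q)) (ι t) +
          L (Finsupp.single q ((-1 : ℤ) ^ wdeg E'.deg q.1 • E.tensD ρ t)) := by
        rw [hΔ, hL, hL, blocks_single, blocks_single]
        change E.tensD _ (E.act _ (ι t)) = _ + E.act _ (ι _)
        rw [tensD_act, W.sgn_of_mem 1 (E'.mon_mem q), one_mul]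
        congr 1
        change E.act _ (D (ι t)) = _
        rw [hιD, map_zsmul, map_zsmul]
        ext m
        rw [act_apply, Finsupp.smul_apply, act_apply]
        rcases neg_one_pow_eq_or ℤ (wdeg E'.deg q.1) with h | h
        · have h' : ((-1 : W) ^ wdeg E'.deg q.1) = 1 := by
            have := congrArg (Int.cast : ℤ → W) h
            push_cast at this; exact this
          rw [h, h', one_mul, one_smul]
        · have h' : ((-1 : W) ^ wdeg E'.deg q.1) = -1 := by
            have := congrArg (Int.cast : ℤ → W) h
            push_cast at this; exact this
          rw [h, h', neg_one_mul, neg_mul, neg_one_smul]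
      have h3 : ∀ m, R'.sgn (wdeg E'.deg q'.1) ((L.symm (E.act (W.d (E'.mon q)) (ι t))) q' m) =
          0 := by
        intro m
        rw [← E.rep_blocks E', ← hL, L.apply_symm_apply, act_apply, hι,
          Finsupp.mapRange.addMonoidHom_apply, Finsupp.mapRange_apply]
        change E'.rep (W.d (E'.mon q) * E'.incl (t m)) q' = 0
        have hm := E'.mon_mem q
        rcases Nat.eq_zero_or_pos (wdeg E'.deg q.1) with h0 | hpos
        · rw [h0] at hm
          rw [W.d_zero hm, zero_mul, map_zero]; rfl
        · rw [← Nat.sub_add_cancel hpos] at hm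
          rw [SemifreeExt.rep_mul_incl E' hη' (W.d_mem hm),
            E'.rep_eq_zero (W.d_mem hm) (by omega), mul_zero]
      have h4 := congrArg L.symm h2
      rw [L.symm_apply_apply, map_add, L.symm_apply_apply] at h4
      rw [h4, Finsupp.add_apply]
      have h5 : (L.symm (E.act (W.d (E'.mon q)) (ι t))) q' = 0 := by
        ext m
        rw [← R'.sgn_self (wdeg E'.deg q'.1) (((L.symm _) q') m), h3, map_zero]; rfl
      rw [h5, zero_add]
    · apply L.injective
      rw [hΔ, hΔ, map_zero]
      exact E.tensD_tensD _ _
    · rw [hgL, hΔ]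
      exact E.toRight_tensD E' ρ hη hη' hcomp hmin' _
  refine ⟨E.toRight_tensD E' ρ hη hη' hcomp hmin', fun z hz b hb => ?_, fun z hz => ?_⟩
  · obtain ⟨a, ha⟩ := h1.inj (L.symm z) (L.injective (by
      rw [hΔ, L.apply_symm_apply, map_zero]; exact hz)) b (by rw [hgL, L.apply_symm_apply, hb])
    refine ⟨L a, ?_⟩
    change D (L a) = z
    rw [← hΔ, ha, L.apply_symm_apply]
  · obtain ⟨y, hy, b, hb⟩ := h1.surj z hz
    refine ⟨L y, ?_, b, by rw [← hgL, hb]⟩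
    change D (L y) = 0
    rw [← hΔ, hy, map_zero]

end Compare

end SemifreeExt

/-! ### Counting monomials and variables -/

section Count

variable {Var : Type w} {deg : Var → ℕ}

theorem finite_wdeg (hpos : ∀ x, 0 < deg x) {j : ℕ} (hfin : {x | deg x ≤ j}.Finite) :
    Finite {e : Adm deg // wdeg deg e.1 = j} := by
  classical
  have := hfin.to_subtype
  let F : {e : Adm deg // wdeg deg e.1 = j} → ({x | deg x ≤ j} → Fin (j + 1)) := fun e x =>
    ⟨e.1.1 x, by
      have h1 := le_wdeg deg e.1.1 x.1
      have h2 : wdeg deg e.1.1 = j := e.2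
      have h3 := Nat.le_mul_of_pos_right (e.1.1 x.1) (hpos x.1)
      omega⟩
  refine Finite.of_injective F fun e f h => ?_
  refine Subtype.ext (Subtype.ext (Finsupp.ext fun x => ?_))
  by_cases hx : deg x ≤ j
  · exact congrArg Fin.val (congrFun h ⟨x, hx⟩)
  · have key : ∀ g : {e : Adm deg // wdeg deg e.1 = j}, g.1.1 x = 0 := by
      intro g
      by_contra h0
      have := deg_le_wdeg deg g.1.1 h0
      have h2 : wdeg deg g.1.1 = j := g.2
      omega
    rw [key, key]

/-- The monomials of degree `j` are the variables of degree `j` and the monomials of degree `j` in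
the variables of smaller degree. -/
theorem exists_equiv_wdeg (hpos : ∀ x, 0 < deg x) (j : ℕ) :
    Nonempty (({x // deg x = j} ⊕
      {e : Adm (fun x : {x // deg x < j} => deg x) // wdeg (fun x : {x // deg x < j} => deg x) e.1 = j})
        ≃ {e : Adm deg // wdeg deg e.1 = j}) := by
  classical
  let d' := fun x : {x // deg x < j} => deg x
  have hw : ∀ e : {x // deg x < j} →₀ ℕ,
      wdeg deg (e.embDomain (Function.Embedding.subtype _)) = wdeg d' e := by
    intro e
    rw [wdeg, wdeg, Finsupp.liftAddHom_apply, Finsupp.liftAddHom_apply, Finsupp.sum_embDomain]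
    rfl
  have hlt : ∀ (e : {x // deg x < j} →₀ ℕ) (x : {x // deg x < j}),
      e.embDomain (Function.Embedding.subtype _) x.1 = e x :=
    fun e x => Finsupp.embDomain_apply_self (Function.Embedding.subtype _) e x
  have hnlt : ∀ (e : {x // deg x < j} →₀ ℕ) (x : Var), ¬ deg x < j →
      e.embDomain (Function.Embedding.subtype _) x = 0 :=
    fun e x hx => Finsupp.embDomain_of_notMem_range _ _ _ (by simpa using hx)
  let F : ({x // deg x = j} ⊕ {e : Adm d' // wdeg d' e.1 = j}) → {e : Adm deg // wdeg deg e.1 = j} :=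
    Sum.elim
      (fun x => ⟨⟨Finsupp.single x.1 1, fun y _ => by
        rw [Finsupp.single_apply]; split_ifs <;> simp⟩, by
        change wdeg deg (Finsupp.single x.1 1) = j
        rw [wdeg_single, one_mul]; exact x.2⟩)
      (fun e => ⟨⟨e.1.1.embDomain (Function.Embedding.subtype _), fun x hx => by
        by_cases h : deg x < j
        · rw [hlt e.1.1 ⟨x, h⟩]; exact e.1.2 ⟨x, h⟩ hx
        · rw [hnlt _ _ h]; exact Nat.zero_le _⟩, by
        change wdeg deg (Finsupp.embDomain _ _) = j
        rw [hw]; exact e.2⟩)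
  have hF1 : ∀ x, (F (Sum.inl x)).1.1 = Finsupp.single x.1 1 := fun _ => rfl
  have hF2 : ∀ e, (F (Sum.inr e)).1.1 = e.1.1.embDomain (Function.Embedding.subtype _) :=
    fun _ => rfl
  refine ⟨Equiv.ofBijective F ⟨?_, ?_⟩⟩
  · rintro (x | e) (y | f) h <;> have h1 := congrArg (fun e => e.1.1) h <;>
      simp only [hF1, hF2] at h1
    · exact congrArg _ (Subtype.ext ((Finsupp.single_left_inj one_ne_zero).1 h1))
    · have := DFunLike.congr_fun h1 x.1
      rw [Finsupp.single_eq_same, hnlt _ _ (by have := x.2; omega)] at this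
      exact absurd this one_ne_zero
    · have := DFunLike.congr_fun h1 y.1
      rw [Finsupp.single_eq_same, hnlt _ _ (by have := y.2; omega)] at this
      exact absurd this.symm one_ne_zero
    · refine congrArg _ (Subtype.ext (Subtype.ext (Finsupp.ext fun x => ?_)))
      rw [← hlt, h1, hlt]
  · rintro ⟨e, he⟩
    by_cases h : ∃ x, e.1 x ≠ 0 ∧ deg x = j
    · obtain ⟨x, hx, hxj⟩ := h
      refine ⟨Sum.inl ⟨x, hxj⟩, Subtype.ext (Subtype.ext ?_)⟩
      rw [hF1]
      have h1 : wdeg deg (e.1 - Finsupp.single x 1) + wdeg deg (Finsupp.single x 1) = j := by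
        rw [← map_add, tsub_add_cancel_of_le, he]
        rw [Finsupp.single_le_iff]; exact Nat.one_le_iff_ne_zero.2 hx
      rw [wdeg_single, one_mul, hxj] at h1
      have h2 : e.1 - Finsupp.single x 1 = 0 := by
        ext y
        by_contra hy
        have := deg_le_wdeg deg _ hy
        have := hpos y
        omega
      rw [← tsub_add_cancel_of_le (a := Finsupp.single x 1) (b := e.1), h2, zero_add]
      rw [Finsupp.single_le_iff]; exact Nat.one_le_iff_ne_zero.2 hx
    · push Not at h
      have hs : ∀ x, e.1 x ≠ 0 → deg x < j := by
        intro x hx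
        have := deg_le_wdeg deg _ hx
        have := h x hx
        omega
      have hemb : (e.1.subtypeDomain fun x => deg x < j).embDomain (Function.Embedding.subtype _) =
          e.1 := by
        ext x
        by_cases hx : deg x < j
        · rw [hlt _ ⟨x, hx⟩]; rfl
        · rw [hnlt _ _ hx]
          by_contra h0
          exact hx (hs x (Ne.symm h0))
      refine ⟨Sum.inr ⟨⟨e.1.subtypeDomain fun x => deg x < j, fun x hx => e.2 x hx⟩, ?_⟩,
        Subtype.ext (Subtype.ext ?_)⟩
      · rw [← hw, hemb, he]
      · rw [hF2]; exact hemb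

/-- The monomials of degree `j` depend only on the numbers of variables in each degree. -/
theorem exists_equiv_wdeg_congr {Var' : Type x} {deg' : Var' → ℕ} (σ : Var ≃ Var')
    (hσ : ∀ x, deg' (σ x) = deg x) (j : ℕ) :
    Nonempty ({e : Adm deg // wdeg deg e.1 = j} ≃ {e : Adm deg' // wdeg deg' e.1 = j}) := by
  have hw : ∀ e, wdeg deg' (Finsupp.domCongr (M := ℕ) σ e) = wdeg deg e := by
    intro e
    rw [wdeg, wdeg, Finsupp.domCongr_apply, Finsupp.liftAddHom_apply, Finsupp.liftAddHom_apply,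
      Finsupp.sum_equivMapDomain]
    refine Finsupp.sum_congr fun x _ => ?_
    rw [hσ]
  refine ⟨((Finsupp.domCongr (M := ℕ) σ).toEquiv.subtypeEquiv (p := IsAdm deg) (q := IsAdm deg')
    fun e => ?_).subtypeEquiv fun e => ?_⟩
  · change _ ↔ ∀ x, Odd (deg' x) → Finsupp.equivMapDomain σ e x ≤ 1
    rw [← σ.forall_congr_right]
    simp only [hσ, Finsupp.equivMapDomain_apply, Equiv.symm_apply_apply]
    rfl
  · rw [← hw]; rfl

/-- Free graded algebras with the same numbers of monomials have the same numbers of variables. -/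
theorem finite_deg_and_card_eq {Var' : Type x} {deg' : Var' → ℕ} (hpos : ∀ x, 0 < deg x)
    (hpos' : ∀ x, 0 < deg' x) (hfin : ∀ j, {x | deg x = j}.Finite)
    (H : ∀ j, Finite {e : Adm deg // wdeg deg e.1 = j} →
      Finite {e : Adm deg' // wdeg deg' e.1 = j} ∧
        Nat.card {e : Adm deg // wdeg deg e.1 = j} = Nat.card {e : Adm deg' // wdeg deg' e.1 = j})
    (j : ℕ) : {x | deg' x = j}.Finite ∧ Nat.card {x // deg x = j} = Nat.card {x // deg' x = j} := by
  induction j using Nat.strong_induction_on with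
  | _ j ih =>
  have hle : ∀ j, {x | deg x ≤ j}.Finite := by
    intro j
    refine ((Set.finite_Iic j).biUnion fun i _ => hfin i).subset fun x hx => ?_
    exact Set.mem_biUnion (Set.mem_Iic.2 hx) rfl
  obtain ⟨h1, h2⟩ := H j (finite_wdeg hpos (hle j))
  have h0 := finite_wdeg hpos (hle j)
  obtain ⟨a⟩ := exists_equiv_wdeg hpos j
  obtain ⟨b⟩ := exists_equiv_wdeg hpos' j
  -- below degree `j` the variables correspond, hence so do the monomials of degree `j` in these
  -- variables; the remaining monomials of degree `j` are the variables of degree `j`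
  have hσ : ∀ i : Fin j, Nonempty ({x // deg x = i} ≃ {x // deg' x = i}) := by
    intro i
    obtain ⟨hi, hi'⟩ := ih i i.2
    have : Finite {x // deg x = i} := (hfin i).to_subtype
    have : Finite {x // deg' x = i} := hi.to_subtype
    exact (Finite.card_eq).1 hi'
  let σ := fun i => (hσ i).some
  let τ : {x // deg x < j} ≃ {x // deg' x < j} :=
    { toFun := fun x => ⟨σ ⟨deg x.1, x.2⟩ ⟨x.1, rfl⟩, by rw [(σ ⟨deg x.1, x.2⟩ ⟨x.1, rfl⟩).2]; exact x.2⟩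
      invFun := fun x => ⟨(σ ⟨deg' x.1, x.2⟩).symm ⟨x.1, rfl⟩, by
        rw [((σ ⟨deg' x.1, x.2⟩).symm ⟨x.1, rfl⟩).2]; exact x.2⟩
      left_inv := by
        rintro ⟨x, hx⟩
        have key : ∀ (i : ℕ) (hi : i < j) (y : {x // deg' x = i}) (hy : deg' y.1 < j),
            (((σ ⟨deg' y.1, hy⟩).symm ⟨y.1, rfl⟩ : {x // deg x = deg' y.1}) : Var) =
              (σ ⟨i, hi⟩).symm y := by
          rintro i hi ⟨y, rfl⟩ hy; rfl
        refine Subtype.ext ?_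
        change ((σ ⟨_, _⟩).symm _ : Var) = x
        rw [key _ hx, Equiv.symm_apply_apply]
      right_inv := by
        rintro ⟨x, hx⟩
        have key : ∀ (i : ℕ) (hi : i < j) (y : {x // deg x = i}) (hy : deg y.1 < j),
            (((σ ⟨deg y.1, hy⟩) ⟨y.1, rfl⟩ : {x // deg' x = deg y.1}) : Var') =
              (σ ⟨i, hi⟩) y := by
          rintro i hi ⟨y, rfl⟩ hy; rfl
        refine Subtype.ext ?_
        change ((σ ⟨_, _⟩) _ : Var') = x
        rw [key _ hx, Equiv.apply_symm_apply] }
  obtain ⟨c⟩ := exists_equiv_wdeg_congr (deg := fun x : {x // deg x < j} => deg x)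
    (deg' := fun x : {x // deg' x < j} => deg' x) τ
    (fun x => (σ ⟨deg x.1, x.2⟩ ⟨x.1, rfl⟩).2) j
  have f1 := Finite.of_equiv _ a.symm
  have f2 := Finite.of_equiv _ b.symm
  have f3 : Finite {x // deg x = j} :=
    Finite.of_injective _ (a.injective.comp Sum.inl_injective)
  have f4 : Finite {x // deg' x = j} :=
    Finite.of_injective _ (b.injective.comp Sum.inl_injective)
  have f5 := Finite.of_injective _ (a.injective.comp Sum.inr_injective)
  have f6 := Finite.of_injective _ (b.injective.comp Sum.inr_injective)
  refine ⟨Set.finite_coe_iff.1 f4, ?_⟩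
  have h3 := Nat.card_congr a
  have h4 := Nat.card_congr b
  have h5 := Nat.card_congr c
  rw [Nat.card_sum] at h3 h4
  omega

end Count

section Compare

namespace SemifreeExt

variable {R : CDGA.{u}} {R' : CDGA.{v}} {U : CDGA.{w}} {W : CDGA.{x}}
  (E : SemifreeExt.{u, w, y} R U) (E' : SemifreeExt.{v, x, z} R' W) (ρ : Hom R R')
  {k : Type*} [Field k] {η : U →+* k} {η' : W →+* k}

/-- Minimal semifree resolutions of a field over quasi-isomorphic dg-algebras have the same numbers
of monomials in each degree: both count a basis of the homology of `W ⊗_R U`. -/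
theorem card_wdeg_eq (hρ : ρ.IsQuasiIso) (hη : IsResolution U η) (hη' : IsResolution W η')
    (hcomp : ∀ r, η (E.incl r) = η' (E'.incl (ρ r)))
    (hsurj : ∀ c, ∃ r ∈ R'.gr 0, η' (E'.incl r) = c)
    (hmin : ∀ u e, η (E.incl (E.rep (U.d u) e)) = 0)
    (hmin' : ∀ w e, η' (E'.incl (E'.rep (W.d w) e)) = 0) (j : ℕ)
    (hfin : Finite {e : Adm E.deg // wdeg E.deg e.1 = j}) :
    Finite {e : Adm E'.deg // wdeg E'.deg e.1 = j} ∧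
      Nat.card {e : Adm E.deg // wdeg E.deg e.1 = j} =
        Nat.card {e : Adm E'.deg // wdeg E'.deg e.1 = j} := by
  classical
  have q1 := E.isQI_toLeft E' ρ hη' hcomp hsurj hmin
  have q2 := E.isQI_toRight E' ρ hρ hη hη' hcomp hsurj hmin'
  choose lift hlift0 hlift using hsurj
  -- both maps respect degrees
  have hpr : ∀ (i : ℕ) w, η' (W.pr i w) = if i = 0 then η' w else 0 := by
    intro i w
    split_ifs with h
    · rw [h, IsResolution.pr_zero hη']
    · exact hη'.pos (Nat.pos_of_ne_zero h) (W.pr_mem _ _)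
  have hL : ∀ f m, E.toLeft η' (E.tensPr j f) m =
      if wdeg E.deg m.1 = j then E.toLeft η' f m else 0 := by
    intro f m
    rw [toLeft_apply, toLeft_apply, tensPr_apply]
    split_ifs with h1 h2 h2
    · rw [hpr, if_pos (by omega)]
    · rw [hpr, if_neg (by omega)]
    · omega
    · rw [map_zero]
  have hR : ∀ f q, E.toRight E' η' (E.tensPr j f) q =
      if wdeg E'.deg q.1 = j then E.toRight E' η' f q else 0 := by
    intro f q
    rw [toRight_apply, toRight_apply, tensPr_apply]
    have h0 : wdeg E.deg E.zeroAdm.1 = 0 := map_zero _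
    rw [if_pos (by omega), h0, tsub_zero, rep_pr]
    split_ifs with h1 h2 h2
    · rw [← E'.incl_pr, hpr, if_pos (by omega)]
    · rw [← E'.incl_pr, hpr, if_neg (by omega)]
    · omega
    · rw [map_zero E'.incl.toRingHom, map_zero]
  -- the action of `k` by lifts of its elements to cycles of degree `0`
  let sm : k → (Adm E.deg →₀ W) →+ (Adm E.deg →₀ W) := fun c => E.act (E'.incl (lift c))
  have hD : ∀ c t, E.tensD (E'.incl.comp ρ) (sm c t) = sm c (E.tensD (E'.incl.comp ρ) t) := by
    intro c t
    have h1 : W.d (E'.incl (lift c)) = 0 := W.d_zero (E'.incl.map_gr (hlift0 c))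
    have h2 : W.sgn 1 (E'.incl (lift c)) = E'.incl (lift c) := by
      rw [W.sgn_of_mem 1 (E'.incl.map_gr (hlift0 c))]; simp
    change E.tensD _ (E.act _ t) = E.act _ _
    rw [tensD_act, h1, h2]
    ext m
    rw [Finsupp.add_apply, act_apply, zero_mul, zero_add]
  have hs1 : ∀ c t m, E.toLeft η' (sm c t) m = c * E.toLeft η' t m := by
    intro c t m
    change E.toLeft η' (E.act _ t) m = _
    rw [toLeft_apply, act_apply, map_mul, hlift, toLeft_apply]
  have hs2 : ∀ c t q, E.toRight E' η' (sm c t) q = c * E.toRight E' η' t q := by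
    intro c t q
    change E.toRight E' η' (E.act _ t) q = _
    rw [toRight_apply, act_apply, rep_incl_mul, map_mul E'.incl.toRingHom, map_mul, hlift,
      toRight_apply]
  have e1 : ∀ t, E.tensD (E'.incl.comp ρ) t = 0 → E.toLeft η' t = 0 →
      ∃ a, E.tensD (E'.incl.comp ρ) a = t := fun t ht ht' => q1.inj t ht 0 ht'
  have e2 : ∀ t, E.tensD (E'.incl.comp ρ) t = 0 → E.toRight E' η' t = 0 →
      ∃ a, E.tensD (E'.incl.comp ρ) a = t := fun t ht ht' => q2.inj t ht 0 ht'
  have a1 : Finite {e : Adm E'.deg | wdeg E'.deg e.1 = j} ∧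
      Nat.card {e : Adm E'.deg | wdeg E'.deg e.1 = j} ≤
        Nat.card {e : Adm E.deg | wdeg E.deg e.1 = j} := by
    have : Finite {e : Adm E.deg | wdeg E.deg e.1 = j} := hfin
    refine finite_and_card_le sm hD hs2 hs1 (fun t => q2.comm t) e1 _ _ fun m hm => ?_
    obtain ⟨y, hy, b, hb⟩ := q2.surj (Finsupp.single m 1) rfl
    have hb' : E.toRight E' η' y = Finsupp.single m 1 := by
      rwa [AddMonoidHom.zero_apply, sub_eq_zero] at hb
    refine ⟨E.tensPr j y, E.tensD_tensPr _ j y hy, ?_, fun q hq => ?_⟩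
    · ext q
      rw [hR, hb']
      split_ifs with h
      · rfl
      · rw [Finsupp.single_apply, if_neg]
        rintro rfl; exact h hm
    · rw [hL]; exact if_neg hq
  have a2 : Finite {e : Adm E.deg | wdeg E.deg e.1 = j} ∧
      Nat.card {e : Adm E.deg | wdeg E.deg e.1 = j} ≤
        Nat.card {e : Adm E'.deg | wdeg E'.deg e.1 = j} := by
    have := a1.1
    refine finite_and_card_le sm hD hs1 hs2 (fun t => q1.comm t) e2 _ _ fun m hm => ?_
    obtain ⟨y, hy, b, hb⟩ := q1.surj (Finsupp.single m 1) rfl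
    have hb' : E.toLeft η' y = Finsupp.single m 1 := by
      rwa [AddMonoidHom.zero_apply, sub_eq_zero] at hb
    refine ⟨E.tensPr j y, E.tensD_tensPr _ j y hy, ?_, fun q hq => ?_⟩
    · ext q
      rw [hL, hb']
      split_ifs with h
      · rfl
      · rw [Finsupp.single_apply, if_neg]
        rintro rfl; exact h hm
    · rw [hR]; exact if_neg hq
  exact ⟨a1.1, le_antisymm a2.2 a1.2⟩

/-- Minimal semifree resolutions of a field over quasi-isomorphic dg-algebras have the same numbers
of variables in each degree. -/
theorem card_deg_eq (hρ : ρ.IsQuasiIso) (hη : IsResolution U η) (hη' : IsResolution W η')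
    (hcomp : ∀ r, η (E.incl r) = η' (E'.incl (ρ r)))
    (hsurj : ∀ c, ∃ r ∈ R'.gr 0, η' (E'.incl r) = c)
    (hmin : ∀ u e, η (E.incl (E.rep (U.d u) e)) = 0)
    (hmin' : ∀ w e, η' (E'.incl (E'.rep (W.d w) e)) = 0)
    (hfin : ∀ j, {x | E.deg x = j}.Finite) (j : ℕ) :
    {x | E'.deg x = j}.Finite ∧
      Nat.card {x // E.deg x = j} = Nat.card {x // E'.deg x = j} :=
  finite_deg_and_card_eq E.deg_pos E'.deg_pos hfin
    (E.card_wdeg_eq E' ρ hρ hη hη' hcomp hsurj hmin hmin') j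

end SemifreeExt

end Compare

/-! ### Regular local rings -/

section Regular

open IsLocalRing

theorem maximalIdeal_quotient_eq_span {R : Type u} [CommRing R] [IsLocalRing R] {I : Ideal R}
    [IsLocalRing (R ⧸ I)] {s : Set R} {T : Set R}
    (h : maximalIdeal R = Ideal.span (s ∪ T)) (hs : s ⊆ I) :
    maximalIdeal (R ⧸ I) = Ideal.span (Ideal.Quotient.mk I '' T) := by
  have h1 : (maximalIdeal R).map (Ideal.Quotient.mk I) = maximalIdeal (R ⧸ I) := by
    refine le_antisymm ?_ ?_
    · exact ((local_hom_TFAE (Ideal.Quotient.mk I)).out 0 2).1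
        (IsLocalHom.of_surjective _ Ideal.Quotient.mk_surjective)
    · intro y hy
      obtain ⟨x, rfl⟩ := Ideal.Quotient.mk_surjective y
      refine Ideal.mem_map_of_mem _ ?_
      rw [mem_maximalIdeal, mem_nonunits_iff] at hy ⊢
      exact fun hx => hy (hx.map _)
  rw [← h1, h, Ideal.map_span, Set.image_union, Ideal.span_union, sup_eq_right, Ideal.span_le]
  rintro _ ⟨x, hx, rfl⟩
  rw [Ideal.Quotient.eq_zero_iff_mem.2 (hs hx)]
  exact zero_mem _

theorem add_natCast_le_add_natCast_iff {a b : WithBot ℕ∞} (n : ℕ) :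
    a + n ≤ b + n ↔ a ≤ b :=
  WithBot.add_le_add_iff_right' (WithBot.coe_ne_bot (a := (n : ℕ∞)))
    (WithBot.coe_injective.ne (ENat.natCast_ne_top n))

/-- A Noetherian local ring whose maximal ideal is generated by at most `dim R` elements is a
domain. -/
theorem isDomain_of_le_ringKrullDim (n : ℕ) : ∀ {R : Type u} [CommRing R] [IsLocalRing R]
    [IsNoetherianRing R] (T : Finset R), maximalIdeal R = Ideal.span (T : Set R) →
    T.card ≤ n → (n : WithBot ℕ∞) ≤ ringKrullDim R → IsDomain R := by
  classical
  induction n with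
  | zero =>
    intro R _ _ _ T hT hc _
    obtain rfl : T = ∅ := Finset.card_eq_zero.1 (by omega)
    rw [Finset.coe_empty, Ideal.span_empty] at hT
    exact (isField_iff_maximalIdeal_eq.2 hT).isDomain
  | succ n ih =>
    intro R _ _ _ T hT hc hdim
    have hm0 : maximalIdeal R ∉ minimalPrimes R := by
      intro h
      have h1 := Ideal.height_eq_zero_iff.2 h
      rw [← maximalIdeal_height_eq_ringKrullDim, h1] at hdim
      exact absurd hdim (by norm_cast)
    have hm2 : ¬ maximalIdeal R ≤ maximalIdeal R ^ 2 := by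
      intro h
      have h1 : maximalIdeal R = ⊥ := by
        refine Submodule.eq_bot_of_le_smul_of_le_jacobson_bot (maximalIdeal R) _
          (IsNoetherian.noetherian _) ?_ ?_
        · rw [smul_eq_mul, ← sq]; exact h
        · rw [jacobson_eq_maximalIdeal _ bot_ne_top]
      have := isField_iff_maximalIdeal_eq.2 h1
      rw [ringKrullDim_eq_zero_of_isField this] at hdim
      exact absurd hdim (by norm_cast)
    -- prime avoidance
    obtain ⟨x, hxm, hx2, hxp⟩ : ∃ x ∈ maximalIdeal R, x ∉ maximalIdeal R ^ 2 ∧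
        ∀ p ∈ minimalPrimes R, x ∉ p := by
      have hfin := minimalPrimes.finite_of_isNoetherianRing R
      have := (Ideal.subset_union_prime (s := insert (maximalIdeal R ^ 2) hfin.toFinset)
        (f := fun I => I) (maximalIdeal R ^ 2) (maximalIdeal R ^ 2) (fun i hi h1 _ => by
          rw [Finset.mem_insert, Set.Finite.mem_toFinset] at hi
          exact (hi.resolve_left h1).1.1) (I := maximalIdeal R)).not.2 (by
          rintro ⟨p, hp, hmp⟩
          rw [Finset.mem_insert, Set.Finite.mem_toFinset] at hp
          rcases hp with rfl | hp
          · exact hm2 hmp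
          · have hpp : p.IsPrime := hp.1.1
            have : maximalIdeal R = p := le_antisymm hmp (le_maximalIdeal hpp.ne_top)
            exact hm0 (this ▸ hp))
      obtain ⟨x, hx, hx'⟩ := Set.not_subset.1 this
      simp only [Finset.coe_insert, Set.Finite.coe_toFinset, Set.mem_iUnion, not_exists] at hx'
      exact ⟨x, hx, hx' _ (Set.mem_insert _ _), fun p hp => hx' p (Set.mem_insert_of_mem _ hp)⟩
    -- since `x ∉ 𝔪²`, it may replace one of the generators
    obtain ⟨t, ht, hspan⟩ : ∃ t ∈ T, maximalIdeal R = Ideal.span ({x} ∪ (T.erase t : Set R)) := by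
      have hx1 := hxm
      rw [hT] at hx1
      obtain ⟨a, ha⟩ := Submodule.mem_span_finset'.1 hx1
      obtain ⟨t, hu⟩ : ∃ t, IsUnit (a t) := by
        by_contra hcon
        push Not at hcon
        refine hx2 ?_
        rw [← ha, sq]
        refine Ideal.sum_mem _ fun t _ => Ideal.mul_mem_mul (hcon t) ?_
        rw [hT]; exact Ideal.subset_span t.2
      refine ⟨t.1, t.2, le_antisymm ?_ ?_⟩
      · rw [hT, Ideal.span_le]
        intro s hs
        by_cases hst : s = t.1
        · rw [hst]
          have h1 : a t * t.1 = x - ∑ s ∈ Finset.univ.erase t, a s * s.1 := by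
            rw [← ha, ← Finset.add_sum_erase _ _ (Finset.mem_univ t)]
            simp only [smul_eq_mul]; ring
          refine (Ideal.unit_mul_mem_iff_mem _ hu).1 ?_
          rw [h1]
          refine sub_mem (Ideal.subset_span (Or.inl rfl)) (Ideal.sum_mem _ fun s hs =>
            Ideal.mul_mem_left _ _ (Ideal.subset_span (Or.inr ?_)))
          exact Finset.mem_coe.2 (Finset.mem_erase.2
            ⟨fun h => (Finset.mem_erase.1 hs).1 (Subtype.ext h), s.2⟩)
        · exact Ideal.subset_span (Or.inr (Finset.mem_coe.2 (Finset.mem_erase.2 ⟨hst, hs⟩)))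
      · rw [Ideal.span_le]
        rintro s (rfl | hs)
        · exact hxm
        · rw [hT]; exact Ideal.subset_span (Finset.mem_of_mem_erase hs)
    have hxle : Ideal.span {x} ≤ maximalIdeal R := (Ideal.span_singleton_le_iff_mem _).2 hxm
    have hne : Ideal.span {x} ≠ ⊤ := fun h => (maximalIdeal.isMaximal R).ne_top (top_le_iff.1 (h ▸ hxle))
    have : Nontrivial (R ⧸ Ideal.span {x}) := Ideal.Quotient.nontrivial_iff.2 hne
    have : IsLocalRing (R ⧸ Ideal.span {x}) :=
      IsLocalRing.of_surjective' (Ideal.Quotient.mk _) Ideal.Quotient.mk_surjective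
    -- the induction hypothesis applies to `R / x`, so `(x)` is prime
    have hq : IsDomain (R ⧸ Ideal.span {x}) := by
      refine ih ((T.erase t).image (Ideal.Quotient.mk _)) ?_ ?_ ?_
      · rw [Finset.coe_image]
        exact maximalIdeal_quotient_eq_span hspan (by
          rw [Set.singleton_subset_iff]; exact Ideal.mem_span_singleton_self x)
      · refine Finset.card_image_le.trans ?_
        rw [Finset.card_erase_of_mem ht]; omega
      · have h1 := ringKrullDim_le_ringKrullDim_quotient_add_card ({x} : Finset R) (by
          rw [Finset.coe_singleton, Set.singleton_subset_iff, ringJacobson_eq_maximalIdeal]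
          exact hxm)
        rw [Finset.card_singleton, Finset.coe_singleton] at h1
        have h2 := hdim.trans h1
        rw [Nat.cast_add] at h2
        exact (add_natCast_le_add_natCast_iff 1).1 h2
    have hprime : (Ideal.span {x}).IsPrime := (Ideal.Quotient.isDomain_iff_prime _).1 hq
    -- a minimal prime `p ⊆ (x)` does not contain `x`, so `p = x p` and `p = 0` by Nakayama
    obtain ⟨p, hp, hpx⟩ := Ideal.exists_minimalPrimes_le (bot_le (a := Ideal.span {x}))
    have hpp : p.IsPrime := hp.1.1
    have hp0 : p = ⊥ := by
      refine Submodule.eq_bot_of_le_smul_of_le_jacobson_bot (Ideal.span {x}) _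
          (IsNoetherian.noetherian _) ?_ ?_
      · intro a ha
        obtain ⟨b, rfl⟩ := Ideal.mem_span_singleton'.1 (hpx ha)
        rw [mul_comm]
        exact Submodule.smul_mem_smul (Ideal.mem_span_singleton_self x)
          ((hpp.mem_or_mem ha).resolve_right (hxp p hp))
      · rw [jacobson_eq_maximalIdeal _ bot_ne_top]; exact hxle
    rw [hp0] at hpp
    exact IsDomain.of_bot_isPrime R

variable {S : Type u} [CommRing S] [IsRegularLocalRing S] {t : Fin (embDim S) → S}
  (ht : Ideal.span (Set.range t) = maximalIdeal S)

include ht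

/-- A minimal system of generators of the maximal ideal of a regular local ring is a regular
sequence in any order. -/
theorem mem_span_of_mul_mem (F : Finset (Fin (embDim S))) {j : Fin (embDim S)} (hj : j ∉ F) {a : S}
    (ha : t j * a ∈ Ideal.span (t '' F)) : a ∈ Ideal.span (t '' F) := by
  classical
  have hle : Ideal.span (t '' F) ≤ maximalIdeal S := by
    rw [← ht]; exact Ideal.span_mono (Set.image_subset_range _ _)
  have hne : Ideal.span (t '' F) ≠ ⊤ :=
    fun h => (maximalIdeal.isMaximal S).ne_top (top_le_iff.1 (h ▸ hle))
  have : Nontrivial (S ⧸ Ideal.span (t '' F)) := Ideal.Quotient.nontrivial_iff.2 hne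
  have : IsLocalRing (S ⧸ Ideal.span (t '' F)) :=
    IsLocalRing.of_surjective' (Ideal.Quotient.mk _) Ideal.Quotient.mk_surjective
  have hcard : (Fᶜ).card + F.card = embDim S := by
    rw [add_comm, Finset.card_add_card_compl, Fintype.card_fin]
  -- the quotient by `t  F` is regular, hence a domain
  have hq : IsDomain (S ⧸ Ideal.span (t '' F)) := by
    refine isDomain_of_le_ringKrullDim (Fᶜ).card (((Fᶜ).image t).image (Ideal.Quotient.mk _)) ?_
      (Finset.card_image_le.trans Finset.card_image_le) ?_
    · rw [Finset.coe_image, Finset.coe_image]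
      refine maximalIdeal_quotient_eq_span (s := t '' F) ?_ Ideal.subset_span
      rw [← ht, ← Set.image_union, Finset.coe_compl, Set.union_compl_self, Set.image_univ]
    · have h1 := ringKrullDim_le_ringKrullDim_quotient_add_card (F.image t) (by
          rw [ringJacobson_eq_maximalIdeal, Finset.coe_image]
          exact fun x hx => hle (Ideal.subset_span hx))
      rw [← IsRegularLocalRing.spanFinrank_maximalIdeal, Finset.coe_image] at h1
      have h2 : ((F.image t).card : WithBot ℕ∞) ≤ (F.card : WithBot ℕ∞) := by
        exact_mod_cast Finset.card_image_le
      have h3 := h1.trans (add_le_add_right h2 _)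
      change ((embDim S : ℕ) : WithBot ℕ∞) ≤ _ at h3
      have h4 : ((embDim S : ℕ) : WithBot ℕ∞) = ((Fᶜ).card : WithBot ℕ∞) + F.card := by
        rw [← Nat.cast_add, hcard]
      rw [h4] at h3
      exact (add_natCast_le_add_natCast_iff _).1 h3
  have hprime : (Ideal.span (t '' F)).IsPrime := (Ideal.Quotient.isDomain_iff_prime _).1 hq
  refine (hprime.mem_or_mem ha).resolve_left fun h => ?_
  -- if `t j` were in the ideal, the other `t i` would generate `𝔪`
  have h1 : maximalIdeal S = Ideal.span (t '' ({j}ᶜ : Set _)) := by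
    refine le_antisymm ?_ (by rw [← ht]; exact Ideal.span_mono (Set.image_subset_range _ _))
    rw [← ht, Ideal.span_le]
    rintro _ ⟨i, rfl⟩
    by_cases hi : i = j
    · subst hi
      refine Ideal.span_mono (Set.image_mono ?_) h
      intro i hi' h
      rw [Set.mem_singleton_iff] at h
      subst h; exact hj hi'
    · exact Ideal.subset_span ⟨i, hi, rfl⟩
  have h2 := Submodule.spanFinrank_span_le_ncard_of_finite (R := S)
    (Set.toFinite (t '' ({j}ᶜ : Set _)))
  change (Ideal.span _).spanFinrank ≤ _ at h2
  rw [← h1] at h2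
  have h3 := Set.ncard_image_le (f := t) (Set.toFinite ({j}ᶜ : Set (Fin (embDim S))))
  rw [Set.ncard_compl, Set.ncard_singleton, Nat.card_eq_fintype_card, Fintype.card_fin] at h3
  have h4 := j.2
  change embDim S ≤ _ at h2
  omega

end Regular

/-! ### The constant term of an element of a semifree extension -/

namespace SemifreeExt

section Const

variable {A : CDGA.{u}} {U : CDGA.{v}} (E : SemifreeExt.{u, v, w} A U)

theorem exists_const : ∃ φ : U →+* A, (∀ a, φ (E.incl a) = a) ∧
    ∀ x n, φ (E.pw x n) = if n = 0 then 1 else 0 := by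
  refine E.exists_lift (g := RingHom.id A) (p := fun _ n => if n = 0 then 1 else 0)
    ⟨fun _ => if_pos rfl, fun x n ha => ?_, fun m n _ => ?_, fun x m n => ?_⟩
    fun _ _ n hn => if_neg (by omega)
  · split_ifs with h
    · simp [h]
    · simp
  · split_ifs with h h' h' <;> simp_all
  · by_cases hm : m = 0
    · by_cases hn : n = 0
      · subst hm hn
        simp only [structConst, add_zero, if_true, mul_one, Nat.choose_self]
        split_ifs <;> simp_all
      · rw [if_neg hn, mul_zero, if_neg (by omega), smul_zero]
    · rw [if_neg hm, zero_mul, if_neg (by omega), smul_zero]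

/-- The constant term: the `A`-algebra homomorphism `A[X]⟨Y⟩ → A` that maps the variables to zero.
It is not compatible with the differentials in general. -/
def const : U →+* A := E.exists_const.choose

theorem const_incl (a : A) : E.const (E.incl a) = a := E.exists_const.choose_spec.1 a

theorem const_pw (x : E.Var) {n : ℕ} (hn : n ≠ 0) : E.const (E.pw x n) = 0 := by
  rw [const, E.exists_const.choose_spec.2, if_neg hn]

theorem const_mon {e : Adm E.deg} (he : e ≠ E.zeroAdm) : E.const (E.mon e) = 0 := by
  have h1 : e.1 ≠ 0 := fun h => he (Subtype.ext h)
  obtain ⟨x, hx⟩ := Finsupp.support_nonempty_iff.2 h1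
  have : ∀ l : List E.Var, x ∈ l → E.const (l.map fun v => E.pw v (e.1 v)).prod = 0 := by
    intro l hl
    rw [map_list_prod, List.map_map]
    exact List.prod_eq_zero (List.mem_map.2 ⟨x, hl, E.const_pw x (Finsupp.mem_support_iff.1 hx)⟩)
  exact this _ ((Finset.mem_sort _).2 hx)

theorem const_apply (u : U) : E.const u = E.rep u E.zeroAdm := by
  classical
  refine E.term_induction (p := fun u => E.const u = E.rep u E.zeroAdm) u (by simp)
    (fun u v hu hv => by rw [map_add, hu, hv, map_add, Finsupp.add_apply]) fun a e => ?_
  rw [map_mul, const_incl, rep_mon, Finsupp.single_apply]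
  split_ifs with h
  · rw [h, mon_zeroAdm, map_one, mul_one]
  · rw [E.const_mon h, mul_zero]

theorem const_mem {i : ℕ} {u : U} (hu : u ∈ U.gr i) : E.const u ∈ A.gr i := by
  have h1 := E.rep_mem hu E.zeroAdm
  have h0 : wdeg E.deg E.zeroAdm.1 = 0 := map_zero _
  rwa [h0, tsub_zero, ← const_apply] at h1

theorem exists_incl_eq_of_mem_zero {u : U} (hu : u ∈ U.gr 0) : E.incl (E.const u) = u := by
  refine E.ext_rep fun e => ?_
  by_cases he : e = E.zeroAdm
  · rw [he, rep_incl, Finsupp.single_eq_same, const_apply]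
  · rw [rep_incl, Finsupp.single_apply, if_neg (Ne.symm he), E.rep_eq_zero hu]
    have h1 : e.1 ≠ 0 := fun h => he (Subtype.ext h)
    obtain ⟨x, hx⟩ := Finsupp.support_nonempty_iff.2 h1
    exact (E.deg_pos x).trans_le (deg_le_wdeg _ _ (Finsupp.mem_support_iff.1 hx))

end Const

theorem map_pr_of_map_gr {A : CDGA.{u}} {U : CDGA.{v}} {f : U →+ A}
    (hf : ∀ i u, u ∈ U.gr i → f u ∈ A.gr i) (i : ℕ) (u : U) : f (U.pr i u) = A.pr i (f u) := by
  refine homogeneous_induction (p := fun u => f (U.pr i u) = A.pr i (f u)) u (by simp)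
    (fun u v hu hv => by rw [map_add, map_add, hu, hv, map_add, map_add]) fun j u hu => ?_
  by_cases h : j = i
  · subst h
    rw [U.pr_same hu, A.pr_same (hf _ _ hu)]
  · rw [U.pr_ne hu h, A.pr_ne (hf _ _ hu) h, map_zero]

theorem map_sgn_of_map_gr {A : CDGA.{u}} {U : CDGA.{v}} {f : U →+* A}
    (hf : ∀ i u, u ∈ U.gr i → f u ∈ A.gr i) (n : ℕ) (u : U) : f (U.sgn n u) = A.sgn n (f u) := by
  refine homogeneous_induction (p := fun u => f (U.sgn n u) = A.sgn n (f u)) u (by simp)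
    (fun u v hu hv => by rw [map_add, map_add, hu, hv, map_add, map_add]) fun j u hu => ?_
  rw [U.sgn_of_mem n hu, A.sgn_of_mem n (hf _ _ hu), map_mul, map_pow, map_neg, map_one]

/-! ### Minimality -/

section Minimal

variable {A : CDGA.{u}} {U : CDGA.{v}} [A.IsLocal] (E : SemifreeExt.{u, v, w} A U)

instance : (A.maxIdeal).IsTwoSided := inferInstanceAs ((Ideal.comap _ _).IsTwoSided)

theorem sgn_mem_maxIdeal (n : ℕ) {a : A} (h : a ∈ A.maxIdeal) : A.sgn n a ∈ A.maxIdeal := by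
  have h1 : A.pr0 (A.sgn n a) = A.pr0 a := by
    refine Subtype.ext ?_
    refine (map_pr_of_map_gr (f := (A.sgn n).toAddMonoidHom)
      (fun i u hu => sgn_mem n hu) 0 a).symm.trans ?_
    change A.sgn n (A.pr 0 a) = _
    rw [A.sgn_of_mem n (A.pr_mem 0 a), mul_zero, pow_zero, one_mul]; rfl
  have h2 : A.pr0 a ∈ IsLocalRing.maximalIdeal A.deg0 := h
  rw [← h1] at h2; exact h2

variable {E} in
/-- In a minimal semifree extension the coefficients in boundaries of `1` and of the variables are
in the maximal ideal. -/
theorem IsMinimal.rep_mem (h : E.IsMinimal) (u : U) (e : Adm E.deg) (he : e.1.degree ≤ 1) :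
    E.rep (U.d u) e ∈ A.maxIdeal := by
  -- the assertion holds for multiples of the generators of the ideal `𝔪 U + (monomials of total
  -- exponent at least two)` of boundaries
  have key : ∀ s ∈ E.incl '' (A.maxIdeal : Set A) ∪
      {m | ∃ e : E.Var →₀ ℕ, 2 ≤ e.degree ∧ m = monomial E.pw e}, ∀ b : U,
      E.rep (b * s) e ∈ A.maxIdeal := by
    rintro s (⟨a, ha, rfl⟩ | ⟨f, hf, rfl⟩) b
    · refine homogeneous_induction (p := fun b => E.rep (b * E.incl a) e ∈ A.maxIdeal) b ?_ ?_ ?_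
      · rw [zero_mul, map_zero]; exact zero_mem _
      · intro b c hb hc
        rw [add_mul, map_add, Finsupp.add_apply]; exact add_mem hb hc
      · intro i b hb
        rw [U.mul_comm_sgn' _ hb, ← E.incl.map_sgn, rep_incl_mul]
        exact Ideal.mul_mem_right _ _ (sgn_mem_maxIdeal i ha)
    · refine E.term_induction (p := fun b => E.rep (b * monomial E.pw f) e ∈ A.maxIdeal) b ?_ ?_ ?_
      · rw [zero_mul, map_zero]; exact zero_mem _
      · intro b c hb hc
        rw [add_mul, map_add, Finsupp.add_apply]; exact add_mem hb hc
      · intro a g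
        obtain ⟨z, hz, hz'⟩ := E.fam.mono_mul_mono g.2 f
        have h1 : E.rep (E.incl a * E.mon g * monomial E.pw f) e = 0 := by
          rw [mul_assoc, rep_incl_mul]
          change a * E.rep (mono E.pw g.1 * mono E.pw f) e = 0
          rw [hz, map_zsmul]
          by_cases hadm : IsAdm E.deg (g.1 + f)
          · have h2 := E.rep_mon ⟨g.1 + f, hadm⟩ 1
            rw [map_one E.incl.toRingHom, one_mul] at h2
            change E.rep (mono E.pw (g.1 + f)) = _ at h2
            classical
            rw [h2, Finsupp.smul_apply, Finsupp.single_apply, if_neg, smul_zero, mul_zero]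
            rintro rfl
            change (g.1 + f).degree ≤ 1 at he
            rw [map_add] at he; omega
          · rw [hz' hadm, zero_smul, Finsupp.zero_apply, mul_zero]
        rw [h1]; exact zero_mem _
  suffices H : ∀ x ∈ Ideal.span (E.incl '' (A.maxIdeal : Set A) ∪
      {m | ∃ e : E.Var →₀ ℕ, 2 ≤ e.degree ∧ m = monomial E.pw e}), ∀ b,
      E.rep (b * x) e ∈ A.maxIdeal by
    have := H _ (h u) 1
    rwa [one_mul] at this
  intro x hx
  induction hx using Submodule.span_induction with
  | mem x hx => exact key x hx
  | zero => intro b; rw [mul_zero, map_zero]; exact zero_mem _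
  | add x y _ _ hx hy =>
    intro b
    rw [mul_add, map_add, Finsupp.add_apply]; exact add_mem (hx _) (hy _)
  | smul c x _ hx => intro b; rw [smul_eq_mul, ← mul_assoc]; exact hx _

theorem varAdm_degree (x : E.Var) : (E.varAdm x).1.degree = 1 := by
  simp [varAdm]

theorem zeroAdm_degree : E.zeroAdm.1.degree = 0 := by
  simp [zeroAdm]

end Minimal

end SemifreeExt

/-! ### Models of residue fields -/

section Augmentation

variable {A : CDGA.{u}} [A.IsLocal] {U : CDGA.{v}} [U.IsLocal] {s : ℕ∞}
  (N : Model.{u, u, v, w} A.augmentation s U)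

/-- The augmentation `U → k` of a model of the residue field `k` of `A`. -/
def Model.aug : U →+* A.residueField :=
  (ofRingSelf A.residueField).symm.toRingHom.comp N.toB.toRingHom

theorem Model.isResolution_aug : SemifreeExt.IsResolution U N.aug where
  pos {i u} hi hu := by
    obtain ⟨i, rfl⟩ := Nat.exists_eq_succ_of_ne_zero hi.ne'
    exact (mem_trivGr_succ (R := A.residueField)).1 (N.toB.map_gr hu)
  d u := N.toB.map_d u
  exact z hz h := N.toB_quasiIso.1 z hz ⟨0, h.symm⟩

theorem Model.aug_incl (a : A) :
    N.aug (N.incl a) = IsLocalRing.residue A.deg0 (A.pr0 a) := by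
  change (ofRingSelf A.residueField).symm (N.toB (N.incl a)) = _
  rw [N.toB_incl]; rfl

theorem Model.aug_eq_zero_iff (u : U) : N.aug u = 0 ↔ u ∈ U.maxIdeal := by
  constructor
  · intro h
    by_contra hu
    have h1 : IsUnit (U.pr0 u) := by
      by_contra h2; exact hu h2
    obtain ⟨v, hv⟩ := h1.exists_right_inv
    have h2 : U.pr 0 u * (v : U) = 1 := congrArg Subtype.val hv
    have h3 := congrArg N.aug h2
    rw [map_mul, SemifreeExt.IsResolution.pr_zero N.isResolution_aug, h, zero_mul, map_one] at h3
    exact zero_ne_one h3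
  · intro h
    have h1 : (ofRing A.residueField).pr0 (N.toB u) ∈
        IsLocalRing.maximalIdeal (ofRing A.residueField).deg0 := N.toB_local u h
    have h2 : (ofRing A.residueField).pr0 (N.toB u) = ofRingEquiv _ (N.aug u) :=
      Subtype.ext ((ofRing A.residueField).pr_same (mem_trivGr_zero (R := A.residueField) _))
    by_contra h3
    rw [h2] at h1
    exact h1 ((Ne.isUnit h3).map (ofRingEquiv A.residueField))

end Augmentation

/-! ### Finiteness of the homogeneous components -/

/-- The component of degree `j` as an `A₀`-module. -/
def grMod (A : CDGA.{u}) (j : ℕ) : Submodule A.deg0 A where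
  carrier := A.gr j
  add_mem' := add_mem
  zero_mem' := zero_mem _
  smul_mem' c x hx := by
    have := A.mul_mem' c.2 hx
    rwa [zero_add] at this

theorem mem_grMod {A : CDGA.{u}} {j : ℕ} {a : A} : a ∈ A.grMod j ↔ a ∈ A.gr j := Iff.rfl

theorem grMod_ofRing_fg (R : Type u) [CommRing R] (j : ℕ) : ((ofRing R).grMod j).FG := by
  rcases j with _ | j
  · refine ⟨{1}, le_antisymm ?_ fun x _ => ?_⟩
    · rw [Submodule.span_le, Finset.coe_singleton, Set.singleton_subset_iff]
      exact mem_trivGr_zero (R := R) 1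
    · rw [Finset.coe_singleton, Submodule.mem_span_singleton]
      exact ⟨ofRingEquiv R x, mul_one x⟩
  · have : (ofRing R).grMod (j + 1) = ⊥ := by
      rw [eq_bot_iff]
      intro x hx
      exact (mem_trivGr_succ (R := R) (i := j)).1 hx
    rw [this]
    exact Submodule.fg_bot

namespace SemifreeExt

variable {A : CDGA.{u}} {U : CDGA.{v}} (E : SemifreeExt.{u, v, w} A U)

theorem eq_varAdm {e : Adm E.deg} {x : E.Var} (hx : e.1 x ≠ 0) (h : wdeg E.deg e.1 ≤ E.deg x) :
    e = E.varAdm x := by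
  have h3 : Finsupp.single x 1 ≤ e.1 := by
    rw [Finsupp.single_le_iff]; exact Nat.one_le_iff_ne_zero.2 hx
  refine Subtype.ext ?_
  have h1 : wdeg E.deg (e.1 - Finsupp.single x 1) + wdeg E.deg (Finsupp.single x 1) ≤ E.deg x := by
    rwa [← map_add, tsub_add_cancel_of_le h3]
  rw [wdeg_single, one_mul] at h1
  have h2 : e.1 - Finsupp.single x 1 = 0 := by
    ext y
    by_contra hy
    have := deg_le_wdeg E.deg _ hy
    have := E.deg_pos y
    omega
  rw [← tsub_add_cancel_of_le h3, h2, zero_add]; rfl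

theorem wdeg_varAdm (x : E.Var) : wdeg E.deg (E.varAdm x).1 = E.deg x := by
  change wdeg E.deg (Finsupp.single x 1) = _
  rw [wdeg_single, one_mul]

theorem finite_deg_le (hfin : ∀ j, {x | E.deg x = j}.Finite) (j : ℕ) :
    {x | E.deg x ≤ j}.Finite := by
  refine ((Set.finite_Iic j).biUnion fun i _ => hfin i).subset fun x hx => ?_
  exact Set.mem_biUnion (Set.mem_Iic.2 hx) rfl

theorem grMod_fg {j : ℕ} (hfin : {x | E.deg x ≤ j}.Finite) (hA : ∀ j, (A.grMod j).FG) :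
    (U.grMod j).FG := by
  have hle : (U.grMod j) = ⨆ i : Fin (j + 1), ⨆ e : {e : Adm E.deg // wdeg E.deg e.1 = i},
      Submodule.span U.deg0 ((fun a => E.incl a * E.mon e.1) '' A.gr (j - i)) := by
    refine le_antisymm (fun u hu => ?_) ?_
    · rw [E.rep_sum u]
      refine Submodule.sum_mem _ fun e he => ?_
      have h1 : wdeg E.deg e.1 ≤ j := by
        by_contra h
        exact Finsupp.mem_support_iff.1 he (E.rep_eq_zero hu (by omega))
      refine Submodule.mem_iSup_of_mem ⟨wdeg E.deg e.1, by omega⟩ ?_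
      refine Submodule.mem_iSup_of_mem ⟨e, rfl⟩ ?_
      exact Submodule.subset_span ⟨_, E.rep_mem hu e, rfl⟩
    · refine iSup_le fun i => iSup_le fun e => ?_
      rw [Submodule.span_le]
      rintro _ ⟨a, ha, rfl⟩
      have := U.mul_mem' (E.incl.map_gr ha) (E.mon_mem e.1)
      rw [e.2, Nat.sub_add_cancel (by omega)] at this
      exact this
  rw [hle]
  refine Submodule.fg_iSup _ fun i => ?_
  have : Finite {e : Adm E.deg // wdeg E.deg e.1 = i} := finite_wdeg E.deg_pos
    (hfin.subset fun x hx => le_trans (show E.deg x ≤ i from hx) (by have := i.2; omega))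
  refine Submodule.fg_iSup _ fun e => ?_
  obtain ⟨s, hs⟩ := hA (j - i)
  have h1 : Submodule.span U.deg0 ((fun a => E.incl a * E.mon e.1) '' A.gr (j - i)) =
      Submodule.span U.deg0 ((fun a => E.incl a * E.mon e.1) '' s) := by
    refine le_antisymm ?_ (Submodule.span_mono (Set.image_mono fun a ha => ?_))
    · rw [Submodule.span_le]
      rintro _ ⟨a, ha, rfl⟩
      have ha' : a ∈ Submodule.span A.deg0 (s : Set A) := by rw [hs]; exact ha
      clear ha
      induction ha' using Submodule.span_induction with
      | mem a ha => exact Submodule.subset_span ⟨a, ha, rfl⟩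
      | zero =>
        change E.incl 0 * _ ∈ _
        rw [map_zero E.incl.toRingHom, zero_mul]; exact zero_mem _
      | add a b _ _ ha hb =>
        change E.incl (a + b) * _ ∈ _
        rw [map_add E.incl.toRingHom, add_mul]; exact add_mem ha hb
      | smul c a _ ha =>
        have := Submodule.smul_mem _ (⟨E.incl c.1, E.incl.map_gr c.2⟩ : U.deg0) ha
        change E.incl (c.1 * a) * _ ∈ _
        rw [map_mul E.incl.toRingHom, mul_assoc]
        exact this
    · have : a ∈ Submodule.span A.deg0 (s : Set A) := Submodule.subset_span ha
      rw [hs] at this; exact this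
  rw [h1]
  exact Submodule.fg_span (s.finite_toSet.image _)

/-- A graded endomorphism of the `A`-algebra `A[X]` which is surjective modulo the maximal ideal of
`A₀` and decomposables is bijective. -/
theorem bijective_of_sub_mem [IsLocalRing U.deg0] [IsNoetherianRing U.deg0]
    (hfg : ∀ j, (U.grMod j).FG) (hdiv : ∀ x, x ∉ E.divided ∨ Odd (E.deg x)) (Φ : U →+* U)
    (hgr : ∀ i u, u ∈ U.gr i → Φ u ∈ U.gr i) (hincl : ∀ a, Φ (E.incl a) = E.incl a)
    (h : ∀ x, ∃ u ∈ U.gr (E.deg x), ∃ v ∈ IsLocalRing.maximalIdeal U.deg0 • U.grMod (E.deg x),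
      ∃ w ∈ E.filtSubring (E.deg x - 1), E.pw x 1 = Φ u + v + w) :
    Function.Bijective Φ := by
  have h0 : ∀ c ∈ U.gr 0, Φ c = c := by
    intro c hc
    rw [← E.exists_incl_eq_of_mem_zero hc, hincl]
  let L : U →ₗ[U.deg0] U := { Φ.toAddMonoidHom with
    map_smul' := fun c u => by
      change Φ (c.1 * u) = c.1 * Φ u
      rw [map_mul, h0 _ c.2] }
  have hL : ∀ u, L u = Φ u := fun _ => rfl
  have hpr : ∀ i u, Φ (U.pr i u) = U.pr i (Φ u) := fun i u =>
    map_pr_of_map_gr (f := Φ.toAddMonoidHom) hgr i u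
  -- surjective in each degree, by induction on the degree and Nakayama
  have hsurj : ∀ j, U.grMod j ≤ (U.grMod j).map L := by
    intro j
    induction j using Nat.strong_induction_on with
    | _ j ih =>
    -- the subalgebra generated by the variables of degree less than `j` is in the image
    have hlow : ∀ w ∈ U.gr j, w ∈ E.filtSubring (j - 1) → j ≠ 0 → w ∈ (U.grMod j).map L := by
      intro w hw hw' hj
      have h1 : E.filtSubring (j - 1) ≤ Φ.range := by
        refine Subring.closure_le.2 ?_
        rintro _ (⟨a, rfl⟩ | ⟨x, n, hx, rfl⟩)
        · exact ⟨E.incl a, hincl a⟩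
        · rw [E.pw_pow x n (hdiv x)]
          refine pow_mem ?_ n
          have h2 := ih (E.deg x) (by omega) (show E.pw x 1 ∈ U.gr _ by
            have := E.pw_mem x 1; rwa [one_mul] at this)
          obtain ⟨y, _, hy⟩ := h2
          exact ⟨y, hy⟩
      obtain ⟨y, hy⟩ := h1 hw'
      refine ⟨U.pr j y, U.pr_mem j y, ?_⟩
      rw [hL, hpr, hy, U.pr_same hw]
    refine Submodule.le_of_le_smul_of_le_jacobson_bot (hfg j)
      (IsLocalRing.maximalIdeal_le_jacobson ⊥) ?_
    intro u hu
    rw [E.rep_sum u]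
    refine Submodule.sum_mem _ fun e he => ?_
    have hej : wdeg E.deg e.1 ≤ j := by
      by_contra h
      exact Finsupp.mem_support_iff.1 he (E.rep_eq_zero hu (by omega))
    have ha := E.rep_mem hu e
    generalize E.rep u e = a at ha
    have hterm : E.incl a * E.mon e ∈ U.gr j := by
      have := U.mul_mem' (E.incl.map_gr ha) (E.mon_mem e)
      rwa [Nat.sub_add_cancel hej] at this
    rcases Nat.eq_zero_or_pos j with hj | hj
    · subst hj
      exact Submodule.mem_sup_left ⟨_, hterm, h0 _ hterm⟩
    by_cases hx : ∃ x, e.1 x ≠ 0 ∧ E.deg x = j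
    · obtain ⟨x, hx, hxj⟩ := hx
      have he := E.eq_varAdm hx (by omega)
      have hw1 : wdeg E.deg e.1 = j := by
        rw [he]; change wdeg E.deg (Finsupp.single x 1) = j
        rw [wdeg_single, one_mul, hxj]
      rw [hw1, Nat.sub_self] at ha
      have ha' := E.incl.map_gr ha
      change E.incl a * E.mon e ∈ _
      rw [he, mon_varAdm]
      obtain ⟨u', hu', v, hv, w, hw, hx'⟩ := h x
      rw [hxj] at hu' hv hw
      have hwj : w ∈ U.gr j := by
        have h1 : w = E.pw x 1 - Φ u' - v := by rw [hx']; abel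
        rw [h1]
        have := E.pw_mem x 1
        rw [one_mul, hxj] at this
        exact sub_mem (sub_mem this (hgr _ _ hu')) (Submodule.smul_le_right hv)
      rw [hx']
      change (⟨E.incl a, ha'⟩ : U.deg0) • (Φ u' + v + w) ∈ _
      refine Submodule.smul_mem _ _ (add_mem (add_mem ?_ ?_) ?_)
      · exact Submodule.mem_sup_left ⟨u', hu', rfl⟩
      · exact Submodule.mem_sup_right hv
      · exact Submodule.mem_sup_left (hlow w hwj hw hj.ne')
    · push Not at hx
      refine Submodule.mem_sup_left (hlow _ hterm ?_ hj.ne')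
      rw [filtSubring_eq]
      refine mul_mem (E.incl_mem_spnRing _ _) (E.mon_mem_spnRing fun x hx' => ?_)
      by_contra h1
      have h2 := deg_le_wdeg E.deg e.1 h1
      have h3 := hx x h1
      change ¬ E.deg x ≤ j - 1 at hx'
      omega
  constructor
  · rw [injective_iff_map_eq_zero]
    intro u hu
    refine eq_zero_of_pr fun j => ?_
    -- a surjective endomorphism of a finite module is injective
    have hf : Module.Finite U.deg0 (U.grMod j) := Module.Finite.iff_fg.2 (hfg j)
    let Lj : U.grMod j →ₗ[U.deg0] U.grMod j := L.restrict fun u hu => hgr j u hu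
    have hs : Function.Surjective Lj := by
      rintro ⟨y, hy⟩
      obtain ⟨x, hx, hxy⟩ := hsurj j hy
      exact ⟨⟨x, hx⟩, Subtype.ext hxy⟩
    have hi := OrzechProperty.injective_of_surjective_endomorphism Lj hs
    have h1 : Lj ⟨U.pr j u, U.pr_mem j u⟩ = 0 := Subtype.ext (by
      change Φ (U.pr j u) = 0
      rw [hpr, hu, map_zero])
    have := hi (h1.trans (map_zero Lj).symm)
    exact congrArg Subtype.val this
  · intro u
    obtain ⟨s, hs⟩ := U.sum_pr u
    suffices u ∈ Φ.range from this
    rw [hs]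
    refine sum_mem fun i _ => ?_
    obtain ⟨y, _, hy⟩ := hsurj i (U.pr_mem i u)
    exact ⟨y, hy⟩

end SemifreeExt

/-! ### Adjoining contractible pairs, and acyclicity over a resolution -/

namespace SemifreeExt

variable {A : CDGA.{u}} {U : CDGA.{v}} (E : SemifreeExt.{u, v, w} A U)

/-- The variables of `P` together with finitely many contractible pairs `xs i`, `ys i`. -/
def withPairs {ι : Type*} (P : Set E.Var) (xs ys : ι → E.Var) (F : Finset ι) : Set E.Var :=
  P ∪ (xs '' F ∪ ys '' F)

theorem withPairs_insert {ι : Type*} [DecidableEq ι] (P : Set E.Var) (xs ys : ι → E.Var)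
    (F : Finset ι) (i : ι) :
    E.withPairs P xs ys (insert i F) = E.withPairs P xs ys F ∪ {xs i, ys i} := by
  ext z
  simp only [withPairs, Finset.coe_insert, Set.image_insert_eq, Set.mem_union, Set.mem_insert_iff,
    Set.mem_singleton_iff]
  tauto

section Pairs

variable {ι : Type*} {P : Set E.Var} {xs ys : ι → E.Var}
  (hPd : ∀ z ∈ P, U.d (E.pw z 1) ∈ E.fam.spnRing P)
  (hdx : ∀ i, U.d (E.pw (xs i) 1) ∈ E.fam.spnRing P)
  (hdy : ∀ i, U.d (E.pw (ys i) 1) - E.pw (xs i) 1 ∈ E.fam.spnRing P)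

include hPd hdx hdy

/-- The variables of `P` and the pairs generate a dg-subalgebra. -/
theorem withPairs_d (F : Finset ι) : ∀ z ∈ E.withPairs P xs ys F,
    U.d (E.pw z 1) ∈ E.fam.spnRing (E.withPairs P xs ys F) := by
  have hle : E.fam.spnRing P ≤ E.fam.spnRing (E.withPairs P xs ys F) :=
    E.spnRing_mono Set.subset_union_left
  rintro z (hz | ⟨i, hi, rfl⟩ | ⟨i, hi, rfl⟩)
  · exact hle (hPd z hz)
  · exact hle (hdx i)
  · have h1 := add_mem (hle (hdy i)) (E.pw_mem_spnRing (P := E.withPairs P xs ys F)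
      (Or.inr (Or.inl ⟨i, hi, rfl⟩)) 1)
    rwa [sub_add_cancel] at h1

/-- Adjoining contractible pairs does not change the homology: they are adjoined one after the
other. -/
theorem exists_sub_d_mem_of_withPairs (hx : ∀ i, xs i ∉ P) (hy : ∀ i, ys i ∉ P)
    (hxi : Function.Injective xs) (hyi : Function.Injective ys) (hxy : ∀ i j, xs i ≠ ys j)
    (hdeg : ∀ i, E.deg (ys i) = E.deg (xs i) + 1)
    (hdiv : ∀ i, (Even (E.deg (xs i)) ∧ xs i ∉ E.divided) ∨
      (Odd (E.deg (xs i)) ∧ ys i ∈ E.divided)) (F : Finset ι) :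
    ∀ u ∈ E.fam.spnRing (E.withPairs P xs ys F), U.d u ∈ E.fam.spnRing P →
      ∃ w ∈ E.fam.spnRing (E.withPairs P xs ys F), u - U.d w ∈ E.fam.spnRing P := by
  classical
  induction F using Finset.induction_on with
  | empty =>
    intro u hu _
    have h0 : E.withPairs P xs ys ∅ = P := by simp [withPairs]
    rw [h0] at hu ⊢
    exact ⟨0, zero_mem _, by rwa [map_zero, sub_zero]⟩
  | insert i F hi ih =>
    intro u hu hdu
    have hle : E.fam.spnRing P ≤ E.fam.spnRing (E.withPairs P xs ys F) :=
      E.spnRing_mono Set.subset_union_left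
    have hP' := E.withPairs_d hPd hdx hdy F
    rw [withPairs_insert] at hu ⊢
    have hle' : E.fam.spnRing (E.withPairs P xs ys F) ≤
        E.fam.spnRing (E.withPairs P xs ys F ∪ {xs i, ys i}) := E.spnRing_mono Set.subset_union_left
    have h1 : xs i ∉ E.withPairs P xs ys F := by
      rintro (h | ⟨j, hj, h⟩ | ⟨j, hj, h⟩)
      · exact hx i h
      · exact hi (hxi h ▸ hj)
      · exact hxy i j h.symm
    have h2 : ys i ∉ E.withPairs P xs ys F := by
      rintro (h | ⟨j, hj, h⟩ | ⟨j, hj, h⟩)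
      · exact hy i h
      · exact hxy j i h
      · exact hi (hyi h ▸ hj)
    obtain ⟨w, hw, hw'⟩ := E.pair hP' h1 h2 (hxy i i) (hdeg i) (hle (hdx i)) (hle (hdy i)) (hdiv i)
      u hu (hle hdu)
    obtain ⟨w', hw1, hw2⟩ := ih (u - U.d w) hw' (by rw [map_sub, U.d_d, sub_zero]; exact hdu)
    refine ⟨w + w', add_mem hw (hle' hw1), ?_⟩
    rwa [map_add, ← sub_sub]

end Pairs

/-- Let `G` be a resolution of a field. A cycle of a semifree extension of `G` whose coefficients
are in the kernel of the augmentation of `G` is the boundary of an element of the same kind. -/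
theorem exists_d_eq_of_rep_mem_ker {k : Type*} [CommRing k] {η : A →+* k} (hη : IsResolution A η)
    {Q : Set E.Var} (hQ : ∀ x ∈ Q, U.d (E.pw x 1) ∈ E.fam.spnRing Q) (n : ℕ) :
    ∀ u ∈ E.fam.spnRing Q, U.d u = 0 → (∀ e, η (E.rep u e) = 0) →
      (∀ e, E.rep u e ≠ 0 → wdeg E.deg e.1 < n) →
      ∃ w ∈ E.fam.spnRing Q, (∀ e, η (E.rep w e) = 0) ∧ U.d w = u := by
  classical
  induction n with
  | zero =>
    intro u _ _ _ h
    refine ⟨0, zero_mem _, fun e => by rw [map_zero, Finsupp.zero_apply, map_zero], ?_⟩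
    rw [map_zero]
    refine (E.ext_rep fun e => ?_).symm
    rw [map_zero, Finsupp.zero_apply]
    by_contra h0
    exact absurd (h e h0) (by omega)
  | succ n ih =>
    intro u hu hdu hker hdeg
    -- the differential of a monomial involves only monomials of smaller degree
    have hlow : ∀ (a : A) (m f : Adm E.deg), wdeg E.deg m.1 ≤ wdeg E.deg f.1 →
        E.rep (E.incl a * U.d (E.mon m)) f = 0 := by
      intro a m f hmf
      rw [rep_incl_mul]
      rcases Nat.eq_zero_or_pos (wdeg E.deg m.1) with h0 | hpos
      · have := E.mon_mem m
        rw [h0] at this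
        rw [U.d_zero this, map_zero, Finsupp.zero_apply, mul_zero]
      · have := E.mon_mem m
        rw [← Nat.sub_add_cancel hpos] at this
        rw [E.rep_eq_zero (U.d_mem this) (by omega), mul_zero]
    -- induction on the degrees of the monomials in `u`: the coefficients at the monomials of top
    -- degree are cycles
    have htop : ∀ e : Adm E.deg, wdeg E.deg e.1 = n → A.d (E.rep u e) = 0 := by
      intro e he
      have h1 : E.rep (U.d u) e = A.d (E.rep u e) := by
        conv_lhs => rw [E.rep_sum u]
        simp only [Finsupp.sum]
        rw [map_sum, map_sum, Finsupp.finsetSum_apply, Finset.sum_eq_single e]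
        · rw [U.d_mul', ← E.incl.map_d, ← E.incl.map_sgn, map_add, Finsupp.add_apply, rep_mon,
            Finsupp.single_eq_same, hlow _ _ _ le_rfl, add_zero]
        · intro f hf hfe
          have := hdeg f (Finsupp.mem_support_iff.1 hf)
          rw [U.d_mul', ← E.incl.map_d, ← E.incl.map_sgn, map_add, Finsupp.add_apply, rep_mon,
            Finsupp.single_apply, if_neg hfe, hlow _ _ _ (by omega), add_zero]
        · intro he
          rw [Finsupp.notMem_support_iff.1 he, map_zero E.incl.toRingHom, zero_mul, map_zero,
            map_zero, Finsupp.zero_apply]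
      rw [← h1, hdu, map_zero, Finsupp.zero_apply]
    -- these cycles bound elements `h`, which may be taken without component of degree `0`
    have hex : ∀ e : Adm E.deg, ∃ h : A, η h = 0 ∧ A.pr 0 h = 0 ∧
        (wdeg E.deg e.1 = n → A.d h = E.rep u e) := by
      intro e
      by_cases he : wdeg E.deg e.1 = n
      · obtain ⟨h, hh⟩ := hη.exact _ (htop e he) (hker e)
        obtain ⟨h', hh', hh0⟩ := A.pr_zero_eq_sub h
        have h1 : η h' = 0 := by rw [← IsResolution.pr_zero hη, hh0, map_zero]
        refine ⟨h', h1, hh0, fun _ => ?_⟩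
        rw [← hh]
        conv_rhs => rw [hh']
        rw [map_add, A.d_pr_zero, zero_add]
      · exact ⟨0, map_zero _, map_zero _, fun h => absurd h he⟩
    choose h hh hh0 hhd using hex
    have hηpr : ∀ a b, A.pr 0 a = 0 → η (a * b) = 0 := by
      intro a b ha
      have : η a = 0 := by rw [← IsResolution.pr_zero hη, ha, map_zero]
      rw [map_mul, this, zero_mul]
    set T := (E.rep u).support.filter fun e => wdeg E.deg e.1 = n with hT
    set w := ∑ e ∈ T, E.incl (h e) * E.mon e with hw
    have hTQ : ∀ e ∈ T, E.mon e ∈ E.fam.spnRing Q := fun e he =>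
      E.mon_mem_spnRing (E.mem_spnRing_iff.1 hu e
        (Finsupp.mem_support_iff.1 (Finset.mem_filter.1 he).1))
    have hwQ : w ∈ E.fam.spnRing Q :=
      sum_mem fun e he => mul_mem (E.incl_mem_spnRing _ _) (hTQ e he)
    have hrw : ∀ f, E.rep w f = if f ∈ T then h f else 0 := by
      intro f
      rw [hw, map_sum, Finsupp.finsetSum_apply]
      simp only [rep_mon, Finsupp.single_apply]
      rw [Finset.sum_ite_eq']
    have hdw : U.d w = ∑ e ∈ T, E.incl (E.rep u e) * E.mon e +
        ∑ e ∈ T, E.incl (A.sgn 1 (h e)) * U.d (E.mon e) := by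
      rw [hw, map_sum, ← Finset.sum_add_distrib]
      refine Finset.sum_congr rfl fun e he => ?_
      rw [U.d_mul', ← E.incl.map_d, ← E.incl.map_sgn, hhd e (Finset.mem_filter.1 he).2]
    have hrep1 : ∀ f, E.rep (∑ e ∈ T, E.incl (E.rep u e) * E.mon e) f =
        if f ∈ T then E.rep u f else 0 := by
      intro f
      rw [map_sum, Finsupp.finsetSum_apply]
      simp only [rep_mon, Finsupp.single_apply]
      rw [Finset.sum_ite_eq']
    have hrep2 : ∀ f, n ≤ wdeg E.deg f.1 →
        E.rep (∑ e ∈ T, E.incl (A.sgn 1 (h e)) * U.d (E.mon e)) f = 0 := by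
      intro f hf
      rw [map_sum, Finsupp.finsetSum_apply]
      refine Finset.sum_eq_zero fun e he => hlow _ _ _ ?_
      rw [(Finset.mem_filter.1 he).2]; exact hf
    -- the coefficients of the remaining terms are multiples of the elements `h`
    have hrep3 : ∀ f, η (E.rep (∑ e ∈ T, E.incl (A.sgn 1 (h e)) * U.d (E.mon e)) f) = 0 := by
      intro f
      rw [map_sum, Finsupp.finsetSum_apply, map_sum]
      refine Finset.sum_eq_zero fun e he => ?_
      rw [rep_incl_mul]
      refine hηpr _ _ ?_
      have h1 := map_pr_of_map_gr (f := (A.sgn 1).toAddMonoidHom) (fun i u hu => sgn_mem 1 hu) 0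
        (h e)
      rw [hh0, map_zero] at h1
      exact h1.symm
    have hηh : ∀ f, η (E.rep w f) = 0 := by
      intro f
      rw [hrw]
      split_ifs
      · exact hh f
      · exact map_zero _
    have hrdw : ∀ f, E.rep (U.d w) f = (if f ∈ T then E.rep u f else 0) +
        E.rep (∑ e ∈ T, E.incl (A.sgn 1 (h e)) * U.d (E.mon e)) f := by
      intro f
      rw [hdw, map_add, Finsupp.add_apply, hrep1]
    obtain ⟨w', hw', hηw', hdw'⟩ := ih (u - U.d w) (sub_mem hu (E.spnRing_d hQ w hwQ))
      (by rw [map_sub, hdu, U.d_d, sub_zero]) (fun f => by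
        rw [map_sub, Finsupp.sub_apply, map_sub, hrdw, map_add, hrep3, hker]
        split_ifs
        · rw [hker]; simp
        · rw [map_zero]; simp) (fun f hf => by
        by_contra hn
        push Not at hn
        rw [map_sub, Finsupp.sub_apply, hrdw, hrep2 f hn, add_zero] at hf
        split_ifs at hf with hfT
        · exact hf (sub_self _)
        · rw [sub_zero] at hf
          have := hdeg f hf
          exact hfT (Finset.mem_filter.2 ⟨Finsupp.mem_support_iff.2 hf, by omega⟩))
    refine ⟨w + w', add_mem hwQ hw', fun e => ?_, ?_⟩
    · rw [map_add, Finsupp.add_apply, map_add, hηh, hηw', add_zero]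
    · rw [map_add, hdw', add_sub_cancel]

/-- Adjoining an exterior variable `x` to `P` gives a module generated by `1` and `x` over the span
of the monomials in `P`. -/
theorem exists_add_mul_of_mem_spnRing {P : Set E.Var} {x : E.Var} (hx : Odd (E.deg x)) {u : U}
    (hu : u ∈ E.fam.spnRing (insert x P)) :
    ∃ a ∈ E.fam.spnRing P, ∃ b ∈ E.fam.spnRing P, u = a + E.pw x 1 * b := by
  classical
  rw [E.rep_sum u]
  refine Finset.sum_induction _ (fun u => ∃ a ∈ E.fam.spnRing P, ∃ b ∈ E.fam.spnRing P,
    u = a + E.pw x 1 * b) ?_ ⟨0, zero_mem _, 0, zero_mem _, by simp⟩ fun e he => ?_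
  · rintro _ _ ⟨a, ha, b, hb, rfl⟩ ⟨a', ha', b', hb', rfl⟩
    exact ⟨a + a', add_mem ha ha', b + b', add_mem hb hb', by rw [mul_add]; abel⟩
  have hs := E.mem_spnRing_iff.1 hu e (Finsupp.mem_support_iff.1 he)
  generalize E.rep u e = a
  change ∃ a' ∈ E.fam.spnRing P, ∃ b ∈ E.fam.spnRing P, E.incl a * E.mon e = a' + E.pw x 1 * b
  by_cases h0 : e.1 x = 0 ∨ x ∈ P
  · refine ⟨_, mul_mem (E.incl_mem_spnRing _ a) (E.mon_mem_spnRing fun y hy => ?_), 0, zero_mem _,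
      by rw [mul_zero, add_zero]⟩
    by_cases hyx : y = x
    · subst hyx; exact h0.resolve_right hy
    · exact hs y (by rw [Set.mem_insert_iff]; tauto)
  · push Not at h0
    have he1 : e.1 x = 1 := by have := e.2 x hx; omega
    obtain ⟨k, hk⟩ := E.fam.mono_add (e := Finsupp.single x 1) (f := e.1.erase x) (by
      rw [Finset.disjoint_left]
      intro y hy
      have := Finset.mem_singleton.1 (Finsupp.support_single_subset hy)
      rw [this]; simp)
    have h5 : Finsupp.single x 1 + e.1.erase x = e.1 :=
      (congrArg (fun n => Finsupp.single x n + e.1.erase x) he1.symm).trans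
        (Finsupp.single_add_erase x e.1)
    rw [E.fam.mono_single', h5] at hk
    let r : Adm E.deg := ⟨e.1.erase x, IsAdm.mono e.2 (by
      intro y; rw [Finsupp.erase_apply]; split_ifs <;> simp)⟩
    have hr : E.mon r ∈ E.fam.spnRing P := E.mon_mem_spnRing fun y hy => by
      change e.1.erase x y = 0
      by_cases hyx : y = x
      · subst hyx; simp
      · rw [Finsupp.erase_ne hyx]; exact hs y (by rw [Set.mem_insert_iff]; tauto)
    have hk' : E.mon e = (-1) ^ k * (E.pw x 1 * E.mon r) := hk
    have hxm : E.pw x 1 ∈ U.gr (E.deg x) := by have := E.pw_mem x 1; rwa [one_mul] at this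
    refine ⟨0, zero_mem _, (-1) ^ k * (U.sgn (E.deg x) (E.incl a) * E.mon r),
      U.neg_one_pow_mem k (P := (E.fam.spnRing P).toAddSubgroup)
        ((E.fam.spnRing P).mul_mem (E.spnRing_sgn P _ (E.incl_mem_spnRing _ a)) hr), ?_⟩
    have h6 : E.incl a * E.pw x 1 = E.pw x 1 * U.sgn (E.deg x) (E.incl a) := U.mul_comm_sgn _ hxm
    rw [hk', zero_add, neg_one_pow_mul_comm, neg_one_pow_mul_comm, ← mul_assoc (E.incl a), h6,
      mul_assoc]

theorem eq_zero_of_add_mul_eq_zero {P : Set E.Var} {x : E.Var} (hx : x ∉ P) {a b : U}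
    (ha : a ∈ E.fam.spnRing P) (hb : b ∈ E.fam.spnRing P) (h : a + E.pw x 1 * b = 0) :
    a = 0 ∧ b = 0 := by
  classical
  have hxm : E.pw x 1 ∈ U.gr (E.deg x) := by have := E.pw_mem x 1; rwa [one_mul] at this
  rw [U.mul_comm_sgn' _ hxm, ← mon_varAdm, ← mul_one a, ← E.mon_zeroAdm] at h
  have h1 := congrArg (E.split P) h
  rw [map_add, map_zero, E.split_mul_mon ha (fun _ _ => rfl),
    E.split_mul_mon (E.spnRing_sgn P _ hb) (fun y hy => Finsupp.single_eq_of_ne (by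
      rintro rfl; exact hx hy))] at h1
  constructor
  · have h2 := DFunLike.congr_fun h1 E.zeroAdm
    rwa [Finsupp.add_apply, Finsupp.single_eq_same, Finsupp.single_eq_of_ne
      (E.varAdm_ne_zeroAdm x).symm, add_zero] at h2
  · have h2 := DFunLike.congr_fun h1 (E.varAdm x)
    rw [Finsupp.add_apply, Finsupp.single_eq_same, Finsupp.single_eq_of_ne
      (E.varAdm_ne_zeroAdm x), zero_add, Finsupp.zero_apply] at h2
    rw [← U.sgn_self (E.deg x) b, h2, map_zero]

end SemifreeExt

/-! ### The Koszul complex of a regular local ring -/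

section Koszul

variable {S : Type u} [CommRing S] [IsRegularLocalRing S] {t : Fin (embDim S) → S}
  (ht : Ideal.span (Set.range t) = IsLocalRing.maximalIdeal S)
  {U : CDGA.{v}} (E : SemifreeExt.{u, v, w} (ofRing S) U) {e : Fin (embDim S) → E.Var}
  (hei : Function.Injective e)
  (he : ∀ j, E.deg (e j) = 1) (hd : ∀ j, U.d (E.pw (e j) 1) = E.incl (t j))

include ht hei he hd

/-- The Koszul complex on a minimal system of generators of the maximal ideal of a regular local
ring is a resolution of the residue field. -/
theorem koszul_exact (F : Finset (Fin (embDim S))) :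
    ∀ u ∈ E.fam.spnRing (e '' F), U.d u = 0 →
      (∃ s ∈ Ideal.span (t '' F), U.pr 0 u = E.incl (ofRingSelf S s)) →
      ∃ w ∈ E.fam.spnRing (e '' F), U.d w = u := by
  classical
  have hS : ∀ s : S, E.incl (ofRingSelf S s) ∈ U.gr 0 := fun s =>
    E.incl.map_gr (mem_trivGr_zero (R := S) s)
  have hdincl : ∀ s : S, U.d (E.incl (ofRingSelf S s)) = 0 := fun s => U.d_zero (hS s)
  have hPd : ∀ F : Finset (Fin (embDim S)), ∀ z ∈ e '' F, U.d (E.pw z 1) ∈ E.fam.spnRing (e '' F) := by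
    rintro F _ ⟨j, hj, rfl⟩
    rw [hd]; exact E.incl_mem_spnRing _ _
  -- the constant term of an element, in `S`
  let ψ : U →+* S :=
    (ofRingSelf S).symm.toRingHom.comp (E.const.comp (U.incl0.comp U.pr0))
  have hψ : ∀ u, U.pr 0 u = E.incl (ofRingSelf S (ψ u)) := by
    intro u
    change _ = E.incl (ofRingSelf S ((ofRingSelf S).symm (E.const (U.pr 0 u))))
    rw [RingEquiv.apply_symm_apply, E.exists_incl_eq_of_mem_zero (U.pr_mem 0 u)]
  have hinj : ∀ s s' : S, E.incl (ofRingSelf S s) = E.incl (ofRingSelf S s') → s = s' :=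
    fun s s' h => (ofRingSelf S).injective (E.incl_injective h)
  have hψincl : ∀ s : S, ψ (E.incl (ofRingSelf S s)) = s := fun s => hinj _ _ (by
    rw [← hψ, U.pr_same (hS s)])
  have hψe : ∀ i b, ψ (E.pw (e i) 1 * b) = 0 := by
    intro i b
    have hem : E.pw (e i) 1 ∈ U.gr 1 := by have := E.pw_mem (e i) 1; rwa [he] at this
    have h1 : ψ (E.pw (e i) 1) = 0 := hinj _ _ (by
      rw [← hψ, U.pr_ne hem (by omega), map_zero, map_zero E.incl.toRingHom])
    rw [map_mul, h1, zero_mul]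
  have hψd : ∀ (F : Finset (Fin (embDim S))), ∀ a ∈ E.fam.spnRing (e '' F),
      ψ (U.d a) ∈ Ideal.span (t '' F) := by
    intro F a ha
    rw [E.spnRing_eq_closure] at ha
    induction ha using Subring.closure_induction with
    | mem a ha =>
      rcases ha with ⟨s, rfl⟩ | ⟨_, n, ⟨i, hi, rfl⟩, rfl⟩
      · have := hdincl ((ofRingSelf S).symm s)
        rw [RingEquiv.apply_symm_apply] at this
        rw [this, map_zero]; exact zero_mem _
      · rcases n with _ | _ | n
        · rw [E.pw_zero, U.d_one, map_zero]; exact zero_mem _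
        · rw [zero_add, hd]
          refine Ideal.subset_span ⟨i, hi, (hψincl (t i)).symm⟩
        · rw [E.pw_pow_odd (by rw [he]; exact odd_one) (by omega), map_zero, map_zero]
          exact zero_mem _
    | zero => rw [map_zero, map_zero]; exact zero_mem _
    | one => rw [U.d_one, map_zero]; exact zero_mem _
    | add a b _ _ ha hb => rw [map_add, map_add]; exact add_mem ha hb
    | neg a _ ha => rw [map_neg, map_neg]; exact neg_mem ha
    | mul a b _ _ ha hb =>
      rw [U.d_mul', map_add, map_mul, map_mul]
      exact add_mem (Ideal.mul_mem_right _ _ ha) (Ideal.mul_mem_left _ _ hb)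
  induction F using Finset.induction_on with
  | empty =>
    rintro u hu _ ⟨s, hs, hus⟩
    rw [Finset.coe_empty, Set.image_empty, Ideal.span_empty, Ideal.mem_bot] at hs
    refine ⟨0, zero_mem _, ?_⟩
    rw [map_zero]
    rw [Finset.coe_empty, Set.image_empty] at hu
    have h1 : u ∈ U.gr 0 := by
      rw [E.rep_sum u]
      refine sum_mem fun f hf => ?_
      have h2 : f = E.zeroAdm := Subtype.ext (Finsupp.ext fun x =>
        E.mem_spnRing_iff.1 hu f (Finsupp.mem_support_iff.1 hf) x (Set.notMem_empty x))
      rw [h2]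
      change E.incl _ * E.mon _ ∈ _
      rw [E.mon_zeroAdm, mul_one]
      exact E.incl.map_gr (mem_trivGr_zero (R := S) _)
    rw [U.pr_same h1, hs, map_zero, map_zero E.incl.toRingHom] at hus
    exact hus.symm
  | insert j F hj ih =>
    rintro u hu hdu ⟨s, hs, hus⟩
    have hle : E.fam.spnRing (e '' F) ≤ E.fam.spnRing (e '' (insert j F : Finset _)) :=
      E.spnRing_mono (Set.image_mono (Finset.coe_subset.2 (Finset.subset_insert j F)))
    have hej : E.pw (e j) 1 ∈ E.fam.spnRing (e '' (insert j F : Finset _)) :=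
      E.pw_mem_spnRing (P := e '' (insert j F : Finset _)) ⟨j, Finset.mem_coe.2 (Finset.mem_insert_self j F), rfl⟩ 1
    have hodd : Odd (E.deg (e j)) := by rw [he]; exact odd_one
    have hu' := hu
    rw [Finset.coe_insert, Set.image_insert_eq] at hu'
    -- write the cycle as `a + x b`, where `d x = t j`: then `d b = 0` and `d a = - t j * b`
    obtain ⟨a, ha, b, hb, rfl⟩ := E.exists_add_mul_of_mem_spnRing hodd hu'
    have hem : E.pw (e j) 1 ∈ U.gr 1 := by have := E.pw_mem (e j) 1; rwa [he] at this
    have hdeb : ∀ b, U.d (E.pw (e j) 1 * b) =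
        E.incl (ofRingSelf S (t j)) * b - E.pw (e j) 1 * U.d b := by
      intro b
      rw [U.d_mul b hem, hd, pow_one, neg_one_mul, ← sub_eq_add_neg]; rfl
    have hjF : e j ∉ e '' F := by
      rintro ⟨i, hi, hij⟩
      exact hj (hei hij ▸ hi)
    have htj : ∀ {P : Set E.Var} {b : U}, b ∈ E.fam.spnRing P →
        E.incl (ofRingSelf S (t j)) * b ∈ E.fam.spnRing P :=
      fun hb => mul_mem (E.incl_mem_spnRing _ _) hb
    obtain ⟨hda, hdb⟩ : U.d a + E.incl (ofRingSelf S (t j)) * b = 0 ∧ - U.d b = 0 := by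
      refine E.eq_zero_of_add_mul_eq_zero hjF (add_mem (E.spnRing_d (hPd F) a ha) (htj hb))
        (neg_mem (E.spnRing_d (hPd F) b hb)) ?_
      rw [map_add, hdeb] at hdu
      rw [← hdu, mul_neg]; abel
    rw [neg_eq_zero] at hdb
    -- `t j * ψ b` is in the ideal of the other generators, hence so is `ψ b`, and `b` is a boundary
    have hψb : ψ b ∈ Ideal.span (t '' F) := by
      refine mem_span_of_mul_mem ht F hj ?_
      have h1 := congrArg ψ hda
      rw [map_add, map_mul, hψincl, map_zero] at h1
      rw [eq_neg_of_add_eq_zero_right h1]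
      exact neg_mem (hψd F a ha)
    obtain ⟨w', hw', hdw'⟩ := ih b hb hdb ⟨ψ b, hψb, hψ b⟩
    have hsa : s = ψ a := hinj _ _ (by
      rw [← hus, map_add, hψ a, hψ (_ * _), hψe, map_zero, map_zero E.incl.toRingHom, add_zero])
    rw [Finset.coe_insert, Set.image_insert_eq, Ideal.mem_span_insert] at hs
    obtain ⟨c, s', hs', hss'⟩ := hs
    -- adding the boundary of a multiple of `x` moves the constant term of `a + t j * w'` into the
    -- ideal `(t i, i ∈ F)`
    set q := E.incl (ofRingSelf S (t j)) * E.incl (ofRingSelf S (c + ψ w')) with hq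
    have hqd : U.d (E.pw (e j) 1 * E.incl (ofRingSelf S (c + ψ w'))) = q := by
      rw [hdeb, hdincl, mul_zero, sub_zero]
    have hdq : U.d q = 0 := by rw [← hqd, U.d_d]
    have hdt : U.d (E.incl (ofRingSelf S (t j)) * w') = E.incl (ofRingSelf S (t j)) * b := by
      rw [U.d_mul', hdincl, zero_mul, zero_add, hdw', U.sgn_of_mem 1 (hS (t j)), mul_zero, pow_zero, one_mul]
    obtain ⟨w'', hw'', hdw''⟩ := ih (a + E.incl (ofRingSelf S (t j)) * w' - q)
      (sub_mem (add_mem ha (htj hw')) (htj (E.incl_mem_spnRing _ _)))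
      (by rw [map_sub, map_add, hdt, hdq, sub_zero, hda]) ⟨s', hs', by
        rw [hψ]
        congr 2
        rw [map_sub, map_add, map_mul, hq, map_mul, hψincl, hψincl, ← hsa, hss']
        ring⟩
    refine ⟨w'' + E.pw (e j) 1 * E.incl (ofRingSelf S (c + ψ w')) - E.pw (e j) 1 * w',
      sub_mem (add_mem (hle hw'') (mul_mem hej (E.incl_mem_spnRing _ _)))
        (mul_mem hej (hle hw')), ?_⟩
    rw [map_sub, map_add, hqd, hdw'', hdeb, hdw']
    abel

end Koszul

/-! ### Finiteness of the variables of a minimal model -/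

/-- The differential is linear over the component of degree zero. -/
def dLin (A : CDGA.{u}) : A →ₗ[A.deg0] A :=
  { A.d with
    map_smul' := fun c a => by
      change A.d (c.1 * a) = c.1 * A.d a
      rw [A.d_mul a c.2, A.d_zero c.2, zero_mul, zero_add, pow_zero, one_mul] }

/-- The component of degree `i` of a local dg-algebra is finitely generated modulo boundaries, if
the boundaries of degree `i - 1` are finitely generated. -/
theorem exists_finset_grMod_le (V : CDGA.{u}) [V.IsLocal] (i : ℕ) (hB : (V.B i).FG) :
    ∃ F : Finset V, V.grMod (i + 1) ≤ Submodule.span V.deg0 (F : Set V) ⊔ V.B (i + 1) := by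
  classical
  have hH := IsLocal.finite_H (A := V) (i + 1)
  have h1 : ((V.grMod (i + 1)).map (V.B (i + 1)).mkQ).FG := by
    have hle : V.B (i + 1) ≤ LinearMap.ker V.dLin := by
      rintro _ ⟨b, _, rfl⟩
      exact V.d_d b
    refine Submodule.fg_of_fg_map_of_fg_inf_ker ((V.B (i + 1)).liftQ V.dLin hle) ?_ ?_
    · rw [← Submodule.map_comp, Submodule.liftQ_mkQ]
      have : (V.grMod (i + 1)).map V.dLin = V.B i := by
        ext x; rfl
      rw [this]; exact hB
    · let g : V.H (i + 1) →ₗ[V.deg0] (V ⧸ V.B (i + 1)) :=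
        ((V.B (i + 1)).submoduleOf (V.Z (i + 1))).mapQ (V.B (i + 1)) (V.Z (i + 1)).subtype le_rfl
      have h2 : (V.grMod (i + 1)).map (V.B (i + 1)).mkQ ⊓
          LinearMap.ker ((V.B (i + 1)).liftQ V.dLin hle) = LinearMap.range g := by
        ext q
        constructor
        · rintro ⟨⟨v, hv, rfl⟩, hq⟩
          exact ⟨Submodule.Quotient.mk ⟨v, hv, hq⟩, rfl⟩
        · rintro ⟨q, rfl⟩
          obtain ⟨z, rfl⟩ := Submodule.Quotient.mk_surjective _ q
          exact ⟨⟨z.1, z.2.1, rfl⟩, z.2.2⟩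
      rw [h2, LinearMap.range_eq_map]
      exact (Module.finite_def.1 hH).map g
  obtain ⟨s, hs⟩ := h1
  choose lift hlift using Submodule.mkQ_surjective (V.B (i + 1))
  refine ⟨s.image lift, fun v hv => ?_⟩
  have h3 : (V.B (i + 1)).mkQ v ∈ (Submodule.span V.deg0 (s.image lift : Set V)).map
      (V.B (i + 1)).mkQ := by
    have h4 : (V.B (i + 1)).mkQ v ∈ (V.grMod (i + 1)).map (V.B (i + 1)).mkQ := ⟨v, hv, rfl⟩
    rw [← hs] at h4
    rw [Submodule.map_span, Finset.coe_image, ← Set.image_comp]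
    have h5 : (fun x => (V.B (i + 1)).mkQ (lift x)) = id := funext hlift
    change _ ∈ Submodule.span _ ((fun x => (V.B (i + 1)).mkQ (lift x)) '' _)
    rw [h5, Set.image_id]; exact h4
  obtain ⟨y, hy, hyv⟩ := h3
  have h6 : v - y ∈ V.B (i + 1) := by
    rw [← Submodule.ker_mkQ (V.B (i + 1)), LinearMap.mem_ker, map_sub, hyv, sub_self]
  rw [← add_sub_cancel y v]
  exact Submodule.add_mem_sup hy h6

namespace SemifreeExt

theorem rep_smul {A : CDGA.{u}} {U : CDGA.{v}} (E : SemifreeExt.{u, v, w} A U) (c : U.deg0) (u : U)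
    (e : Adm E.deg) : E.rep (c • u) e = E.const c * E.rep u e := by
  rw [smul_def, ← rep_incl_mul, E.exists_incl_eq_of_mem_zero c.2]

/-- A minimal local semifree extension of a Noetherian local ring has finitely many variables in each
degree. -/
theorem IsMinimal.finite_deg {R : CDGA.{u}} [R.IsLocal] (hR : ∀ j, (R.grMod j).FG)
    {V : CDGA.{v}} [V.IsLocal]
    {M : SemifreeExt.{u, v, w} R V} (hM : M.IsMinimal) (i : ℕ) : {x | M.deg x = i}.Finite := by
  classical
  induction i using Nat.strong_induction_on with
  | _ i ih =>
  rcases i with _ | i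
  · have : {x | M.deg x = 0} = ∅ := by
      ext x
      have := M.deg_pos x
      simp only [Set.mem_ofPred_eq, Set.mem_empty_iff_false, iff_false]; omega
    rw [this]; exact Set.finite_empty
  have hfin : {x | M.deg x ≤ i}.Finite := by
    refine ((Set.finite_Iic i).biUnion (t := fun j => {x | M.deg x = j ∧ j ≤ i}) fun j hj => ?_).subset
      fun x hx => Set.mem_biUnion (Set.mem_Iic.2 hx) ⟨rfl, hx⟩
    exact (ih j (by have := Set.mem_Iic.1 hj; omega)).subset fun x hx => hx.1
  have hB : (V.B i).FG := (M.grMod_fg hfin hR).of_le (by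
    rintro _ ⟨b, hb, rfl⟩
    exact V.d_mem hb)
  obtain ⟨F, hF⟩ := V.exists_finset_grMod_le i hB
  -- every variable of degree `i + 1` occurs linearly in one of the finitely many generators modulo
  -- boundaries, since by minimality boundaries have no linear part
  have hsub : M.varAdm '' {x | M.deg x = i + 1} ⊆ ⋃ f ∈ F, ((M.rep f).support : Set _) := by
    rintro _ ⟨x, hx, rfl⟩
    by_contra hcon
    simp only [Set.mem_iUnion, not_exists, Finset.mem_coe, Finsupp.mem_support_iff, not_not] at hcon
    have hxV : M.pw x 1 ∈ V.grMod (i + 1) := by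
      have := M.pw_mem x 1
      rwa [one_mul, hx] at this
    have key1 : ∀ y ∈ Submodule.span V.deg0 (F : Set V), M.rep y (M.varAdm x) ∈ R.maxIdeal := by
      intro y hy
      induction hy using Submodule.span_induction with
      | mem y hy => rw [hcon y hy]; exact zero_mem _
      | zero => rw [map_zero]; exact zero_mem _
      | add y z _ _ hy hz => rw [map_add, Finsupp.add_apply]; exact add_mem hy hz
      | smul c y _ hy => rw [rep_smul]; exact Ideal.mul_mem_left _ _ hy
    have key : ∀ v ∈ Submodule.span V.deg0 (F : Set V) ⊔ V.B (i + 1),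
        M.rep v (M.varAdm x) ∈ R.maxIdeal := by
      intro v hv
      obtain ⟨y, hy, b, ⟨b', _, rfl⟩, rfl⟩ := Submodule.mem_sup.1 hv
      rw [map_add, Finsupp.add_apply]
      exact add_mem (key1 y hy) (hM.rep_mem _ _ (M.varAdm_degree x).le)
    have h1 := key _ (hF hxV)
    rw [← mon_varAdm, ← one_mul (M.mon _), ← map_one M.incl.toRingHom, rep_mon,
      Finsupp.single_eq_same] at h1
    have h2 : R.pr0 1 ∈ IsLocalRing.maximalIdeal R.deg0 := h1
    rw [map_one] at h2
    exact (Ideal.ne_top_iff_one _).1 (IsLocalRing.maximalIdeal.isMaximal R.deg0).ne_top h2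
  exact Set.Finite.of_finite_image ((F.finite_toSet.biUnion fun f _ => Finset.finite_toSet _).subset
    hsub) M.varAdm_injective.injOn

/-! ### Maximal ideals along semifree extensions -/

section Local

variable {A : CDGA.{u}} {U : CDGA.{v}} (E : SemifreeExt.{u, v, w} A U) [A.IsLocal] [U.IsLocal]

theorem mem_maxIdeal_iff_pr {A : CDGA.{u}} [A.IsLocal] (a : A) :
    a ∈ A.maxIdeal ↔ A.pr 0 a ∈ A.maxIdeal := by
  have h : A.pr0 (A.pr 0 a) = A.pr0 a := Subtype.ext (A.pr_same (A.pr_mem 0 a))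
  change A.pr0 a ∈ IsLocalRing.maximalIdeal A.deg0 ↔ A.pr0 (A.pr 0 a) ∈ IsLocalRing.maximalIdeal A.deg0
  rw [h]

theorem mem_maxIdeal_of_mem_gr {A : CDGA.{u}} [A.IsLocal] {i : ℕ} (hi : 0 < i) {a : A}
    (ha : a ∈ A.gr i) : a ∈ A.maxIdeal := by
  rw [mem_maxIdeal_iff_pr, A.pr_ne ha hi.ne']
  exact zero_mem _

theorem one_notMem_maxIdeal {A : CDGA.{u}} [A.IsLocal] : (1 : A) ∉ A.maxIdeal := by
  intro h
  have h2 : A.pr0 1 ∈ IsLocalRing.maximalIdeal A.deg0 := h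
  rw [map_one] at h2
  exact (Ideal.ne_top_iff_one _).1 (IsLocalRing.maximalIdeal.isMaximal A.deg0).ne_top h2

theorem notMem_maxIdeal_iff {A : CDGA.{u}} [A.IsLocal] {a : A} (ha : a ∈ A.gr 0) :
    a ∉ A.maxIdeal ↔ ∃ b ∈ A.gr 0, a * b = 1 := by
  have h0 : A.pr0 a = ⟨a, ha⟩ := Subtype.ext (A.pr_same ha)
  constructor
  · intro h
    have h1 : IsUnit (A.pr0 a) := by
      by_contra h2; exact h h2
    rw [h0] at h1
    obtain ⟨b, hb⟩ := h1.exists_right_inv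
    exact ⟨b, b.2, congrArg Subtype.val hb⟩
  · rintro ⟨b, hb, hab⟩ h
    exact one_notMem_maxIdeal (hab ▸ (inferInstanceAs (Ideal.comap _ _).IsTwoSided :
      A.maxIdeal.IsTwoSided).mul_mem_of_left b h)

theorem incl_mem_maxIdeal_iff (a : A) : E.incl a ∈ U.maxIdeal ↔ a ∈ A.maxIdeal := by
  rw [mem_maxIdeal_iff_pr, mem_maxIdeal_iff_pr a, ← E.incl.map_pr]
  have ha := A.pr_mem 0 a
  rw [← not_iff_not, notMem_maxIdeal_iff ha, notMem_maxIdeal_iff (E.incl.map_gr ha)]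
  constructor
  · rintro ⟨b, hb, hab⟩
    refine ⟨E.const b, E.const_mem hb, E.incl_injective ?_⟩
    rw [map_mul E.incl.toRingHom, E.exists_incl_eq_of_mem_zero hb, hab, map_one E.incl.toRingHom]
  · rintro ⟨b, hb, hab⟩
    refine ⟨E.incl b, E.incl.map_gr hb, ?_⟩
    rw [← map_mul E.incl.toRingHom, hab, map_one E.incl.toRingHom]

theorem const_pr {A : CDGA.{u}} {U : CDGA.{v}} (E : SemifreeExt.{u, v, w} A U) (i : ℕ) (u : U) :
    E.const (U.pr i u) = A.pr i (E.const u) :=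
  map_pr_of_map_gr (f := E.const.toAddMonoidHom) (fun _ _ hu => E.const_mem hu) i u

theorem const_mem_maxIdeal_iff (u : U) : E.const u ∈ A.maxIdeal ↔ u ∈ U.maxIdeal := by
  rw [mem_maxIdeal_iff_pr, mem_maxIdeal_iff_pr u,
    ← const_pr]
  rw [← E.incl_mem_maxIdeal_iff, E.exists_incl_eq_of_mem_zero (U.pr_mem 0 u)]

end Local

end SemifreeExt

theorem ofRingSelf_mem_maxIdeal_iff {R : Type u} [CommRing R] [IsLocalRing R] [IsNoetherianRing R]
    (s : R) : ofRingSelf R s ∈ (ofRing R).maxIdeal ↔ s ∈ IsLocalRing.maximalIdeal R := by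
  have h : (ofRing R).pr0 (ofRingSelf R s) = ofRingEquiv R s :=
    Subtype.ext ((ofRing R).pr_same (mem_trivGr_zero (R := R) s))
  change (ofRing R).pr0 _ ∈ IsLocalRing.maximalIdeal (ofRing R).deg0 ↔ _
  rw [h, IsLocalRing.mem_maximalIdeal, IsLocalRing.mem_maximalIdeal, mem_nonunits_iff,
    mem_nonunits_iff, MulEquiv.isUnit_map]

namespace SemifreeExt

/-! ### The projection of a semifree extension to its coefficients -/

section General

variable {A : CDGA.{u}} {U : CDGA.{v}} (E : SemifreeExt.{u, v, w} A U)

theorem spnRing_induction {P : Set E.Var} {p : U → Prop} (h0 : p 0) (h1 : p 1)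
    (hadd : ∀ a b, p a → p b → p (a + b)) (hneg : ∀ a, p a → p (-a))
    (hmul : ∀ a b, p a → p b → p (a * b)) (hincl : ∀ a, p (E.incl a))
    (hpw : ∀ x ∈ P, ∀ n, p (E.pw x n)) : ∀ u ∈ E.fam.spnRing P, p u := by
  intro u hu
  rw [E.spnRing_eq_closure] at hu
  induction hu using Subring.closure_induction with
  | mem u hu =>
    rcases hu with ⟨a, rfl⟩ | ⟨x, n, hx, rfl⟩
    · exact hincl a
    · exact hpw x hx n
  | zero => exact h0
  | one => exact h1
  | add a b _ _ ha hb => exact hadd a b ha hb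
  | neg a _ ha => exact hneg a ha
  | mul a b _ _ ha hb => exact hmul a b ha hb

/-- Modulo an ideal that contains the constant terms of the differentials of the variables in `P`,
the projection to the coefficients commutes with the differential. -/
theorem const_d_sub_mem (I : Ideal A) [I.IsTwoSided] {P : Set E.Var}
    (hP : ∀ x ∈ P, E.const (U.d (E.pw x 1)) ∈ I) :
    ∀ u ∈ E.fam.spnRing P, E.const (U.d u) - A.d (E.const u) ∈ I := by
  have hmul : ∀ a b, E.const (U.d a) - A.d (E.const a) ∈ I →
      E.const (U.d b) - A.d (E.const b) ∈ I →
      E.const (U.d (a * b)) - A.d (E.const (a * b)) ∈ I := by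
    intro a b ha hb
    have h1 : E.const (U.sgn 1 a) = A.sgn 1 (E.const a) :=
      map_sgn_of_map_gr (fun _ _ => E.const_mem) 1 a
    have h2 : E.const (U.d (a * b)) - A.d (E.const (a * b)) =
        (E.const (U.d a) - A.d (E.const a)) * E.const b +
          A.sgn 1 (E.const a) * (E.const (U.d b) - A.d (E.const b)) := by
      rw [d_mul', map_add, map_mul, map_mul, map_mul, d_mul', h1]
      noncomm_ring
    rw [h2]
    exact add_mem (I.mul_mem_right _ ha) (I.mul_mem_left _ hb)
  have hone : E.const (U.d 1) - A.d (E.const 1) ∈ I := by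
    rw [d_one, map_one, d_one, map_zero, sub_zero]; exact zero_mem _
  refine E.spnRing_induction ?_ hone ?_ ?_ hmul ?_ ?_
  · simp
  · intro a b ha hb
    simp only [map_add]
    rw [add_sub_add_comm]; exact add_mem ha hb
  · intro a ha
    simp only [map_neg]
    rw [← neg_sub']
    exact neg_mem ha
  · intro a
    rw [← E.incl.map_d]
    rw [const_incl, const_incl, sub_self]; exact zero_mem _
  · intro x hx n
    have h1 : E.const (U.d (E.pw x 1)) - A.d (E.const (E.pw x 1)) ∈ I := by
      rw [E.const_pw x one_ne_zero, map_zero, sub_zero]; exact hP x hx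
    by_cases hx' : x ∈ E.divided ∧ Even (E.deg x)
    · rcases n with _ | n
      · rw [E.pw_zero]; exact hone
      · rw [E.d_pw x n hx'.1 hx'.2, E.const_pw x n.succ_ne_zero, map_zero, sub_zero, map_mul]
        exact I.mul_mem_right _ (hP x hx)
    · rw [E.pw_pow x n (by rw [← Nat.not_even_iff_odd]; tauto)]
      induction n with
      | zero => rw [pow_zero]; exact hone
      | succ n ih => rw [pow_succ]; exact hmul _ _ ih h1

/-- Over the dg-subalgebra generated by `P`, the variables in `Q` generate what `P` and `Q` generate
together. -/
theorem mem_spnRing_subExt {P : Set E.Var} (hP : ∀ x ∈ P, U.d (E.pw x 1) ∈ E.fam.spnRing P)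
    {Q : Set (E.subExt P hP).Var} {u : U} :
    u ∈ (E.subExt P hP).fam.spnRing Q ↔ u ∈ E.fam.spnRing (P ∪ Subtype.val '' Q) := by
  constructor
  · refine (E.subExt P hP).spnRing_induction (zero_mem _) (one_mem _) (fun _ _ => add_mem)
      (fun _ => neg_mem) (fun _ _ => mul_mem) (fun a => ?_) (fun x hx n => ?_) u
    · exact E.spnRing_mono Set.subset_union_left a.2
    · exact E.pw_mem_spnRing (Or.inr ⟨x, hx, rfl⟩) n
  · refine E.spnRing_induction (zero_mem _) (one_mem _) (fun _ _ => add_mem)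
      (fun _ => neg_mem) (fun _ _ => mul_mem) (fun a => ?_) ?_ u
    · exact (E.subExt P hP).incl_mem_spnRing Q ⟨E.incl a, E.incl_mem_spnRing P a⟩
    · rintro x (hx | ⟨x, hx, rfl⟩) n
      · exact (E.subExt P hP).incl_mem_spnRing Q ⟨E.pw x n, E.pw_mem_spnRing hx n⟩
      · exact (E.subExt P hP).pw_mem_spnRing hx n

/-- A change of the values of the exterior and polynomial variables extends to a ring
endomorphism. -/
theorem exists_ringEnd (hdiv : ∀ x, x ∉ E.divided ∨ Odd (E.deg x)) (z : E.Var → U)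
    (hz : ∀ x, z x ∈ U.gr (E.deg x)) :
    ∃ Φ : U →+* U, (∀ a, Φ (E.incl a) = E.incl a) ∧ (∀ x, Φ (E.pw x 1) = z x) ∧
      ∀ i u, u ∈ U.gr i → Φ u ∈ U.gr i := by
  have hzn : ∀ x n, z x ^ n ∈ U.gr (n * E.deg x) := by
    intro x n
    have := SetLike.pow_mem_graded n (hz x)
    rwa [smul_eq_mul] at this
  have hodd : ∀ x, Odd (E.deg x) → ∀ n, 2 ≤ n → z x ^ n = 0 := by
    intro x hx n hn
    obtain ⟨m, rfl⟩ := Nat.exists_eq_add_of_le hn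
    rw [pow_add, pow_two, U.sq_zero hx (hz x), zero_mul]
  have F : IsFamily A E.deg E.divided E.incl.toRingHom fun x n => z x ^ n :=
    { zero := fun x => pow_zero _
      coef := fun x n ha => U.comm (E.incl.map_gr ha) (hzn x n)
      comm := fun m n _ => U.comm (hzn _ m) (hzn _ n)
      mul := fun x m n => by
        rw [structConst, ← pow_add]
        split_ifs with h1 h2 h3
        · rw [one_smul]
        · rw [zero_smul, hodd x h1 _ (by omega)]
        · exact absurd h3 ((hdiv x).resolve_right h1)
        · rw [one_smul] }
  obtain ⟨Φ, h1, h2⟩ := E.exists_lift F hodd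
  refine ⟨Φ, h1, fun x => by rw [h2, pow_one], fun i u hu => ?_⟩
  rw [E.rep_sum u, Finsupp.sum, map_sum]
  refine sum_mem fun e he => ?_
  have hle : wdeg E.deg e.1 ≤ i := by
    by_contra h
    exact Finsupp.mem_support_iff.1 he (E.rep_eq_zero hu (not_le.1 h))
  have h3 : Φ (E.mon e) ∈ U.gr (wdeg E.deg e.1) := by
    have h : wdeg E.deg e.1 = (e.1.support.sort.map fun x => e.1 x * E.deg x).sum := by
      rw [wdeg_apply, ← Finset.sum_map_toList]
      exact (List.Perm.map _ (Finset.sort_perm_toList _ _).symm).sum_eq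
    rw [h, mon, IsFamily.map_mono]
    simp only [h2]
    exact SetLike.list_prod_map_mem_graded _ _ _ fun x _ => hzn x _
  have h4 := U.mul_mem' (E.incl.map_gr (E.rep_mem hu e)) h3
  rw [Nat.sub_add_cancel hle] at h4
  rw [map_mul, h1]
  exact h4

end General

section Tower

variable {A : CDGA.{u}} {B : CDGA.{v}} {C : CDGA.{x}} (E : SemifreeExt.{u, v, w} A B)
  (F : SemifreeExt.{v, x, y} B C)

/-- The variables of a tower that belong to `P` or to `P'`. -/
def towerSet (P : Set E.Var) (P' : Set F.Var) : Set (tower E F).Var :=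
  {z | Sum.elim (· ∈ P) (· ∈ P') (ofLex z)}

theorem mem_spnRing_tower {P : Set E.Var} {P' : Set F.Var} {u : C} :
    u ∈ (tower E F).fam.spnRing (towerSet E F P P') ↔
      u ∈ F.fam.spnRing P' ∧ ∀ f, F.rep u f ∈ E.fam.spnRing P := by
  simp only [mem_spnRing_iff]
  constructor
  · refine fun h => ⟨fun f hf y hy => ?_, fun f e he x hx => ?_⟩
    · by_contra hfy
      refine hf (E.ext_rep fun e => ?_)
      by_contra he
      rw [map_zero, Finsupp.zero_apply, ← tower_rep] at he
      exact hfy (h _ he (Sum.inrₗ y) hy)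
    · rw [← tower_rep] at he
      exact h _ he (Sum.inlₗ x) hx
  · rintro ⟨h1, h2⟩ m hm z hz
    obtain ⟨e, f, rfl⟩ := exists_tAdm E F m
    rw [tower_rep] at hm
    rcases z with x | y
    · exact h2 f e hm x hz
    · refine h1 f (fun h0 => hm ?_) y hz
      rw [h0, map_zero]; rfl

theorem incl_mem_spnRing_tower {P : Set E.Var} {b : B} (hb : b ∈ E.fam.spnRing P) (P' : Set F.Var) :
    F.incl b ∈ (tower E F).fam.spnRing (towerSet E F P P') := by
  classical
  rw [mem_spnRing_tower]
  refine ⟨F.incl_mem_spnRing _ b, fun f => ?_⟩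
  rw [rep_incl, Finsupp.single_apply]
  split_ifs
  exacts [hb, zero_mem _]

end Tower

theorem coe_toFilt {A : CDGA.{u}} {U : CDGA.{v}} (E : SemifreeExt.{u, v, w} A U) (i : ℕ) (a : A) :
    (E.toFilt i a).1 = E.incl a := rfl

theorem coe_filtIncl {A : CDGA.{u}} {U : CDGA.{v}} (E : SemifreeExt.{u, v, w} A U) (i : ℕ)
    (u : E.filt i) : (E.filtIncl i u).1 = u.1 :=
  Subring.coe_inclusion (E.filtSubring_mono i.le_succ) u

/-- The linear coefficients do not change, up to constant terms and signs, when variables in `P` are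
moved to the coefficients. -/
theorem const_subExt_rep_varAdm {A : CDGA.{u}} {U : CDGA.{v}} (E : SemifreeExt.{u, v, w} A U)
    {P : Set E.Var} (hP : ∀ x ∈ P, U.d (E.pw x 1) ∈ E.fam.spnRing P) (u : U) (x : {x // x ∉ P}) :
    ∃ k : ℕ, E.const ((E.subExt P hP).rep u ((E.subExt P hP).varAdm x)).1 =
      (-1) ^ k * E.rep u (E.varAdm x.1) := by
  classical
  have h0 : ∀ z ∈ P, (E.varAdm x.1).1 z = 0 := by
    intro z hz
    refine Finsupp.single_eq_of_ne ?_
    rintro rfl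
    exact x.2 hz
  obtain ⟨e, he⟩ := E.exists_extAdm h0
  have h1 : e = (E.subExt P hP).varAdm x := by
    refine Subtype.ext (Finsupp.ext fun z => ?_)
    rw [← E.extAdm_apply, he]
    change Finsupp.single x.1 1 z.1 = Finsupp.single x 1 z
    simp only [Finsupp.single_apply, Subtype.ext_iff]
  have h2 := E.subExt_rep P hP u e
  rw [he, h1] at h2
  rw [h2, const_apply]
  exact E.rep_split u h0 (fun _ _ => rfl) (zero_add _).symm

/-! ### The fibers `k ⊗_{V(i)} V` and the morphisms to them -/

section Fiber

variable {R : CDGA.{u}} [R.IsLocal] {V : CDGA.{v}} [V.IsLocal] (M : SemifreeExt.{u, v, w} R V)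

theorem d_pw_mem_spnRing_deg_le (i : ℕ) :
    ∀ x ∈ {x | M.deg x ≤ i}, V.d (M.pw x 1) ∈ M.fam.spnRing {x | M.deg x ≤ i} := by
  intro x hx
  rw [← filtSubring_eq]
  exact M.filt_d i _ (M.pw_mem_filt hx 1)

/-- A semifree extension `V` of `R` as a semifree extension of `V(i)`. -/
abbrev filtExt (i : ℕ) : SemifreeExt.{v, v, w}
    (M.subAlg {x | M.deg x ≤ i} (M.d_pw_mem_spnRing_deg_le i)) V :=
  M.subExt _ (M.d_pw_mem_spnRing_deg_le i)

/-- The elements of `𝔪_{V(i)} V` have coefficients in the maximal ideal of `V(i)`. -/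
theorem filtExt_rep_mem_maxIdeal {i : ℕ} {v : V} (hv : v ∈ M.fiberIdeal i)
    (e : Adm (M.filtExt i).deg) : ((M.filtExt i).rep v e).1 ∈ V.maxIdeal := by
  have key : ∀ g ∈ M.fiberSet i, ∀ b : V, ((M.filtExt i).rep (b * g) e).1 ∈ V.maxIdeal := by
    intro g hg b
    refine homogeneous_induction
      (p := fun b => ((M.filtExt i).rep (b * g) e).1 ∈ V.maxIdeal) b ?_ ?_ ?_
    · rw [zero_mul, map_zero]; exact zero_mem _
    · intro b c hb hc
      rw [add_mul, map_add, Finsupp.add_apply]; exact add_mem hb hc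
    · intro j b hb
      have hg' : g ∈ M.fam.spnRing {x | M.deg x ≤ i} := by rw [← filtSubring_eq]; exact hg.1
      let g' : M.subAlg {x | M.deg x ≤ i} (M.d_pw_mem_spnRing_deg_le i) := ⟨g, hg'⟩
      have h1 : (M.filtExt i).rep (b * (M.filtExt i).incl g') e =
          (M.subAlg {x | M.deg x ≤ i} (M.d_pw_mem_spnRing_deg_le i)).sgn j g' * (M.filtExt i).rep b e := by
        rw [V.mul_comm_sgn' _ hb, ← (M.filtExt i).incl.map_sgn, rep_incl_mul]
      have h2 : ((M.subAlg {x | M.deg x ≤ i} (M.d_pw_mem_spnRing_deg_le i)).sgn j g').1 =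
          V.sgn j g := (M.filtExt i).incl.map_sgn j g'
      change (M.filtExt i).rep (b * g) e = _ at h1
      rw [h1]
      change (Subring.subtype _ _) * _ ∈ _
      refine Ideal.mul_mem_right _ _ ?_
      change ((M.subAlg {x | M.deg x ≤ i} (M.d_pw_mem_spnRing_deg_le i)).sgn j g').1 ∈ _
      rw [h2]
      exact sgn_mem_maxIdeal j hg.2
  suffices H : ∀ b, ((M.filtExt i).rep (b * v) e).1 ∈ V.maxIdeal by
    have := H 1
    rwa [one_mul] at this
  induction hv using Submodule.span_induction with
  | mem x hx => exact key x hx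
  | zero => intro b; rw [mul_zero, map_zero]; exact zero_mem _
  | add x y _ _ hx hy =>
    intro b
    rw [mul_add, map_add, Finsupp.add_apply]; exact add_mem (hx _) (hy _)
  | smul c x _ hx => intro b; rw [smul_eq_mul, ← mul_assoc]; exact hx _

/-- The linear coefficients outside `V(i)` of an element of `𝔪_{V(i)} V` are in the maximal
ideal. -/
theorem rep_varAdm_mem_of_mem_fiberIdeal {i : ℕ} {v : V} (hv : v ∈ M.fiberIdeal i) {x : M.Var}
    (hx : i < M.deg x) : M.rep v (M.varAdm x) ∈ R.maxIdeal := by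
  obtain ⟨k, hk⟩ := M.const_subExt_rep_varAdm (M.d_pw_mem_spnRing_deg_le i) v ⟨x, not_le.2 hx⟩
  have h1 := (M.const_mem_maxIdeal_iff _).2 (M.filtExt_rep_mem_maxIdeal hv
    ((M.filtExt i).varAdm ⟨x, not_le.2 hx⟩))
  rw [hk] at h1
  rw [← neg_one_pow_mul_self k (M.rep v (M.varAdm x))]
  exact Ideal.mul_mem_left _ _ h1

/-- In degree `i + 1` this condition is also sufficient: the other coefficients over `V(i)` have
positive degree. -/
theorem mem_fiberIdeal_of_rep_varAdm_mem {i : ℕ} {v : V} (hv : v ∈ V.gr (i + 1))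
    (h : ∀ x, M.deg x = i + 1 → M.rep v (M.varAdm x) ∈ R.maxIdeal) : v ∈ M.fiberIdeal i := by
  rw [(M.filtExt i).rep_sum v]
  refine sum_mem fun e he => ?_
  refine Ideal.mul_mem_right _ _ (Ideal.subset_span ⟨?_, ?_⟩)
  · rw [filtSubring_eq]; exact ((M.filtExt i).rep v e).2
  have h1 : ((M.filtExt i).rep v e).1 ∈ V.gr (i + 1 - wdeg (M.filtExt i).deg e.1) :=
    (M.filtExt i).rep_mem hv e
  have h2 : wdeg (M.filtExt i).deg e.1 ≤ i + 1 := by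
    by_contra h2
    exact Finsupp.mem_support_iff.1 he ((M.filtExt i).rep_eq_zero hv (not_le.1 h2))
  rcases h2.lt_or_eq with h3 | h3
  · exact mem_maxIdeal_of_mem_gr (by omega) h1
  · have h4 : e.1 ≠ 0 := by
      intro h4; rw [h4, map_zero] at h3; omega
    obtain ⟨x, hx⟩ := Finsupp.support_nonempty_iff.2 h4
    have h5 := Finsupp.mem_support_iff.1 hx
    have h6 : M.deg x.1 ≤ wdeg (M.filtExt i).deg e.1 :=
      deg_le_wdeg (M.filtExt i).deg e.1 h5
    have h7 : i < M.deg x.1 := not_le.1 x.2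
    have h8 : M.deg x.1 = i + 1 := by omega
    have h9 : e = (M.filtExt i).varAdm x :=
      (M.filtExt i).eq_varAdm h5 (h3.le.trans h8.ge)
    obtain ⟨k, hk⟩ := M.const_subExt_rep_varAdm (M.d_pw_mem_spnRing_deg_le i) v x
    rw [h9, ← M.const_mem_maxIdeal_iff]
    exact hk ▸ Ideal.mul_mem_left _ _ (h x.1 h8)

theorem fiberMap_toFiber (i : ℕ) (v : V) : M.fiberMap i (M.toFiber i v) = M.toFiber (i + 1) v := rfl

section Map

variable {U : CDGA.{x}} [U.IsLocal] (T : SemifreeExt.{v, x, y} V U)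

/-- On `T(i + 1)` the projection to `V` is compatible with the differentials modulo
`𝔪_{V(i)} V`. -/
theorem const_d_sub_mem_fiberIdeal (i : ℕ) {u : U} (hu : u ∈ T.filtSubring (i + 1)) :
    T.const (U.d u) - V.d (T.const u) ∈ M.fiberIdeal i := by
  rw [filtSubring_eq] at hu
  refine T.const_d_sub_mem _ (fun x hx => ?_) u hu
  have h1 : U.d (T.pw x 1) ∈ U.gr (T.deg x - 1) := by
    refine U.d_mem ?_
    have := T.pw_mem x 1
    rwa [one_mul, ← Nat.sub_add_cancel (T.deg_pos x)] at this
  -- the constant term of `d y` has degree at most `i` and is in the maximal ideal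
  have hx' : T.deg x ≤ i + 1 := hx
  exact Ideal.subset_span ⟨M.mem_filt_of_deg (by omega) (T.const_mem h1),
    (T.const_mem_maxIdeal_iff _).2 (U.d_mem_maxIdeal _)⟩

/-- The projection to `V` lifts cycles: cycles of `T(i + 1)` with projection in `𝔪_{V(i)} V` bound
elements of `T(i + 1)` of the same kind. -/
def LiftsCycles (i : ℕ) : Prop :=
  ∀ u ∈ T.filtSubring (i + 1), U.d u = 0 → T.const u ∈ M.fiberIdeal i →
    ∃ w ∈ T.filtSubring (i + 1), T.const w ∈ M.fiberIdeal i ∧ U.d w = u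

variable {K : CDGA.{z}} (F : SemifreeExt.{z, x, y'} K U)
  (hF : ∀ i, F.filtSubring (i + 1) = T.filtSubring (i + 1))

/-- The morphism `U(i + 1) → k ⊗_{V(i)} V` that maps the variables of `U` over `V` to zero. Here `U`
carries two structures: `T`, over `V`, and `F`, over the Koszul complex; `hF` says that both define
the same filtration, which starts with `U(1)`. -/
def fiberHom (i : ℕ) : Hom (F.filt (i + 1)) (M.fiber i) where
  toRingHom := (Ideal.Quotient.mk (M.fiberIdeal i)).comp
    (T.const.comp (F.filtSubring (i + 1)).subtype)
  map_gr {_ a} ha := ⟨T.const a.1, T.const_mem ha, rfl⟩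
  map_d a := Ideal.Quotient.eq.2 (M.const_d_sub_mem_fiberIdeal T i (hF i ▸ a.2))

theorem fiberHom_apply (i : ℕ) (u : F.filt (i + 1)) :
    M.fiberHom T F hF i u = M.toFiber i (T.const u.1) := rfl

theorem fiberHom_surjective (i : ℕ) : Function.Surjective (M.fiberHom T F hF i) := by
  intro q
  obtain ⟨v, rfl⟩ := Ideal.Quotient.mk_surjective q
  refine ⟨⟨T.incl v, by rw [hF]; exact T.incl_mem _ v⟩, ?_⟩
  exact congrArg _ (T.const_incl v)

/-- As the morphism has the section `T.incl` on `V`, cycles and boundaries of the fiber lift to `U`,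
up to elements of the kernel, and `LiftsCycles` takes care of these. -/
theorem fiberHom_isQuasiIso {i : ℕ} (h : M.LiftsCycles T i) :
    (M.fiberHom T F hF i).IsQuasiIso := by
  constructor
  · rintro ⟨u, hu⟩ hdu ⟨b, hb⟩
    obtain ⟨b, rfl⟩ := Ideal.Quotient.mk_surjective b
    have hu' : u ∈ T.filtSubring (i + 1) := hF i ▸ hu
    have h1 : V.d b - T.const u ∈ M.fiberIdeal i := Ideal.Quotient.eq.1 hb
    have h2 : U.d (T.incl b) = T.incl (V.d b) := (T.incl.map_d b).symm
    have h3 : U.d u = 0 := congrArg Subtype.val hdu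
    obtain ⟨w, hw, -, hw'⟩ := h (u - U.d (T.incl b)) (by
        rw [h2]; exact sub_mem hu' (T.incl_mem _ _)) (by rw [map_sub, h3, U.d_d, sub_zero]) (by
        rw [h2, map_sub, const_incl, ← neg_sub]; exact neg_mem h1)
    refine ⟨⟨w + T.incl b, by rw [hF]; exact add_mem hw (T.incl_mem _ _)⟩, Subtype.ext ?_⟩
    change U.d (w + T.incl b) = u
    rw [map_add, hw', sub_add_cancel]
  · intro q hq
    obtain ⟨v, rfl⟩ := Ideal.Quotient.mk_surjective q
    have h1 : V.d v ∈ M.fiberIdeal i := Ideal.Quotient.eq_zero_iff_mem.1 hq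
    have h2 : U.d (T.incl v) = T.incl (V.d v) := (T.incl.map_d v).symm
    obtain ⟨w, hw, hcw, hw'⟩ := h (U.d (T.incl v)) (by rw [h2]; exact T.incl_mem _ _) (U.d_d _)
      (by rw [h2, const_incl]; exact h1)
    refine ⟨⟨T.incl v - w, by rw [hF]; exact sub_mem (T.incl_mem _ _) hw⟩, Subtype.ext ?_, 0, ?_⟩
    · change U.d (T.incl v - w) = 0
      rw [map_sub, hw', sub_self]
    · rw [map_zero, add_zero]
      refine Ideal.Quotient.eq.2 ?_
      change v - T.const (T.incl v - w) ∈ _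
      rw [map_sub, const_incl, sub_sub_cancel]
      exact hcw

end Map

end Fiber

end SemifreeExt

/-! ### Linear parts of differentials -/

/-- The residue map of a local ring `S`, on `S` as a dg-algebra. -/
def ofRingResidue (S : Type u) [CommRing S] [IsLocalRing S] :
    ofRing S →+* IsLocalRing.ResidueField S :=
  (IsLocalRing.residue S).comp (ofRingSelf S).symm.toRingHom

theorem ofRingResidue_eq_zero_iff {S : Type u} [CommRing S] [IsLocalRing S] [IsNoetherianRing S]
    (s : ofRing S) : ofRingResidue S s = 0 ↔ s ∈ (ofRing S).maxIdeal :=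
  (IsLocalRing.residue_eq_zero_iff (R := S) s).trans (ofRingSelf_mem_maxIdeal_iff (R := S) s).symm

theorem ofRingResidue_surjective (S : Type u) [CommRing S] [IsLocalRing S] :
    Function.Surjective (ofRingResidue S) :=
  IsLocalRing.residue_surjective (R := S)

namespace SemifreeExt

section Linear

variable {S : Type u} [CommRing S] [IsLocalRing S] [IsNoetherianRing S] {V : CDGA.{v}} [V.IsLocal]
  (M : SemifreeExt.{u, v, w} (ofRing S) V)

/-- The coefficient of the variable `x`, in the residue field. -/
def linCoef (x : M.Var) : V →+ IsLocalRing.ResidueField S :=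
  (ofRingResidue S).toAddMonoidHom.comp
    ((Finsupp.applyAddHom (M.varAdm x)).comp M.rep.toAddMonoidHom)

theorem linCoef_apply (x : M.Var) (v : V) :
    M.linCoef x v = ofRingResidue S (M.rep v (M.varAdm x)) := rfl

theorem linCoef_eq_zero_iff {x : M.Var} {v : V} :
    M.linCoef x v = 0 ↔ M.rep v (M.varAdm x) ∈ (ofRing S).maxIdeal :=
  ofRingResidue_eq_zero_iff (S := S) _

theorem linCoef_incl_mul (x : M.Var) (s : ofRing S) (v : V) :
    M.linCoef x (M.incl s * v) = ofRingResidue S s * M.linCoef x v := by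
  rw [linCoef_apply, rep_incl_mul, map_mul]; rfl

theorem linCoef_pw (x x' : M.Var) [Decidable (x' = x)] :
    M.linCoef x (M.pw x' 1) = if x' = x then 1 else 0 := by
  classical
  have h : M.rep (M.pw x' 1) = Finsupp.single (M.varAdm x') 1 := by
    rw [← rep_mon, map_one M.incl.toRingHom, one_mul, mon_varAdm]
  rw [linCoef_apply, h, Finsupp.single_apply]
  by_cases hx : x' = x
  · rw [if_pos hx, if_pos (by rw [hx]), map_one]
  · rw [if_neg hx, if_neg (fun h => hx (M.varAdm_injective h)), map_zero]

theorem linCoef_fiberIdeal {i : ℕ} {x : M.Var} (hx : i < M.deg x) {v : V}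
    (hv : v ∈ M.fiberIdeal i) : M.linCoef x v = 0 :=
  M.linCoef_eq_zero_iff.2 (M.rep_varAdm_mem_of_mem_fiberIdeal hv hx)

theorem linCoef_d (hM : M.IsMinimal) (x : M.Var) (v : V) : M.linCoef x (V.d v) = 0 :=
  M.linCoef_eq_zero_iff.2 (hM.rep_mem v _ (M.varAdm_degree x).le)

/-- The augmentation of `V` over the residue field of `S`. -/
def constResidue : V →+* IsLocalRing.ResidueField S := (ofRingResidue S).comp M.const

theorem constResidue_eq_zero_iff (v : V) : M.constResidue v = 0 ↔ v ∈ V.maxIdeal :=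
  (ofRingResidue_eq_zero_iff (S := S) _).trans (M.const_mem_maxIdeal_iff v)

variable {U : CDGA.{x}} [U.IsLocal] (T : SemifreeExt.{v, x, y} V U)

/-- The coefficients of the variables of degree `j` of `T`, in the residue field. -/
def varCoef (j : ℕ) : U →+ ({y // T.deg y = j} →₀ IsLocalRing.ResidueField S) :=
  (Finsupp.mapRange.addMonoidHom M.constResidue.toAddMonoidHom).comp
    ((Finsupp.comapDomain.addMonoidHom (f := fun y : {y // T.deg y = j} => T.varAdm y.1)
      (T.varAdm_injective.comp Subtype.val_injective)).comp T.rep.toAddMonoidHom)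

theorem varCoef_apply (j : ℕ) (u : U) (y : {y // T.deg y = j}) :
    M.varCoef T j u y = M.constResidue (T.rep u (T.varAdm y)) := rfl

/-- The linear part of the differential of the variables of `T` of degree `j + 1`, in the
coefficients of the variables of `M` of degree `j`. -/
def linMap (j : ℕ) : ({y // T.deg y = j + 1} →₀ IsLocalRing.ResidueField S) →ₗ[
    IsLocalRing.ResidueField S] ({x // M.deg x = j} → IsLocalRing.ResidueField S) :=
  Finsupp.linearCombination _ fun y x => M.linCoef x.1 (T.const (U.d (T.pw y.1 1)))

/-- By minimality of `M`, the linear part of the projection of `d u` depends only on the linear part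
of `u`. -/
theorem linMap_varCoef (hM : M.IsMinimal) {i : ℕ} {u : U} (hu : u ∈ U.gr (i + 2))
    (x : {x // M.deg x = i + 1}) :
    M.linMap T (i + 1) (M.varCoef T (i + 1 + 1) u) x = M.linCoef x.1 (T.const (U.d u)) := by
  classical
  let f : U →+ IsLocalRing.ResidueField S :=
    (M.linCoef x.1).comp (T.const.toAddMonoidHom.comp U.d)
  let g : U →+ IsLocalRing.ResidueField S :=
    (Pi.evalAddMonoidHom _ x).comp ((M.linMap T (i + 1)).toAddMonoidHom.comp
      (M.varCoef T (i + 1 + 1)))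
  suffices H : ∀ m, f (T.incl (T.rep u m) * T.mon m) = g (T.incl (T.rep u m) * T.mon m) by
    change g u = f u
    rw [T.rep_sum u, Finsupp.sum, map_sum, map_sum]
    exact Finset.sum_congr rfl fun m _ => (H m).symm
  intro m
  by_cases hm : i + 2 < wdeg T.deg m.1
  · rw [T.rep_eq_zero hu hm, map_zero T.incl.toRingHom, zero_mul, map_zero, map_zero]
  by_cases hy : ∃ y, T.deg y = i + 2 ∧ m.1 y ≠ 0
  · obtain ⟨y, hy, hmy⟩ := hy
    obtain rfl := T.eq_varAdm hmy (by omega)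
    have h0 : T.rep u (T.varAdm y) ∈ V.gr 0 := by
      have := T.rep_mem hu (T.varAdm y)
      rwa [wdeg_varAdm, hy, Nat.sub_self] at this
    have h1 : M.varCoef T (i + 1 + 1) (T.incl (T.rep u (T.varAdm y)) * T.mon (T.varAdm y)) =
        Finsupp.single ⟨y, hy⟩ (M.constResidue (T.rep u (T.varAdm y))) := by
      ext z
      rw [varCoef_apply, rep_mon, Finsupp.single_apply, Finsupp.single_apply]
      by_cases h : (⟨y, hy⟩ : {y // T.deg y = i + 2}) = z
      · subst h; simp
      · rw [if_neg h, if_neg, map_zero]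
        exact fun h' => h (Subtype.ext (T.varAdm_injective h'))
    change M.linCoef x.1 (T.const (U.d _)) = M.linMap T (i + 1) (M.varCoef T (i + 1 + 1) _) x
    rw [h1, linMap, Finsupp.linearCombination_single, U.d_mul _ (T.incl.map_gr h0),
      U.d_zero (T.incl.map_gr h0), zero_mul, zero_add, pow_zero, one_mul, map_mul, const_incl,
      Pi.smul_apply, smul_eq_mul, mon_varAdm]
    conv_lhs => rw [← M.exists_incl_eq_of_mem_zero h0]
    rw [linCoef_incl_mul]; rfl
  · have h1 : M.varCoef T (i + 1 + 1) (T.incl (T.rep u m) * T.mon m) = 0 := by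
      ext z
      rw [varCoef_apply, rep_mon, Finsupp.single_apply, if_neg, map_zero]; rfl
      rintro rfl
      exact hy ⟨z.1, z.2, by simp [varAdm]⟩
    have h2 : T.incl (T.rep u m) * T.mon m ∈ T.filtSubring (i + 1) := by
      refine mul_mem (T.incl_mem _ _) ?_
      rw [filtSubring_eq]
      refine T.mon_mem_spnRing fun z hz => ?_
      by_contra h
      have h3 := deg_le_wdeg T.deg m.1 h
      have h4 : ¬ T.deg z ≤ i + 1 := hz
      exact hy ⟨z, by omega, h⟩
    have h3 := M.linCoef_fiberIdeal (x := x.1) (by rw [x.2]; omega)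
      (M.const_d_sub_mem_fiberIdeal T i h2)
    rw [map_sub, M.linCoef_d hM, sub_zero] at h3
    change M.linCoef x.1 _ = M.linMap T (i + 1) (M.varCoef T (i + 1 + 1) _) x
    rw [h1, map_zero]
    exact h3

section Lifts

variable {k : Type*} [CommRing k] {η : U →+* k} {i : ℕ}

/-- A variable `x` of degree `i + 1` differs from a cycle by an element `w` that does not affect
linear parts, as `d x` is a cycle that is mapped to zero in the fiber. This cycle is the boundary of
an element `u`, and the linear part of `u` is a preimage of `x`. -/
theorem linMap_surjective (hη : IsResolution U η) (hM : M.IsMinimal)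
    (h : M.LiftsCycles T i) [Finite {x // M.deg x = i + 1}] :
    Function.Surjective (M.linMap T (i + 1)) := by
  classical
  have := Fintype.ofFinite {x // M.deg x = i + 1}
  rw [← LinearMap.range_eq_top, eq_top_iff, ← (Pi.basisFun _ _).span_eq, Submodule.span_le]
  rintro _ ⟨x, rfl⟩
  have hx : M.pw x.1 1 ∈ V.gr (i + 1) := by
    have := M.pw_mem x.1 1
    rwa [one_mul, x.2] at this
  have h1 : V.d (M.pw x.1 1) ∈ M.fiberIdeal i :=
    Ideal.subset_span ⟨M.mem_filt_of_deg le_rfl (V.d_mem hx), V.d_mem_maxIdeal _⟩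
  obtain ⟨w, hw, hcw, hdw⟩ := h (T.incl (V.d (M.pw x.1 1))) (T.incl_mem _ _)
    (by rw [T.incl.map_d, U.d_d]) (by rw [const_incl]; exact h1)
  have h2 : U.d (T.incl (M.pw x.1 1) - w) = 0 := by
    rw [map_sub, hdw, T.incl.map_d, sub_self]
  obtain ⟨u, hu, hdu⟩ := hη.exact_gr (U.pr_mem (i + 1) (T.incl (M.pw x.1 1) - w))
    (d_pr_of_d_eq_zero h2 _) (hη.pos (by omega) (U.pr_mem _ _))
  refine ⟨M.varCoef T (i + 1 + 1) u, funext fun x' => ?_⟩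
  rw [M.linMap_varCoef T hM hu, hdu, const_pr, map_sub, const_incl, map_sub, V.pr_same hx, map_sub,
    linCoef_pw, M.linCoef_fiberIdeal (i := i) (by rw [x'.2]; omega)
      (V.span_pr_mem _ (M.fiberSet_pr i) _ hcw _), sub_zero, Pi.basisFun_apply, Pi.single_apply]
  simp only [Subtype.ext_iff, eq_comm]

/-- If the projection of the differential of a combination `u` of variables of degree `i + 2` has no
linear part, it is zero in the fiber, so `d u = d w` with `w` in `T(i + 1)`. Then `u - w` is a
boundary, and by minimality `u` has coefficients in the maximal ideal. -/
theorem linMap_injective (hη : IsResolution U η) (hM : M.IsMinimal)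
    (h : M.LiftsCycles T i)
    (hT : ∀ u y, T.deg y = i + 2 → T.rep (U.d u) (T.varAdm y) ∈ V.maxIdeal) :
    Function.Injective (M.linMap T (i + 1)) := by
  classical
  rw [injective_iff_map_eq_zero]
  intro a ha
  obtain ⟨b, rfl⟩ := Finsupp.mapRange_surjective (α := {y // T.deg y = i + 1 + 1})
    (ofRingResidue S) (map_zero _) (ofRingResidue_surjective S) a
  set u : U := b.sum fun y s => T.incl (M.incl s) * T.pw y.1 1 with hu_def
  have hu : u ∈ U.gr (i + 2) := by
    refine sum_mem fun y _ => ?_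
    have h1 := U.mul_mem' (T.incl.map_gr (M.incl.map_gr (mem_trivGr_zero (R := S) (b y))))
      (T.pw_mem y.1 1)
    rwa [one_mul, zero_add, y.2] at h1
  have hrep : ∀ y : {y // T.deg y = i + 2}, T.rep u (T.varAdm y) = M.incl (b y) := by
    intro y
    have h1 : ∀ y' : {y // T.deg y = i + 2}, T.rep (T.incl (M.incl (b y')) * T.pw y'.1 1)
        (T.varAdm y.1) = if y' = y then M.incl (b y') else 0 := by
      intro y'
      rw [← mon_varAdm, rep_mon, Finsupp.single_apply]
      by_cases hy : y' = y
      · rw [if_pos hy, if_pos (by rw [hy])]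
      · rw [if_neg hy, if_neg fun h => hy (Subtype.ext (T.varAdm_injective h))]
    rw [hu_def, Finsupp.sum, map_sum, Finsupp.finsetSum_apply, Finset.sum_congr rfl fun y' _ => h1 y',
      Finset.sum_ite_eq']
    split_ifs with h2
    · rfl
    · rw [Finsupp.notMem_support_iff.1 h2, map_zero M.incl.toRingHom]
  have hq : M.varCoef T (i + 1 + 1) u = Finsupp.mapRange (ofRingResidue S) (map_zero _) b := by
    ext y
    rw [varCoef_apply, hrep, Finsupp.mapRange_apply, constResidue, RingHom.comp_apply, const_incl]
  -- the projection of `d u` has no linear part, so it is zero in the fiber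
  have h1 : T.const (U.d u) ∈ M.fiberIdeal i := by
    refine M.mem_fiberIdeal_of_rep_varAdm_mem (T.const_mem (U.d_mem hu)) fun x hx => ?_
    rw [← linCoef_eq_zero_iff, ← M.linMap_varCoef T hM hu ⟨x, hx⟩, hq, ha]; rfl
  obtain ⟨w, hw, -, hdw⟩ := h _ (T.mem_filt_of_deg le_rfl (U.d_mem hu)) (U.d_d u) h1
  have h2 : U.d (u - w) = 0 := by rw [map_sub, hdw, sub_self]
  obtain ⟨z, -, hz⟩ := hη.exact_gr (U.pr_mem (i + 2) (u - w))
    (d_pr_of_d_eq_zero h2 _) (hη.pos (by omega) (U.pr_mem _ _))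
  rw [← hq]
  ext y
  rw [varCoef_apply, Finsupp.zero_apply, constResidue_eq_zero_iff]
  have h3 : T.rep (U.pr (i + 2) w) (T.varAdm y) = 0 := by
    by_contra h4
    have h5 := T.filt_pr _ _ hw (i + 2)
    rw [filtSubring_eq, mem_spnRing_iff] at h5
    have h6 := h5 _ h4 y.1 (by
      change ¬ T.deg y.1 ≤ i + 1
      rw [y.2]; omega)
    simp [varAdm] at h6
  have h4 : U.d z = u - U.pr (i + 2) w := by rw [hz, map_sub, U.pr_same hu]
  have h5 := hT z y.1 y.2
  rw [h4, map_sub, Finsupp.sub_apply, h3, sub_zero] at h5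
  exact h5

/-- The variables of degree `j` of `M` match those of degree `j + 1` of `T`: modulo the maximal
ideal and decomposable elements, the projections of the differentials of the latter form a basis of
the space spanned by the former. -/
def VarsMatch (j : ℕ) : Prop :=
  ∃ β : {x // M.deg x = j} ≃ {y // T.deg y = j + 1}, ∀ x : {x // M.deg x = j},
    ∃ a : {x // M.deg x = j} →₀ ofRing S, ∀ x' : {x // M.deg x = j},
      M.linCoef x'.1 (M.pw x.1 1 - a.sum fun x s => M.incl s * T.const (U.d (T.pw (β x).1 1))) = 0

/-- The linear part of the differential is bijective, and so gives a bijection between bases. -/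
theorem varsMatch_of_liftsCycles (hη : IsResolution U η) (hM : M.IsMinimal)
    (h : M.LiftsCycles T i)
    (hT : ∀ u y, T.deg y = i + 2 → T.rep (U.d u) (T.varAdm y) ∈ V.maxIdeal) :
    M.VarsMatch T (i + 1) := by
  classical
  have : Finite {x // M.deg x = i + 1} := hM.finite_deg (grMod_ofRing_fg S) (i + 1)
  have := Fintype.ofFinite {x // M.deg x = i + 1}
  have hs := M.linMap_surjective T hη hM h
  let L := LinearEquiv.ofBijective (M.linMap T (i + 1)) ⟨M.linMap_injective T hη hM h hT, hs⟩
  let β : {x // M.deg x = i + 1} ≃ {y // T.deg y = i + 1 + 1} :=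
    ((Pi.basisFun (IsLocalRing.ResidueField S) _).map L.symm).indexEquiv
      Finsupp.basisSingleOne
  refine ⟨β, fun x => ?_⟩
  obtain ⟨b, hb⟩ := hs (Pi.single x 1)
  obtain ⟨a, ha⟩ := Finsupp.mapRange_surjective (α := {x // M.deg x = i + 1})
    (ofRingResidue S) (map_zero _) (ofRingResidue_surjective S) (Finsupp.equivMapDomain β.symm b)
  refine ⟨a, fun x' => ?_⟩
  have h1 : b = Finsupp.equivMapDomain β (Finsupp.mapRange (ofRingResidue S) (map_zero _) a) := by
    rw [ha, ← Finsupp.equivMapDomain_trans]; simp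
  rw [map_sub, sub_eq_zero, linCoef_pw, Finsupp.sum, map_sum]
  have h2 := congrFun hb x'
  rw [h1, linMap, Finsupp.linearCombination_equivMapDomain, Finsupp.linearCombination_apply,
    Finsupp.sum_mapRange_index (by simp), Finsupp.sum, Finset.sum_apply, Pi.single_apply] at h2
  simp only [linCoef_incl_mul]
  simp only [Subtype.ext_iff] at h2
  simp only [eq_comm] at h2 ⊢
  refine Eq.trans ?_ h2
  rfl

end Lifts

end Linear

/-! ### Lifting cycles when the variables match -/

section Tower

variable {R : CDGA.{u}} {V : CDGA.{v}} {U : CDGA.{x}} (M : SemifreeExt.{u, v, w} R V)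
  (T : SemifreeExt.{v, x, y} V U)

/-- The variables of degree less than `j` of `M` and of degree at most `j` of `T`. -/
def stage (j : ℕ) : Set (tower M T).Var := towerSet M T {x | M.deg x < j} {y | T.deg y ≤ j}

theorem stage_mono {i j : ℕ} (h : i ≤ j) : stage M T i ⊆ stage M T j := by
  rintro (x | y) hz
  · exact lt_of_lt_of_le (show M.deg x < i from hz) h
  · exact (show T.deg y ≤ i from hz).trans h

theorem incl_mem_spnRing_stage {l j : ℕ} (h : l < j) {v : V} (hv : v ∈ V.gr l) :
    T.incl v ∈ (tower M T).fam.spnRing (stage M T j) := by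
  refine incl_mem_spnRing_tower M T (M.spnRing_mono (fun x (hx : M.deg x ≤ l) => ?_)
    ((M.filtSubring_eq l).le (M.mem_filt_of_deg le_rfl hv))) _
  exact lt_of_le_of_lt hx h

/-- Up to its projection to `V`, an element of degree `j` involves variables of `T`, hence only
variables of `M` of degree less than `j`. -/
theorem sub_incl_const_mem_spnRing_stage {j : ℕ} {u : U} (hu : u ∈ U.gr j) :
    u - T.incl (T.const u) ∈ (tower M T).fam.spnRing (stage M T j) := by
  classical
  refine (mem_spnRing_tower M T).2 ⟨sub_mem ((T.filtSubring_eq j).le (T.mem_filt_of_deg le_rfl hu))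
    (T.incl_mem_spnRing _ _), fun f => ?_⟩
  rw [map_sub, Finsupp.sub_apply, rep_incl]
  by_cases hf : f = T.zeroAdm
  · rw [hf, Finsupp.single_eq_same, const_apply, sub_self]; exact zero_mem _
  rw [Finsupp.single_apply, if_neg (Ne.symm hf), sub_zero]
  have h0 : 0 < wdeg T.deg f.1 := by
    obtain ⟨y, hy⟩ := Finsupp.support_nonempty_iff.2 fun h : f.1 = 0 => hf (Subtype.ext h)
    exact (T.deg_pos y).trans_le (deg_le_wdeg _ _ (Finsupp.mem_support_iff.1 hy))
  by_cases hj : j < wdeg T.deg f.1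
  · rw [T.rep_eq_zero hu hj]; exact zero_mem _
  · refine M.spnRing_mono (fun x hx => ?_)
      ((M.filtSubring_eq _).le (M.mem_filt_of_deg le_rfl (T.rep_mem hu f)))
    have hx' : M.deg x ≤ j - wdeg T.deg f.1 := hx
    change M.deg x < j
    omega

theorem pw_one_mem {A : CDGA.{u}} {U : CDGA.{v}} (E : SemifreeExt.{u, v, w} A U) (x : E.Var) :
    E.pw x 1 ∈ U.gr (E.deg x) := by
  have := E.pw_mem x 1
  rwa [one_mul] at this

theorem d_pw_one_mem {A : CDGA.{u}} {U : CDGA.{v}} (E : SemifreeExt.{u, v, w} A U) (x : E.Var) :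
    U.d (E.pw x 1) ∈ U.gr (E.deg x - 1) := by
  refine U.d_mem ?_
  rw [Nat.sub_add_cancel (E.deg_pos x)]; exact E.pw_one_mem x

theorem d_pw_mem_spnRing_stage (j : ℕ) : ∀ z ∈ stage M T j,
    U.d ((tower M T).pw z 1) ∈ (tower M T).fam.spnRing (stage M T j) := by
  rintro (x | y) hz
  · change U.d (T.incl (M.pw x 1)) ∈ _
    have hx : M.deg x < j := hz
    rw [← T.incl.map_d]
    exact incl_mem_spnRing_stage M T (by omega) (M.d_pw_one_mem x)
  · change U.d (T.pw y 1) ∈ _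
    have hy : T.deg y ≤ j := hz
    have hy' := T.deg_pos y
    rw [← sub_add_cancel (U.d (T.pw y 1)) (T.incl (T.const (U.d (T.pw y 1))))]
    exact add_mem ((tower M T).spnRing_mono (stage_mono M T (by omega))
      (sub_incl_const_mem_spnRing_stage M T (T.d_pw_one_mem y)))
      (incl_mem_spnRing_stage M T (by omega) (T.const_mem (T.d_pw_one_mem y)))

end Tower

section Acyclic

variable {S : Type u} [CommRing S] [IsRegularLocalRing S] {t : Fin (embDim S) → S}
  (ht : Ideal.span (Set.range t) = IsLocalRing.maximalIdeal S)
  {V : CDGA.{v}} [V.IsLocal] (M : SemifreeExt.{u, v, w} (ofRing S) V)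
  {U : CDGA.{x}} [U.IsLocal] (T : SemifreeExt.{v, x, y} V U)
  {k : Type*} [CommRing k] {η : U →+* k} (hη : IsResolution U η)
  (hη0 : ∀ u, η u = 0 ↔ u ∈ U.maxIdeal)
  {e : Fin (embDim S) → T.Var} (he : Function.Injective e)
  (hed : ∀ y, T.deg y ≤ 1 ↔ ∃ j, e j = y)
  (hde : ∀ j, U.d (T.pw (e j) 1) = T.incl (M.incl (ofRingSelf S (t j))))
  (hMdiv : M.divided = ∅) (hMfin : ∀ j, Finite {x // M.deg x = j}) (hTdiv : ∀ y, Even (T.deg y) → y ∈ T.divided)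
  {i : ℕ} (hm : ∀ j, 0 < j → j ≤ i → ∃ β : {x // M.deg x = j} ≃ {y // T.deg y = j + 1},
    ∀ x, M.pw x.1 1 = T.const (U.d (T.pw (β x).1 1)))

include ht hη hη0 he hed hde hMdiv hMfin hTdiv hm in
/-- Each stage is a resolution of the residue field: the first one is the Koszul complex of `S`, and
each of the others arises from the preceding one by adjoining contractible pairs. -/
theorem exists_d_eq_of_mem_stage : ∀ j ≤ i, ∀ u ∈ (tower M T).fam.spnRing (stage M T (j + 1)),
    U.d u = 0 → η u = 0 → ∃ w ∈ (tower M T).fam.spnRing (stage M T (j + 1)), U.d w = u := by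
  classical
  intro j
  induction j with
  | zero =>
    intro _ u hu hdu hηu
    have h1 : (stage M T 1 : Set (tower M T).Var) =
        (fun j => (Sum.inrₗ (e j) : (tower M T).Var)) '' (Finset.univ : Finset (Fin (embDim S))) := by
      ext z
      rw [Finset.coe_univ, Set.image_univ]
      change _ ↔ ∃ j, (Sum.inrₗ (e j) : (tower M T).Var) = z
      rcases z with x | y
      · refine ⟨fun hz => absurd (show M.deg x < 1 from hz) (by have := M.deg_pos x; omega), ?_⟩
        rintro ⟨j, hj⟩; cases hj
      · refine (hed y).trans (exists_congr fun j => ⟨fun h => by rw [h]; rfl, fun h => ?_⟩)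
        exact Sum.inr.inj h
    rw [zero_add, h1] at hu ⊢
    refine koszul_exact (t := t) ht (tower M T) (e := fun j => Sum.inrₗ (e j))
      (fun a b h => he (Sum.inr.inj h)) (fun j => ?_) hde Finset.univ u hu hdu ?_
    · have h2 : T.deg (e j) ≤ 1 := (hed _).2 ⟨j, rfl⟩
      have h3 := T.deg_pos (e j)
      change T.deg (e j) = 1
      omega
    · refine ⟨(ofRingSelf S).symm ((tower M T).const (U.pr 0 u)), ?_, ?_⟩
      · rw [Finset.coe_univ, Set.image_univ, ht, ← ofRingSelf_mem_maxIdeal_iff,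
          RingEquiv.apply_symm_apply, const_mem_maxIdeal_iff, ← mem_maxIdeal_iff_pr, ← hη0]
        exact hηu
      · rw [RingEquiv.apply_symm_apply, (tower M T).exists_incl_eq_of_mem_zero (U.pr_mem 0 u)]
  | succ j ih =>
    intro hj u hu hdu hηu
    obtain ⟨β, hβ⟩ := hm (j + 1) (by omega) hj
    have := hMfin (j + 1)
    have := Fintype.ofFinite {x // M.deg x = j + 1}
    let xs : {x // M.deg x = j + 1} → (tower M T).Var := fun x => Sum.inlₗ x.1
    let ys : {x // M.deg x = j + 1} → (tower M T).Var := fun x => Sum.inrₗ (β x).1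
    have hP : (stage M T (j + 1 + 1) : Set (tower M T).Var) =
        (tower M T).withPairs (stage M T (j + 1)) xs ys Finset.univ := by
      ext z
      constructor
      · rcases z with x | y
        · intro hz
          have hz' : M.deg x < j + 1 + 1 := hz
          by_cases h : M.deg x = j + 1
          · exact Or.inr (Or.inl ⟨⟨x, h⟩, by simp, rfl⟩)
          · exact Or.inl (show M.deg x < j + 1 by omega)
        · intro hz
          have hz' : T.deg y ≤ j + 1 + 1 := hz
          by_cases h : T.deg y = j + 1 + 1
          · exact Or.inr (Or.inr ⟨β.symm ⟨y, h⟩, by simp, by simp [ys]; rfl⟩)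
          · exact Or.inl (show T.deg y ≤ j + 1 by omega)
      · rintro (hz | ⟨x, -, rfl⟩ | ⟨x, -, rfl⟩)
        · exact stage_mono M T (by omega) hz
        · change M.deg x.1 < _
          rw [x.2]; omega
        · exact (β x).2.le
    have hdx : ∀ x, U.d ((tower M T).pw (xs x) 1) ∈
        (tower M T).fam.spnRing (stage M T (j + 1)) := by
      intro x
      change U.d (T.incl (M.pw x.1 1)) ∈ _
      rw [← T.incl.map_d]
      exact incl_mem_spnRing_stage M T (by rw [x.2]; omega) (M.d_pw_one_mem x.1)
    have hdy : ∀ x, U.d ((tower M T).pw (ys x) 1) - (tower M T).pw (xs x) 1 ∈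
        (tower M T).fam.spnRing (stage M T (j + 1)) := by
      intro x
      change U.d (T.pw (β x).1 1) - T.incl (M.pw x.1 1) ∈ _
      rw [hβ]
      refine sub_incl_const_mem_spnRing_stage M T ?_
      have := T.d_pw_one_mem (β x).1
      rwa [(β x).2] at this
    have h1 := (tower M T).exists_sub_d_mem_of_withPairs
      (d_pw_mem_spnRing_stage M T (j + 1)) hdx hdy
      (fun x (h : M.deg x.1 < j + 1) => by rw [x.2] at h; omega)
      (fun x (h : T.deg (β x).1 ≤ j + 1) => by rw [(β x).2] at h; omega)
      (fun a b h => Subtype.ext (Sum.inl.inj h))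
      (fun a b h => β.injective (Subtype.ext (Sum.inr.inj h)))
      (fun a b h => by cases h)
      (fun x => by
        change T.deg (β x).1 = M.deg x.1 + 1
        rw [(β x).2, x.2])
      (fun x => by
        rcases Nat.even_or_odd (M.deg x.1) with h | h
        · exact Or.inl ⟨h, fun h' : x.1 ∈ M.divided => by rw [hMdiv] at h'; exact h'⟩
        · refine Or.inr ⟨h, hTdiv (β x).1 ?_⟩
          rw [(β x).2, ← x.2]; exact h.add_one)
      Finset.univ u (by rw [← hP]; exact hu) (by rw [hdu]; exact zero_mem _)
    obtain ⟨w, hw, hw'⟩ := h1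
    obtain ⟨w', hw1, hw2⟩ := ih (by omega) _ hw' (by rw [map_sub, hdu, U.d_d, sub_zero])
      (by rw [map_sub, hηu, hη.d, sub_zero])
    refine ⟨w + w', add_mem (by rw [hP]; exact hw)
      ((tower M T).spnRing_mono (stage_mono M T (by omega)) hw1), ?_⟩
    rw [map_add, hw2, add_sub_cancel]

/-- The filtration of `S[X]`, hence `𝔪_{V(i)} V`, does not depend on the choice of the variables. -/
theorem filtSubring_eq_closure_gr (hMdiv : M.divided = ∅) (i : ℕ) :
    M.filtSubring i = Subring.closure {v | ∃ j ≤ i, v ∈ V.gr j} := by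
  refine le_antisymm (Subring.closure_le.2 ?_) (Subring.closure_le.2 ?_)
  · rintro _ (⟨s, rfl⟩ | ⟨x, n, hx, rfl⟩)
    · exact Subring.subset_closure ⟨0, i.zero_le, M.incl.map_gr (mem_trivGr_zero (R := S) s)⟩
    · rw [M.pw_pow x n (Or.inl (by rw [hMdiv]; exact id))]
      have h : M.pw x 1 ∈ Subring.closure {v | ∃ j ≤ i, v ∈ V.gr j} :=
        Subring.subset_closure ⟨_, hx, M.pw_one_mem x⟩
      exact pow_mem h n
  · rintro v ⟨j, hj, hv⟩
    exact M.mem_filt_of_deg hj hv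

include ht hη hη0 he hed hde hMdiv hMfin hTdiv hm in
/-- If the variables of degree at most `i` of `M` are the projections of the differentials of those
of degree at most `i + 1` of `T`, then these variables cancel against each other, and what remains
is a semifree extension of a resolution of the residue field. -/
theorem liftsCycles_of_match : M.LiftsCycles T i := by
  classical
  -- the stage `G` is a resolution, over which `U` is semifree
  let G := (tower M T).subAlg _ (d_pw_mem_spnRing_stage M T (i + 1))
  let B := (tower M T).subExt _ (d_pw_mem_spnRing_stage M T (i + 1))
  have hG : IsResolution G (η.comp B.incl.toRingHom) :=
    { pos := fun hi hu => hη.pos hi hu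
      d := fun u => hη.d u.1
      exact := fun z hz hηz => by
        obtain ⟨w, hw, hw'⟩ := exists_d_eq_of_mem_stage ht M T hη hη0 he hed hde hMdiv hMfin hTdiv
          hm i le_rfl z.1 z.2 (congrArg Subtype.val hz) hηz
        exact ⟨⟨w, hw⟩, Subtype.ext hw'⟩ }
  -- `T(i + 1)` is generated over `G` by the variables of `M` of degree greater than `i`
  let Q : Set B.Var := {z | ∃ x, z.1 = Sum.inlₗ x}
  have hQ : ∀ u, u ∈ B.fam.spnRing Q ↔ u ∈ T.filtSubring (i + 1) := by
    intro u
    have h1 : stage M T (i + 1) ∪ Subtype.val '' Q =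
        towerSet M T Set.univ {y | T.deg y ≤ i + 1} := by
      ext z
      rcases z with x | y
      · refine ⟨fun _ => trivial, fun _ => ?_⟩
        by_cases h : (Sum.inlₗ x : (tower M T).Var) ∈ stage M T (i + 1)
        · exact Or.inl h
        · exact Or.inr ⟨⟨_, h⟩, ⟨x, rfl⟩, rfl⟩
      · refine ⟨?_, fun h => Or.inl h⟩
        rintro (h | ⟨z, ⟨x, hx⟩, hz⟩)
        · exact h
        · rw [hz] at hx; cases hx
    rw [mem_spnRing_subExt, h1, mem_spnRing_tower, ← filtSubring_eq, and_iff_left_iff_imp]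
    intro _ f
    rw [mem_spnRing_iff]
    exact fun _ _ x hx => absurd trivial hx
  have hincl : ∀ v, T.incl v ∈ B.fam.spnRing Q := fun v => (hQ _).2 (T.incl_mem _ v)
  have hQd : ∀ z ∈ Q, U.d (B.pw z 1) ∈ B.fam.spnRing Q := by
    rintro ⟨z, hz⟩ ⟨x, rfl⟩
    change U.d (T.incl (M.pw x 1)) ∈ _
    rw [← T.incl.map_d]; exact hincl _
  have hmul : ∀ (u : U) (g : G) e, η (B.rep (u * g.1) e).1 = η (B.rep u e).1 * η g.1 :=
    fun u g e => IsResolution.rep_mul_incl B hη u g e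
  -- the coefficients of `u` and of its projection to `V` have the same augmentation
  have hproj : ∀ u ∈ T.filtSubring (i + 1), ∀ e,
      η (B.rep u e).1 = η (B.rep (T.incl (T.const u)) e).1 := by
    intro u hu e
    let f : U →+ k := η.toAddMonoidHom.comp (B.incl.toRingHom.toAddMonoidHom.comp
      ((Finsupp.applyAddHom e).comp B.rep.toAddMonoidHom))
    change f u = f _
    rw [filtSubring_eq, mem_spnRing_iff] at hu
    conv_lhs => rw [T.rep_sum u, Finsupp.sum, map_sum]
    rw [Finset.sum_eq_single T.zeroAdm, mon_zeroAdm, mul_one, const_apply]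
    · intro m hm hm0
      have h1 : T.mon m ∈ (tower M T).fam.spnRing (stage M T (i + 1)) := by
        refine (mem_spnRing_tower M T).2 ⟨T.mon_mem_spnRing fun y hy => ?_, fun f => ?_⟩
        · exact hu m (Finsupp.mem_support_iff.1 hm) y hy
        · have h2 := T.rep_mon m 1
          rw [map_one T.incl.toRingHom, one_mul] at h2
          rw [h2, Finsupp.single_apply]
          split_ifs
          exacts [one_mem _, zero_mem _]
      have h2 : 0 < wdeg T.deg m.1 := by
        obtain ⟨y, hy⟩ := Finsupp.support_nonempty_iff.2 fun h : m.1 = 0 => hm0 (Subtype.ext h)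
        exact (T.deg_pos y).trans_le (deg_le_wdeg _ _ (Finsupp.mem_support_iff.1 hy))
      refine (hmul _ ⟨_, h1⟩ e).trans ?_
      rw [hη.pos h2 (T.mon_mem m), mul_zero]
    · intro h
      rw [Finsupp.notMem_support_iff.1 h, map_zero T.incl.toRingHom, zero_mul, map_zero]
  -- elements of `𝔪_{V(i)} V` have coefficients in the maximal ideal, as `V(i) ⊆ G`
  have hfib : ∀ v ∈ M.fiberIdeal i, ∀ e, η (B.rep (T.incl v) e).1 = 0 := by
    intro v hv e
    have key : ∀ g ∈ M.fiberSet i, ∀ b, η (B.rep (T.incl (b * g)) e).1 = 0 := by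
      intro g hg b
      have h1 : T.incl g ∈ (tower M T).fam.spnRing (stage M T (i + 1)) := by
        refine incl_mem_spnRing_tower M T (M.spnRing_mono (fun x (hx : M.deg x ≤ i) => ?_)
          ((M.filtSubring_eq i).le hg.1)) _
        exact Nat.lt_succ_of_le hx
      rw [map_mul T.incl.toRingHom]
      refine (hmul _ ⟨_, h1⟩ e).trans ?_
      rw [(hη0 _).2 ((T.incl_mem_maxIdeal_iff g).2 hg.2), mul_zero]
    suffices H : ∀ b, η (B.rep (T.incl (b * v)) e).1 = 0 by
      have := H 1
      rwa [one_mul] at this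
    induction hv using Submodule.span_induction with
    | mem x hx => exact key x hx
    | zero =>
      intro b
      rw [mul_zero, map_zero T.incl.toRingHom, map_zero]
      exact map_zero η
    | add x y _ _ hx hy =>
      intro b
      rw [mul_add, map_add T.incl.toRingHom, map_add, Finsupp.add_apply]
      exact (map_add η _ _).trans (by rw [hx, hy, add_zero])
    | smul c x _ hx => intro b; rw [smul_eq_mul, ← mul_assoc]; exact hx _
  -- conversely, projections of elements of `G` are in `V(i)`
  have hconst : ∀ g ∈ (tower M T).fam.spnRing (stage M T (i + 1)),
      T.const g ∈ M.filtSubring i := by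
    refine (tower M T).spnRing_induction (p := fun g => T.const g ∈ M.filtSubring i) ?_ ?_ ?_ ?_ ?_
      ?_ ?_
    · rw [map_zero]; exact zero_mem _
    · rw [map_one]; exact one_mem _
    · intro a b ha hb; rw [map_add]; exact add_mem ha hb
    · intro a ha; rw [map_neg]; exact neg_mem ha
    · intro a b ha hb; rw [map_mul]; exact mul_mem ha hb
    · intro s
      change T.const (T.incl (M.incl s)) ∈ _
      rw [const_incl]; exact M.incl_mem i s
    · rintro (x | y) hz n
      · change T.const (T.incl (M.pw x n)) ∈ _
        rw [const_incl]
        exact M.pw_mem_filt (Nat.le_of_lt_succ hz) n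
      · change T.const (T.pw y n) ∈ _
        rcases n with _ | n
        · rw [T.pw_zero, map_one]; exact one_mem _
        · rw [T.const_pw y n.succ_ne_zero]; exact zero_mem _
  intro u hu hdu hcu
  obtain ⟨w, hw, hηw, hdw⟩ := B.exists_d_eq_of_rep_mem_ker hG hQd
    ((B.rep u).support.sup (fun e => wdeg B.deg e.1) + 1) u ((hQ u).2 hu) hdu
    (fun e => (hproj u hu e).trans (hfib _ hcu e))
    (fun e he => Nat.lt_succ_of_le (Finset.le_sup (f := fun e : Adm B.deg => wdeg B.deg e.1)
      (Finsupp.mem_support_iff.2 he)))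
  refine ⟨w, (hQ w).1 hw, ?_, hdw⟩
  rw [B.rep_sum w, Finsupp.sum, map_sum]
  refine sum_mem fun e _ => ?_
  rw [map_mul]
  refine Ideal.mul_mem_right _ _ (Ideal.subset_span ⟨hconst _ (B.rep w e).2, ?_⟩)
  exact (T.const_mem_maxIdeal_iff _).2 ((hη0 _).1 (hηw e))

end Acyclic

/-- A homogeneous element of degree `j` whose coefficients at the variables of degree `j` are in the
maximal ideal is, modulo `𝔪 U_j`, in the subalgebra generated by the variables of lower degree. -/
theorem exists_add_of_rep_varAdm_mem {A : CDGA.{u}} [A.IsLocal] {V : CDGA.{v}} [V.IsLocal]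
    (M : SemifreeExt.{u, v, w} A V) {j : ℕ} {v : V} (hv : v ∈ V.gr j)
    (h : ∀ x, M.deg x = j → M.rep v (M.varAdm x) ∈ A.maxIdeal) :
    ∃ a ∈ IsLocalRing.maximalIdeal V.deg0 • V.grMod j, ∃ w ∈ M.filtSubring (j - 1), v = a + w := by
  suffices H : v ∈ (IsLocalRing.maximalIdeal V.deg0 • V.grMod j).toAddSubgroup ⊔
      (M.filtSubring (j - 1)).toAddSubgroup by
    obtain ⟨a, ha, w, hw, rfl⟩ := AddSubgroup.mem_sup.1 H
    exact ⟨a, ha, w, hw, rfl⟩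
  rw [M.rep_sum v]
  refine sum_mem fun e he => ?_
  have hle : wdeg M.deg e.1 ≤ j := by
    by_contra h
    exact Finsupp.mem_support_iff.1 he (M.rep_eq_zero hv (not_le.1 h))
  by_cases hx : ∃ x, e.1 x ≠ 0 ∧ j ≤ M.deg x
  · obtain ⟨x, hx, hjx⟩ := hx
    have h1 := deg_le_wdeg M.deg e.1 hx
    obtain rfl := M.eq_varAdm hx (hle.trans hjx)
    have hxj : M.deg x = j := by omega
    have h2 := h x hxj
    refine AddSubgroup.mem_sup_left ?_
    have h3 : M.incl (M.rep v (M.varAdm x)) ∈ V.gr 0 := by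
      have := M.rep_mem hv (M.varAdm x)
      rw [wdeg_varAdm, hxj, Nat.sub_self] at this
      exact M.incl.map_gr this
    change M.incl _ * M.mon (M.varAdm x) ∈ _
    rw [mon_varAdm]
    refine Submodule.smul_mem_smul (r := (⟨_, h3⟩ : V.deg0)) (n := M.pw x 1) ?_ ?_
    · have h4 := (M.incl_mem_maxIdeal_iff _).2 h2
      have h5 : V.pr0 (M.incl (M.rep v (M.varAdm x))) = ⟨_, h3⟩ := Subtype.ext (V.pr_same h3)
      rw [← h5]; exact h4
    · rw [mem_grMod, ← hxj]; exact M.pw_one_mem x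
  · refine AddSubgroup.mem_sup_right ((M.filtSubring (j - 1)).mul_mem (M.incl_mem _ _) ?_)
    rw [filtSubring_eq]
    refine M.mon_mem_spnRing fun x hx' => ?_
    by_contra h1
    refine hx ⟨x, h1, ?_⟩
    have h2 : ¬ M.deg x ≤ j - 1 := hx'
    omega

section Transport

variable {S : Type u} [CommRing S] [IsLocalRing S] [IsNoetherianRing S]
  {V : CDGA.{v}} [V.IsLocal] (M : SemifreeExt.{u, v, w} (ofRing S) V)
  {U : CDGA.{x}} (T : SemifreeExt.{v, x, y} V U)

/-- If the variables of degree at most `i` match those of degree at most `i + 1` of `T`, then the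
former may be replaced by the projections of the differentials of the latter. -/
theorem exists_ringEquiv_of_varsMatch (hM : M.IsMinimal) (hMdiv : M.divided = ∅) {i : ℕ}
    (hm : ∀ j, 0 < j → j ≤ i → M.VarsMatch T j) :
    ∃ Φ : V ≃+* V, (∀ {i v}, v ∈ V.gr i → Φ v ∈ V.gr i) ∧ (∀ s, Φ (M.incl s) = M.incl s) ∧
      ∀ j, 0 < j → j ≤ i → ∃ β : {x // M.deg x = j} ≃ {y // T.deg y = j + 1},
        ∀ x, Φ (M.pw x.1 1) = T.const (U.d (T.pw (β x).1 1)) := by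
  classical
  choose β hβ using hm
  let z : M.Var → V := fun x => if h : M.deg x ≤ i then
    T.const (U.d (T.pw (β (M.deg x) (M.deg_pos x) h ⟨x, rfl⟩).1 1)) else M.pw x 1
  have hz : ∀ x, z x ∈ V.gr (M.deg x) := by
    intro x
    by_cases h : M.deg x ≤ i
    · simp only [z, dif_pos h]
      have h1 := T.const_mem (T.d_pw_one_mem (β (M.deg x) (M.deg_pos x) h ⟨x, rfl⟩).1)
      rwa [(β (M.deg x) (M.deg_pos x) h ⟨x, rfl⟩).2] at h1
    · simp only [z, dif_neg h]
      exact M.pw_one_mem x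
  have hzβ : ∀ j (hj : 0 < j) (hji : j ≤ i) (x : {x // M.deg x = j}),
      z x.1 = T.const (U.d (T.pw (β j hj hji x).1 1)) := by
    rintro _ hj hji ⟨x, rfl⟩
    exact dif_pos hji
  have hdiv : ∀ x, x ∉ M.divided ∨ Odd (M.deg x) := fun x => Or.inl (by rw [hMdiv]; exact id)
  obtain ⟨Φ, hΦ, hΦz, hΦgr⟩ := M.exists_ringEnd hdiv z hz
  -- by Nakayama, the new elements generate `V`, since they do so modulo the maximal ideal and
  -- decomposables
  have hbij : Function.Bijective Φ := by
    refine M.bijective_of_sub_mem (fun j => M.grMod_fg (M.finite_deg_le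
      (fun j => hM.finite_deg (grMod_ofRing_fg S) j) j) (grMod_ofRing_fg S)) hdiv Φ hΦgr hΦ
      fun x => ?_
    by_cases h : M.deg x ≤ i
    · obtain ⟨a, ha⟩ := hβ (M.deg x) (M.deg_pos x) h ⟨x, rfl⟩
      have hu : (a.sum fun x s => M.incl s * M.pw x.1 1) ∈ V.gr (M.deg x) := by
        refine sum_mem fun x' _ => ?_
        have h1 := V.mul_mem' (M.incl.map_gr (mem_trivGr_zero (R := S) (a x'))) (M.pw_one_mem x'.1)
        rwa [zero_add, x'.2] at h1
      have hΦu : Φ (a.sum fun x s => M.incl s * M.pw x.1 1) = a.sum fun x' s => M.incl s *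
          T.const (U.d (T.pw (β (M.deg x) (M.deg_pos x) h x').1 1)) := by
        rw [Finsupp.sum, map_sum]
        refine Finset.sum_congr rfl fun x' _ => ?_
        rw [map_mul, hΦ, hΦz, hzβ _ (M.deg_pos x) h]
      rw [← hΦu] at ha
      obtain ⟨v, hv, w, hw, hvw⟩ := M.exists_add_of_rep_varAdm_mem
        (sub_mem (M.pw_one_mem x) (hΦgr _ _ hu)) fun x' hx' => M.linCoef_eq_zero_iff.1 (ha ⟨x', hx'⟩)
      refine ⟨_, hu, v, hv, w, hw, ?_⟩
      rw [add_assoc, ← hvw, add_sub_cancel]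
    · refine ⟨_, M.pw_one_mem x, 0, zero_mem _, 0, zero_mem _, ?_⟩
      rw [hΦz, add_zero, add_zero]
      simp only [z, dif_neg h]
  refine ⟨RingEquiv.ofBijective Φ hbij, fun h => hΦgr _ _ h, hΦ, fun j hj hji =>
    ⟨β j hj hji, fun x => (hΦz x.1).trans (hzβ j hj hji x)⟩⟩

end Transport

section Main

variable {S : Type u} [CommRing S] [IsRegularLocalRing S] {t : Fin (embDim S) → S}
  (ht : Ideal.span (Set.range t) = IsLocalRing.maximalIdeal S)
  {V : CDGA.{v}} [V.IsLocal] (M : SemifreeExt.{u, v, w} (ofRing S) V) (hM : M.IsMinimal)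
  (hMdiv : M.divided = ∅)
  {U : CDGA.{x}} [U.IsLocal] (T : SemifreeExt.{v, x, y} V U)
  {k : Type*} [CommRing k] {η : U →+* k} (hη : IsResolution U η)
  (hη0 : ∀ u, η u = 0 ↔ u ∈ U.maxIdeal)
  {e : Fin (embDim S) → T.Var} (he : Function.Injective e)
  (hed : ∀ y, T.deg y ≤ 1 ↔ ∃ j, e j = y)
  (hde : ∀ j, U.d (T.pw (e j) 1) = T.incl (M.incl (ofRingSelf S (t j))))
  (hTdiv : ∀ y, Even (T.deg y) → y ∈ T.divided)

include ht hM hMdiv hη hη0 he hed hde hTdiv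

/-- Replacing the matched variables by the projections of differentials does not change the
condition. -/
theorem liftsCycles_of_varsMatch {i : ℕ} (hm : ∀ j, 0 < j → j ≤ i → M.VarsMatch T j) :
    M.LiftsCycles T i := by
  obtain ⟨Φ, hgr, hΦ, hβ⟩ := M.exists_ringEquiv_of_varsMatch T hM hMdiv hm
  let M' := M.transport Φ hgr hΦ fun x hx => by rw [hMdiv] at hx; exact absurd hx id
  have h1 : M'.LiftsCycles T i := liftsCycles_of_match ht M' T hη hη0 he hed hde hMdiv
    (fun j => hM.finite_deg (grMod_ofRing_fg S) j) hTdiv hβ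
  have h2 : M'.fiberIdeal i = M.fiberIdeal i := by
    rw [fiberIdeal, fiberIdeal, fiberSet, fiberSet, M'.filtSubring_eq_closure_gr hMdiv,
      M.filtSubring_eq_closure_gr hMdiv]
  rw [LiftsCycles, h2] at h1
  exact h1

/-- Matching of the variables of degree `i + 1` follows from lifting of cycles at stage `i`, hence
from matching in degrees at most `i`. -/
theorem varsMatch (hT : ∀ u y, 1 < T.deg y → T.rep (U.d u) (T.varAdm y) ∈ V.maxIdeal) :
    ∀ j, 0 < j → M.VarsMatch T j := by
  intro j
  induction j using Nat.strong_induction_on with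
  | _ j ih =>
    intro hj
    obtain ⟨i, rfl⟩ := Nat.exists_eq_succ_of_ne_zero hj.ne'
    exact M.varsMatch_of_liftsCycles T hη hM (liftsCycles_of_varsMatch ht M hM hMdiv T hη hη0 he
      hed hde hTdiv fun j hj hji => ih j (Nat.lt_succ_of_le hji) hj)
      fun u y hy => hT u y (by omega)

theorem liftsCycles (hT : ∀ u y, 1 < T.deg y → T.rep (U.d u) (T.varAdm y) ∈ V.maxIdeal) (i : ℕ) :
    M.LiftsCycles T i :=
  liftsCycles_of_varsMatch ht M hM hMdiv T hη hη0 he hed hde hTdiv fun j hj _ =>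
    varsMatch ht M hM hMdiv T hη hη0 he hed hde hTdiv hT j hj

end Main

/-! ### The acyclic closure over the Koszul complex -/

section Tower

variable {A : CDGA.{u}} {B : CDGA.{v}} {C : CDGA.{x}} (E : SemifreeExt.{u, v, w} A B)
  (F : SemifreeExt.{v, x, y} B C)

theorem tower_varAdm_inr (y : F.Var) :
    (tower E F).varAdm (Sum.inrₗ y) = tAdm E F E.zeroAdm (F.varAdm y) := by
  classical
  refine Subtype.ext (Finsupp.ext fun z => ?_)
  rcases z with x | y'
  · refine Finsupp.single_eq_of_ne ?_
    intro h; cases h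
  · change Finsupp.single (Sum.inrₗ y : (tower E F).Var) 1 (Sum.inrₗ y' : (tower E F).Var) =
      Finsupp.single y 1 y'
    rw [Finsupp.single_apply, Finsupp.single_apply]
    by_cases hyy : y = y'
    · rw [if_pos hyy, if_pos (by rw [hyy])]
    · rw [if_neg hyy, if_neg fun h : (Sum.inrₗ y : (tower E F).Var) = Sum.inrₗ y' =>
        hyy (Sum.inr.inj h)]

end Tower

section KoszulTower

variable {S : Type u} [CommRing S] [IsRegularLocalRing S] {t : Fin (embDim S) → S}
  (ht : Ideal.span (Set.range t) = IsLocalRing.maximalIdeal S)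
  {V : CDGA.{v}} [V.IsLocal] (M : SemifreeExt.{u, v, w} (ofRing S) V) (hM : M.IsMinimal)
  (hMdiv : M.divided = ∅)
  {K : CDGA.{x}} [K.IsLocal] (E : SemifreeExt.{v, x, y} V K)
  (hE : E.IsKoszul fun j => M.incl (ofRingSelf S (t j)))
  {U : CDGA.{z}} [U.IsLocal] (N : Model.{x, x, z, y'} K.augmentation 0 U)
  (hN : N.toSemifreeExt.IsMinimal)

include ht hE hN

/-- The Koszul complex kills the maximal ideal of `S`, so the acyclic closure of the residue field
over it has no variables of degree one. -/
theorem one_lt_deg_of_isKoszul (y : N.Var) : 1 < N.deg y := by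
  classical
  obtain ⟨-, hE1, e, he⟩ := hE
  by_contra hy
  have hy1 : N.deg y = 1 := by have := N.deg_pos y; omega
  have h0 : U.d (N.pw y 1) ∈ U.gr 0 := by
    have := N.d_pw_one_mem y
    rwa [hy1] at this
  have h1 := N.const_mem h0
  have h2 := E.const_mem h1
  have h3 : M.const (E.const (N.const (U.d (N.pw y 1)))) ∈ (ofRing S).maxIdeal := by
    rw [const_mem_maxIdeal_iff, const_mem_maxIdeal_iff, const_mem_maxIdeal_iff]
    exact U.d_mem_maxIdeal _
  -- the differential of a variable `y` of degree one is in `𝔪_S`, so it is the differential of an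
  -- element `b` of `K`
  obtain ⟨c, hc⟩ : ∃ c : Fin (embDim S) → S, ∑ j, c j * t j =
      (ofRingSelf S).symm (M.const (E.const (N.const (U.d (N.pw y 1))))) := by
    rw [← Ideal.mem_span_range_iff_exists_fun, ht, ← ofRingSelf_mem_maxIdeal_iff,
      RingEquiv.apply_symm_apply]
    exact h3
  have hcoe : ∀ s : S, M.incl (ofRingSelf S s) ∈ V.gr 0 := fun s =>
    M.incl.map_gr (mem_trivGr_zero (R := S) s)
  set b : K := ∑ j, E.incl (M.incl (ofRingSelf S (c j))) * E.pw (e j) 1 with hb_def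
  have hb : b ∈ K.gr 1 := by
    refine sum_mem fun j _ => ?_
    have := K.mul_mem' (E.incl.map_gr (hcoe (c j))) (E.pw_one_mem (e j))
    rwa [hE1] at this
  have hdb : N.incl (K.d b) = U.d (N.pw y 1) := by
    rw [← N.exists_incl_eq_of_mem_zero h0, ← E.exists_incl_eq_of_mem_zero h1,
      ← M.exists_incl_eq_of_mem_zero h2]
    congr 1
    rw [hb_def, map_sum]
    have h5 : M.const (E.const (N.const (U.d (N.pw y 1)))) = ofRingSelf S (∑ j, c j * t j) := by
      rw [hc, RingEquiv.apply_symm_apply]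
    rw [h5, map_sum, map_sum M.incl.toRingHom, map_sum E.incl.toRingHom]
    refine Finset.sum_congr rfl fun j _ => ?_
    rw [K.d_mul _ (E.incl.map_gr (hcoe (c j))), K.d_zero (E.incl.map_gr (hcoe (c j))), zero_mul,
      zero_add, pow_zero, one_mul, he, map_mul, map_mul M.incl.toRingHom, map_mul E.incl.toRingHom]
  have h5 : N.pw y 1 - N.incl b ∈ U.gr 1 := by
    have := N.pw_one_mem y
    rw [hy1] at this
    exact sub_mem this (N.incl.map_gr hb)
  -- the cycle `y - b` is a boundary with coefficient `1` at `y`, contrary to minimality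
  obtain ⟨w, -, hw⟩ := N.isResolution_aug.exact_gr h5 (by rw [map_sub, ← N.incl.map_d, hdb, sub_self])
    (N.isResolution_aug.pos one_pos h5)
  have h6 := hN.rep_mem w _ (N.varAdm_degree y).le
  have h7 : N.rep (N.pw y 1) (N.varAdm y) = 1 := by
    rw [← mon_varAdm, ← one_mul (N.mon _), ← map_one N.incl.toRingHom, rep_mon,
      Finsupp.single_eq_same]
  rw [hw, map_sub, Finsupp.sub_apply, h7, rep_incl, Finsupp.single_apply,
    if_neg (Ne.symm (N.varAdm_ne_zeroAdm y)), sub_zero] at h6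
  exact one_notMem_maxIdeal h6

/-- `U(1) = K`, as there are no variables of degree one. -/
theorem toFilt_one_bijective : Function.Bijective (N.toFilt 1) := by
  constructor
  · intro a b h
    exact N.incl_injective (congrArg Subtype.val h)
  · rintro ⟨u, hu⟩
    suffices h : u ∈ N.incl.toRingHom.range by
      obtain ⟨a, ha⟩ := h
      exact ⟨a, Subtype.ext ha⟩
    refine Subring.closure_le.2 ?_ hu
    rintro _ (⟨a, rfl⟩ | ⟨y, n, hy, rfl⟩)
    · exact ⟨a, rfl⟩
    · exact absurd (one_lt_deg_of_isKoszul ht M E hE N hN y) (not_lt.2 hy)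

omit ht hN in
/-- The filtrations of `U` over `K` and over `V` agree from `U(1)` on, since the Koszul variables
have degree one. -/
theorem filtSubring_tower_of_isKoszul (i : ℕ) :
    N.filtSubring (i + 1) = (tower E N.toSemifreeExt).filtSubring (i + 1) := by
  obtain ⟨-, hE1, -⟩ := hE
  have h : {z | (tower E N.toSemifreeExt).deg z ≤ i + 1} =
      towerSet E N.toSemifreeExt Set.univ {y | N.deg y ≤ i + 1} := by
    ext z
    rcases z with x | y
    · refine ⟨fun _ => trivial, fun _ => ?_⟩
      change E.deg x ≤ i + 1
      rw [hE1]; omega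
    · exact Iff.rfl
  ext u
  rw [filtSubring_eq, filtSubring_eq, h, mem_spnRing_tower, and_iff_left]
  intro f
  rw [mem_spnRing_iff]
  exact fun _ _ x hx => absurd trivial hx

/-- Minimality of `U` over `K`: boundaries have no linear part at the variables of degree at least
two of `U` over `V`. -/
theorem tower_rep_d_mem_maxIdeal (u : U) (y : (tower E N.toSemifreeExt).Var)
    (hy : 1 < (tower E N.toSemifreeExt).deg y) :
    (tower E N.toSemifreeExt).rep (U.d u) ((tower E N.toSemifreeExt).varAdm y) ∈ V.maxIdeal := by
  rcases y with x | y
  · exact absurd (hE.2.1 x) (Nat.ne_of_gt hy)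
  · classical
    change (tower E N.toSemifreeExt).rep (U.d u) ((tower E N.toSemifreeExt).varAdm (Sum.inrₗ y)) ∈ _
    rw [tower_varAdm_inr, tower_rep, ← const_apply, const_mem_maxIdeal_iff]
    exact hN.rep_mem u _ (N.varAdm_degree y).le

include hM hMdiv

/-- The results for semifree resolutions over `V` apply to the acyclic closure over the Koszul
complex. -/
theorem varsMatch_and_liftsCycles_of_isKoszul :
    (∀ j, 0 < j → M.VarsMatch (tower E N.toSemifreeExt) j) ∧
      ∀ i, M.LiftsCycles (tower E N.toSemifreeExt) i := by
  obtain ⟨hE0, hE1, e, he⟩ := id hE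
  have h1 : Function.Injective fun j => (Sum.inlₗ (e j) : (tower E N.toSemifreeExt).Var) :=
    fun a b h => e.injective (Sum.inl.inj h)
  have h2 : ∀ y, (tower E N.toSemifreeExt).deg y ≤ 1 ↔
      ∃ j, (Sum.inlₗ (e j) : (tower E N.toSemifreeExt).Var) = y := by
    rintro (x | y)
    · refine ⟨fun _ => ⟨e.symm x, ?_⟩, fun _ => (hE1 x).le⟩
      rw [e.apply_symm_apply]; rfl
    · refine ⟨fun h => absurd (one_lt_deg_of_isKoszul ht M E hE N hN y) (not_lt.2 h), ?_⟩
      rintro ⟨j, hj⟩; cases hj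
  have h3 : ∀ j, U.d ((tower E N.toSemifreeExt).pw (Sum.inlₗ (e j)) 1) =
      (tower E N.toSemifreeExt).incl (M.incl (ofRingSelf S (t j))) := by
    intro j
    change U.d (N.incl (E.pw (e j) 1)) = N.incl (E.incl _)
    rw [← N.incl.map_d, he]
  have h4 : ∀ y, Even ((tower E N.toSemifreeExt).deg y) → y ∈ (tower E N.toSemifreeExt).divided := by
    rintro (x | y) h
    · have h' : Even (E.deg x) := h
      rw [hE1] at h'; exact absurd h' (by decide)
    · exact (N.switch y).2 zero_le
  exact ⟨varsMatch ht M hM hMdiv _ N.isResolution_aug N.aug_eq_zero_iff h1 h2 h3 h4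
    (tower_rep_d_mem_maxIdeal ht M E hE N hN),
    liftsCycles ht M hM hMdiv _ N.isResolution_aug N.aug_eq_zero_iff h1 h2 h3 h4
    (tower_rep_d_mem_maxIdeal ht M E hE N hN)⟩

theorem exists_fiberHom :
    ∃ φ : ∀ i : ℕ, Hom (N.filt (i + 1)) (M.fiber i),
      (∀ i, Function.Surjective (φ i) ∧ (φ i).IsQuasiIso) ∧
      (∀ v : V, φ 0 (N.toFilt 1 (E.incl v)) = M.toFiber 0 v) ∧
      (∀ (i : ℕ) (u : N.filt (i + 1)),
        φ (i + 1) (N.filtIncl (i + 1) u) = M.fiberMap i (φ i u)) := by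
  have hF := filtSubring_tower_of_isKoszul M E hE N
  have hL := (varsMatch_and_liftsCycles_of_isKoszul ht M hM hMdiv E hE N hN).2
  refine ⟨M.fiberHom (tower E N.toSemifreeExt) N.toSemifreeExt hF, fun i =>
    ⟨M.fiberHom_surjective _ _ hF i, M.fiberHom_isQuasiIso _ _ hF (hL i)⟩,
    fun v => ?_, fun i u => ?_⟩
  · have h : (tower E N.toSemifreeExt).const (N.incl (E.incl v)) = v :=
      (tower E N.toSemifreeExt).const_incl v
    rw [fiberHom_apply, coe_toFilt, h]
  · rw [fiberHom_apply, fiberHom_apply, fiberMap_toFiber, coe_filtIncl]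

/-- There are as many variables of degree `j` in the minimal model as variables of degree `j + 1` in
the acyclic closure over the Koszul complex. -/
theorem exists_deg_equiv {j : ℕ} (hj : 0 < j) :
    Nonempty ({x // M.deg x = j} ≃ {y // N.deg y = j + 1}) := by
  obtain ⟨β, -⟩ := (varsMatch_and_liftsCycles_of_isKoszul ht M hM hMdiv E hE N hN).1 j hj
  refine ⟨β.trans ⟨fun y => ?_, fun y => ⟨Sum.inrₗ y.1, y.2⟩, ?_, ?_⟩⟩
  · rcases y with ⟨x | y, hy⟩
    · exact absurd ((hE.2.1 x).symm.trans hy) (by omega)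
    · exact ⟨y, hy⟩
  · rintro ⟨x | y, hy⟩
    · exact absurd ((hE.2.1 x).symm.trans hy) (by omega)
    · rfl
  · intro y; rfl

end KoszulTower

end SemifreeExt

/-! ### Exchanging Koszul variables -/

section LinearAlgebra

/-- Exchange: some of the vectors `v y` span all of them and are completed by standard basis vectors
to a spanning set of the same size as the standard basis. -/
theorem exists_span_exchange {k : Type u} [Field k] {ι : Type v} [Finite ι] [DecidableEq ι]
    {Y : Type w} (v : Y → ι → k) :
    ∃ (J : Set ι) (a : {x // x ∉ J} → Y), Function.Injective a ∧
      (∀ y, v y ∈ Submodule.span k (Set.range (v ∘ a))) ∧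
      ∀ w : ι → k, w ∈ Submodule.span k ((fun x => Pi.single x 1) '' J ∪ Set.range (v ∘ a)) := by
  have := Fintype.ofFinite ι
  obtain ⟨κ, b, hb, hspan, hli⟩ := exists_linearIndependent' k v
  let W := Submodule.span k (Set.range v)
  -- complete a basis `v ∘ b` of the span `W` by standard basis vectors that form a basis modulo `W`
  obtain ⟨κ', b', hb', hspan', hli'⟩ :=
    exists_linearIndependent' k (fun x : ι => W.mkQ (Pi.single x 1))
  have htop : Submodule.span k (Set.range fun x : ι => W.mkQ (Pi.single x 1)) = ⊤ := by
    have h1 : (Set.range fun x : ι => W.mkQ (Pi.single x 1)) =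
        W.mkQ '' Set.range (Pi.basisFun k ι) := by
      rw [← Set.range_comp]; congr 1; ext x; simp
    rw [h1, Submodule.span_image, (Pi.basisFun k ι).span_eq, Submodule.map_top, W.range_mkQ]
  have hκ : Nat.card κ = Module.finrank k W := by
    have h1 := Module.finrank_eq_nat_card_basis (Module.Basis.span hli)
    rw [hspan] at h1
    exact h1.symm
  have hκ' : Nat.card κ' = Module.finrank k ((ι → k) ⧸ W) :=
    (Module.finrank_eq_nat_card_basis (Module.Basis.mk hli' (by rw [hspan', htop]))).symm
  have : Finite κ' := Finite.of_injective b' hb'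
  have : Finite κ := Module.Finite.finite_basis (Module.Basis.span hli)
  have hcard : Nat.card {x // x ∉ Set.range b'} = Nat.card κ := by
    have h1 := W.finrank_quotient_add_finrank
    rw [← hκ, ← hκ', Module.finrank_fintype_fun_eq_card, ← Nat.card_eq_fintype_card] at h1
    have h2 : Nat.card (Set.range b') = Nat.card κ' := Nat.card_congr (Equiv.ofInjective b' hb').symm
    have h3 : Nat.card (Set.range b') + Nat.card {x // x ∉ Set.range b'} = Nat.card ι :=
      by classical exact (Nat.card_sum).symm.trans (Nat.card_congr (Equiv.Set.sumCompl _))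
    omega
  obtain ⟨σ⟩ := Finite.card_eq.1 hcard
  have hrange : Set.range (v ∘ b ∘ σ) = Set.range (v ∘ b) := by
    rw [← Function.comp_assoc, Set.range_comp (v ∘ b) σ, σ.range_eq_univ, Set.image_univ]
  refine ⟨Set.range b', b ∘ σ, hb.comp σ.injective, fun y => ?_, fun w => ?_⟩
  · rw [hrange, hspan]
    exact Submodule.subset_span ⟨y, rfl⟩
  · rw [hrange, Submodule.span_union, hspan, ← Set.range_comp]
    have h1 : W.mkQ w ∈ Submodule.map W.mkQ (Submodule.span k (Set.range fun x : κ' =>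
        (Pi.single (b' x) 1 : ι → k))) := by
      rw [← Submodule.span_image, ← Set.range_comp]
      have h2 := hspan'.trans htop
      exact h2 ▸ Submodule.mem_top
    obtain ⟨w', hw', hww⟩ := h1
    rw [← sub_add_cancel w w', add_comm]
    refine Submodule.add_mem_sup hw' ?_
    change w - w' ∈ W
    rw [← Submodule.Quotient.mk_eq_zero, Submodule.Quotient.mk_sub]
    exact sub_eq_zero.2 hww.symm

end LinearAlgebra

theorem Hom.IsQuasiIso.comp {A : CDGA.{u}} {B : CDGA.{v}} {C : CDGA.{w}} {g : Hom B C} {f : Hom A B}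
    (hg : g.IsQuasiIso) (hf : f.IsQuasiIso) : (g.comp f).IsQuasiIso := by
  constructor
  · intro z hz hb
    refine hf.1 z hz ?_
    obtain ⟨b, hb⟩ := hg.1 (f z) (by rw [← f.map_d, hz, map_zero f.toRingHom]) hb
    exact ⟨b, hb⟩
  · intro z hz
    obtain ⟨y, hy, b, rfl⟩ := hg.2 z hz
    obtain ⟨x, hx, c, rfl⟩ := hf.2 y hy
    refine ⟨x, hx, g c + b, ?_⟩
    rw [map_add g.toRingHom, g.map_d, map_add, add_assoc]; rfl

theorem Hom.IsLocalMap.mem_maxIdeal_iff {A : CDGA.{u}} {B : CDGA.{v}} [A.IsLocal] [B.IsLocal]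
    {f : Hom A B} (hf : f.IsLocalMap) (a : A) : f a ∈ B.maxIdeal ↔ a ∈ A.maxIdeal := by
  refine ⟨fun h => ?_, hf a⟩
  rw [SemifreeExt.mem_maxIdeal_iff_pr] at h ⊢
  by_contra h1
  obtain ⟨b, hb, hab⟩ := (SemifreeExt.notMem_maxIdeal_iff (A.pr_mem 0 a)).1 h1
  refine (SemifreeExt.notMem_maxIdeal_iff (B.pr_mem 0 (f a))).2 ⟨f b, f.map_gr hb, ?_⟩ h
  rw [← f.map_pr, ← map_mul f.toRingHom, hab, map_one]

namespace SemifreeExt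

theorem exists_incl_eq_of_mem_filtSubring_zero {A : CDGA.{u}} {U : CDGA.{v}}
    (E : SemifreeExt.{u, v, w} A U) {u : U} (hu : u ∈ E.filtSubring 0) : ∃ a, E.incl a = u := by
  change u ∈ E.incl.toRingHom.range
  refine Subring.closure_le.2 ?_ hu
  rintro _ (⟨a, rfl⟩ | ⟨y, n, hy, rfl⟩)
  · exact ⟨a, rfl⟩
  · exact absurd (E.deg_pos y) (not_lt.2 hy)

/-- An extension without divided variables such that the differentials of its variables are in `𝔪_A`
is minimal. -/
theorem isMinimal_of_incl {A : CDGA.{u}} {U : CDGA.{v}} [A.IsLocal] (E : SemifreeExt.{u, v, w} A U)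
    (hdiv : E.divided = ∅) (h : ∀ x, ∃ a ∈ A.maxIdeal, U.d (E.pw x 1) = E.incl a) :
    E.IsMinimal := by
  have hpr : ∀ a ∈ E.incl '' (A.maxIdeal : Set A), ∀ i, U.pr i a ∈ E.incl '' (A.maxIdeal : Set A) := by
    rintro _ ⟨a, ha, rfl⟩ i
    exact ⟨A.pr i a, A.pr_mem_maxIdeal ha i, (E.incl_pr i a).symm⟩
  have := U.span_isTwoSided _ hpr
  have hmul : ∀ a b, U.d a ∈ Ideal.span (E.incl '' (A.maxIdeal : Set A)) →
      U.d b ∈ Ideal.span (E.incl '' (A.maxIdeal : Set A)) →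
      U.d (a * b) ∈ Ideal.span (E.incl '' (A.maxIdeal : Set A)) := by
    intro a b ha hb
    rw [d_mul']
    exact add_mem (Ideal.mul_mem_right _ _ ha) (Ideal.mul_mem_left _ _ hb)
  have hone : U.d 1 ∈ Ideal.span (E.incl '' (A.maxIdeal : Set A)) := by
    rw [d_one]; exact zero_mem _
  intro u
  refine Ideal.span_mono Set.subset_union_left ?_
  refine E.spnRing_induction (P := Set.univ)
    (p := fun u => U.d u ∈ Ideal.span (E.incl '' (A.maxIdeal : Set A))) (by simp) hone
    (fun a b ha hb => by rw [map_add]; exact add_mem ha hb)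
    (fun a ha => by rw [map_neg]; exact neg_mem ha) hmul (fun a => ?_) (fun x _ n => ?_) u
    (E.mem_spnRing_iff.2 fun _ _ x hx => absurd trivial hx)
  · rw [← E.incl.map_d]
    exact Ideal.subset_span ⟨_, A.d_mem_maxIdeal a, rfl⟩
  · rw [E.pw_pow x n (Or.inl (by rw [hdiv]; exact id))]
    induction n with
    | zero => rw [pow_zero]; exact hone
    | succ n ih =>
      rw [pow_succ]
      refine hmul _ _ ih ?_
      obtain ⟨a, ha, hda⟩ := h x
      rw [hda]
      exact Ideal.subset_span ⟨a, ha, rfl⟩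

section Exchange

variable {S : Type u} [CommRing S] [IsLocalRing S] [IsNoetherianRing S]
  {V : CDGA.{v}} [V.IsLocal] (M : SemifreeExt.{u, v, w} (ofRing S) V)
  {K : CDGA.{x}} [K.IsLocal] (E : SemifreeExt.{v, x, y} V K)

/-- The coefficients of the variables of `E`, in the residue field of `S`. -/
def coefs : K →+ (E.Var → IsLocalRing.ResidueField S) where
  toFun κ x := M.constResidue (E.rep κ (E.varAdm x))
  map_zero' := by ext x; simp
  map_add' a b := by ext x; simp

theorem coefs_apply (κ : K) (x : E.Var) :
    M.coefs E κ x = M.constResidue (E.rep κ (E.varAdm x)) := rfl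

theorem coefs_pw [DecidableEq E.Var] (x : E.Var) : M.coefs E (E.pw x 1) = Pi.single x 1 := by
  ext x'
  have h := E.rep_mon (E.varAdm x) 1
  rw [map_one E.incl.toRingHom, one_mul, mon_varAdm] at h
  rw [coefs_apply, h, Finsupp.single_apply, Pi.single_apply]
  by_cases hx : x = x'
  · rw [if_pos (by rw [hx]), if_pos hx.symm, map_one]
  · rw [if_neg fun h => hx (E.varAdm_injective h), if_neg (Ne.symm hx), map_zero]

theorem coefs_incl_mul (s : ofRing S) (κ : K) :
    M.coefs E (E.incl (M.incl s) * κ) = ofRingResidue S s • M.coefs E κ := by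
  ext x
  rw [coefs_apply, rep_incl_mul, map_mul, Pi.smul_apply, smul_eq_mul, coefs_apply, constResidue,
    RingHom.comp_apply, const_incl]

theorem coefs_incl (b : V) : M.coefs E (E.incl b) = 0 := by
  classical
  ext x
  rw [coefs_apply, rep_incl, Finsupp.single_apply, if_neg (Ne.symm (E.varAdm_ne_zeroAdm x)), map_zero]
  rfl

/-- Elements of `𝔪 K_j` have no linear part over the residue field. -/
theorem coefs_of_mem_smul {a : K} {j : ℕ}
    (ha : a ∈ IsLocalRing.maximalIdeal K.deg0 • K.grMod j) : M.coefs E a = 0 := by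
  refine Submodule.smul_induction_on (p := fun a => M.coefs E a = 0) ha (fun c hc κ _ => ?_)
    fun a b ha hb => by rw [map_add, ha, hb, add_zero]
  ext x
  rw [coefs_apply, rep_smul, map_mul, (M.constResidue_eq_zero_iff _).2, zero_mul]; rfl
  rw [const_mem_maxIdeal_iff]
  have h : K.pr0 (c : K) = c := Subtype.ext (K.pr_same c.2)
  change K.pr0 (c : K) ∈ IsLocalRing.maximalIdeal K.deg0
  rw [h]; exact hc

/-- Vectors in the span of linear parts are linear parts, for elements with a property stable under
`S`-linear combinations. -/
theorem exists_coefs_eq_of_mem_span {P : K → Prop} (h0 : P 0) (hadd : ∀ a b, P a → P b → P (a + b))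
    (hmul : ∀ s a, P a → P (E.incl (M.incl s) * a)) {X : Set (E.Var → IsLocalRing.ResidueField S)}
    (hX : ∀ w ∈ X, ∃ κ, P κ ∧ M.coefs E κ = w) {w : E.Var → IsLocalRing.ResidueField S}
    (hw : w ∈ Submodule.span (IsLocalRing.ResidueField S) X) : ∃ κ, P κ ∧ M.coefs E κ = w := by
  induction hw using Submodule.span_induction with
  | mem w hw => exact hX w hw
  | zero => exact ⟨0, h0, map_zero _⟩
  | add w w' _ _ h h' =>
    obtain ⟨a, ha, rfl⟩ := h
    obtain ⟨b, hb, rfl⟩ := h'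
    exact ⟨a + b, hadd a b ha hb, map_add _ _ _⟩
  | smul c w _ h =>
    obtain ⟨a, ha, rfl⟩ := h
    obtain ⟨s, rfl⟩ := ofRingResidue_surjective S c
    exact ⟨_, hmul s a ha, M.coefs_incl_mul E s a⟩

include M in
/-- The change of variables of the Koszul complex that splits off the variables of degree two of an
acyclic closure whose differentials have independent linear parts: after it, these differentials are
variables, and the linear parts of all boundaries vanish at the remaining variables. -/
theorem exists_koszul_exchange (hMfg : ∀ j, (V.grMod j).FG) (hEfin : Finite E.Var)
    (hE1 : ∀ x, E.deg x = 1) (hEdiv : E.divided = ∅)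
    (hEd : ∀ x, ∃ a ∈ V.maxIdeal, K.d (E.pw x 1) = E.incl a)
    {U : CDGA.{z}} [U.IsLocal] (N : SemifreeExt.{x, z, y'} K U) (hN : ∀ y, 1 < N.deg y) :
    ∃ (E' : SemifreeExt.{v, x, y} V K) (J : Set E'.Var) (a : {x // x ∉ J} → {y // N.deg y = 2}),
      Finite E'.Var ∧ Nat.card E'.Var = Nat.card E.Var ∧ (∀ x, E'.deg x = 1) ∧
      Function.Injective a ∧
      (∀ x, N.incl (E'.pw x.1 1) = U.d (N.pw (a x).1 1)) ∧
      ∀ u, ∀ x ∈ J, E'.rep (N.const (U.d u)) (E'.varAdm x) ∈ V.maxIdeal := by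
  classical
  have hM0 : ∀ s, E.incl (M.incl s) ∈ K.gr 0 := fun s =>
    E.incl.map_gr (M.incl.map_gr (mem_trivGr_zero (R := S) s))
  have hK0 : ∀ b ∈ K.gr 0, ∃ s, E.incl (M.incl s) = b := by
    intro b hb
    refine ⟨M.const (E.const b), ?_⟩
    rw [M.exists_incl_eq_of_mem_zero (E.const_mem hb), E.exists_incl_eq_of_mem_zero hb]
  -- `U` and `K` agree in degree one, as `U` has no variables of degree one over `K`
  have hU1 : ∀ u ∈ U.gr 1, N.incl (N.const u) = u := by
    intro u hu
    refine N.ext_rep fun m => ?_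
    rw [rep_incl]
    by_cases hm : m = N.zeroAdm
    · rw [hm, Finsupp.single_eq_same, const_apply]
    · rw [Finsupp.single_apply, if_neg (Ne.symm hm), N.rep_eq_zero hu]
      obtain ⟨y, hy⟩ := Finsupp.support_nonempty_iff.2 fun h : m.1 = 0 => hm (Subtype.ext h)
      exact (hN y).trans_le (deg_le_wdeg _ _ (Finsupp.mem_support_iff.1 hy))
  have hd2 : ∀ y : {y // N.deg y = 2}, U.d (N.pw y.1 1) ∈ U.gr 1 := by
    intro y
    have := N.d_pw_one_mem y.1
    rwa [y.2] at this
  -- the linear parts of the differentials of the variables of degree two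
  let v : {y // N.deg y = 2} → E.Var → IsLocalRing.ResidueField S := fun y =>
    M.coefs E (N.const (U.d (N.pw y.1 1)))
  obtain ⟨J, a, ha, hspan, htop⟩ := exists_span_exchange v
  -- the new variables of the Koszul complex
  let z : E.Var → K := fun x => if h : x ∈ J then E.pw x 1 else
    N.const (U.d (N.pw (a ⟨x, h⟩).1 1))
  have hzJ : ∀ x ∈ J, z x = E.pw x 1 := fun x hx => dif_pos hx
  have hza : ∀ x : {x // x ∉ J}, z x.1 = N.const (U.d (N.pw (a x).1 1)) := fun x => dif_neg x.2
  have hz : ∀ x, z x ∈ K.gr (E.deg x) := by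
    intro x
    by_cases hx : x ∈ J
    · rw [hzJ x hx]; exact E.pw_one_mem x
    · rw [hza ⟨x, hx⟩, hE1]; exact N.const_mem (hd2 _)
  have hdiv : ∀ x, x ∉ E.divided ∨ Odd (E.deg x) := fun x => Or.inl (by rw [hEdiv]; exact id)
  obtain ⟨Φ, hΦ, hΦz, hΦgr⟩ := E.exists_ringEnd hdiv z hz
  have hbij : Function.Bijective Φ := by
    refine E.bijective_of_sub_mem (fun j => E.grMod_fg (Set.toFinite _) hMfg) hdiv Φ hΦgr hΦ
      fun x => ?_
    obtain ⟨κ, ⟨u, hu, rfl⟩, hκ⟩ := M.exists_coefs_eq_of_mem_span E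
      (P := fun κ => ∃ u ∈ K.gr 1, Φ u = κ) ⟨0, zero_mem _, map_zero _⟩
      (by rintro _ _ ⟨u, hu, rfl⟩ ⟨u', hu', rfl⟩; exact ⟨_, add_mem hu hu', map_add _ _ _⟩)
      (by
        rintro s _ ⟨u, hu, rfl⟩
        refine ⟨E.incl (M.incl s) * u, ?_, by rw [map_mul, hΦ]⟩
        have := K.mul_mem' (hM0 s) hu
        rwa [zero_add] at this)
      (by
        have h1 : ∀ x, E.pw x 1 ∈ K.gr 1 := fun x => hE1 x ▸ E.pw_one_mem x
        rintro _ (⟨x, hx, rfl⟩ | ⟨x, rfl⟩)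
        · exact ⟨z x, ⟨_, h1 x, hΦz x⟩, by rw [hzJ x hx, coefs_pw]⟩
        · exact ⟨z x.1, ⟨_, h1 x.1, hΦz x.1⟩, by rw [hza]; rfl⟩)
      (htop (Pi.single x 1))
    obtain ⟨b, hb, w, hw, hbw⟩ := E.exists_add_of_rep_varAdm_mem
      (sub_mem (E.pw_one_mem x) (hE1 x ▸ hΦgr _ _ hu)) (fun x' _ => by
        rw [← M.constResidue_eq_zero_iff, ← coefs_apply, map_sub, hκ, coefs_pw, sub_self]; rfl)
    refine ⟨u, hE1 x ▸ hu, b, hb, w, hw, ?_⟩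
    rw [add_assoc, ← hbw, add_sub_cancel]
  let E' := E.transport (RingEquiv.ofBijective Φ hbij) (fun h => hΦgr _ _ h) hΦ
    fun x hx => by rw [hEdiv] at hx; exact absurd hx id
  have hz' : ∀ x, E'.pw x 1 = z x := hΦz
  have hza' : ∀ x : {x // x ∉ J}, N.incl (E'.pw x.1 1) = U.d (N.pw (a x).1 1) := by
    intro x
    exact (congrArg N.incl ((hz' x.1).trans (hza x))).trans (hU1 _ (hd2 _))
  have hmin : E'.IsMinimal := by
    refine E'.isMinimal_of_incl hEdiv fun x => ?_
    by_cases hx : x ∈ J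
    · rw [hz', hzJ x hx]; exact hEd x
    · refine ⟨0, zero_mem _, N.incl_injective ?_⟩
      rw [N.incl.map_d, hza' ⟨x, hx⟩, U.d_d, map_zero E'.incl.toRingHom, map_zero N.incl.toRingHom]
  refine ⟨E', J, a, hEfin, rfl, hE1, ha, hza', fun u x hx => ?_⟩
  have hker : ∀ κ ∈ K.gr 1, M.coefs E κ = 0 → M.coefs E' κ = 0 := by
    intro κ hκ h
    obtain ⟨b, hb, w, hw, rfl⟩ := E.exists_add_of_rep_varAdm_mem hκ fun x' _ => by
        rw [← M.constResidue_eq_zero_iff, ← coefs_apply, h]; rfl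
    obtain ⟨b', rfl⟩ := E.exists_incl_eq_of_mem_filtSubring_zero hw
    rw [map_add, M.coefs_of_mem_smul E' hb, zero_add]
    exact M.coefs_incl E' b'
  -- the differentials of the variables of degree two have no linear part at the variables in `J`
  have hy : ∀ y : {y // N.deg y = 2}, M.coefs E' (N.const (U.d (N.pw y.1 1))) x = 0 := by
    intro y
    obtain ⟨κ, ⟨hκ, hκx⟩, hκy⟩ := M.exists_coefs_eq_of_mem_span E
      (P := fun κ => κ ∈ K.gr 1 ∧ M.coefs E' κ x = 0) ⟨zero_mem _, by rw [map_zero]; rfl⟩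
      (fun b c hb hc => ⟨add_mem hb.1 hc.1, by rw [map_add, Pi.add_apply, hb.2, hc.2, add_zero]⟩)
      (fun s b hb => ⟨by
        have := K.mul_mem' (hM0 s) hb.1
        rwa [zero_add] at this, by
        have h := congrFun (M.coefs_incl_mul E' s b) x
        rw [Pi.smul_apply, hb.2, smul_zero] at h
        exact h⟩)
      (by
        rintro _ ⟨x', rfl⟩
        refine ⟨z x'.1, ⟨hE1 x'.1 ▸ hz x'.1, ?_⟩, by rw [hza]; rfl⟩
        refine (congrArg (fun κ => M.coefs E' κ x) (hz' x'.1).symm).trans ?_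
        refine (congrFun (M.coefs_pw E' x'.1) x).trans (Pi.single_eq_of_ne ?_ _)
        rintro rfl
        exact x'.2 hx)
      (hspan y)
    have h1 := hker _ (sub_mem (N.const_mem (hd2 y)) hκ) (by rw [map_sub, hκy, sub_self])
    rw [map_sub, sub_eq_zero] at h1
    rw [h1, hκx]
  rw [← M.constResidue_eq_zero_iff]
  let f : U →+ IsLocalRing.ResidueField S := (Pi.evalAddMonoidHom _ x).comp
    ((M.coefs E').comp (N.const.toAddMonoidHom.comp U.d))
  change f u = 0
  refine homogeneous_induction (p := fun u => f u = 0) u (map_zero f)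
    (fun b c hb hc => by rw [map_add, hb, hc, add_zero]) fun i u hu => ?_
  have hw1 : wdeg E'.deg (E'.varAdm x).1 = 1 := (E'.wdeg_varAdm x).trans (hE1 x)
  -- only elements of degree two have boundaries with linear parts at Koszul variables
  rcases i with _ | _ | _ | i
  · change M.coefs E' (N.const (U.d u)) x = 0
    rw [U.d_zero hu, map_zero, map_zero]; rfl
  · change M.constResidue _ = 0
    exact (congrArg M.constResidue (E'.rep_eq_zero (N.const_mem (U.d_mem hu))
      (by rw [hw1]; exact one_pos))).trans (map_zero _)
  · rw [N.rep_sum u, Finsupp.sum, map_sum]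
    refine Finset.sum_eq_zero fun m _ => ?_
    change M.coefs E' (N.const (U.d (N.incl (N.rep u m) * N.mon m))) x = 0
    by_cases hm : m = N.zeroAdm
    · rw [hm, mon_zeroAdm, mul_one, ← N.incl.map_d, const_incl, coefs_apply,
        M.constResidue_eq_zero_iff]
      exact hmin.rep_mem _ _ (E'.varAdm_degree x).le
    · obtain ⟨y, hy'⟩ := Finsupp.support_nonempty_iff.2 fun h : m.1 = 0 => hm (Subtype.ext h)
      have hmy := Finsupp.mem_support_iff.1 hy'
      by_cases h2 : 2 < wdeg N.deg m.1
      · rw [N.rep_eq_zero hu h2, map_zero N.incl.toRingHom, zero_mul, map_zero, map_zero, map_zero]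
        rfl
      have h3 := deg_le_wdeg N.deg m.1 hmy
      have h4 := hN y
      obtain rfl := N.eq_varAdm hmy (by omega)
      have h5 : N.deg y = 2 := by omega
      have h6 : N.rep u (N.varAdm y) ∈ K.gr 0 := by
        have := N.rep_mem hu (N.varAdm y)
        rwa [wdeg_varAdm, h5] at this
      rw [U.d_mul _ (N.incl.map_gr h6), U.d_zero (N.incl.map_gr h6), zero_mul, zero_add, pow_zero,
        one_mul, map_mul, const_incl, mon_varAdm]
      obtain ⟨s, hs⟩ := hK0 _ h6
      rw [← hs]
      have h7 := congrFun (M.coefs_incl_mul E' s (N.const (U.d (N.pw y 1)))) x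
      rw [Pi.smul_apply, hy ⟨y, h5⟩, smul_zero] at h7
      exact h7
  · change M.constResidue _ = 0
    rw [M.constResidue_eq_zero_iff]
    have h1 := E'.rep_mem (N.const_mem (U.d_mem hu)) (E'.varAdm x)
    rw [hw1] at h1
    exact mem_maxIdeal_of_mem_gr (by omega) h1

end Exchange

/-! ### Cancelling pairs of variables in the resolution over `V` -/

/-- Contractible pairs of variables with differentials `y ↦ x ↦ 0` generate, over `V`, a dg-algebra
that retracts onto `V` by a quasi-isomorphism. -/
theorem exists_retraction {V : CDGA.{u}} {U : CDGA.{v}} (T : SemifreeExt.{u, v, w} V U)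
    {ι : Type x} [Fintype ι] {xs ys : ι → T.Var} (hxi : Function.Injective xs)
    (hyi : Function.Injective ys) (hxy : ∀ i j, xs i ≠ ys j)
    (hdeg : ∀ i, T.deg (ys i) = T.deg (xs i) + 1) (hodd : ∀ i, Odd (T.deg (xs i)))
    (hdiv : ∀ i, ys i ∈ T.divided) (hdx : ∀ i, U.d (T.pw (xs i) 1) = 0)
    (hdy : ∀ i, U.d (T.pw (ys i) 1) = T.pw (xs i) 1) :
    ∃ (hP : ∀ z ∈ T.withPairs ∅ xs ys Finset.univ,
        U.d (T.pw z 1) ∈ T.fam.spnRing (T.withPairs ∅ xs ys Finset.univ))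
      (r : Hom (T.subAlg (T.withPairs ∅ xs ys Finset.univ) hP) V),
      (∀ g, r g = T.const g.1) ∧ r.IsQuasiIso := by
  classical
  have h0 : ∀ z ∈ (∅ : Set T.Var), U.d (T.pw z 1) ∈ T.fam.spnRing ∅ := fun z hz => absurd hz id
  have h1 : ∀ i, U.d (T.pw (xs i) 1) ∈ T.fam.spnRing ∅ := fun i => by rw [hdx]; exact zero_mem _
  have h2 : ∀ i, U.d (T.pw (ys i) 1) - T.pw (xs i) 1 ∈ T.fam.spnRing ∅ := fun i => by
    rw [hdy, sub_self]; exact zero_mem _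
  have hP := T.withPairs_d h0 h1 h2 Finset.univ
  -- the constant terms of the differentials of the pairs are zero, so the projection is a morphism
  have hconst : ∀ u ∈ T.fam.spnRing (T.withPairs ∅ xs ys Finset.univ),
      T.const (U.d u) = V.d (T.const u) := by
    intro u hu
    have h := T.const_d_sub_mem ⊥ (P := T.withPairs ∅ xs ys Finset.univ) (fun z hz => ?_) u hu
    · exact sub_eq_zero.1 h
    · rcases hz with hz | ⟨i, -, rfl⟩ | ⟨i, -, rfl⟩
      · exact absurd hz id
      · rw [hdx, map_zero]; exact zero_mem _
      · rw [hdy, T.const_pw _ one_ne_zero]; exact zero_mem _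
  have hincl : ∀ u ∈ T.fam.spnRing ∅, ∃ v, T.incl v = u := by
    intro u hu
    refine ⟨T.const u, T.ext_rep fun e => ?_⟩
    rw [rep_incl]
    by_cases he : e = T.zeroAdm
    · rw [he, Finsupp.single_eq_same, const_apply]
    · rw [Finsupp.single_apply, if_neg (Ne.symm he)]
      by_contra h
      refine he (Subtype.ext (Finsupp.ext fun x => T.mem_spnRing_iff.1 hu e (Ne.symm h) x id))
  refine ⟨hP, ⟨T.const.comp (T.fam.spnRing _).subtype, fun hu => T.const_mem hu,
    fun u => hconst u.1 u.2⟩, fun g => rfl, fun u hdu ⟨b, hb⟩ => ?_, fun v hv => ?_⟩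
  · have hdu' : U.d u.1 = 0 := congrArg Subtype.val hdu
    have hb' : V.d b = T.const u.1 := hb
    obtain ⟨w, hw, hw'⟩ := T.exists_sub_d_mem_of_withPairs h0 h1 h2 (fun i => id) (fun i => id) hxi
      hyi hxy hdeg (fun i => Or.inr ⟨hodd i, hdiv i⟩) Finset.univ u.1 u.2
      (by rw [hdu']; exact zero_mem _)
    obtain ⟨v, hv⟩ := hincl _ hw'
    have h3 : v = V.d (b - T.const w) := by
      rw [map_sub, hb', ← hconst w hw, ← map_sub, ← hv, const_incl]
    refine ⟨⟨w + T.incl (b - T.const w), add_mem hw (T.incl_mem_spnRing _ _)⟩, Subtype.ext ?_⟩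
    change U.d (w + T.incl (b - T.const w)) = u.1
    rw [map_add, ← T.incl.map_d, ← h3, hv, add_sub_cancel]
  · refine ⟨⟨T.incl v, T.incl_mem_spnRing _ v⟩, Subtype.ext ?_, 0, ?_⟩
    · change U.d (T.incl v) = 0
      rw [← T.incl.map_d, hv, map_zero T.incl.toRingHom]
    · rw [map_zero, add_zero]
      exact (T.const_incl v).symm

section Count

variable {V : CDGA.{u}} [V.IsLocal] {K : CDGA.{v}} [K.IsLocal] {U : CDGA.{w}} [U.IsLocal]
  (E : SemifreeExt.{u, v, x} V K) (N : Model.{v, v, w, y} K.augmentation 0 U)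
  (hN : N.toSemifreeExt.IsMinimal) (hN1 : ∀ y, 1 < N.deg y) (hNfin : ∀ j, {y | N.deg y = j}.Finite)
  (hE : Finite E.Var) (hE1 : ∀ x, E.deg x = 1)
  {J : Set E.Var} {a : {x // x ∉ J} → {y // N.deg y = 2}} (ha : Function.Injective a)
  (hda : ∀ x, N.incl (E.pw x.1 1) = U.d (N.pw (a x).1 1))
  (hJ : ∀ u, ∀ x ∈ J, E.rep (N.const (U.d u)) (E.varAdm x) ∈ V.maxIdeal)
  {A : CDGA.{z}} [A.IsLocal] {f : Hom V A} (hf : f.IsQuasiIso) (hfl : f.IsLocalMap)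
  {W : CDGA.{w'}} [W.IsLocal] (Q : Model.{z, z, w', y'} A.augmentation 0 W)
  (hQ : Q.toSemifreeExt.IsMinimal)

theorem tower_varAdm_inl {A : CDGA.{u}} {B : CDGA.{v}} {C : CDGA.{x}} (E : SemifreeExt.{u, v, w} A B)
    (F : SemifreeExt.{v, x, y} B C) (z : E.Var) :
    (tower E F).varAdm (Sum.inlₗ z) = tAdm E F (E.varAdm z) F.zeroAdm := by
  classical
  refine Subtype.ext (Finsupp.ext fun z' => ?_)
  rcases z' with z' | y
  · change Finsupp.single (Sum.inlₗ z : (tower E F).Var) 1 (Sum.inlₗ z' : (tower E F).Var) =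
      Finsupp.single z 1 z'
    rw [Finsupp.single_apply, Finsupp.single_apply]
    by_cases hzz : z = z'
    · rw [if_pos hzz, if_pos (by rw [hzz])]
    · rw [if_neg hzz, if_neg fun h : (Sum.inlₗ z : (tower E F).Var) = Sum.inlₗ z' =>
        hzz (Sum.inl.inj h)]
  · refine Finsupp.single_eq_of_ne ?_
    intro h; cases h

include hN hN1 hNfin hE hE1 ha hda hJ hf hfl hQ

/-- Cancelling the variables of degree one that are differentials of variables of degree two turns
the resolution `U` of the residue field over `V` into a minimal one, over a dg-algebra
quasi-isomorphic to `A`; it has as many variables as an acyclic closure over `A`. -/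
theorem card_deg_eq_of_exchange :
    (∀ j, {q | Q.deg q = j}.Finite) ∧ Nat.card {q // Q.deg q = 1} = Nat.card J ∧
      Nat.card {q // Q.deg q = 2} + Nat.card {x // x ∉ J} = Nat.card {y // N.deg y = 2} ∧
      ∀ j, 2 < j → Nat.card {q // Q.deg q = j} = Nat.card {y // N.deg y = j} := by
  classical
  have := Fintype.ofFinite {x // x ∉ J}
  let T := tower E N.toSemifreeExt
  let xs : {x // x ∉ J} → T.Var := fun x => Sum.inlₗ x.1
  let ys : {x // x ∉ J} → T.Var := fun x => Sum.inrₗ (a x).1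
  have hNdiv : ∀ y, y ∈ N.divided := fun y => (N.switch y).2 zero_le
  have hdy : ∀ x, U.d (T.pw (ys x) 1) = T.pw (xs x) 1 := fun x => (hda x).symm
  obtain ⟨hP, r, hr, hrq⟩ := T.exists_retraction (xs := xs) (ys := ys)
    (fun x x' h => Subtype.ext (Sum.inl.inj h))
    (fun x x' h => ha (Subtype.ext (Sum.inr.inj h))) (fun x x' h => by cases h)
    (fun x => by
      change N.deg (a x).1 = E.deg x.1 + 1
      rw [(a x).2, hE1])
    (fun x => by
      change Odd (E.deg x.1)
      rw [hE1]; exact odd_one)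
    (fun x => hNdiv _) (fun x => by rw [← hdy, U.d_d]) hdy
  set P := T.withPairs ∅ xs ys Finset.univ with hP_def
  have hPl : ∀ x : E.Var, (Sum.inlₗ x : T.Var) ∈ P ↔ x ∉ J := by
    intro x
    constructor
    · rintro (hz | ⟨x', -, h⟩ | ⟨x', -, h⟩)
      · exact absurd hz id
      · cases h; exact x'.2
      · cases h
    · exact fun h => Or.inr (Or.inl ⟨⟨x, h⟩, by simp, rfl⟩)
  have hPr : ∀ y : N.Var, (Sum.inrₗ y : T.Var) ∈ P ↔ ∃ x, (a x).1 = y := by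
    intro y
    constructor
    · rintro (hz | ⟨x', -, h⟩ | ⟨x', -, h⟩)
      · exact absurd hz id
      · cases h
      · cases h; exact ⟨x', rfl⟩
    · rintro ⟨x, rfl⟩
      exact Or.inr (Or.inr ⟨x, by simp, rfl⟩)
  -- `U` as a semifree extension of the dg-algebra generated by the pairs
  let B := T.subExt P hP
  let ηA : A →+* A.residueField := (IsLocalRing.residue A.deg0).comp A.pr0
  have hηA : ∀ b, ηA b = 0 ↔ b ∈ A.maxIdeal := fun b => IsLocalRing.residue_eq_zero_iff _
  let η : U →+* A.residueField := ηA.comp (f.toRingHom.comp T.const)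
  have hη0 : ∀ u, η u = 0 ↔ u ∈ U.maxIdeal := fun u =>
    (hηA _).trans ((hfl.mem_maxIdeal_iff _).trans (T.const_mem_maxIdeal_iff u))
  have hη : IsResolution U η :=
    { pos := fun hi hu => (hη0 _).2 (mem_maxIdeal_of_mem_gr hi hu)
      d := fun u => (hη0 _).2 (U.d_mem_maxIdeal u)
      exact := fun z hz hηz => N.isResolution_aug.exact z hz
        ((N.aug_eq_zero_iff z).2 ((hη0 z).1 hηz)) }
  -- it is minimal: linear parts vanish at the Koszul variables in `J` by the exchange, and at the
  -- other variables by minimality over `K`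
  have hmin : ∀ u e, η (B.incl (B.rep (U.d u) e)) = 0 := by
    refine B.coeff_d_mem_ker hη ?_ fun u g => ?_
    · rintro ⟨x | y, hz⟩ h
      · have h' : Even (E.deg x) := h
        rw [hE1] at h'; exact absurd h' (by decide)
      · exact hNdiv y
    · obtain ⟨k, hk⟩ := T.const_subExt_rep_varAdm hP (U.d u) g
      refine (hη0 _).2 ((T.const_mem_maxIdeal_iff _).1 ?_)
      refine hk ▸ Ideal.mul_mem_left _ _ ?_
      rcases g with ⟨x | y, hz⟩
      · change T.rep (U.d u) (T.varAdm (Sum.inlₗ x)) ∈ _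
        rw [tower_varAdm_inl, tower_rep, ← const_apply]
        exact hJ u x (not_not.1 fun h => hz ((hPl x).2 h))
      · change T.rep (U.d u) (T.varAdm (Sum.inrₗ y)) ∈ _
        rw [tower_varAdm_inr, tower_rep, ← const_apply, const_mem_maxIdeal_iff]
        exact hN.rep_mem u _ (N.varAdm_degree y).le
  have hmin' : ∀ w e, Q.aug (Q.incl (Q.rep (W.d w) e)) = 0 := by
    refine Q.coeff_d_mem_ker Q.isResolution_aug (fun y _ => (Q.switch y).2 zero_le)
      fun w g => ?_
    rw [Q.aug_incl]
    exact (hηA _).2 (hQ.rep_mem w _ (Q.varAdm_degree g).le)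
  have hcomp : ∀ g, η (B.incl g) = Q.aug (Q.incl ((f.comp r) g)) := by
    intro g
    rw [Q.aug_incl]
    change ηA (f (T.const g.1)) = ηA (f (r g))
    rw [hr]
  have hsurj : ∀ c, ∃ b ∈ A.gr 0, Q.aug (Q.incl b) = c := by
    intro c
    obtain ⟨b, rfl⟩ := IsLocalRing.residue_surjective c
    refine ⟨b, b.2, ?_⟩
    rw [Q.aug_incl]
    exact congrArg _ (Subtype.ext (A.pr_same b.2))
  -- the remaining variables: those of `J` in degree one, and in higher degrees those of `N` that
  -- are not in a pair
  have hcard1 : Nat.card {b // B.deg b = 1} = Nat.card J := by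
    symm
    refine Nat.card_eq_of_bijective (fun x : J => (⟨⟨Sum.inlₗ x.1, fun h => (hPl x.1).1 h x.2⟩,
      hE1 x.1⟩ : {b // B.deg b = 1})) ⟨fun x x' h => ?_, ?_⟩
    · exact Subtype.ext (Sum.inl.inj (congrArg (fun b => b.1.1) h))
    · rintro ⟨⟨x | y, hz⟩, hb⟩
      · exact ⟨⟨x, not_not.1 fun h => hz ((hPl x).2 h)⟩, rfl⟩
      · exact absurd hb (hN1 y).ne'
  have hcard2 : ∀ j, 1 < j → Nat.card {y : {y // N.deg y = j} // ∀ x, (a x).1 ≠ y.1} =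
      Nat.card {b // B.deg b = j} := by
    intro j hj
    refine Nat.card_eq_of_bijective (fun y => (⟨⟨Sum.inrₗ y.1.1, fun h => ?_⟩,
      y.1.2⟩ : {b // B.deg b = j})) ⟨fun y y' h => ?_, ?_⟩
    · obtain ⟨x, hx⟩ := (hPr y.1.1).1 h
      exact y.2 x hx
    · exact Subtype.ext (Subtype.ext (Sum.inr.inj (congrArg (fun b => b.1.1) h)))
    · rintro ⟨⟨x | y, hz⟩, hb⟩
      · have hb' : E.deg x = j := hb
        rw [hE1] at hb'; omega
      · exact ⟨⟨⟨y, hb⟩, fun x hx => hz ((hPr y).2 ⟨x, hx⟩)⟩, rfl⟩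
  have hfin : ∀ j, {b | B.deg b = j}.Finite := by
    intro j
    have h1 : (Set.range (fun x : E.Var => (Sum.inlₗ x : T.Var)) ∪
        (fun y : N.Var => (Sum.inrₗ y : T.Var)) '' {y | N.deg y = j}).Finite :=
      (Set.finite_range _).union ((hNfin j).image _)
    refine Set.Finite.of_finite_image (f := Subtype.val) (h1.subset ?_) Subtype.val_injective.injOn
    rintro _ ⟨⟨x | y, hz⟩, hb, rfl⟩
    · exact Or.inl ⟨x, rfl⟩
    · exact Or.inr ⟨y, hb, rfl⟩
  have key := B.card_deg_eq Q.toSemifreeExt (f.comp r) (hf.comp hrq) hη Q.isResolution_aug hcomp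
    hsurj hmin hmin' hfin
  refine ⟨fun j => (key j).1, (key 1).2.symm.trans hcard1, ?_, fun j hj => ?_⟩
  · rw [← (key 2).2, ← hcard2 2 one_lt_two]
    have hfin2 : Finite {y // N.deg y = 2} := hNfin 2
    have h1 : Nat.card {x // x ∉ J} = Nat.card {y : {y // N.deg y = 2} // ¬ ∀ x, (a x).1 ≠ y.1} := by
      refine Nat.card_eq_of_bijective (fun x => ⟨a x, fun h => h x rfl⟩)
        ⟨fun x x' h => ha (congrArg Subtype.val h), fun y => ?_⟩
      obtain ⟨x, hx⟩ := not_forall.1 y.2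
      exact ⟨x, Subtype.ext (Subtype.ext (not_not.1 hx))⟩
    rw [h1, ← Nat.card_sum]
    exact Nat.card_congr (Equiv.sumCompl _)
  · rw [← (key j).2, ← hcard2 j (by omega)]
    refine Nat.card_congr (Equiv.subtypeUnivEquiv fun y x h => ?_)
    have h1 := (a x).2
    rw [h, y.2] at h1
    omega

end Count

end SemifreeExt

/-! ### Variables of degree one of an acyclic closure -/

section DegreeOne

open IsLocalRing

variable {A : CDGA.{u}} [A.IsLocal]

theorem coe_mem_maxIdeal_iff (r : A.deg0) : (r : A) ∈ A.maxIdeal ↔ r ∈ maximalIdeal A.deg0 := by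
  have h : A.pr0 (r : A) = r := Subtype.ext (A.pr_same r.2)
  change A.pr0 (r : A) ∈ maximalIdeal A.deg0 ↔ _
  rw [h]

theorem mk_mem_maximalIdeal_iff (r : A.deg0) :
    Ideal.Quotient.mk A.B0 r ∈ maximalIdeal A.H0 ↔ r ∈ maximalIdeal A.deg0 := by
  have := Ideal.comap_isMaximal_of_surjective (Ideal.Quotient.mk A.B0)
    Ideal.Quotient.mk_surjective (K := maximalIdeal A.H0)
  rw [← eq_maximalIdeal this, Ideal.mem_comap]

namespace AcyclicClosure

variable {W : CDGA.{v}} [W.IsLocal] (Q : AcyclicClosure.{u, u, w, v} A.augmentation W)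

/-- The differential of a variable of degree one, as an element of `A₀`. -/
def dVar (q : {q // Q.deg q = 1}) : A.deg0 :=
  ⟨Q.const (W.d (Q.pw q.1 1)), Q.const_mem (W.d_mem (by
    have := Q.pw_mem q.1 1
    rwa [q.2] at this))⟩

theorem incl_dVar (q : {q // Q.deg q = 1}) : Q.incl (Q.dVar q) = W.d (Q.pw q.1 1) :=
  Q.exists_incl_eq_of_mem_zero (W.d_mem (by
    have := Q.pw_mem q.1 1
    rwa [q.2] at this))

theorem dVar_mem (q : {q // Q.deg q = 1}) : Q.dVar q ∈ maximalIdeal A.deg0 := by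
  rw [← coe_mem_maxIdeal_iff]
  change Q.const (W.d (Q.pw q.1 1)) ∈ _
  rw [Q.const_apply]
  exact Q.minimal.rep_mem _ _ (Q.zeroAdm_degree.trans_le zero_le_one)

/-- An element of the maximal ideal of `A₀` is a boundary in an acyclic closure; modulo boundaries
of `A` it is a combination of differentials of variables of degree one. -/
theorem exists_sub_mem_span_dVar {r : A.deg0} (hr : r ∈ maximalIdeal A.deg0) :
    ∃ b ∈ A.B0, r - b ∈ Ideal.span (Set.range Q.dVar) := by
  have h0 : Q.incl (r : A) ∈ W.gr 0 := Q.incl.map_gr r.2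
  obtain ⟨w, hw, hdw⟩ := Q.isResolution_aug.exact_gr h0 (W.d_zero h0)
    ((Q.aug_eq_zero_iff _).2 ((Q.incl_mem_maxIdeal_iff _).2 ((coe_mem_maxIdeal_iff r).2 hr)))
  have hT : (Ideal.comap A.pr0 (Ideal.span (Set.range Q.dVar))).IsTwoSided := inferInstance
  have h1 := Q.const_d_sub_mem (Ideal.comap A.pr0 (Ideal.span (Set.range Q.dVar)))
    (P := {x | Q.deg x ≤ 1}) (fun x hx => by
      have hx1 : Q.deg x = 1 := le_antisymm hx (Q.deg_pos x)
      have h2 : A.pr0 (Q.dVar ⟨x, hx1⟩ : A) = Q.dVar ⟨x, hx1⟩ :=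
        Subtype.ext (A.pr_same (Q.dVar ⟨x, hx1⟩).2)
      change A.pr0 (Q.dVar ⟨x, hx1⟩ : A) ∈ Ideal.span (Set.range Q.dVar)
      rw [h2]
      exact Ideal.subset_span ⟨_, rfl⟩) w
    (Q.filtSubring_eq 1 ▸ Q.mem_filt_of_deg (le_refl 1) hw)
  rw [hdw, Q.const_incl] at h1
  have hc := Q.const_mem hw
  refine ⟨⟨A.d (Q.const w), A.d_mem hc⟩, ⟨_, hc, rfl⟩, ?_⟩
  have h2 : A.pr0 (r - A.d (Q.const w)) = r - ⟨A.d (Q.const w), A.d_mem hc⟩ :=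
    Subtype.ext (A.pr_same (sub_mem r.2 (A.d_mem hc)))
  rw [← h2]
  exact h1

theorem span_mk_dVar :
    Ideal.span (Set.range fun q => Ideal.Quotient.mk A.B0 (Q.dVar q)) = maximalIdeal A.H0 := by
  refine le_antisymm (Ideal.span_le.2 ?_) fun h hh => ?_
  · rintro _ ⟨q, rfl⟩
    exact (mk_mem_maximalIdeal_iff _).2 (Q.dVar_mem q)
  · obtain ⟨r, rfl⟩ := Ideal.Quotient.mk_surjective h
    obtain ⟨b, hb, hrb⟩ := Q.exists_sub_mem_span_dVar ((mk_mem_maximalIdeal_iff _).1 hh)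
    have h1 : Ideal.Quotient.mk A.B0 r = Ideal.Quotient.mk A.B0 (r - b) := by
      rw [map_sub, Ideal.Quotient.eq_zero_iff_mem.2 hb, sub_zero]
    rw [h1, Set.range_comp' (Ideal.Quotient.mk A.B0) Q.dVar, ← Ideal.map_span]
    exact Ideal.mem_map_of_mem _ hrb

/-- A combination of variables of degree one whose differential is a boundary of `A` gives a cycle
of degree one, hence a boundary, and has coefficients in the maximal ideal by minimality. -/
theorem mem_maximalIdeal_of_sum_mem [Fintype {q // Q.deg q = 1}] (a : {q // Q.deg q = 1} → A.deg0)
    (h : ∑ q, a q * Q.dVar q ∈ A.B0) (q : {q // Q.deg q = 1}) : a q ∈ maximalIdeal A.deg0 := by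
  classical
  obtain ⟨c, hc, hdc⟩ := h
  have hpw : ∀ q : {q // Q.deg q = 1}, Q.pw q.1 1 ∈ W.gr 1 := fun q => by
    have := Q.pw_mem q.1 1
    rwa [q.2] at this
  let w : W := ∑ q, Q.incl (a q) * Q.pw q.1 1 - Q.incl c
  have hw : w ∈ W.gr 1 := by
    refine sub_mem (sum_mem fun q _ => ?_) (Q.incl.map_gr hc)
    have := W.mul_mem' (Q.incl.map_gr (a q).2) (hpw q)
    rwa [zero_add] at this
  have hdw : W.d w = 0 := by
    rw [map_sub, map_sum, sub_eq_zero, ← Q.incl.map_d, hdc, AddSubgroup.val_finsetSum,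
      map_sum Q.incl.toRingHom]
    refine Finset.sum_congr rfl fun q _ => ?_
    have h0 := Q.incl.map_gr (a q).2
    rw [W.d_mul _ h0, W.d_zero h0, zero_mul, zero_add, pow_zero, one_mul, ← Q.incl_dVar,
      ← map_mul Q.incl.toRingHom]
    rfl
  obtain ⟨z, hz⟩ := Q.isResolution_aug.exact w hdw (Q.isResolution_aug.pos one_pos hw)
  have h1 := Q.minimal.rep_mem z (Q.varAdm q.1) (Q.varAdm_degree q.1).le
  have h2 : Q.rep w (Q.varAdm q.1) = a q := by
    rw [map_sub, map_sum, Q.rep_incl, Finsupp.sub_apply, Finsupp.finsetSum_apply,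
      Finsupp.single_eq_of_ne (Q.varAdm_ne_zeroAdm q.1), sub_zero, Finset.sum_eq_single q]
    · rw [← Q.mon_varAdm, Q.rep_mon, Finsupp.single_eq_same]
    · intro q' _ hq
      rw [← Q.mon_varAdm, Q.rep_mon, Finsupp.single_eq_of_ne]
      exact fun h => hq (Subtype.ext (Q.varAdm_injective h.symm))
    · exact fun h => absurd (Finset.mem_univ q) h
  rw [hz, h2, coe_mem_maxIdeal_iff] at h1
  exact h1

/-- The differentials of the variables of degree one are a minimal system of generators of the
maximal ideal of `H₀(A)`. -/
theorem card_deg_one (hfin : {q | Q.deg q = 1}.Finite) :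
    Nat.card {q // Q.deg q = 1} = embDim A.H0 := by
  have : Finite {q // Q.deg q = 1} := hfin
  have := Fintype.ofFinite {q // Q.deg q = 1}
  have hmem : ∀ q, Ideal.Quotient.mk A.B0 (Q.dVar q) ∈ maximalIdeal A.H0 := fun q =>
    (mk_mem_maximalIdeal_iff _).2 (Q.dVar_mem q)
  let x : {q // Q.deg q = 1} → CotangentSpace A.H0 := fun q =>
    (maximalIdeal A.H0).toCotangent ⟨_, hmem q⟩
  have hspan : Submodule.span (ResidueField A.H0) (Set.range x) = ⊤ := by
    have h1 : Set.range x = (maximalIdeal A.H0).toCotangent ''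
        Set.range fun q => (⟨_, hmem q⟩ : maximalIdeal A.H0) := by
      rw [← Set.range_comp]; rfl
    rw [h1, CotangentSpace.span_image_eq_top_iff]
    refine Submodule.map_injective_of_injective (maximalIdeal A.H0).injective_subtype ?_
    rw [Submodule.map_span, ← Set.range_comp, Submodule.map_top, Submodule.range_subtype]
    exact Q.span_mk_dVar
  have hli : LinearIndependent (ResidueField A.H0) x := by
    rw [Fintype.linearIndependent_iff]
    intro c hc q
    choose a ha using fun q => (residue_surjective.comp
      (Ideal.Quotient.mk_surjective (I := A.B0))) (c q)
    -- a linear relation in `𝔪 / 𝔪²` lifts to a relation modulo `𝔪²`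
    have h1 : ∑ q, Ideal.Quotient.mk A.B0 (a q * Q.dVar q) ∈ maximalIdeal A.H0 ^ 2 := by
      have h2 : ∑ q, Ideal.Quotient.mk A.B0 (a q * Q.dVar q) =
          (∑ q, Ideal.Quotient.mk A.B0 (a q) • (⟨_, hmem q⟩ : maximalIdeal A.H0) :
            maximalIdeal A.H0) := by
        rw [AddSubmonoidClass.coe_finsetSum]
        exact Finset.sum_congr rfl fun q _ => map_mul _ _ _
      rw [h2, ← (maximalIdeal A.H0).toCotangent_eq_zero, map_sum, ← hc]
      refine Finset.sum_congr rfl fun q _ => ?_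
      rw [map_smul, ← ha q]
      rfl
    rw [pow_two, ← smul_eq_mul] at h1
    -- subtracting an element of `𝔪²`, a combination with coefficients in `𝔪`, gives a relation in
    -- `H₀(A)`
    nth_rw 2 [← Q.span_mk_dVar] at h1
    obtain ⟨b, hb, hsum⟩ := (Submodule.mem_ideal_smul_span_iff_exists_sum _ _ _).1 h1
    choose b' hb' using fun q => Ideal.Quotient.mk_surjective (b q)
    have hbm : ∀ q, b' q ∈ maximalIdeal A.deg0 := fun q => by
      rw [← mk_mem_maximalIdeal_iff, hb']
      exact hb q
    rw [Finsupp.sum_fintype _ _ fun q => zero_smul A.H0 (Ideal.Quotient.mk A.B0 (Q.dVar q))] at hsum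
    have h3 := Q.mem_maximalIdeal_of_sum_mem (fun q => a q - b' q) (by
      rw [← Ideal.Quotient.eq_zero_iff_mem]
      simp only [sub_mul, Finset.sum_sub_distrib, map_sub, map_sum]
      rw [← hsum, sub_eq_zero]
      refine Finset.sum_congr rfl fun q _ => ?_
      rw [map_mul, hb', smul_eq_mul]) q
    have h4 : a q ∈ maximalIdeal A.deg0 := by
      have := add_mem h3 (hbm q)
      rwa [sub_add_cancel] at this
    rw [← ha q]
    exact (residue_eq_zero_iff _).2 ((mk_mem_maximalIdeal_iff _).2 h4)
  have hN : IsNoetherianRing A.H0 := inferInstance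
  rw [embDim, spanFinrank_maximalIdeal_eq_finrank_cotangentSpace,
    Module.finrank_eq_nat_card_basis (Module.Basis.mk hli hspan.ge)]

end AcyclicClosure

end DegreeOne

/-! ### Numbers of variables -/

theorem SemifreeExt.numX_eq {A : CDGA.{u}} {U : CDGA.{v}} (E : SemifreeExt.{u, v, w} A U)
    (h : E.divided = ∅) (j : ℕ) : E.numX j = Nat.card {x // E.deg x = j} :=
  Nat.card_congr (Equiv.subtypeEquivRight fun x => by simp [h])

theorem SemifreeExt.numY_eq {A : CDGA.{u}} {U : CDGA.{v}} (E : SemifreeExt.{u, v, w} A U)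
    (h : ∀ x, x ∈ E.divided) (j : ℕ) : E.numY j = Nat.card {x // E.deg x = j} :=
  Nat.card_congr (Equiv.subtypeEquivRight fun x => by simp [h])

theorem SemifreeExt.numX_of_nonpos {A : CDGA.{u}} {U : CDGA.{v}} (E : SemifreeExt.{u, v, w} A U)
    {i : ℤ} (hi : i ≤ 0) : E.numX i = 0 := by
  have : IsEmpty {x : E.Var // x ∉ E.divided ∧ (E.deg x : ℤ) = i} :=
    ⟨fun x => by have := E.deg_pos x.1; have := x.2.2; omega⟩
  exact Nat.card_of_isEmpty

end

end CDGA

theorem proposition5p3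
    {S : Type*} [CommRing S] [IsRegularLocalRing S]
    {A : CDGA} [A.IsLocal]
    (f : S →+* A.deg0) (hf : Function.Surjective f)
    -- the minimal model `V` of `A` over `S`
    {V : CDGA} [V.IsLocal] (M : CDGA.MinimalModel (CDGA.ofRingHom f) V)
    -- the Koszul complex `K = K(𝔪_S, V)` on a minimal system of generators of `𝔪_S`
    (t : Fin (CDGA.embDim S) → S)
    (ht : Ideal.span (Set.range t) = IsLocalRing.maximalIdeal S)
    {K : CDGA} [K.IsLocal] (E : CDGA.SemifreeExt V K)
    (hE : E.IsKoszul fun j => M.incl (CDGA.ofRingSelf S (t j)))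
    -- the acyclic closure `U` of the residue field over `K`
    {U : CDGA} [U.IsLocal] (N : CDGA.AcyclicClosure K.augmentation U)
    -- the acyclic closure `W` of the residue field over `A`
    {W : CDGA} [W.IsLocal] (Q : CDGA.AcyclicClosure A.augmentation W) :
    Function.Bijective (N.toFilt 1) ∧
    (∃ φ : ∀ i : ℕ, CDGA.Hom (N.filt (i + 1)) (M.fiber i),
      (∀ i, Function.Surjective (φ i) ∧ (φ i).IsQuasiIso) ∧
      (∀ v : V, φ 0 (N.toFilt 1 (E.incl v)) = M.toFiber 0 v) ∧
      (∀ (i : ℕ) (u : N.filt (i + 1)),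
        φ (i + 1) (N.filtIncl (i + 1) u) = M.fiberMap i (φ i u))) ∧
    (∀ i : ℕ, {x | M.deg x = i}.Finite ∧ {y | Q.deg y = i}.Finite) ∧
    (∀ i : ℤ, i ≤ 0 → M.numX i = 0) ∧
    (M.numX 1 : ℤ) = Q.numY 2 + CDGA.embDim S - CDGA.embDim A.H0 ∧
    (CDGA.embDim A.deg0 = CDGA.embDim S →
      (M.numX 1 : ℤ) = Q.numY 2 + CDGA.embDim A.deg0 - CDGA.embDim A.H0) ∧
    (∀ i : ℤ, 1 < i → M.numX i = Q.numY (i + 1)) := by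
  have hMdiv : M.divided = ∅ := Set.eq_empty_of_forall_notMem fun x hx =>
    absurd ((M.switch x).1 hx) (not_le.2 (ENat.natCast_lt_top _))
  have hNdiv : ∀ y, y ∈ N.divided := fun y => (N.switch y).2 zero_le
  have hQdiv : ∀ y, y ∈ Q.divided := fun y => (Q.switch y).2 zero_le
  have hMfin := CDGA.SemifreeExt.IsMinimal.finite_deg (CDGA.grMod_ofRing_fg S) M.minimal
  have hVfg : ∀ j, (V.grMod j).FG := fun j =>
    M.grMod_fg (M.finite_deg_le hMfin j) (CDGA.grMod_ofRing_fg S)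
  have hN1 : ∀ y, 1 < N.deg y :=
    CDGA.SemifreeExt.one_lt_deg_of_isKoszul ht M.toSemifreeExt E hE N.toModel N.minimal
  have hequiv : ∀ j, 0 < j → Nonempty ({x // M.deg x = j} ≃ {y // N.deg y = j + 1}) := fun j hj =>
    CDGA.SemifreeExt.exists_deg_equiv ht M.toSemifreeExt M.minimal hMdiv E hE N.toModel N.minimal hj
  have hNfin : ∀ j, {y | N.deg y = j}.Finite := by
    rintro (_ | _ | j)
    · exact Set.finite_empty.subset fun y hy => by have := hN1 y; have : N.deg y = 0 := hy; omega
    · exact Set.finite_empty.subset fun y hy => by have := hN1 y; have : N.deg y = 1 := hy; omega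
    · obtain ⟨σ⟩ := hequiv (j + 1) j.succ_pos
      have : Finite {x // M.deg x = j + 1} := hMfin (j + 1)
      exact Finite.of_equiv _ σ
  obtain ⟨hEdiv, hE1, e, he⟩ := id hE
  have hEfin : Finite E.Var := Finite.of_equiv _ e
  have hEcard : Nat.card E.Var = CDGA.embDim S := by
    rw [← Nat.card_congr e, Nat.card_eq_fintype_card, Fintype.card_fin]
  obtain ⟨E', J, a, hE'fin, hE'card, hE'1, ha, hda, hJ⟩ :=
    M.exists_koszul_exchange E hVfg hEfin hE1 hEdiv (fun x => by
      refine ⟨M.incl (CDGA.ofRingSelf S (t (e.symm x))), ?_, ?_⟩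
      · rw [CDGA.SemifreeExt.incl_mem_maxIdeal_iff, CDGA.ofRingSelf_mem_maxIdeal_iff, ← ht]
        exact Ideal.subset_span ⟨_, rfl⟩
      · rw [← he, e.apply_symm_apply]) N.toSemifreeExt hN1
  obtain ⟨hQfin, hQ1, hQ2, hQ3⟩ := CDGA.SemifreeExt.card_deg_eq_of_exchange E' N.toModel N.minimal
    hN1 hNfin hE'fin hE'1 ha hda hJ M.toB_quasiIso M.toB_local Q.toModel Q.minimal
  have hQ1' := Q.card_deg_one (hQfin 1)
  have hJcard : Nat.card J + Nat.card {x // x ∉ J} = CDGA.embDim S := by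
    classical
    rw [← hEcard, ← hE'card, ← Nat.card_sum]
    exact Nat.card_congr (Equiv.sumCompl (· ∈ J))
  -- `|X₁| = |Y₂| = |Q₂| + |Jᶜ|`, where `|J| = |Q₁|` is the embedding dimension of `H₀(A)` and `|J|
  -- + |Jᶜ|` is that of `S`
  have hX1 : (M.numX 1 : ℤ) = Q.numY 2 + CDGA.embDim S - CDGA.embDim A.H0 := by
    have h1 := M.numX_eq hMdiv 1
    have h2 := Q.numY_eq hQdiv 2
    obtain ⟨σ⟩ := hequiv 1 one_pos
    rw [Nat.card_congr σ] at h1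
    push_cast at h1 h2
    rw [h1, h2]
    have h3 : Nat.card {q // Q.deg q = 2} + Nat.card {x // x ∉ J} = Nat.card {y // N.deg y = 1 + 1} :=
      hQ2
    omega
  refine ⟨CDGA.SemifreeExt.toFilt_one_bijective ht M.toSemifreeExt E hE N.toModel N.minimal,
    CDGA.SemifreeExt.exists_fiberHom ht M.toSemifreeExt M.minimal hMdiv E hE N.toModel N.minimal,
    fun i => ⟨hMfin i, hQfin i⟩, fun i hi => M.numX_of_nonpos hi, hX1, fun h => h ▸ hX1,
    fun i hi => ?_⟩
  obtain ⟨j, rfl⟩ := Int.eq_ofNat_of_zero_le (zero_le_one.trans hi.le)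
  have hj : 1 < j := by exact_mod_cast hi
  obtain ⟨σ⟩ := hequiv j (by omega)
  rw [M.numX_eq hMdiv, ← Nat.cast_succ, Q.numY_eq hQdiv, hQ3 (j + 1) (by omega)]
  exact Nat.card_congr σ
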